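/- **Setting.** Let $d\ge1$, $GL_d(\mathbb R)=\{A\in\mathbb R^{d\times d}:\det A>0\}$, $GL_d(\mathbb Z)=\{B\in\mathbb Z^{d\times d}:\det B=1\}$, $\|A\|^2=\sum A_{ij}^2$, $|A|$ the operator norm, and for $\mathbf a=(A,\tau)$ put $\|\mathbf a\|_\lambda^2=\lambda^2\|A\|^2+|\tau|^2$. For $\mathbf b=(B,t)\in GL_d(\mathbb Z)\times\mathbb Z^d$ (a reparametrisation) put $\mathbf b\mathbf a=(BA,B\tau+t)$. For a map $\tau$, $\nabla\tau$ is the matrix $(\partial_j\tau_i)_{ij}$ and $\|\nabla^2\tau\|^2=\sum_{i,j,k}(\partial_k\partial_j\tau_i)^2$. Fix the following data. * $F\in C^2(GL_d(\mathbb R))$ with $F(A)=F(AR)$ for $R\in SO_d$, $F(E)=0$ for some $E\in GL_d(\mathbb R)$, and $F(A)\ge C^{El}_1(\det E-\det A)^2+C_2^{El}\,\mathrm{dist}^2(A,E\,SO_d)$ with $C_1^{El},C_2^{El}>0$. * $W\in C^\infty(\mathbb R^d)$, even and $\mathbb Z^d$-periodic, with $C_0^W\mathrm{dist}^2(z,\mathbb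 Z^d)\le W(z)\le C_1^W\mathrm{dist}^2(z,\mathbb Z^d)$ for all $z$, and $c_\Theta^0|y|^2\le y\cdot\nabla^2W(z)y\le c^1_\Theta|y|^2$ for all $y$ and all $z$ with $\mathrm{dist}(z,\mathbb Z^d)<\Theta_W$; the constants $\Theta_W,c_\Theta^0,c_\Theta^1,C_0^W,C_1^W$ are positive. * $\varphi\in C^\infty$, $\varphi'\le0$, $\varphi=1$ on $[0,1]$, $\varphi=0$ on $[2,\infty)$; $\tilde\varphi(y)=\varphi(|y|)$ on $\mathbb R^d$; $C_\varphi=\int_{\mathbb R^d}\tilde\varphi$. * $\vartheta>0$ and $s_0>0$. For $\lambda>0$, $x\in\mathbb R^d$ and a finite set $\chi\subset\mathbb R^d$ any two distinct points of which have distance at least $s_0$ (an atom configuration), let $$\rho_\lambda(\chi,x)=\frac1{C_\varphi\lambda^d}\sum_{p\in\chi}\varphi\big(\tfrac{|p-x|}\lambda\big),\qquad J_\lambda(\mathbf a,\chi,x)=\frac{\|A^{-1}\|^2}{C_\varphi\lambda^d}\sum_{p\in\chi}W(A(p-x)+\tau)\,\varphi\big(\tfrac{|p-x|}\lambda\big),$$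 $$h_\lambda(\mathbf a,\chi,x)=F(A)+J_\lambda(\mathbf a,\chi,x)+\vartheta|\det A-\rho_\lambda(\chi,x)|,\qquad \hat h_\lambda(\chi,x)=\inf_{\mathbf a\in GL_d(\mathbb R)\times\mathbb R^d}h_\lambda(\mathbf a,\chi,x).$$ **Constants.** With $w_{d-1}$ the volume of the unit ball of $\mathbb R^{d-1}$, let $$C_{con}(\rho,D)=c_\Theta^0\min\Big\{\tfrac1{12},\tfrac{C_\varphi^2}{4(9+d)w_{d-1}^24^d}\tfrac{\rho^2}{D^2}\Big\},\quad C_A=\tfrac{3^{d-1}|E|^{d-1}}{2^{d-2}\det E},\quad C_{rep}=9\tfrac{C_1^W}{C_0^W}4^{d-1}C_A^{2d}(\det E)^2,$$ $$\alpha_\nabla=64\max\Big\{\tfrac{\|\nabla W\|_\infty^2}{C_0^W\Theta_W^2},\tfrac{(c_\Theta^1)^2}{c_\Theta^0}\Big\},$$ $$C_{\nabla2}(X)^{-1/2}=\tfrac{\sqrt{\alpha_\nabla}}{C_{con}}\big(\|\nabla\sqrt{\tilde\varphi}\|_\infty^2+\|\nabla^2\sqrt{\tilde\varphi}\|_\infty+2\|\nabla\sqrt[4]{\tilde\varphi}\|_\infty^2\big)d\sqrt{2^dX}$$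 $$\qquad+\tfrac{\sqrt{\alpha_\nabla}}{C_{con}^2}\|\nabla^2W\|_\infty\|\nabla\sqrt{\tilde\varphi}\|_\infty\big(2^d\|\nabla\sqrt{\tilde\varphi}\|_\infty^2\big)^{1/2}\big(16\cdot2^{d/2}X+\sqrt{8d}\sqrt X\big),$$ $$\tilde C_\nabla(X)^{-1}=C_{rep}\Big(C_{\nabla2}(X)^{-1}+\tfrac{\alpha_\nabla2^d\|\nabla\sqrt{\tilde\varphi}\|^2_\infty X}{C_{con}^2}\Big),$$ where Hessians are measured in the operator norm and $\tilde C_\nabla=0$ if one of the suprema is infinite. For $A\in GL_d(\mathbb R)$ let $F_C(A)$ be the infimum over $A_1,A_2\in GL_d(\mathbb R)$, $B\in GL_d(\mathbb Z)$ of $$F(A_2)+\tfrac13C_{con}C_{rep}^{-1}\|(BA_2)^{-1}\|^2\det(A)\lambda^2\|BA_2-A_1\|^2+\tfrac12\tilde C_\nabla\big(\tfrac{\rho_{2\lambda}}{\rho_\lambda}\big)\|A_1^{-1}\|^2\det(A)\lambda^2\|A-A_1\|^2 .$$ **Theorem.** There are $\hat\lambda>0$ and $\hat\epsilon>0$, depending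 only on the fixed data, such that for all $\lambda>\hat\lambda$, all atom configurations $\chi$ and all $x$ with $\hat h_\lambda(\chi,x)\le\hat\epsilon$ the following holds. The function $h_\lambda(\cdot,\chi,x)$ has a global minimizer on $GL_d(\mathbb R)\times\mathbb R^d$. For every such minimizer $\hat{\mathbf a}=(\hat A,\hat\tau)$ and every reparametrisation $\mathbf b=(B,t)$ with $\|\hat A^{-1}B^{-1}\|\le2\|E^{-1}\|$ there are an open neighbourhood $U$ of $x$ and a $C^2$ map $\tilde{\mathbf a}_B=(\tilde A_B,\tilde\tau_B):U\to GL_d(\mathbb R)\times\mathbb R^d$ such that: 1. with $\mathbf a_0=(A_0,\tau_0)=\mathbf b\hat{\mathbf a}$, $\rho_\lambda=\rho_\lambda(\chi,x)$ and $C_{con}=C_{con}(\rho_\lambda,\det A_0)$, $$\|\tilde{\mathbf a}_B(x)-\mathbf a_0\|_\lambda\le\big(\tfrac12C_{con}\|A_0^{-1}\|^2\rho_\lambda\big)^{-1/2}\sqrt{J_\lambda(\mathbf a_0,\chi,x)};$$ 2. for every $y\in U$, $\tilde{\mathbf a}_B(y)$ is a local minimizer of $J_\lambda(\cdot,\chi,y)$;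 3. $\tilde\tau_B$ is a local Lagrangian coordinate: it is injective on $U$ and $\det\nabla\tilde\tau_B>0$ on $U$; 4. for every $y\in U$, with $\rho_\lambda=\rho_\lambda(\chi,y)$, $\rho_{2\lambda}=\rho_{2\lambda}(\chi,y)$ and $C_{con}=C_{con}(\rho_\lambda,\det\nabla\tilde\tau_B(y))$ in all constants, $$\hat h_\lambda(\chi,y)\ge F_C(\nabla\tilde\tau_B(y))+\tfrac15\tilde C_\nabla\big(\tfrac{\rho_{2\lambda}}{\rho_\lambda}\big)\|(\nabla\tilde\tau_B(y))^{-1}\|^2\lambda^4\|\nabla^2\tilde\tau_B(y)\|^2\det\nabla\tilde\tau_B(y).$$ -/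

import Mathlib

open scoped ENNReal

attribute [local instance] Matrix.frobeniusNormedAddCommGroup Matrix.frobeniusNormedSpace

noncomputable section

namespace Kac

/-- Points of `ℝ^d`, with the Euclidean norm. -/
abbrev Vec (d : ℕ) : Type := EuclideanSpace ℝ (Fin d)

/-- Real `d × d` matrices; the norm `‖A‖` is the Frobenius norm, `‖A‖² = ∑ A_{ij}²`. -/
abbrev Mat (d : ℕ) : Type := Matrix (Fin d) (Fin d) ℝ

/-- `GL_d(ℝ)`: real matrices with positive determinant. -/
def GLPos (d : ℕ) : Set (Mat d) := {A | 0 < A.det}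

/-- `GL_d(ℤ)`: integer matrices with determinant one. -/
abbrev GLInt (d : ℕ) : Type := Matrix.SpecialLinearGroup (Fin d) ℤ

/-- An integer matrix of determinant one, read as a real matrix. -/
def GLInt.toMat {d : ℕ} (B : GLInt d) : Mat d :=
  (B : Matrix (Fin d) (Fin d) ℤ).map (fun n : ℤ => (n : ℝ))

/-- An integer vector, read as a real vector. -/
def intVec {d : ℕ} (n : Fin d → ℤ) : Vec d := WithLp.toLp 2 (fun i => (n i : ℝ))

/-- The lattice `ℤ^d` in `ℝ^d`. -/
def intLattice (d : ℕ) : Set (Vec d) := Set.range (intVec (d := d))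

/-- The vector `A v`. -/
def act {d : ℕ} (A : Mat d) (v : Vec d) : Vec d := Matrix.toEuclideanLin A v

/-- The operator norm `|A|` with respect to the Euclidean norm. -/
def opNorm {d : ℕ} (A : Mat d) : ℝ := ‖Matrix.toEuclideanCLM (n := Fin d) (𝕜 := ℝ) A‖

/-- The orbit `E SO_d`. -/
def orbitSO {d : ℕ} (E : Mat d) : Set (Mat d) :=
  {M | ∃ R ∈ Matrix.specialOrthogonalGroup (Fin d) ℝ, M = E * R}

/-- Lattice parameters `𝐚 = (A, τ)`. -/
abbrev Aff (d : ℕ) : Type := Mat d × Vec d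

/-- `‖(A, τ)‖_λ = (λ² ‖A‖² + |τ|²)^{1/2}`. -/
def affNorm {d : ℕ} (lam : ℝ) (a : Aff d) : ℝ := Real.sqrt (lam ^ 2 * ‖a.1‖ ^ 2 + ‖a.2‖ ^ 2)

/-- The reparametrisation of `(A, τ)` by `(B, t)`, i.e. `(B A, B τ + t)`. -/
def reparam {d : ℕ} (B : GLInt d) (t : Fin d → ℤ) (a : Aff d) : Aff d :=
  (B.toMat * a.1, act B.toMat a.2 + intVec t)

/-- The supremum norm of a vector valued function on `ℝ^d`, as an extended number. -/
def supNorm {d : ℕ} {V : Type} [NormedAddCommGroup V] (g : Vec d → V) : ℝ≥0∞ := ⨆ y, ‖g y‖ₑ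

/-- The standing data of the model: elastic energy `F`, periodic potential `W`, cut-off `φ`,
cost `ϑ` of a vacancy, hard-core radius `s₀`, together with the constants and the standing
assumptions on them. -/
structure Model (d : ℕ) where
  /-- elastic energy density -/
  F : Mat d → ℝ
  /-- a stress-free lattice -/
  E : Mat d
  /-- first coercivity constant of `F` -/
  C₁El : ℝ
  /-- second coercivity constant of `F` -/
  C₂El : ℝ
  /-- periodic potential -/
  W : Vec d → ℝ
  /-- radius of local convexity of `W` -/
  Θ : ℝ
  /-- lower bound of the Hessian of `W` near the lattice points -/
  c₀ : ℝ
  /-- upper bound of the Hessian of `W` near the lattice points -/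
  c₁ : ℝ
  /-- lower coercivity constant of `W` -/
  C₀W : ℝ
  /-- upper coercivity constant of `W` -/
  C₁W : ℝ
  /-- cut-off function; only its values on `[0, ∞)` matter -/
  φ : ℝ → ℝ
  /-- energy per vacancy -/
  ϑ : ℝ
  /-- hard-core radius -/
  s₀ : ℝ
  F_contDiff : ContDiffOn ℝ 2 F (GLPos d)
  F_frame : ∀ A ∈ GLPos d, ∀ R ∈ Matrix.specialOrthogonalGroup (Fin d) ℝ, F A = F (A * R)
  E_mem : E ∈ GLPos d
  F_E : F E = 0
  C₁El_pos : 0 < C₁El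
  C₂El_pos : 0 < C₂El
  F_coercive : ∀ A ∈ GLPos d,
    C₁El * (E.det - A.det) ^ 2 + C₂El * Metric.infDist A (orbitSO E) ^ 2 ≤ F A
  W_contDiff : ContDiff ℝ ((⊤ : ℕ∞) : WithTop ℕ∞) W
  Θ_pos : 0 < Θ
  c₀_pos : 0 < c₀
  c₁_pos : 0 < c₁
  C₀W_pos : 0 < C₀W
  C₁W_pos : 0 < C₁W
  W_periodic : ∀ (n : Fin d → ℤ) (z : Vec d), W z = W (z + intVec n)
  W_convex : ∀ z ∈ Metric.thickening Θ (intLattice d), ∀ y : Vec d,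
    c₀ * ‖y‖ ^ 2 ≤ fderiv ℝ (fderiv ℝ W) z y y ∧ fderiv ℝ (fderiv ℝ W) z y y ≤ c₁ * ‖y‖ ^ 2
  W_coercive : ∀ z : Vec d,
    C₀W * Metric.infDist z (intLattice d) ^ 2 ≤ W z ∧
      W z ≤ C₁W * Metric.infDist z (intLattice d) ^ 2
  W_symm : ∀ z : Vec d, W z = W (-z)
  φ_contDiff : ContDiff ℝ ((⊤ : ℕ∞) : WithTop ℕ∞) φ
  φ_one : ∀ r ≤ 1, φ r = 1
  φ_zero : ∀ r, 2 ≤ r → φ r = 0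
  φ_deriv : ∀ r, deriv φ r ≤ 0
  ϑ_pos : 0 < ϑ
  s₀_pos : 0 < s₀

namespace Model

variable {d : ℕ} (m : Model d)

/-- The hard-core condition (finiteness of the hard-core part of the Hamiltonian): distinct atoms
have distance at least `s₀`. -/
def HardCore (χ : Finset (Vec d)) : Prop :=
  ∀ p ∈ χ, ∀ q ∈ χ, p ≠ q → m.s₀ ≤ dist p q

/-- `C_φ = ∫ φ(|y|) dy`. -/
def Cφ : ℝ := ∫ y : Vec d, m.φ ‖y‖

/-- The local density `ρ_λ(χ, x)`. -/
def rho (lam : ℝ) (χ : Finset (Vec d)) (x : Vec d) : ℝ :=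
  1 / (m.Cφ * lam ^ d) * ∑ p ∈ χ, m.φ (lam⁻¹ * ‖p - x‖)

/-- The misfit energy `J_λ(𝐚, χ, x)`. -/
def J (lam : ℝ) (a : Aff d) (χ : Finset (Vec d)) (x : Vec d) : ℝ :=
  ‖a.1⁻¹‖ ^ 2 / (m.Cφ * lam ^ d) *
    ∑ p ∈ χ, m.W (act a.1 (p - x) + a.2) * m.φ (lam⁻¹ * ‖p - x‖)

/-- The vacancy energy `ν_λ(A, χ, x)`. -/
def nu (lam : ℝ) (A : Mat d) (χ : Finset (Vec d)) (x : Vec d) : ℝ :=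
  m.ϑ * |A.det - m.rho lam χ x|

/-- The pre-energy density `h_λ(𝐚, χ, x)`. -/
def h (lam : ℝ) (a : Aff d) (χ : Finset (Vec d)) (x : Vec d) : ℝ :=
  m.F a.1 + m.J lam a χ x + m.nu lam a.1 χ x

/-- The energy density `ĥ_λ(χ, x)`, the infimum of `h_λ(·, χ, x)` over `GL_d(ℝ) × ℝ^d`. -/
def hHat (lam : ℝ) (χ : Finset (Vec d)) (x : Vec d) : ℝ :=
  sInf ((fun a : Aff d => m.h lam a χ x) '' {a | a.1 ∈ GLPos d})

/-- `𝐚` is a global minimizer of `h_λ(·, χ, x)` over `GL_d(ℝ) × ℝ^d`. -/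
def IsGlobalMinimizer (lam : ℝ) (χ : Finset (Vec d)) (x : Vec d) (a : Aff d) : Prop :=
  a.1 ∈ GLPos d ∧ ∀ b : Aff d, b.1 ∈ GLPos d → m.h lam a χ x ≤ m.h lam b χ x

/-- `C_A = 3^{d-1} |E|^{d-1} / (2^{d-2} det E)`. -/
def CA : ℝ := 3 ^ (d - 1) * opNorm m.E ^ (d - 1) / ((2 : ℝ) ^ ((d : ℤ) - 2) * m.E.det)

/-- `w_k`, the volume of the unit ball of `ℝ^k`. -/
def ballVol (k : ℕ) : ℝ := (MeasureTheory.volume (Metric.ball (0 : Vec k) 1)).toReal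

/-- The convexity constant `C_con`, as a function of the density `ρ = ρ_λ` and of `D = det A`. -/
def Ccon (ρ D : ℝ) : ℝ :=
  m.c₀ * min (1 / 12)
    (m.Cφ ^ 2 / (4 * (9 + (d : ℝ)) * ballVol (d - 1) ^ 2 * 4 ^ d) * (ρ ^ 2 / D ^ 2))

/-- `C_rep = 9 (C₁ᵂ / C₀ᵂ) 4^{d-1} C_A^{2d} (det E)²`. -/
def Crep : ℝ := 9 * (m.C₁W / m.C₀W) * 4 ^ (d - 1) * m.CA ^ (2 * d) * m.E.det ^ 2

/-- `‖∇W‖_∞`. -/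
def supGradW : ℝ := (supNorm (fun y => fderiv ℝ m.W y)).toReal

/-- `‖∇²W‖_∞`. -/
def supHessW : ℝ := (supNorm (fun y => fderiv ℝ (fderiv ℝ m.W) y)).toReal

/-- `α_∇ = 64 max {‖∇W‖_∞² / (C₀ᵂ Θ²), c₁² / c₀}`. -/
def αGrad : ℝ := 64 * max (m.supGradW ^ 2 / (m.C₀W * m.Θ ^ 2)) (m.c₁ ^ 2 / m.c₀)

/-- `√φ̃`, where `φ̃(y) = φ(|y|)`. -/
def sqrtφ (y : Vec d) : ℝ := Real.sqrt (m.φ ‖y‖)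

/-- The fourth root of `φ̃`. -/
def root4φ (y : Vec d) : ℝ := Real.sqrt (Real.sqrt (m.φ ‖y‖))

/-- `‖∇√φ̃‖_∞`. -/
def N₁ : ℝ≥0∞ := supNorm (fun y => fderiv ℝ m.sqrtφ y)

/-- `‖∇²√φ̃‖_∞`. -/
def N₂ : ℝ≥0∞ := supNorm (fun y => fderiv ℝ (fderiv ℝ m.sqrtφ) y)

/-- `‖∇φ̃^{1/4}‖_∞`. -/
def N₄ : ℝ≥0∞ := supNorm (fun y => fderiv ℝ m.root4φ y)

/-- `C_{∇2}(X)^{-1/2}`, with `Cc` the value of `C_con`; it is `∞` if `‖∇²√φ̃‖_∞` or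
`‖∇φ̃^{1/4}‖_∞` is. -/
def invSqrtCgrad2 (Cc X : ℝ) : ℝ≥0∞ :=
  ENNReal.ofReal (Real.sqrt m.αGrad / Cc) * (m.N₁ ^ 2 + m.N₂ + 2 * m.N₄ ^ 2)
      * ENNReal.ofReal (d * Real.sqrt (2 ^ d * X))
    + ENNReal.ofReal (Real.sqrt m.αGrad / Cc ^ 2 * m.supHessW) * m.N₁
      * (ENNReal.ofReal (Real.sqrt (2 ^ d)) * m.N₁)
      * ENNReal.ofReal (16 * Real.sqrt (2 ^ d) * X + Real.sqrt (8 * d) * Real.sqrt X)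

/-- `C̃_∇(X)`, where
`C̃_∇(X)⁻¹ = C_rep (C_{∇2}(X)⁻¹ + α_∇ 2^d ‖∇√φ̃‖_∞² X / C_con²)` and `∞⁻¹ = 0`. -/
def Cgrad (Cc X : ℝ) : ℝ :=
  ((ENNReal.ofReal m.Crep *
    (m.invSqrtCgrad2 Cc X ^ 2
      + ENNReal.ofReal (m.αGrad * 2 ^ d / Cc ^ 2 * X) * m.N₁ ^ 2))⁻¹).toReal

/-- The integrand `U(A, A₁, B, A₂)` of the relaxation, with `Cc = C_con` and
`Ct = C̃_∇(ρ_{2λ}/ρ_λ)`. -/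
def U (lam Cc Ct : ℝ) (A A₁ : Mat d) (B : GLInt d) (A₂ : Mat d) : ℝ :=
  m.F A₂
    + 1 / 3 * Cc * m.Crep⁻¹ * ‖(B.toMat * A₂)⁻¹‖ ^ 2 * A.det * lam ^ 2 * ‖B.toMat * A₂ - A₁‖ ^ 2
    + 1 / 2 * Ct * ‖A₁⁻¹‖ ^ 2 * A.det * lam ^ 2 * ‖A - A₁‖ ^ 2

/-- The relaxed elastic energy `F_C(A)`. -/
def FC (lam Cc Ct : ℝ) (A : Mat d) : ℝ :=
  sInf {r | ∃ A₁ ∈ GLPos d, ∃ A₂ ∈ GLPos d, ∃ B : GLInt d, r = m.U lam Cc Ct A A₁ B A₂}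

end Model

/-- The matrix `∇τ(y)`, with entries `(∇τ)_{ij} = ∂_j τ_i`. -/
def gradMat {d : ℕ} (τ : Vec d → Vec d) (y : Vec d) : Mat d :=
  Matrix.of fun i j => fderiv ℝ τ y (EuclideanSpace.single j 1) i

/-- `‖∇²τ(y)‖² = ∑_{i,j,k} (∂_k ∂_j τ_i(y))²`. -/
def hessNormSq {d : ℕ} (τ : Vec d → Vec d) (y : Vec d) : ℝ :=
  ∑ i, ∑ j, ∑ k,
    (fderiv ℝ (fderiv ℝ τ) y (EuclideanSpace.single k 1) (EuclideanSpace.single j 1) i) ^ 2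

end Kac

end

/-!
# The lower bound for low-energy atom configurations

Three facts about an atom configuration of low energy carry the proof.

**Low energy forces a fit.** If `h_λ(𝐚, χ, y)` is small, then the coercivity of `F` keeps the matrix
of `𝐚` in a compact set near the ground states, the misfit of the atoms is small, and the determinant
is close to the density of the atoms (`exists_fit_of_h_le`). Translations matter only modulo the
integers, so that compactness provides global minimizers (`exists_isGlobalMinimizer`).

**A fit forces convexity.** Suppose that `𝐚` fits the atoms. By the hard core, the cells of the
lattice that contain a nearby atom contain only one, and since density and determinant nearly agree,
these cells cover almost all of the support of the cut-off (`exists_cover`). Hence the atoms carry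
nearly the second moments of the perfect lattice (`exists_moment_le`), and as `W` is convex near the
integers, the misfit energy is uniformly convex in `‖·‖_λ` near `𝐚` (`exists_hess_lower`). The factor
`‖A⁻¹‖²` changes this only at order `1 / λ` (`exists_ddJ_lower`). A uniformly convex function that
is small at the centre of a ball has a unique critical point in it (`UnifConvex.exists_crit`), and
by the implicit function theorem this point is a `C²` function of the position (`exists_branch`,
`exists_branch_of_fit`). The gradient of its translation part is close to its matrix, so that the
translation part is locally injective.

The derivatives of this branch are controlled by differentiating the critical point equation once
or twice and testing it with the derivatives themselves. All the error terms contain derivatives of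
the cut-off and of `W`; since `|∇W|²` is bounded by a multiple of `W`, they are bounded by the root
of the misfit (`exists_normU_le_sqrt`, `exists_normW_le_sqrt`, combined in `exists_grad_energy_le`).
If a norm of a root of the cut-off is infinite, the constant in front of the derivatives vanishes.

**Two fits agree up to reparametrisation.** Two lattices that both fit the atoms differ by a
reparametrisation and a small error (`exists_reparam_close`), and the misfit energies of equivalent
lattices are comparable with the constant `C_rep` (`J_reparam_le`). For a lattice `𝐚` competing for
the minimum at `y`, this and convexity bound `C_rep J(𝐚)` from below by the misfit energy of the
branch plus a multiple of the squared distance to the branch. The first term controls the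
derivatives of the branch, the second one its distance to `𝐚`; choosing the matrix of the branch for
`A₁` and the matrix of `𝐚` for `A₂` in the infimum `F_C` gives the lower bound (`FC_add_le_h`).
-/

section

-- The entrywise topology of matrices is switched off, so that the topology in use is always the one
-- of the Frobenius norm; the two coincide.
attribute [-instance] instTopologicalSpaceMatrix Matrix.instUniformSpace
set_option maxSynthPendingDepth 3

/-! ### Matrices acting on vectors -/

namespace Kac

open Matrix Filter Topology

variable {d : ℕ}

lemma le_of_sq_le_sq {a b : ℝ} (h : a ^ 2 ≤ b ^ 2) (hb : 0 ≤ b) : a ≤ b :=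
  (abs_le_of_sq_le_sq' h hb).2

lemma normSq_eq_sum (A : Mat d) : ‖A‖ ^ 2 = ∑ i, ∑ j, A i j ^ 2 := by
  rw [Matrix.frobenius_norm_def, ← Real.sqrt_eq_rpow, Real.sq_sqrt (by positivity)]
  simp [Real.norm_eq_abs]

lemma act_apply (A : Mat d) (v : Vec d) (i : Fin d) : act A v i = ∑ j, A i j * v j := by
  simp [act, Matrix.toLpLin_apply, Matrix.mulVec, dotProduct]

lemma act_eq_clm (A : Mat d) (v : Vec d) : act A v = Matrix.toEuclideanCLM (n := Fin d) (𝕜 := ℝ) A v :=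
  rfl

lemma act_one (v : Vec d) : act (1 : Mat d) v = v := by
  simp [act]

lemma act_mul (A B : Mat d) (v : Vec d) : act (A * B) v = act A (act B v) := by
  simp [act_eq_clm, map_mul]

lemma act_add_left (A B : Mat d) (v : Vec d) : act (A + B) v = act A v + act B v := by
  simp [act]

lemma act_sub_left (A B : Mat d) (v : Vec d) : act (A - B) v = act A v - act B v := by
  simp [act]

lemma act_smul_left (c : ℝ) (A : Mat d) (v : Vec d) : act (c • A) v = c • act A v := by
  simp [act]

lemma act_add_right (A : Mat d) (v w : Vec d) : act A (v + w) = act A v + act A w := by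
  simp [act]

lemma act_sub_right (A : Mat d) (v w : Vec d) : act A (v - w) = act A v - act A w := by
  simp [act]

lemma act_smul_right (c : ℝ) (A : Mat d) (v : Vec d) : act A (c • v) = c • act A v := by
  simp [act]

lemma act_zero_right (A : Mat d) : act A 0 = 0 := by
  simp [act]

lemma act_single (A : Mat d) (i j : Fin d) : act A (EuclideanSpace.single j 1) i = A i j := by
  simp [act_apply]

lemma normSq_eq_sum_act (A : Mat d) :
    ‖A‖ ^ 2 = ∑ j, ‖act A (EuclideanSpace.single j 1)‖ ^ 2 := by
  simp_rw [normSq_eq_sum, EuclideanSpace.norm_sq_eq, act_single, Real.norm_eq_abs, sq_abs]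
  exact Finset.sum_comm

lemma norm_act_le_opNorm (A : Mat d) (v : Vec d) : ‖act A v‖ ≤ opNorm A * ‖v‖ :=
  ContinuousLinearMap.le_opNorm (Matrix.toEuclideanCLM (n := Fin d) (𝕜 := ℝ) A) v

lemma opNorm_nonneg (A : Mat d) : 0 ≤ opNorm A := norm_nonneg _

lemma norm_act_le (A : Mat d) (v : Vec d) : ‖act A v‖ ≤ ‖A‖ * ‖v‖ := by
  refine le_of_sq_le_sq ?_ (by positivity)
  rw [mul_pow, normSq_eq_sum, EuclideanSpace.norm_sq_eq, EuclideanSpace.norm_sq_eq, Finset.sum_mul]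
  refine Finset.sum_le_sum fun i _ => ?_
  simp only [Real.norm_eq_abs, sq_abs, act_apply]
  exact Finset.sum_mul_sq_le_sq_mul_sq _ _ _

lemma opNorm_le_norm (A : Mat d) : opNorm A ≤ ‖A‖ :=
  ContinuousLinearMap.opNorm_le_bound _ (norm_nonneg _) (norm_act_le A)

lemma opNorm_mul_le (A B : Mat d) : opNorm (A * B) ≤ opNorm A * opNorm B := by
  simp only [opNorm, map_mul]
  exact ContinuousLinearMap.opNorm_comp_le _ _

lemma norm_single_one (j : Fin d) : ‖(EuclideanSpace.single j 1 : Vec d)‖ = 1 := by simp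

lemma norm_le_sqrt_mul_opNorm (A : Mat d) : ‖A‖ ≤ Real.sqrt d * opNorm A := by
  refine le_of_sq_le_sq ?_ (by have := opNorm_nonneg A; positivity)
  rw [mul_pow, Real.sq_sqrt (by positivity), normSq_eq_sum_act]
  calc _ ≤ ∑ _j : Fin d, opNorm A ^ 2 := by
        refine Finset.sum_le_sum fun j _ => ?_
        have := norm_act_le_opNorm A (EuclideanSpace.single j 1)
        rw [norm_single_one, mul_one] at this
        gcongr
    _ = _ := by simp

lemma norm_mul_le' (A B : Mat d) : ‖A * B‖ ≤ ‖A‖ * ‖B‖ := Matrix.frobenius_norm_mul A B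

/-- The bilinear map `(A, v) ↦ A v` as a continuous bilinear map. -/
noncomputable def actL (d : ℕ) : Mat d →L[ℝ] Vec d →L[ℝ] Vec d :=
  LinearMap.toContinuousLinearMap
    ((Matrix.toEuclideanCLM (n := Fin d) (𝕜 := ℝ)).toAlgEquiv.toLinearMap)

lemma actL_apply (A : Mat d) (v : Vec d) : actL d A v = act A v := rfl

/-! ### Lattice parameters -/

/-- The value at `x` of the affine map with linear part `a.1` and translation `a.2`. -/
noncomputable def lin (a : Aff d) (x : Vec d) : Vec d := act a.1 x + a.2

lemma lin_add (a b : Aff d) (x : Vec d) : lin (a + b) x = lin a x + lin b x := by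
  simp [lin, act_add_left]; abel

lemma lin_sub (a b : Aff d) (x : Vec d) : lin (a - b) x = lin a x - lin b x := by
  simp [lin, act_sub_left]; abel

lemma lin_smul (c : ℝ) (a : Aff d) (x : Vec d) : lin (c • a) x = c • lin a x := by
  simp [lin, act_smul_left]

lemma affNorm_nonneg (l : ℝ) (a : Aff d) : 0 ≤ affNorm l a := Real.sqrt_nonneg _

lemma affNorm_sq (l : ℝ) (a : Aff d) : affNorm l a ^ 2 = l ^ 2 * ‖a.1‖ ^ 2 + ‖a.2‖ ^ 2 :=
  Real.sq_sqrt (by positivity)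

lemma norm_fst_le_affNorm (l : ℝ) (a : Aff d) : l * ‖a.1‖ ≤ affNorm l a := by
  refine le_of_sq_le_sq ?_ (affNorm_nonneg _ _)
  rw [affNorm_sq, mul_pow]; have := sq_nonneg ‖a.2‖; linarith

lemma norm_snd_le_affNorm (l : ℝ) (a : Aff d) : ‖a.2‖ ≤ affNorm l a := by
  refine le_of_sq_le_sq ?_ (affNorm_nonneg _ _)
  rw [affNorm_sq]; have : 0 ≤ l ^ 2 * ‖a.1‖ ^ 2 := by positivity
  linarith

lemma affNorm_le {l : ℝ} (hl : 0 ≤ l) (a : Aff d) : affNorm l a ≤ l * ‖a.1‖ + ‖a.2‖ := by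
  have h : 0 ≤ l * ‖a.1‖ + ‖a.2‖ := by positivity
  refine le_of_sq_le_sq ?_ h
  rw [affNorm_sq]
  nlinarith [norm_nonneg a.1, norm_nonneg a.2, mul_nonneg (mul_nonneg hl (norm_nonneg a.1)) (norm_nonneg a.2)]

lemma affNorm_smul (l c : ℝ) (a : Aff d) : affNorm l (c • a) = |c| * affNorm l a := by
  rw [affNorm, affNorm, ← Real.sqrt_sq (abs_nonneg c), ← Real.sqrt_mul (by positivity)]
  congr 1
  simp only [Prod.smul_fst, Prod.smul_snd, norm_smul, Real.norm_eq_abs]; ring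

lemma affNorm_neg (l : ℝ) (a : Aff d) : affNorm l (-a) = affNorm l a := by
  have := affNorm_smul l (-1) a; simpa using this

lemma affNorm_sub_comm (l : ℝ) (a b : Aff d) : affNorm l (a - b) = affNorm l (b - a) := by
  rw [← affNorm_neg, neg_sub]

lemma affNorm_pos {l : ℝ} (hl : 0 < l) {a : Aff d} (ha : a ≠ 0) : 0 < affNorm l a := by
  refine Real.sqrt_pos.2 ?_
  by_contra! h
  have h1 : 0 ≤ l ^ 2 * ‖a.1‖ ^ 2 := by positivity
  have h2 : 0 ≤ ‖a.2‖ ^ 2 := by positivity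
  have h3 : ‖a.2‖ ^ 2 = 0 := by linarith
  have h4 : l ^ 2 * ‖a.1‖ ^ 2 = 0 := by linarith
  refine ha (Prod.ext ?_ ?_)
  · simpa [hl.ne'] using h4
  · simpa using h3

lemma continuous_affNorm (l : ℝ) : Continuous (affNorm (d := d) l) := by
  unfold affNorm; fun_prop

lemma affNorm_add_le (l : ℝ) (a b : Aff d) : affNorm l (a + b) ≤ affNorm l a + affNorm l b := by
  have h : 0 ≤ affNorm l a + affNorm l b := add_nonneg (affNorm_nonneg _ _) (affNorm_nonneg _ _)
  refine le_of_sq_le_sq ?_ h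
  have h1 : ‖(a + b).1‖ ^ 2 ≤ (‖a.1‖ + ‖b.1‖) ^ 2 := by
    have := norm_add_le a.1 b.1; gcongr; exact this
  have h2 : ‖(a + b).2‖ ^ 2 ≤ (‖a.2‖ + ‖b.2‖) ^ 2 := by
    have := norm_add_le a.2 b.2; gcongr; exact this
  have h3 : l ^ 2 * (‖a.1‖ * ‖b.1‖) + ‖a.2‖ * ‖b.2‖ ≤ affNorm l a * affNorm l b := by
    rw [affNorm, affNorm, ← Real.sqrt_mul (by positivity)]
    refine Real.le_sqrt_of_sq_le ?_
    nlinarith [mul_nonneg (sq_nonneg l) (sq_nonneg (‖a.1‖ * ‖b.2‖ - ‖a.2‖ * ‖b.1‖))]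
  have h4 : l ^ 2 * ‖(a + b).1‖ ^ 2 ≤ l ^ 2 * (‖a.1‖ + ‖b.1‖) ^ 2 := by gcongr
  rw [affNorm_sq, add_sq, affNorm_sq, affNorm_sq]
  nlinarith

lemma norm_lin_sq_le {l r : ℝ} (a : Aff d) {x : Vec d}
    (hx : ‖x‖ ≤ r * l) : ‖lin a x‖ ^ 2 ≤ (r ^ 2 + 1) * affNorm l a ^ 2 := by
  have h1 : ‖lin a x‖ ≤ r * (l * ‖a.1‖) + ‖a.2‖ := by
    calc ‖lin a x‖ ≤ ‖act a.1 x‖ + ‖a.2‖ := norm_add_le _ _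
      _ ≤ ‖a.1‖ * (r * l) + ‖a.2‖ := by
        have := norm_act_le a.1 x
        have h2 : ‖a.1‖ * ‖x‖ ≤ ‖a.1‖ * (r * l) := by gcongr
        linarith
      _ = _ := by ring
  have h2 : ‖lin a x‖ ^ 2 ≤ (r * (l * ‖a.1‖) + ‖a.2‖) ^ 2 := by gcongr
  rw [affNorm_sq]
  nlinarith [sq_nonneg (l * ‖a.1‖ - r * ‖a.2‖)]

lemma norm_lin_le {l r : ℝ} (hr : 0 ≤ r) (a : Aff d) {x : Vec d}
    (hx : ‖x‖ ≤ r * l) : ‖lin a x‖ ≤ (r + 1) * affNorm l a := by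
  refine le_of_sq_le_sq ?_ (by have := affNorm_nonneg l a; positivity)
  refine (norm_lin_sq_le a hx).trans ?_
  rw [mul_pow]
  gcongr
  nlinarith

/-! ### Inverses and determinants -/

lemma mul_inv_cancel_of_det {A : Mat d} (hA : A.det ≠ 0) : A * A⁻¹ = 1 :=
  Matrix.mul_nonsing_inv A (isUnit_iff_ne_zero.2 hA)

lemma inv_mul_cancel_of_det {A : Mat d} (hA : A.det ≠ 0) : A⁻¹ * A = 1 :=
  Matrix.nonsing_inv_mul A (isUnit_iff_ne_zero.2 hA)

lemma act_inv_act {A : Mat d} (hA : A.det ≠ 0) (v : Vec d) : act A⁻¹ (act A v) = v := by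
  rw [← act_mul, inv_mul_cancel_of_det hA, act_one]

lemma act_act_inv {A : Mat d} (hA : A.det ≠ 0) (v : Vec d) : act A (act A⁻¹ v) = v := by
  rw [← act_mul, mul_inv_cancel_of_det hA, act_one]

lemma norm_inv_pos (hd : 1 ≤ d) {A : Mat d} (hA : A.det ≠ 0) : 0 < ‖A⁻¹‖ := by
  rw [norm_pos_iff]
  intro h
  have := mul_inv_cancel_of_det hA
  rw [h, mul_zero] at this
  have h2 := congrFun (congrFun this ⟨0, hd⟩) ⟨0, hd⟩
  simp at h2

lemma norm_inv_sub_inv_le {A B : Mat d} (hA : A.det ≠ 0) (hB : B.det ≠ 0) :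
    ‖B⁻¹‖ ≤ ‖A⁻¹‖ * (1 + ‖A - B‖ * ‖B⁻¹‖) := by
  have h : B⁻¹ = A⁻¹ + A⁻¹ * ((A - B) * B⁻¹) := by
    rw [sub_mul, mul_inv_cancel_of_det hB, mul_sub, ← mul_assoc, inv_mul_cancel_of_det hA]
    simp
  calc ‖B⁻¹‖ = ‖A⁻¹ + A⁻¹ * ((A - B) * B⁻¹)‖ := by rw [← h]
    _ ≤ ‖A⁻¹‖ + ‖A⁻¹‖ * (‖A - B‖ * ‖B⁻¹‖) := by
      refine (norm_add_le _ _).trans ?_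
      gcongr
      refine (norm_mul_le' _ _).trans ?_
      gcongr
      exact norm_mul_le' _ _
    _ = _ := by ring

/-- The largest singular value of `M⁻¹` is the inverse of the smallest one of `M`, and the product of
the singular values of `M` is `det M`. -/
lemma opNorm_inv_mul_det_le {M : Mat d} (hM : 0 < M.det) :
    opNorm M⁻¹ * M.det ≤ opNorm M ^ (d - 1) := by
  have hH : (Mᵀ * M).IsHermitian := by
    simpa using Matrix.isHermitian_conjTranspose_mul_self M
  -- an orthonormal basis of eigenvectors of `MᵀM`; the eigenvalues `μ` are the squared singular
  -- values
  set b := hH.eigenvectorBasis with hb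
  set μ := hH.eigenvalues with hμ
  have hin : ∀ x y : Vec d, inner ℝ x (act (Mᵀ * M) y) = inner ℝ (act M x) (act M y) := by
    intro x y
    rw [act_mul]
    have := LinearMap.adjoint_inner_right (Matrix.toEuclideanLin M) x (act M y)
    rw [← Matrix.toEuclideanLin_conjTranspose_eq_adjoint] at this
    simpa [act] using this
  have heig : ∀ k, act (Mᵀ * M) (b k) = μ k • b k := by
    intro k
    have := hH.mulVec_eigenvectorBasis k
    simp only [act, Matrix.toLpLin_apply]
    rw [this]
    simp [hb, hμ]
  have hμe : ∀ k, μ k = ‖act M (b k)‖ ^ 2 := by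
    intro k
    have h1 := hin (b k) (b k)
    rw [heig, inner_smul_right, real_inner_self_eq_norm_sq, real_inner_self_eq_norm_sq,
      b.orthonormal.1 k] at h1
    linarith
  have hμ0 : ∀ k, 0 ≤ μ k := fun k => by rw [hμe]; positivity
  have hμ1 : ∀ k, μ k ≤ opNorm M ^ 2 := fun k => by
    rw [hμe]
    have := norm_act_le_opNorm M (b k)
    rw [b.orthonormal.1 k, mul_one] at this
    gcongr
  have hdet : M.det ^ 2 = ∏ k, μ k := by
    have := hH.det_eq_prod_eigenvalues
    rw [Matrix.det_mul, Matrix.det_transpose] at this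
    simpa [sq] using this
  -- each eigenvalue is bounded below, because all the others are at most `|M|²`
  have hmin : ∀ k, M.det ^ 2 ≤ μ k * (opNorm M ^ (d - 1)) ^ 2 := by
    intro k
    rw [hdet, ← Finset.mul_prod_erase _ _ (Finset.mem_univ k)]
    refine mul_le_mul_of_nonneg_left ?_ (hμ0 k)
    calc _ ≤ ∏ _i ∈ Finset.univ.erase k, opNorm M ^ 2 :=
          Finset.prod_le_prod (fun i _ => hμ0 i) fun i _ => hμ1 i
      _ = _ := by simp [← pow_mul, mul_comm]
  -- in the eigenbasis this bounds `|M x|` from below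
  have hlow : ∀ x, M.det * ‖x‖ ≤ opNorm M ^ (d - 1) * ‖act M x‖ := by
    intro x
    refine le_of_sq_le_sq ?_ (by have := opNorm_nonneg M; positivity)
    have h1 : ‖act M x‖ ^ 2 = ∑ k, μ k * inner ℝ (b k) x ^ 2 := by
      rw [← real_inner_self_eq_norm_sq, ← hin, ← b.sum_inner_mul_inner]
      refine Finset.sum_congr rfl fun k _ => ?_
      have h3 : inner ℝ (b k) (act (Mᵀ * M) x) = μ k * inner ℝ (b k) x := by
        rw [hin, real_inner_comm, ← hin, heig, inner_smul_right, real_inner_comm]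
      rw [h3, real_inner_comm]; ring
    have h2 : ‖x‖ ^ 2 = ∑ k, inner ℝ (b k) x ^ 2 := by
      rw [← real_inner_self_eq_norm_sq, ← b.sum_inner_mul_inner]
      refine Finset.sum_congr rfl fun k _ => ?_
      rw [real_inner_comm x]; ring
    rw [mul_pow, mul_pow, h1, h2, Finset.mul_sum, Finset.mul_sum]
    refine Finset.sum_le_sum fun k _ => ?_
    have := mul_le_mul_of_nonneg_right (hmin k) (sq_nonneg (inner ℝ (b k) x))
    linarith
  have hfin : opNorm M⁻¹ ≤ opNorm M ^ (d - 1) / M.det := by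
    refine ContinuousLinearMap.opNorm_le_bound _ (by have := opNorm_nonneg M; positivity) fun x => ?_
    have := hlow (act M⁻¹ x)
    rw [act_act_inv hM.ne'] at this
    rw [div_mul_eq_mul_div, le_div_iff₀ hM]
    change ‖act M⁻¹ x‖ * M.det ≤ _
    linarith
  rwa [le_div_iff₀ hM] at hfin

lemma contDiff_entry (i j : Fin d) {n : WithTop ℕ∞} : ContDiff ℝ n (fun A : Mat d => A i j) :=
  (LinearMap.toContinuousLinearMap (Matrix.entryLinearMap ℝ ℝ i j)).contDiff

lemma contDiff_det {n : WithTop ℕ∞} : ContDiff ℝ n (fun A : Mat d => A.det) := by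
  simp only [Matrix.det_apply]
  refine ContDiff.sum fun σ _ => ContDiff.const_smul _ ?_
  exact contDiff_prod fun i _ => contDiff_entry _ _

lemma continuous_det : Continuous (fun A : Mat d => A.det) := contDiff_det (n := 0).continuous

lemma isOpen_GLPos : IsOpen (GLPos d) := isOpen_lt continuous_const continuous_det

lemma contDiffAt_inv {n : WithTop ℕ∞} {A : Mat d} (hA : A.det ≠ 0) :
    ContDiffAt ℝ n (fun A : Mat d => A⁻¹) A := by
  have : (fun A : Mat d => A⁻¹) = fun A => (A.det)⁻¹ • A.adjugate := by
    ext1 A; rw [Matrix.inv_def, Ring.inverse_eq_inv']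
  rw [this]
  refine ContDiffAt.smul (contDiff_det.contDiffAt.inv hA) (ContDiff.contDiffAt ?_)
  have h2 : (Matrix.adjugate : Mat d → Mat d)
      = fun A => ∑ i, ∑ j, A.adjugate i j • Matrix.single i j (1 : ℝ) := by
    ext1 A
    conv_lhs => rw [Matrix.matrix_eq_sum_single A.adjugate]
    simp [Matrix.smul_single]
  rw [h2]
  refine ContDiff.sum fun i _ => ContDiff.sum fun j _ => ?_
  have h3 : ContDiff ℝ n fun A : Mat d => A.adjugate i j := ?_
  · exact h3.smul contDiff_const
  simp only [Matrix.adjugate_apply, Matrix.det_apply]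
  refine ContDiff.sum fun σ _ => ContDiff.const_smul _ ?_
  refine contDiff_prod fun k _ => ?_
  by_cases hk : σ k = j
  · simp only [Matrix.updateRow_apply, hk, if_true]; exact contDiff_const
  · simp only [Matrix.updateRow_apply, hk, if_false]; exact contDiff_entry _ _

/-- The factor `‖A⁻¹‖²` of the misfit energy. -/
noncomputable def invSq (A : Mat d) : ℝ := ‖A⁻¹‖ ^ 2

lemma contDiff_normSq {n : WithTop ℕ∞} : ContDiff ℝ n (fun A : Mat d => ‖A‖ ^ 2) := by
  simp only [normSq_eq_sum]
  exact ContDiff.sum fun i _ => ContDiff.sum fun j _ => (contDiff_entry i j).pow 2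

lemma contDiffAt_invSq {n : WithTop ℕ∞} {A : Mat d} (hA : A.det ≠ 0) :
    ContDiffAt ℝ n (invSq (d := d)) A :=
  contDiff_normSq.contDiffAt.comp A (contDiffAt_inv hA)

lemma invSq_pos (hd : 1 ≤ d) {A : Mat d} (hA : A.det ≠ 0) : 0 < invSq A :=
  pow_pos (norm_inv_pos hd hA) 2

/-- The derivative of `log ‖A⁻¹‖²`. -/
noncomputable def dlog (A : Mat d) : Mat d →L[ℝ] ℝ := (invSq A)⁻¹ • fderiv ℝ (invSq (d := d)) A

lemma contDiffOn_dlog (hd : 1 ≤ d) {n : ℕ} : ContDiffOn ℝ n (dlog (d := d)) (GLPos d) := by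
  intro A hA
  have hA' : A.det ≠ 0 := ne_of_gt hA
  refine ContDiffAt.contDiffWithinAt ?_
  refine ContDiffAt.smul ((contDiffAt_invSq hA').inv (invSq_pos hd hA').ne') ?_
  exact (contDiffAt_invSq (n := (n : WithTop ℕ∞) + 1) hA').fderiv_right le_rfl

/-- The matrices of norm at most `K` and determinant at least `K⁻¹`, a compact subset of
`GL_d(ℝ)`. -/
def bddSet (d : ℕ) (K : ℝ) : Set (Mat d) := {A | ‖A‖ ≤ K ∧ K⁻¹ ≤ A.det}

lemma isCompact_bddSet (K : ℝ) : IsCompact (bddSet d K) := by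
  refine Metric.isCompact_of_isClosed_isBounded ?_ ?_
  · exact (isClosed_le continuous_norm continuous_const).inter
      (isClosed_le continuous_const continuous_det)
  · refine Metric.isBounded_closedBall (x := (0 : Mat d)) (r := K) |>.subset fun A hA => ?_
    simpa using hA.1

lemma bddSet_subset_GLPos {K : ℝ} (hK : 0 < K) : bddSet d K ⊆ GLPos d :=
  fun _ hA => lt_of_lt_of_le (inv_pos.2 hK) hA.2

lemma bddSet_mono {K L : ℝ} (hK : 0 < K) (h : K ≤ L) : bddSet d K ⊆ bddSet d L :=
  fun _ hA => ⟨hA.1.trans h, (inv_anti₀ hK h).trans hA.2⟩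

lemma exists_bound_on_bddSet {K : ℝ} (hK : 0 < K) {V : Type*} [NormedAddCommGroup V]
    {f : Mat d → V} (hf : ContinuousOn f (GLPos d)) : ∃ C > 0, ∀ A ∈ bddSet d K, ‖f A‖ ≤ C := by
  obtain ⟨C, hC⟩ := (isCompact_bddSet K).exists_bound_of_continuousOn
    (hf.mono (bddSet_subset_GLPos hK))
  exact ⟨max C 1, by positivity, fun A hA => (hC A hA).trans (le_max_left _ _)⟩

lemma exists_inv_bound_on_bddSet {K : ℝ} (hK : 0 < K) :
    ∃ C > 0, ∀ A ∈ bddSet d K, ‖A⁻¹‖ ≤ C :=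
  exists_bound_on_bddSet hK (f := fun A : Mat d => A⁻¹) fun _ hA =>
    (contDiffAt_inv (n := 0) (ne_of_gt hA)).continuousAt.continuousWithinAt

lemma exists_dist_bddSet {K : ℝ} (hK : 0 < K) :
    ∃ r > 0, ∀ A₀ ∈ bddSet d K, ∀ A : Mat d, ‖A - A₀‖ ≤ r → A ∈ bddSet d (2 * K) := by
  have ho : IsOpen {A : Mat d | ‖A‖ < 2 * K ∧ (2 * K)⁻¹ < A.det} :=
    (isOpen_lt continuous_norm continuous_const).inter (isOpen_lt continuous_const continuous_det)
  obtain ⟨r, hr, hsub⟩ := (isCompact_bddSet (d := d) K).exists_thickening_subset_open ho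
    (fun _ hA => ⟨by have := hA.1; linarith, lt_of_lt_of_le
      (inv_strictAnti₀ hK (by linarith)) hA.2⟩)
  refine ⟨r / 2, by positivity, fun A₀ hA₀ A hA => ?_⟩
  have := hsub (Metric.mem_thickening_iff.2 ⟨A₀, hA₀, by rw [dist_eq_norm]; linarith⟩)
  exact ⟨this.1.le, this.2.le⟩

/-- The determinant is uniformly continuous near bounded sets. -/
lemma exists_det_close (K : ℝ) {e : ℝ} (he : 0 < e) :
    ∃ r > 0, ∀ A₀ : Mat d, ‖A₀‖ ≤ K → ∀ A : Mat d, ‖A - A₀‖ ≤ r → |A.det - A₀.det| < e := by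
  have hc : IsCompact (Metric.closedBall (0 : Mat d) (K + 1)) := isCompact_closedBall _ _
  have hu := hc.uniformContinuousOn_of_continuous continuous_det.continuousOn
  rw [Metric.uniformContinuousOn_iff] at hu
  obtain ⟨r, hr, h⟩ := hu e he
  refine ⟨min (r / 2) 1, by positivity, fun A₀ hA₀ A hA => ?_⟩
  have h1 : ‖A - A₀‖ ≤ r / 2 := hA.trans (min_le_left _ _)
  have h2 : ‖A - A₀‖ ≤ 1 := hA.trans (min_le_right _ _)
  have h3 : ‖A‖ ≤ ‖A₀‖ + ‖A - A₀‖ := by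
    have := norm_add_le A₀ (A - A₀); simpa using this
  have := h A (by simp; linarith) A₀ (by simp; linarith) (by rw [dist_eq_norm]; linarith)
  rwa [Real.dist_eq] at this

end Kac

/-! ### The periodic potential -/

namespace Kac

open Filter Topology

variable {d : ℕ}

/-- A second order Taylor estimate on the unit interval. -/
lemma add_add_half_le_of_deriv2_ge {f f' f'' : ℝ → ℝ} {c : ℝ}
    (h1 : ∀ s ∈ Set.Icc (0 : ℝ) 1, HasDerivAt f (f' s) s)
    (h2 : ∀ s ∈ Set.Icc (0 : ℝ) 1, HasDerivAt f' (f'' s) s)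
    (hc : ∀ s ∈ Set.Icc (0 : ℝ) 1, c ≤ f'' s) : f 0 + f' 0 + c / 2 ≤ f 1 := by
  have key : ∀ g g' : ℝ → ℝ, (∀ s ∈ Set.Icc (0 : ℝ) 1, HasDerivAt g (g' s) s) →
      (∀ s ∈ Set.Icc (0 : ℝ) 1, 0 ≤ g' s) → MonotoneOn g (Set.Icc 0 1) := by
    intro g g' hg hg'
    refine monotoneOn_of_deriv_nonneg (convex_Icc 0 1)
      (fun s hs => (hg s hs).continuousAt.continuousWithinAt)
      (fun s hs => (hg s (interior_subset hs)).differentiableAt.differentiableWithinAt)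
      fun s hs => ?_
    rw [(hg s (interior_subset hs)).deriv]
    exact hg' s (interior_subset hs)
  have hm1 := key (fun s => f' s - c * s) (fun s => f'' s - c * 1)
    (fun s hs => (h2 s hs).sub ((hasDerivAt_id s).const_mul c)) fun s hs => by
      have := hc s hs; linarith
  have hm2 := key (fun s => f s - (f' 0 * s + c / 2 * s ^ 2))
    (fun s => f' s - (f' 0 * 1 + c / 2 * (2 * s)))
    (fun s hs => (h1 s hs).sub (((hasDerivAt_id s).const_mul _).add
      (by simpa using (hasDerivAt_pow 2 s).const_mul (c / 2)))) fun s hs => by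
      have := hm1 (Set.left_mem_Icc.2 zero_le_one) hs hs.1
      simp only at this
      linarith
  have := hm2 (Set.left_mem_Icc.2 zero_le_one) (Set.right_mem_Icc.2 zero_le_one) zero_le_one
  simp only at this
  linarith

lemma intVec_apply (n : Fin d → ℤ) (i : Fin d) : intVec n i = (n i : ℝ) := rfl

lemma intVec_add (n k : Fin d → ℤ) : intVec (n + k) = intVec n + intVec k := by
  ext i; simp [intVec_apply]

lemma intVec_sub (n k : Fin d → ℤ) : intVec (n - k) = intVec n - intVec k := by
  ext i; simp [intVec_apply]

lemma intVec_zero : intVec (0 : Fin d → ℤ) = 0 := by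
  ext i; simp [intVec_apply]

lemma intVec_neg (n : Fin d → ℤ) : intVec (-n) = -intVec n := by
  ext i; simp [intVec_apply]

lemma mem_intLattice (n : Fin d → ℤ) : intVec n ∈ intLattice d := ⟨n, rfl⟩

lemma intLattice_nonempty : (intLattice d).Nonempty := ⟨_, mem_intLattice 0⟩

lemma act_toMat_intVec (B : GLInt d) (n : Fin d → ℤ) :
    act B.toMat (intVec n) = intVec ((B : Matrix (Fin d) (Fin d) ℤ).mulVec n) := by
  ext i
  simp [act_apply, intVec_apply, GLInt.toMat, Matrix.mulVec, dotProduct]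

/-- Coordinatewise integer part. -/
noncomputable def floorVec (z : Vec d) : Fin d → ℤ := fun i => ⌊z i⌋

lemma norm_sub_floorVec_le (z : Vec d) : ‖z - intVec (floorVec z)‖ ≤ d := by
  refine le_of_sq_le_sq ?_ (by positivity)
  rw [EuclideanSpace.norm_sq_eq]
  calc _ ≤ ∑ _i : Fin d, (1 : ℝ) := by
        refine Finset.sum_le_sum fun i _ => ?_
        have h0 : (z - intVec (floorVec z)) i = Int.fract (z i) := rfl
        rw [h0, Real.norm_eq_abs, sq_abs]
        have h1 := Int.fract_nonneg (z i)
        have h2 := Int.fract_lt_one (z i)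
        nlinarith
    _ ≤ _ := by
      simp only [Finset.sum_const, Finset.card_univ, Fintype.card_fin, nsmul_eq_mul, mul_one]
      rcases Nat.eq_zero_or_pos d with rfl | h
      · simp
      · have : (1 : ℝ) ≤ d := by exact_mod_cast h
        nlinarith

/-- A lattice-periodic continuous map is bounded. -/
lemma exists_bound_of_periodic {V : Type*} [NormedAddCommGroup V] {g : Vec d → V}
    (hg : Continuous g) (hp : ∀ (n : Fin d → ℤ) z, g (z + intVec n) = g z) :
    ∃ C > 0, ∀ z, ‖g z‖ ≤ C := by
  obtain ⟨C, hC⟩ := (isCompact_closedBall (0 : Vec d) (d : ℝ)).exists_bound_of_continuousOn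
    hg.continuousOn
  refine ⟨max C 1, by positivity, fun z => le_trans ?_ (le_max_left _ _)⟩
  have h := hp (-floorVec z) z
  rw [← h, intVec_neg, ← sub_eq_add_neg]
  exact hC _ (by simpa using norm_sub_floorVec_le z)

lemma fderiv_periodic {V : Type*} [NormedAddCommGroup V] [NormedSpace ℝ V] {g : Vec d → V}
    (hp : ∀ (n : Fin d → ℤ) z, g (z + intVec n) = g z) (n : Fin d → ℤ) (z : Vec d) :
    fderiv ℝ g (z + intVec n) = fderiv ℝ g z := by
  rw [← fderiv_comp_add_right]
  congr 1
  funext z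
  exact hp n z

lemma norm_le_toReal_supNorm {V : Type} [NormedAddCommGroup V] {g : Vec d → V}
    (h : supNorm g ≠ ⊤) (y : Vec d) : ‖g y‖ ≤ (supNorm g).toReal := by
  have h1 : ‖g y‖ₑ ≤ supNorm g := le_iSup (fun y => ‖g y‖ₑ) y
  have h2 := ENNReal.toReal_mono h h1
  simpa using h2

lemma supNorm_ne_top {V : Type} [NormedAddCommGroup V] {g : Vec d → V} {C : ℝ}
    (h : ∀ y, ‖g y‖ ≤ C) : supNorm g ≠ ⊤ := by
  have h1 : supNorm g ≤ ENNReal.ofReal C := by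
    refine iSup_le fun y => ?_
    rw [← ofReal_norm]
    exact ENNReal.ofReal_le_ofReal (h y)
  exact ne_top_of_le_ne_top ENNReal.ofReal_ne_top h1

namespace Model

variable (m : Model d)

/-- The derivative of the potential. -/
noncomputable def W1 : Vec d → Vec d →L[ℝ] ℝ := fderiv ℝ m.W

/-- The second derivative of the potential. -/
noncomputable def W2 : Vec d → Vec d →L[ℝ] Vec d →L[ℝ] ℝ := fderiv ℝ m.W1

/-- The third derivative of the potential. -/
noncomputable def W3 : Vec d → Vec d →L[ℝ] Vec d →L[ℝ] Vec d →L[ℝ] ℝ := fderiv ℝ m.W2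

lemma contDiff_W {n : ℕ} : ContDiff ℝ n m.W := m.W_contDiff.of_le (by exact_mod_cast le_top)

lemma contDiff_W1 {n : ℕ} : ContDiff ℝ n m.W1 :=
  (m.contDiff_W (n := n + 1)).fderiv_right (by norm_cast)

lemma contDiff_W2 {n : ℕ} : ContDiff ℝ n m.W2 :=
  (m.contDiff_W1 (n := n + 1)).fderiv_right (by norm_cast)

lemma contDiff_W3 {n : ℕ} : ContDiff ℝ n m.W3 :=
  (m.contDiff_W2 (n := n + 1)).fderiv_right (by norm_cast)

lemma hasFDerivAt_W (z : Vec d) : HasFDerivAt m.W (m.W1 z) z :=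
  ((m.contDiff_W (n := 1)).differentiable (by simp) z).hasFDerivAt

lemma hasFDerivAt_W1 (z : Vec d) : HasFDerivAt m.W1 (m.W2 z) z :=
  ((m.contDiff_W1 (n := 1)).differentiable (by simp) z).hasFDerivAt

lemma hasFDerivAt_W2 (z : Vec d) : HasFDerivAt m.W2 (m.W3 z) z :=
  ((m.contDiff_W2 (n := 1)).differentiable (by simp) z).hasFDerivAt

lemma W_per (n : Fin d → ℤ) (z : Vec d) : m.W (z + intVec n) = m.W z := (m.W_periodic n z).symm

lemma W1_per (n : Fin d → ℤ) (z : Vec d) : m.W1 (z + intVec n) = m.W1 z :=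
  fderiv_periodic m.W_per n z

lemma W2_per (n : Fin d → ℤ) (z : Vec d) : m.W2 (z + intVec n) = m.W2 z :=
  fderiv_periodic m.W1_per n z

lemma W3_per (n : Fin d → ℤ) (z : Vec d) : m.W3 (z + intVec n) = m.W3 z :=
  fderiv_periodic m.W2_per n z

/-- The potential and its derivatives up to third order are bounded. -/
lemma exists_bound_W : ∃ C > 0, ∀ z, |m.W z| ≤ C ∧ ‖m.W1 z‖ ≤ C ∧ ‖m.W2 z‖ ≤ C ∧ ‖m.W3 z‖ ≤ C := by
  obtain ⟨C₀, h₀, H₀⟩ := exists_bound_of_periodic (m.contDiff_W (n := 0)).continuous m.W_per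
  obtain ⟨C₁, h₁, H₁⟩ := exists_bound_of_periodic (m.contDiff_W1 (n := 0)).continuous m.W1_per
  obtain ⟨C₂, h₂, H₂⟩ := exists_bound_of_periodic (m.contDiff_W2 (n := 0)).continuous m.W2_per
  obtain ⟨C₃, h₃, H₃⟩ := exists_bound_of_periodic (m.contDiff_W3 (n := 0)).continuous m.W3_per
  exact ⟨C₀ + C₁ + C₂ + C₃, by positivity, fun z =>
    ⟨(H₀ z).trans (by linarith), (H₁ z).trans (by linarith), (H₂ z).trans (by linarith),
      (H₃ z).trans (by linarith)⟩⟩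

lemma norm_W1_le (z : Vec d) : ‖m.W1 z‖ ≤ m.supGradW := by
  obtain ⟨C, -, hC⟩ := m.exists_bound_W
  exact norm_le_toReal_supNorm (g := fun y => fderiv ℝ m.W y)
    (supNorm_ne_top fun y => (hC y).2.1) z

lemma norm_W2_le (z : Vec d) : ‖m.W2 z‖ ≤ m.supHessW := by
  obtain ⟨C, -, hC⟩ := m.exists_bound_W
  exact norm_le_toReal_supNorm (g := fun y => fderiv ℝ (fderiv ℝ m.W) y)
    (supNorm_ne_top fun y => (hC y).2.2.1) z

lemma W_nonneg (z : Vec d) : 0 ≤ m.W z :=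
  le_trans (mul_nonneg m.C₀W_pos.le (sq_nonneg _)) (m.W_coercive z).1

lemma W_intVec (n : Fin d → ℤ) : m.W (intVec n) = 0 := by
  have := (m.W_coercive (intVec n)).2
  rw [Metric.infDist_zero_of_mem (mem_intLattice n)] at this
  refine le_antisymm (by simpa using this) (m.W_nonneg _)

lemma W1_intVec (n : Fin d → ℤ) : m.W1 (intVec n) = 0 :=
  IsLocalMin.fderiv_eq_zero (Filter.Eventually.of_forall fun z => by
    rw [m.W_intVec n]; exact m.W_nonneg z)

lemma W2_symm (z x y : Vec d) : m.W2 z x y = m.W2 z y x := by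
  have h := ((m.contDiff_W (n := 2)).contDiffAt (x := z)).isSymmSndFDerivAt (by simp)
  exact h.eq x y

lemma mem_thickening_of_norm_lt {z : Vec d} {n : Fin d → ℤ} {r : ℝ} (h : ‖z - intVec n‖ < r) :
    z ∈ Metric.thickening r (intLattice d) :=
  Metric.mem_thickening_iff.2 ⟨_, mem_intLattice n, by rwa [dist_eq_norm]⟩

lemma norm_W2_le_of_near {z : Vec d} (hz : z ∈ Metric.thickening m.Θ (intLattice d)) :
    ‖m.W2 z‖ ≤ m.c₁ := by
  have hq : ∀ y, m.c₀ * ‖y‖ ^ 2 ≤ m.W2 z y y ∧ m.W2 z y y ≤ m.c₁ * ‖y‖ ^ 2 := m.W_convex z hz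
  have h1 : ∀ x y, ‖x‖ = ‖y‖ → m.W2 z x y ≤ m.c₁ * ‖x‖ ^ 2 := by
    intro x y hxy
    have ha := (hq (x + y)).2
    have hb := (hq (x - y)).1
    have hc : 0 ≤ m.c₀ * ‖x - y‖ ^ 2 := mul_nonneg m.c₀_pos.le (sq_nonneg _)
    have hs := m.W2_symm z x y
    simp only [map_add, map_sub, _root_.add_apply, _root_.sub_apply]
      at ha hb
    have hn : ‖x + y‖ ^ 2 ≤ (2 * ‖x‖) ^ 2 := by
      have := norm_add_le x y
      gcongr; linarith
    have := mul_le_mul_of_nonneg_left hn m.c₁_pos.le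
    linarith
  have h2 : ∀ x y, m.W2 z x y ≤ m.c₁ * ‖x‖ * ‖y‖ := by
    intro x y
    rcases eq_or_ne x 0 with rfl | hx
    · simp
    rcases eq_or_ne y 0 with rfl | hy
    · simp
    have hx' := norm_pos_iff.2 hx
    have hy' := norm_pos_iff.2 hy
    have := h1 (‖y‖ • x) (‖x‖ • y) (by simp [norm_smul, mul_comm])
    simp only [map_smul, _root_.smul_apply, norm_smul, norm_norm, smul_eq_mul] at this
    have h3 : (‖x‖ * ‖y‖) * m.W2 z x y ≤ (‖x‖ * ‖y‖) * (m.c₁ * ‖x‖ * ‖y‖) := by linarith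
    exact le_of_mul_le_mul_left h3 (by positivity)
  refine ContinuousLinearMap.opNorm_le_bound₂ _ m.c₁_pos.le fun x y => ?_
  rw [Real.norm_eq_abs, abs_le]
  refine ⟨?_, h2 x y⟩
  have := h2 (-x) y
  simp only [map_neg, _root_.neg_apply, norm_neg] at this
  linarith

lemma αGrad_pos : 0 < m.αGrad := by
  have : 0 < m.c₁ ^ 2 / m.c₀ := by have := m.c₁_pos; have := m.c₀_pos; positivity
  have := lt_max_of_lt_right (b := m.supGradW ^ 2 / (m.C₀W * m.Θ ^ 2)) this
  unfold αGrad; linarith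

/-- The gradient of the potential is controlled by the potential itself. -/
lemma norm_W1_sq_le (z : Vec d) : ‖m.W1 z‖ ^ 2 ≤ m.αGrad / 32 * m.W z := by
  have hα1 : m.supGradW ^ 2 / (m.C₀W * m.Θ ^ 2) ≤ m.αGrad / 64 := by
    unfold αGrad; have := le_max_left (m.supGradW ^ 2 / (m.C₀W * m.Θ ^ 2)) (m.c₁ ^ 2 / m.c₀)
    linarith
  have hα2 : m.c₁ ^ 2 / m.c₀ ≤ m.αGrad / 64 := by
    unfold αGrad; have := le_max_right (m.supGradW ^ 2 / (m.C₀W * m.Θ ^ 2)) (m.c₁ ^ 2 / m.c₀)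
    linarith
  have hW := m.W_nonneg z
  have hα := m.αGrad_pos
  have hΘ := m.Θ_pos
  have hC0 := m.C₀W_pos
  have hc0 := m.c₀_pos
  -- near the lattice `|DW| ≤ c₁ |z - n|` and `W ≥ c₀ |z - n|² / 2`; away from it `W ≥ C₀ Θ²`
  by_cases hz : Metric.infDist z (intLattice d) < m.Θ
  · obtain ⟨_, ⟨n, rfl⟩, hn⟩ := (Metric.infDist_lt_iff intLattice_nonempty).1 hz
    rw [dist_eq_norm] at hn
    have hseg : ∀ s ∈ Set.Icc (0 : ℝ) 1,
        intVec n + s • (z - intVec n) ∈ Metric.thickening m.Θ (intLattice d) := by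
      intro s hs
      refine mem_thickening_of_norm_lt (n := n) ?_
      rw [add_sub_cancel_left, norm_smul, Real.norm_eq_abs, abs_of_nonneg hs.1]
      nlinarith [hs.2, norm_nonneg (z - intVec n)]
    have hline : ∀ s : ℝ, HasDerivAt (fun s : ℝ => intVec n + s • (z - intVec n))
        (z - intVec n) s := fun s => by
      simpa using ((hasDerivAt_id s).smul_const (z - intVec n)).const_add (intVec n)
    have hgrad : ‖m.W1 z‖ ≤ m.c₁ * ‖z - intVec n‖ := by
      have h := norm_image_sub_le_of_norm_deriv_le_segment_01'
        (f := fun s : ℝ => m.W1 (intVec n + s • (z - intVec n)))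
        (f' := fun s => m.W2 (intVec n + s • (z - intVec n)) (z - intVec n))
        (C := m.c₁ * ‖z - intVec n‖)
        (fun s _ => ((m.hasFDerivAt_W1 _).comp_hasDerivAt s (hline s)).hasDerivWithinAt)
        (fun s hs => (ContinuousLinearMap.le_opNorm _ _).trans (by
          gcongr; exact m.norm_W2_le_of_near (hseg s ⟨hs.1, hs.2.le⟩)))
      simpa [m.W1_intVec] using h
    have hlow : m.c₀ * ‖z - intVec n‖ ^ 2 / 2 ≤ m.W z := by
      have h := add_add_half_le_of_deriv2_ge
        (f := fun s : ℝ => m.W (intVec n + s • (z - intVec n)))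
        (f' := fun s => m.W1 (intVec n + s • (z - intVec n)) (z - intVec n))
        (f'' := fun s => m.W2 (intVec n + s • (z - intVec n)) (z - intVec n) (z - intVec n))
        (c := m.c₀ * ‖z - intVec n‖ ^ 2)
        (fun s _ => (m.hasFDerivAt_W _).comp_hasDerivAt s (hline s))
        (fun s _ => by
          have := ((m.hasFDerivAt_W1 _).comp_hasDerivAt s (hline s)).clm_apply
            (hasDerivAt_const s (z - intVec n))
          simpa using this)
        (fun s hs => (m.W_convex _ (hseg s hs) _).1)
      simpa [m.W1_intVec, m.W_intVec] using h
    have h1 : ‖m.W1 z‖ ^ 2 ≤ (m.c₁ * ‖z - intVec n‖) ^ 2 := by gcongr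
    have h2 : (m.c₁ * ‖z - intVec n‖) ^ 2
        = 2 * (m.c₁ ^ 2 / m.c₀) * (m.c₀ * ‖z - intVec n‖ ^ 2 / 2) := by
      field_simp
    calc ‖m.W1 z‖ ^ 2 ≤ 2 * (m.c₁ ^ 2 / m.c₀) * (m.c₀ * ‖z - intVec n‖ ^ 2 / 2) := h2 ▸ h1
      _ ≤ 2 * (m.αGrad / 64) * m.W z := by gcongr
      _ = _ := by ring
  · push Not at hz
    have h1 : m.C₀W * m.Θ ^ 2 ≤ m.W z := by
      refine le_trans ?_ (m.W_coercive z).1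
      gcongr
    have h2 : ‖m.W1 z‖ ^ 2 ≤ m.supGradW ^ 2 := by
      have := m.norm_W1_le z; gcongr
    have h3 : m.supGradW ^ 2
        = m.supGradW ^ 2 / (m.C₀W * m.Θ ^ 2) * (m.C₀W * m.Θ ^ 2) := by field_simp
    calc ‖m.W1 z‖ ^ 2 ≤ m.supGradW ^ 2 / (m.C₀W * m.Θ ^ 2) * (m.C₀W * m.Θ ^ 2) := h3 ▸ h2
      _ ≤ m.αGrad / 64 * m.W z := by gcongr
      _ ≤ _ := by nlinarith [mul_nonneg hα.le hW]

/-- Distances to the lattice grow at most by the factor `|B|` under an integer matrix `B`. -/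
lemma W_act_toMat_le (B : GLInt d) (t : Fin d → ℤ) (z : Vec d) :
    m.W (act B.toMat z + intVec t) ≤ m.C₁W / m.C₀W * opNorm B.toMat ^ 2 * m.W z := by
  -- `B` maps the integer lattice into itself
  have hinf : Metric.infDist (act B.toMat z) (intLattice d)
      ≤ opNorm B.toMat * Metric.infDist z (intLattice d) := by
    refine le_of_forall_pos_le_add fun e he => ?_
    have hB := opNorm_nonneg B.toMat
    obtain ⟨_, ⟨n, rfl⟩, hn⟩ := (Metric.infDist_lt_iff intLattice_nonempty).1
      (lt_add_of_pos_right (Metric.infDist z (intLattice d))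
        (show 0 < e / (opNorm B.toMat + 1) by positivity))
    have h1 : Metric.infDist (act B.toMat z) (intLattice d)
        ≤ dist (act B.toMat z) (act B.toMat (intVec n)) :=
      Metric.infDist_le_dist_of_mem (by rw [act_toMat_intVec]; exact mem_intLattice _)
    rw [dist_eq_norm, ← act_sub_right] at h1
    have h2 := norm_act_le_opNorm B.toMat (z - intVec n)
    rw [dist_eq_norm] at hn
    have h3 : opNorm B.toMat * ‖z - intVec n‖
        ≤ opNorm B.toMat * (Metric.infDist z (intLattice d) + e / (opNorm B.toMat + 1)) := by
      gcongr
    have h4 : opNorm B.toMat * (e / (opNorm B.toMat + 1)) ≤ e := by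
      rw [mul_div_assoc', div_le_iff₀ (by positivity)]
      nlinarith
    rw [mul_add] at h3
    linarith
  rw [m.W_per]
  have hC0 := m.C₀W_pos
  have hC1 := m.C₁W_pos
  have hB := opNorm_nonneg B.toMat
  calc m.W (act B.toMat z) ≤ m.C₁W * Metric.infDist (act B.toMat z) (intLattice d) ^ 2 :=
        (m.W_coercive _).2
    _ ≤ m.C₁W * (opNorm B.toMat * Metric.infDist z (intLattice d)) ^ 2 := by
        have := Metric.infDist_nonneg (x := act B.toMat z) (s := intLattice d)
        gcongr
    _ = m.C₁W / m.C₀W * opNorm B.toMat ^ 2 * (m.C₀W * Metric.infDist z (intLattice d) ^ 2) := by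
        field_simp
    _ ≤ _ := by
        have := (m.W_coercive z).1
        gcongr

end Model

end Kac

/-! ### The cut-off function -/

namespace Kac

open Filter Topology MeasureTheory

variable {d : ℕ}

lemma sum_sq_apply_single_le (l : Vec d →L[ℝ] ℝ) :
    ∑ j, l (EuclideanSpace.single j 1) ^ 2 ≤ ‖l‖ ^ 2 := by
  set g : Vec d := ∑ j, l (EuclideanSpace.single j 1) • EuclideanSpace.single j 1 with hg
  have h1 : l g = ∑ j, l (EuclideanSpace.single j 1) ^ 2 := by
    simp [hg, map_sum, sq]
  have h2 : ‖g‖ ^ 2 = ∑ j, l (EuclideanSpace.single j 1) ^ 2 := by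
    rw [EuclideanSpace.norm_sq_eq]
    refine Finset.sum_congr rfl fun i _ => ?_
    simp [hg, Finset.sum_apply, Pi.single_apply]
  have h3 := (le_abs_self _).trans (l.le_opNorm g)
  rw [h1, ← h2] at h3
  rw [← h2]
  rcases eq_or_lt_of_le (norm_nonneg g) with h | h
  · rw [← h]; simp
  · have : ‖g‖ ≤ ‖l‖ := by nlinarith
    gcongr

namespace Model

variable (m : Model d)

/-- The radial cut-off `ξ ↦ φ(|ξ|)` on `ℝ^d`. -/
noncomputable def φt (x : Vec d) : ℝ := m.φ ‖x‖

lemma φ_antitone : Antitone m.φ :=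
  antitone_of_deriv_nonpos (m.φ_contDiff.differentiable (by simp)) m.φ_deriv

lemma φ_nonneg (r : ℝ) : 0 ≤ m.φ r := by
  rw [← m.φ_zero (max r 2) (le_max_right _ _)]
  exact m.φ_antitone (le_max_left _ _)

lemma φ_le_one (r : ℝ) : m.φ r ≤ 1 := by
  rw [← m.φ_one (min r 1) (min_le_right _ _)]
  exact m.φ_antitone (min_le_left _ _)

lemma φt_nonneg (x : Vec d) : 0 ≤ m.φt x := m.φ_nonneg _

lemma φt_le_one (x : Vec d) : m.φt x ≤ 1 := m.φ_le_one _

lemma φt_one {x : Vec d} (hx : ‖x‖ ≤ 1) : m.φt x = 1 := m.φ_one _ hx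

lemma φt_zero {x : Vec d} (hx : 2 ≤ ‖x‖) : m.φt x = 0 := m.φ_zero _ hx

lemma φt_neg (x : Vec d) : m.φt (-x) = m.φt x := by simp [φt]

lemma contDiff_φt {n : ℕ} : ContDiff ℝ n m.φt := by
  rw [contDiff_iff_contDiffAt]
  intro x
  by_cases hx : ‖x‖ < 1
  · have : m.φt =ᶠ[𝓝 x] fun _ => 1 := by
      filter_upwards [(isOpen_lt continuous_norm continuous_const).mem_nhds hx] with y hy
      exact m.φt_one (le_of_lt hy)
    exact contDiffAt_const.congr_of_eventuallyEq this
  · have hx0 : x ≠ 0 := by rintro rfl; simp at hx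
    exact ((m.φ_contDiff.of_le (by exact_mod_cast le_top)).contDiffAt).comp x (contDiffAt_norm ℝ hx0)

lemma continuous_φt : Continuous m.φt := (m.contDiff_φt (n := 0)).continuous

/-- The first derivative of the radial cut-off. -/
noncomputable def dφ : Vec d → Vec d →L[ℝ] ℝ := fderiv ℝ m.φt

/-- The second derivative of the radial cut-off. -/
noncomputable def ddφ : Vec d → Vec d →L[ℝ] Vec d →L[ℝ] ℝ := fderiv ℝ m.dφ

lemma contDiff_dφ {n : ℕ} : ContDiff ℝ n m.dφ :=
  (m.contDiff_φt (n := n + 1)).fderiv_right (by norm_cast)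

lemma contDiff_ddφ {n : ℕ} : ContDiff ℝ n m.ddφ :=
  (m.contDiff_dφ (n := n + 1)).fderiv_right (by norm_cast)

lemma hasFDerivAt_φt (x : Vec d) : HasFDerivAt m.φt (m.dφ x) x :=
  ((m.contDiff_φt (n := 1)).differentiable (by simp) x).hasFDerivAt

lemma hasFDerivAt_dφ (x : Vec d) : HasFDerivAt m.dφ (m.ddφ x) x :=
  ((m.contDiff_dφ (n := 1)).differentiable (by simp) x).hasFDerivAt

lemma dφ_eq_zero {x : Vec d} (hx : m.φt x = 0) : m.dφ x = 0 :=
  IsLocalMin.fderiv_eq_zero (Filter.Eventually.of_forall fun z => by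
    rw [hx]; exact m.φt_nonneg z)

/-- Beyond a zero the cut-off vanishes on the outer half of a line, hence to second order. -/
lemma ddφ_eq_zero {x : Vec d} (hx : m.φt x = 0) : m.ddφ x = 0 := by
  have hx1 : 1 < ‖x‖ := by
    by_contra! h
    rw [m.φt_one h] at hx; exact one_ne_zero hx
  have h1 : ∀ t : ℝ, 1 < t → m.ddφ (t • x) = 0 := by
    intro t ht
    have hlt : ‖x‖ < ‖t • x‖ := by
      rw [norm_smul, Real.norm_eq_abs, abs_of_pos (by linarith)]; nlinarith
    have : m.dφ =ᶠ[𝓝 (t • x)] fun _ => 0 := by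
      filter_upwards [(isOpen_lt continuous_const continuous_norm).mem_nhds hlt] with y hy
      refine m.dφ_eq_zero (le_antisymm ?_ (m.φt_nonneg y))
      rw [← hx]
      exact m.φ_antitone (le_of_lt hy)
    rw [ddφ, this.fderiv_eq]; simp
  have h2 : Tendsto (fun t : ℝ => m.ddφ (t • x)) (𝓝[>] 1) (𝓝 (m.ddφ ((1 : ℝ) • x))) := by
    have : Continuous fun t : ℝ => m.ddφ (t • x) :=
      (m.contDiff_ddφ (n := 0)).continuous.comp (by fun_prop)
    exact (this.tendsto 1).mono_left nhdsWithin_le_nhds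
  rw [one_smul] at h2
  refine tendsto_nhds_unique h2 (tendsto_const_nhds.congr' ?_)
  filter_upwards [self_mem_nhdsWithin] with t ht
  exact (h1 t ht).symm

lemma exists_bound_φ : ∃ C > 0, ∀ x, ‖m.dφ x‖ ≤ C ∧ ‖m.ddφ x‖ ≤ C := by
  obtain ⟨C₁, h₁⟩ := (isCompact_closedBall (0 : Vec d) 2).exists_bound_of_continuousOn
    (m.contDiff_dφ (n := 0)).continuous.continuousOn
  obtain ⟨C₂, h₂⟩ := (isCompact_closedBall (0 : Vec d) 2).exists_bound_of_continuousOn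
    (m.contDiff_ddφ (n := 0)).continuous.continuousOn
  refine ⟨max (max C₁ C₂) 1, by positivity, fun x => ?_⟩
  by_cases hx : ‖x‖ ≤ 2
  · exact ⟨(h₁ x (by simpa using hx)).trans (by simp), (h₂ x (by simpa using hx)).trans (by simp)⟩
  · have h0 : m.φt x = 0 := m.φt_zero (by linarith)
    rw [m.dφ_eq_zero h0, m.ddφ_eq_zero h0]
    simp

lemma sqrtφ_eq (x : Vec d) : m.sqrtφ x = Real.sqrt (m.φt x) := rfl

lemma root4φ_eq (x : Vec d) : m.root4φ x = Real.sqrt (Real.sqrt (m.φt x)) := rfl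

/-- `|∇φ̃| ≤ 2 √φ̃ ‖∇√φ̃‖_∞`. -/
lemma norm_dφ_le (h1 : m.N₁ ≠ ⊤) (x : Vec d) :
    ‖m.dφ x‖ ≤ 2 * m.N₁.toReal * Real.sqrt (m.φt x) := by
  rcases eq_or_lt_of_le (m.φt_nonneg x) with h | h
  · rw [m.dφ_eq_zero h.symm, ← h]; simp
  · have hs : HasFDerivAt m.sqrtφ ((1 / (2 * Real.sqrt (m.φt x))) • m.dφ x) x :=
      (m.hasFDerivAt_φt x).sqrt h.ne'
    have hb : ‖fderiv ℝ m.sqrtφ x‖ ≤ m.N₁.toReal :=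
      norm_le_toReal_supNorm (g := fun y => fderiv ℝ m.sqrtφ y) h1 x
    rw [hs.fderiv, norm_smul, Real.norm_eq_abs, abs_of_pos (by positivity), one_div,
      inv_mul_le_iff₀ (by positivity)] at hb
    linarith

/-- The Frobenius norm of the Hessian of the cut-off is at most a multiple of `√φ̃`; here the second
derivatives of `√φ̃` and the first ones of its root enter. -/
lemma sqrt_sum_ddφ_sq_le (h2 : m.N₂ ≠ ⊤) (h4 : m.N₄ ≠ ⊤) (x : Vec d) :
    Real.sqrt (∑ i, ∑ j, (m.ddφ x (EuclideanSpace.single i 1) (EuclideanSpace.single j 1)) ^ 2)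
      ≤ 2 * (4 * m.N₄.toReal ^ 2 + Real.sqrt d * m.N₂.toReal) * Real.sqrt (m.φt x) := by
  rcases eq_or_lt_of_le (m.φt_nonneg x) with h | h
  · rw [m.ddφ_eq_zero h.symm, ← h]; simp
  set s : ℝ := Real.sqrt (m.φt x) with hs
  have hspos : 0 < s := Real.sqrt_pos.2 h
  set S : Vec d →L[ℝ] Vec d →L[ℝ] ℝ := fderiv ℝ (fderiv ℝ m.sqrtφ) x with hS
  set R : Vec d →L[ℝ] ℝ := fderiv ℝ m.root4φ x with hR
  have hSn : ‖S‖ ≤ m.N₂.toReal :=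
    norm_le_toReal_supNorm (g := fun y => fderiv ℝ (fderiv ℝ m.sqrtφ) y) h2 x
  have hRn : ‖R‖ ≤ m.N₄.toReal := norm_le_toReal_supNorm (g := fun y => fderiv ℝ m.root4φ y) h4 x
  have hpos : ∀ᶠ y in 𝓝 x, 0 < m.φt y := m.continuous_φt.continuousAt.eventually (lt_mem_nhds h)
  have hsd : ∀ y, 0 < m.φt y → ContDiffAt ℝ 2 m.sqrtφ y := fun y hy =>
    ((m.contDiff_φt (n := 2)).contDiffAt).sqrt hy.ne'
  have hrd : DifferentiableAt ℝ m.root4φ x :=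
    ((hsd x h).sqrt hspos.ne').differentiableAt (by simp)
  have hsR : fderiv ℝ m.sqrtφ x = (2 * Real.sqrt s) • R := by
    have : m.sqrtφ = fun y => m.root4φ y ^ 2 := by
      funext y; rw [root4φ_eq, sqrtφ_eq, Real.sq_sqrt (Real.sqrt_nonneg _)]
    rw [this, (hrd.hasFDerivAt.pow 2).fderiv]
    simp [hR, hs, root4φ_eq]
  have hD : m.dφ =ᶠ[𝓝 x] fun y => (2 * m.sqrtφ y) • fderiv ℝ m.sqrtφ y := by
    filter_upwards [hpos] with y hy
    have : m.φt = fun y => m.sqrtφ y ^ 2 := by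
      funext y; rw [sqrtφ_eq, Real.sq_sqrt (m.φt_nonneg y)]
    have h3 := (((hsd y hy).differentiableAt (by simp)).hasFDerivAt.pow 2)
    rw [← this] at h3
    rw [dφ, h3.fderiv]
    simp
  -- with `φ̃ = s²` and `s = r²`: `D²φ̃ = 8 s (Dr ⊗ Dr) + 2 s D²s`
  have hDD : ∀ a b, m.ddφ x a b = 8 * s * (R a * R b) + 2 * s * S a b := by
    intro a b
    have h5 : HasFDerivAt (fderiv ℝ m.sqrtφ) S x :=
      ((((hsd x h).fderiv_right (m := 1) (by norm_num))).differentiableAt (by simp)).hasFDerivAt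
    have h6 : HasFDerivAt (fun y => 2 * m.sqrtφ y) ((2 : ℝ) • fderiv ℝ m.sqrtφ x) x :=
      ((hsd x h).differentiableAt (by simp)).hasFDerivAt.const_mul 2
    have h7 := (h6.smul h5).congr_of_eventuallyEq hD
    rw [ddφ, h7.fderiv, hsR]
    simp only [sqrtφ_eq, ← hs, _root_.add_apply, _root_.smul_apply,
      ContinuousLinearMap.smulRight_apply, smul_eq_mul]
    have : Real.sqrt s * Real.sqrt s = s := Real.mul_self_sqrt hspos.le
    linear_combination 8 * (R a * R b) * this
  set e : Fin d → Vec d := fun i => EuclideanSpace.single i 1 with he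
  set P : Mat d := Matrix.of fun i j => 8 * s * (R (e i) * R (e j)) with hP
  set Q : Mat d := Matrix.of fun i j => 2 * s * S (e i) (e j) with hQ
  -- the first summand has rank one, so that its Frobenius norm is its operator norm
  have hPn : ‖P‖ ≤ 8 * s * m.N₄.toReal ^ 2 := by
    refine le_of_sq_le_sq ?_ (by positivity)
    have h8 : ‖P‖ ^ 2 = (8 * s) ^ 2 * ((∑ i, R (e i) ^ 2) * ∑ j, R (e j) ^ 2) := by
      rw [normSq_eq_sum, Finset.sum_mul_sum, Finset.mul_sum]
      refine Finset.sum_congr rfl fun i _ => ?_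
      rw [Finset.mul_sum]
      refine Finset.sum_congr rfl fun j _ => ?_
      simp only [hP, Matrix.of_apply]; ring
    have h9 := sum_sq_apply_single_le R
    have h10 : ‖R‖ ^ 2 ≤ m.N₄.toReal ^ 2 := by gcongr
    rw [h8, show (8 * s * m.N₄.toReal ^ 2) ^ 2
      = (8 * s) ^ 2 * (m.N₄.toReal ^ 2 * m.N₄.toReal ^ 2) by ring]
    have h11 := h9.trans h10
    have h12 : 0 ≤ ∑ j, R (e j) ^ 2 := Finset.sum_nonneg fun _ _ => sq_nonneg _
    gcongr
  have hQn : ‖Q‖ ≤ 2 * s * (Real.sqrt d * m.N₂.toReal) := by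
    refine le_of_sq_le_sq ?_ (by positivity)
    rw [normSq_eq_sum, mul_pow, mul_pow (Real.sqrt d), Real.sq_sqrt (by positivity)]
    calc ∑ i, ∑ j, Q i j ^ 2 ≤ ∑ _i : Fin d, (2 * s) ^ 2 * m.N₂.toReal ^ 2 := by
          refine Finset.sum_le_sum fun i _ => ?_
          have h13 : ∑ j, Q i j ^ 2 = (2 * s) ^ 2 * ∑ j, S (e i) (e j) ^ 2 := by
            rw [Finset.mul_sum]
            refine Finset.sum_congr rfl fun j _ => ?_
            simp only [hQ, Matrix.of_apply]; ring
          rw [h13]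
          have h14 := sum_sq_apply_single_le (S (e i))
          have h15 : ‖S (e i)‖ ≤ m.N₂.toReal := by
            have := S.le_opNorm (e i)
            rw [he, norm_single_one, mul_one] at this
            exact this.trans hSn
          have h16 : ‖S (e i)‖ ^ 2 ≤ m.N₂.toReal ^ 2 := by gcongr
          have := h14.trans h16
          gcongr
      _ = _ := by simp; ring
  have hsum : Real.sqrt (∑ i, ∑ j, (m.ddφ x (e i) (e j)) ^ 2) = ‖P + Q‖ := by
    rw [← Real.sqrt_sq (norm_nonneg (P + Q)), normSq_eq_sum]
    congr 1
    refine Finset.sum_congr rfl fun i _ => Finset.sum_congr rfl fun j _ => ?_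
    rw [hDD, Matrix.add_apply]
    simp only [hP, hQ, Matrix.of_apply]
  rw [hsum]
  refine (norm_add_le _ _).trans ((add_le_add hPn hQn).trans (le_of_eq (by ring)))

end Model

end Kac

/-! ### Moments of the cut-off and volumes of balls -/

namespace Kac

open Filter Topology MeasureTheory

variable {d : ℕ}

lemma ballVol_eq : ∀ n : ℕ, Model.ballVol n = Real.sqrt Real.pi ^ n / Real.Gamma (n / 2 + 1) := by
  intro n
  rcases Nat.eq_zero_or_pos n with rfl | hn
  · have hb : Metric.ball (0 : Vec 0) 1 = Set.univ := by
      ext x; simp [Subsingleton.elim x 0]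
    have h1 : volume (Set.univ : Set (Vec 0)) = 1 := by
      have := (EuclideanSpace.volume_preserving_symm_measurableEquiv_toLp (Fin 0)).measure_preimage
        (s := Set.univ) MeasurableSet.univ.nullMeasurableSet
      rw [Set.preimage_univ] at this
      rw [this, MeasureTheory.volume_pi, Measure.pi_univ]; simp
    rw [Model.ballVol, hb, h1]; simp
  · have : Nonempty (Fin n) := ⟨⟨0, hn⟩⟩
    rw [Model.ballVol, EuclideanSpace.volume_ball]
    have hG : 0 < Real.Gamma (n / 2 + 1) := Real.Gamma_pos_of_pos (by positivity)
    simp only [Fintype.card_fin, ENNReal.ofReal_one, one_pow, one_mul]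
    exact ENNReal.toReal_ofReal (by positivity)

lemma ballVol_pos (n : ℕ) : 0 < Model.ballVol n := by
  rw [ballVol_eq]
  have hG : 0 < Real.Gamma (n / 2 + 1) := Real.Gamma_pos_of_pos (by positivity)
  positivity

lemma ballVol_add_two (n : ℕ) :
    Model.ballVol (n + 2) = Real.pi / (n / 2 + 1) * Model.ballVol n := by
  have hG : 0 < Real.Gamma (n / 2 + 1) := Real.Gamma_pos_of_pos (by positivity)
  rw [ballVol_eq, ballVol_eq]
  have h1 : (((n + 2 : ℕ) : ℝ) / 2 + 1) = (n / 2 + 1) + 1 := by push_cast; ring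
  rw [h1, Real.Gamma_add_one (by positivity), pow_add, Real.sq_sqrt Real.pi_pos.le]
  field_simp

/-- The volume of the unit ball at most doubles from one dimension to the next; the recursion in
steps of two reduces this to the dimensions zero and one. -/
lemma ballVol_succ_le : ∀ n : ℕ, Model.ballVol (n + 1) ≤ 2 * Model.ballVol n
  | 0 => by
    have h1 := ballVol_eq 0
    have h2 := ballVol_eq 1
    have h3 : Real.Gamma (1 / 2 + 1) = 1 / 2 * Real.sqrt Real.pi := by
      rw [Real.Gamma_add_one (by norm_num), Real.Gamma_one_half_eq]
    have h4 : 0 < Real.sqrt Real.pi := Real.sqrt_pos.2 Real.pi_pos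
    simp only [Nat.cast_zero, zero_div, zero_add, Real.Gamma_one, pow_zero] at h1
    simp only [Nat.cast_one, pow_one, h3] at h2
    rw [h1, zero_add, h2]
    apply le_of_eq; field_simp
  | 1 => by
    have h1 := ballVol_add_two 0
    have h2 := ballVol_eq 1
    have h3 : Real.Gamma (1 / 2 + 1) = 1 / 2 * Real.sqrt Real.pi := by
      rw [Real.Gamma_add_one (by norm_num), Real.Gamma_one_half_eq]
    have h4 : 0 < Real.sqrt Real.pi := Real.sqrt_pos.2 Real.pi_pos
    have h0 := ballVol_eq 0
    simp only [Nat.cast_zero, zero_div, zero_add, Real.Gamma_one, pow_zero] at h0 h1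
    simp only [Nat.cast_one, pow_one, h3] at h2
    rw [h1, h0, h2]
    have h5 : Real.sqrt Real.pi / (1 / 2 * Real.sqrt Real.pi) = 2 := by field_simp
    rw [h5]
    have := Real.pi_le_four
    linarith
  | n + 2 => by
    have ih := ballVol_succ_le n
    have h1 := ballVol_add_two (n + 1)
    have h2 := ballVol_add_two n
    have hn := ballVol_pos n
    rw [show n + 2 + 1 = n + 1 + 2 by ring, h1, h2]
    have h3 : Real.pi / (((n + 1 : ℕ) : ℝ) / 2 + 1) ≤ Real.pi / ((n : ℝ) / 2 + 1) := by
      have := Real.pi_pos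
      gcongr; simp
    have hp : 0 ≤ Real.pi / ((n : ℝ) / 2 + 1) := by have := Real.pi_pos; positivity
    have hn1 := (ballVol_pos (n + 1)).le
    calc _ ≤ Real.pi / ((n : ℝ) / 2 + 1) * (2 * Model.ballVol n) := by gcongr
      _ = _ := by ring

lemma volume_ball_real (x : Vec d) {r : ℝ} (hr : 0 < r) :
    volume.real (Metric.ball x r) = r ^ d * Model.ballVol d := by
  rw [Measure.real, Measure.addHaar_ball_of_pos _ _ hr, ENNReal.toReal_mul,
    ENNReal.toReal_ofReal (by positivity)]
  simp [Model.ballVol]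

lemma integral_comp_isometry (e : Vec d ≃ₗᵢ[ℝ] Vec d) (f : Vec d → ℝ) :
    ∫ x, f (e x) = ∫ x, f x :=
  e.measurePreserving.integral_comp e.toHomeomorph.measurableEmbedding f

namespace Model

variable (m : Model d)

lemma hasCompactSupport_φt_mul (f : Vec d → ℝ) : HasCompactSupport fun x => m.φt x * f x :=
  HasCompactSupport.intro (isCompact_closedBall (0 : Vec d) 2) fun x hx => by
    rw [m.φt_zero, zero_mul]; simp at hx; exact hx.le

lemma integrable_φt_mul {f : Vec d → ℝ} (hf : Continuous f) :
    Integrable fun x => m.φt x * f x :=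
  (m.continuous_φt.mul hf).integrable_of_hasCompactSupport (m.hasCompactSupport_φt_mul f)

lemma integrable_φt : Integrable m.φt := by
  simpa using m.integrable_φt_mul (f := fun _ => 1) continuous_const

lemma Cφ_eq : m.Cφ = ∫ x, m.φt x := rfl

lemma ballVol_le_Cφ : ballVol d ≤ m.Cφ := by
  have h1 : ∫ x, (Metric.ball (0 : Vec d) 1).indicator (fun _ => (1 : ℝ)) x = ballVol d := by
    rw [integral_indicator_const _ measurableSet_ball, volume_ball_real _ one_pos]; simp
  rw [← h1, Cφ_eq]
  refine integral_mono_of_nonneg (Filter.Eventually.of_forall fun x => ?_) m.integrable_φt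
    (Filter.Eventually.of_forall fun x => ?_)
  · exact Set.indicator_nonneg (fun _ _ => zero_le_one) _
  · refine Set.indicator_le' (fun x hx => ?_) (fun x _ => m.φt_nonneg x) x
    rw [m.φt_one (by simpa using (mem_ball_zero_iff.1 hx).le)]

lemma Cφ_pos : 0 < m.Cφ := (ballVol_pos d).trans_le m.ballVol_le_Cφ

lemma Cφ_le : m.Cφ ≤ 2 ^ d * ballVol d := by
  have h1 : ∫ x, (Metric.ball (0 : Vec d) 2).indicator (fun _ => (1 : ℝ)) x = 2 ^ d * ballVol d := by
    rw [integral_indicator_const _ measurableSet_ball, volume_ball_real _ two_pos]; simp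
  rw [← h1, Cφ_eq]
  refine integral_mono_of_nonneg (Filter.Eventually.of_forall m.φt_nonneg)
    ?_
    (Filter.Eventually.of_forall fun x => ?_)
  · exact (integrableOn_const (by finiteness)).integrable_indicator measurableSet_ball
  · by_cases hx : x ∈ Metric.ball (0 : Vec d) 2
    · rw [Set.indicator_of_mem hx]; exact m.φt_le_one x
    · rw [Set.indicator_of_notMem hx, m.φt_zero (by simpa using hx)]

/-- The second radial moment of the cut-off is at least the one of the unit ball. -/
lemma le_moment (hd : 1 ≤ d) :
    d / (d + 2) * m.Cφ ≤ ∫ x, m.φt x * ‖x‖ ^ 2 := by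
  have : Nonempty (Fin d) := ⟨⟨0, hd⟩⟩
  have hr : ∀ f : ℝ → ℝ, ∫ x : Vec d, f ‖x‖
      = d * ballVol d * ∫ y in Set.Ioi (0 : ℝ), y ^ (d - 1) * f y := by
    intro f
    rw [integral_fun_norm_addHaar]
    simp [mul_assoc, ballVol, Measure.real]
  have hI : ∀ k : ℕ, ∫ y in Set.Ioi (0 : ℝ), y ^ k * m.φ y = ∫ y in (0 : ℝ)..2, y ^ k * m.φ y := by
    intro k
    rw [intervalIntegral.integral_of_le zero_le_two]
    refine setIntegral_eq_of_subset_of_forall_sdiff_eq_zero measurableSet_Ioi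
      (fun y (hy : y ∈ Set.Ioc (0 : ℝ) 2) => hy.1) fun y hy => ?_
    have : 2 ≤ y := by
      by_contra! h
      exact hy.2 ⟨hy.1, h.le⟩
    rw [m.φ_zero y this, mul_zero]
  have hC : m.Cφ = d * ballVol d * ∫ y in (0 : ℝ)..2, y ^ (d - 1) * m.φ y := by
    rw [← hI, Cφ, hr]
  have hM : ∫ x : Vec d, m.φt x * ‖x‖ ^ 2
      = d * ballVol d * ∫ y in (0 : ℝ)..2, y ^ (d + 1) * m.φ y := by
    rw [← hI, show (fun x : Vec d => m.φt x * ‖x‖ ^ 2)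
      = fun x => (fun r => m.φ r * r ^ 2) ‖x‖ from rfl, hr fun r => m.φ r * r ^ 2]
    congr 2
    funext y
    rw [show d + 1 = (d - 1) + 2 by omega, pow_add]; ring
  have hcφ : Continuous m.φ := m.φ_contDiff.continuous
  have hcφ' : Continuous (deriv m.φ) := m.φ_contDiff.continuous_deriv (by simp)
  have hder : ∀ y ∈ Set.uIcc (0 : ℝ) 2, HasDerivAt (fun y => (y ^ (d + 2) - y ^ d) * m.φ y)
      ((((d + 2 : ℕ) : ℝ) * y ^ (d + 1) - d * y ^ (d - 1)) * m.φ y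
        + (y ^ (d + 2) - y ^ d) * deriv m.φ y) y := fun y _ => by
    have h1 := (hasDerivAt_pow (d + 2) y).sub (hasDerivAt_pow d y)
    exact h1.mul (m.φ_contDiff.differentiable (by simp) y).hasDerivAt
  -- integrate the derivative of `(y^(d+2) - y^d) φ(y)`, which vanishes at both ends
  have hftc := intervalIntegral.integral_eq_sub_of_hasDerivAt hder
    (Continuous.intervalIntegrable (by fun_prop) _ _)
  rw [m.φ_zero 2 le_rfl] at hftc
  have h0 : (0 : ℝ) ^ (d + 2) - 0 ^ d = 0 := by
    rw [zero_pow (by omega), zero_pow (by omega)]; ring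
  rw [h0, intervalIntegral.integral_add (Continuous.intervalIntegrable (by fun_prop) _ _)
    (Continuous.intervalIntegrable (by fun_prop) _ _)] at hftc
  -- the derivative of `φ` is nonpositive, and zero where `y^(d+2) < y^d`
  have hneg : ∫ y in (0 : ℝ)..2, (y ^ (d + 2) - y ^ d) * deriv m.φ y ≤ 0 := by
    have : 0 ≤ ∫ y in (0 : ℝ)..2, -((y ^ (d + 2) - y ^ d) * deriv m.φ y) := by
      refine intervalIntegral.integral_nonneg zero_le_two fun y hy => ?_
      rcases lt_or_ge y 1 with h | h
      · have : deriv m.φ y = 0 := by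
          have h2 : m.φ =ᶠ[𝓝 y] fun _ => 1 := by
            filter_upwards [gt_mem_nhds h] with z hz
            exact m.φ_one z hz.le
          rw [h2.deriv_eq]; simp
        rw [this]; simp
      · have h2 := m.φ_deriv y
        have h3 : y ^ d ≤ y ^ (d + 2) := pow_le_pow_right₀ h (by omega)
        nlinarith
    rw [intervalIntegral.integral_neg] at this
    linarith
  have hsplit : ∫ y in (0 : ℝ)..2, (((d + 2 : ℕ) : ℝ) * y ^ (d + 1) - d * y ^ (d - 1)) * m.φ y
      = (d + 2) * (∫ y in (0 : ℝ)..2, y ^ (d + 1) * m.φ y)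
        - d * ∫ y in (0 : ℝ)..2, y ^ (d - 1) * m.φ y := by
    rw [← intervalIntegral.integral_const_mul, ← intervalIntegral.integral_const_mul,
      ← intervalIntegral.integral_sub (Continuous.intervalIntegrable (by fun_prop) _ _)
        (Continuous.intervalIntegrable (by fun_prop) _ _)]
    congr 1
    funext y
    push_cast; ring
  rw [hsplit] at hftc
  have hfin : d * (∫ y in (0 : ℝ)..2, y ^ (d - 1) * m.φ y)
      ≤ (d + 2) * ∫ y in (0 : ℝ)..2, y ^ (d + 1) * m.φ y := by linarith
  rw [hC, hM, div_mul_eq_mul_div, div_le_iff₀ (by positivity)]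
  have := mul_le_mul_of_nonneg_left hfin
    (show 0 ≤ d * ballVol d by have := ballVol_pos d; positivity)
  linarith

lemma moment_single (i : Fin d) : ∫ x : Vec d, m.φt x * x i = 0 := by
  have h := integral_comp_isometry (LinearIsometryEquiv.neg ℝ (E := Vec d)) fun x => m.φt x * x i
  simp only [LinearIsometryEquiv.coe_neg, φt_neg, PiLp.neg_apply, mul_neg] at h
  rw [integral_neg] at h
  linarith

/-- Reflection in a coordinate. -/
noncomputable def flip (i : Fin d) : Vec d ≃ₗᵢ[ℝ] Vec d :=
  LinearIsometryEquiv.piLpCongrRight 2 fun k =>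
    if k = i then LinearIsometryEquiv.neg ℝ else LinearIsometryEquiv.refl ℝ ℝ

lemma moment_mixed {i j : Fin d} (hij : i ≠ j) : ∫ x : Vec d, m.φt x * (x i * x j) = 0 := by
  have h := integral_comp_isometry (flip i) fun x => m.φt x * (x i * x j)
  have h1 : ∀ x : Vec d, m.φt (flip i x) * (flip i x i * flip i x j) = -(m.φt x * (x i * x j)) := by
    intro x
    have h2 : flip i x i = -x i := by simp [flip]
    have h3 : flip i x j = x j := by simp [flip, hij.symm]
    rw [h2, h3, φt, LinearIsometryEquiv.norm_map, ← φt]; ring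
  simp only [h1] at h
  rw [integral_neg] at h
  linarith

lemma moment_diag (i j : Fin d) : ∫ x : Vec d, m.φt x * x i ^ 2 = ∫ x : Vec d, m.φt x * x j ^ 2 := by
  have h := integral_comp_isometry
    (LinearIsometryEquiv.piLpCongrLeft 2 ℝ ℝ (Equiv.swap i j)) fun x => m.φt x * x i ^ 2
  rw [← h]
  congr 1
  funext x
  rw [φt, φt, LinearIsometryEquiv.norm_map]
  simp [LinearIsometryEquiv.piLpCongrLeft_apply, Equiv.piCongrLeft']

lemma le_moment_diag (hd : 1 ≤ d) (i : Fin d) :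
    m.Cφ / (d + 2) ≤ ∫ x : Vec d, m.φt x * x i ^ 2 := by
  have h1 : ∫ x : Vec d, m.φt x * ‖x‖ ^ 2 = d * ∫ x : Vec d, m.φt x * x i ^ 2 := by
    simp_rw [EuclideanSpace.norm_sq_eq, Real.norm_eq_abs, sq_abs, Finset.mul_sum]
    rw [integral_finsetSum _ fun j _ => m.integrable_φt_mul (by fun_prop)]
    rw [Finset.sum_congr rfl fun j _ => m.moment_diag j i]
    simp
  have h2 := m.le_moment hd
  rw [h1, div_mul_eq_mul_div, mul_div_assoc] at h2
  exact le_of_mul_le_mul_left h2 (by exact_mod_cast hd)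

/-- The quadratic form governing the convexity of the misfit energy of a perfect lattice. -/
lemma le_integral_lin (hd : 1 ≤ d) (b : Aff d) :
    m.Cφ * (‖b.1‖ ^ 2 / (d + 2) + ‖b.2‖ ^ 2) ≤ ∫ x, m.φt x * ‖lin b x‖ ^ 2 := by
  set M := b.1
  set t := b.2
  -- the square splits into quadratic, linear and constant terms in `x`; the linear ones and the
  -- mixed quadratic ones integrate to zero by symmetry
  have hexp : ∀ x : Vec d, m.φt x * ‖lin b x‖ ^ 2
      = (∑ k, ∑ i, ∑ j, M k i * M k j * (m.φt x * (x i * x j)))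
        + ((∑ k, ∑ i, 2 * t k * M k i * (m.φt x * x i)) + m.φt x * ‖t‖ ^ 2) := by
    intro x
    have hk : ∀ k, (lin b x) k ^ 2 = (∑ i, ∑ j, M k i * M k j * (x i * x j))
        + ((∑ i, 2 * t k * M k i * x i) + t k ^ 2) := by
      intro k
      have : lin b x k = (∑ i, M k i * x i) + t k := by
        simp [lin, act_apply, M, t]
      rw [this, add_sq, sq (∑ i, M k i * x i), Finset.sum_mul_sum, add_assoc]
      congr 1
      · refine Finset.sum_congr rfl fun i _ => Finset.sum_congr rfl fun j _ => by ring
      · congr 1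
        rw [Finset.mul_sum, Finset.sum_mul]
        exact Finset.sum_congr rfl fun i _ => by ring
    rw [EuclideanSpace.norm_sq_eq, EuclideanSpace.norm_sq_eq]
    simp only [Real.norm_eq_abs, sq_abs, hk, Finset.sum_add_distrib, mul_add, Finset.mul_sum]
    congr 1
    · refine Finset.sum_congr rfl fun k _ => Finset.sum_congr rfl fun i _ =>
        Finset.sum_congr rfl fun j _ => by ring
    · congr 1
      refine Finset.sum_congr rfl fun k _ => Finset.sum_congr rfl fun i _ => by ring
  have hi2 : ∀ i j, Integrable fun x : Vec d => m.φt x * (x i * x j) :=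
    fun i j => m.integrable_φt_mul (by fun_prop)
  have hi1 : ∀ i, Integrable fun x : Vec d => m.φt x * x i :=
    fun i => m.integrable_φt_mul (by fun_prop)
  simp_rw [hexp]
  rw [integral_add, integral_add, integral_finsetSum, integral_finsetSum]
  rotate_left
  · exact fun k _ => integrable_finsetSum _ fun i _ => (hi1 i).const_mul _
  · exact fun k _ => integrable_finsetSum _ fun i _ => integrable_finsetSum _ fun j _ =>
      (hi2 i j).const_mul _
  · exact integrable_finsetSum _ fun k _ => integrable_finsetSum _ fun i _ => (hi1 i).const_mul _
  · exact m.integrable_φt.mul_const _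
  · exact integrable_finsetSum _ fun k _ => integrable_finsetSum _ fun i _ =>
      integrable_finsetSum _ fun j _ => (hi2 i j).const_mul _
  · exact (integrable_finsetSum _ fun k _ => integrable_finsetSum _ fun i _ =>
      (hi1 i).const_mul _).add (m.integrable_φt.mul_const _)
  have hz : ∑ k, ∫ x : Vec d, ∑ i, 2 * t k * M k i * (m.φt x * x i) = 0 := by
    refine Finset.sum_eq_zero fun k _ => ?_
    rw [integral_finsetSum _ fun i _ => (hi1 i).const_mul _]
    refine Finset.sum_eq_zero fun i _ => ?_
    rw [integral_const_mul, m.moment_single, mul_zero]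
  rw [hz, zero_add, integral_mul_const, ← Cφ_eq, mul_add]
  refine add_le_add ?_ le_rfl
  rw [normSq_eq_sum, Finset.sum_div, Finset.mul_sum]
  refine Finset.sum_le_sum fun k _ => ?_
  rw [integral_finsetSum _ fun i _ => integrable_finsetSum _ fun j _ => (hi2 i j).const_mul _,
    Finset.sum_div, Finset.mul_sum]
  refine Finset.sum_le_sum fun i _ => ?_
  rw [integral_finsetSum _ fun j _ => (hi2 i j).const_mul _, Finset.sum_eq_single i]
  · rw [integral_const_mul]
    have h3 := m.le_moment_diag hd i
    have h4 : ∫ x : Vec d, m.φt x * (x i * x i) = ∫ x : Vec d, m.φt x * x i ^ 2 := by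
      simp_rw [sq]
    rw [h4]
    calc _ = M k i ^ 2 * (m.Cφ / (d + 2)) := by ring
      _ ≤ M k i ^ 2 * ∫ x : Vec d, m.φt x * x i ^ 2 := by gcongr
      _ = _ := by ring
  · intro j _ hj
    rw [integral_const_mul, m.moment_mixed hj.symm, mul_zero]
  · simp

lemma Ccon_pos {ρ D : ℝ} (hρ : 0 < ρ) (hD : 0 < D) : 0 < m.Ccon ρ D := by
  have := m.c₀_pos
  have := m.Cφ_pos
  have := ballVol_pos (d - 1)
  unfold Ccon
  positivity

/-- The convexity constant lies below the one of a perfect lattice. -/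
lemma Ccon_le (hd : 1 ≤ d) (ρ D : ℝ) :
    m.Ccon ρ D ≤ m.c₀ * min (1 / 12) (1 / (9 + d) * (ρ ^ 2 / D ^ 2)) := by
  have h0 := m.c₀_pos
  have hw := ballVol_pos (d - 1)
  have h1 : m.Cφ ≤ 2 ^ d * (2 * ballVol (d - 1)) := by
    refine m.Cφ_le.trans ?_
    have := ballVol_succ_le (d - 1)
    rw [Nat.sub_add_cancel hd] at this
    gcongr
  have h2 : m.Cφ ^ 2 ≤ 4 * ballVol (d - 1) ^ 2 * 4 ^ d := by
    have : m.Cφ ^ 2 ≤ (2 ^ d * (2 * ballVol (d - 1))) ^ 2 := by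
      have := m.Cφ_pos
      gcongr
    refine this.trans (le_of_eq ?_)
    rw [mul_pow, ← pow_mul, mul_comm d 2, pow_mul]; norm_num; ring
  unfold Ccon
  have h3 : m.Cφ ^ 2 / (4 * (9 + (d : ℝ)) * ballVol (d - 1) ^ 2 * 4 ^ d) ≤ 1 / (9 + d) := by
    rw [div_le_div_iff₀ (by positivity) (by positivity)]
    nlinarith [show (0 : ℝ) ≤ 9 + d by positivity]
  gcongr

end Model

end Kac

/-! ### Lattice cells -/

namespace Kac

open Filter Topology MeasureTheory

variable {d : ℕ}

lemma det_toEuclideanLin (A : Mat d) : LinearMap.det (Matrix.toEuclideanLin A) = A.det := by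
  rw [Matrix.toEuclideanLin_eq_toLin_orthonormal]
  exact LinearMap.det_toLin _ A

/-- The unit cube of points with integer part `n`. -/
lemma volume_floorVec (n : Fin d → ℤ) : volume {z : Vec d | floorVec z = n} = 1 := by
  have h1 : {z : Vec d | floorVec z = n} = (MeasurableEquiv.toLp 2 (Fin d → ℝ)).symm ⁻¹'
      (Set.univ.pi fun i => Set.Ico (n i : ℝ) (n i + 1)) := by
    ext z
    simp only [Set.mem_ofPred_eq, Set.mem_preimage, Set.mem_pi, Set.mem_univ, true_implies, floorVec,
      funext_iff, Int.floor_eq_iff, Set.mem_Ico]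
    rfl
  rw [h1, (EuclideanSpace.volume_preserving_symm_measurableEquiv_toLp (Fin d)).measure_preimage
    (MeasurableSet.univ_pi fun i => measurableSet_Ico).nullMeasurableSet, Real.volume_pi_Ico]
  simp

lemma measurableSet_floorVec (n : Fin d → ℤ) : MeasurableSet {z : Vec d | floorVec z = n} := by
  have : {z : Vec d | floorVec z = n} = ⋂ i, {z : Vec d | ⌊z i⌋ = n i} := by
    ext z; simp [floorVec, funext_iff]
  rw [this]
  refine MeasurableSet.iInter fun i => ?_
  have h : Measurable fun z : Vec d => ⌊z i⌋ := Int.measurable_floor.comp (by fun_prop)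
  exact h (measurableSet_singleton (n i))

/-- The cell of the lattice `a` (rescaled by `l`) with index `n`: all points whose lattice coordinate
has integer part `n`. -/
def cell (l : ℝ) (a : Aff d) (n : Fin d → ℤ) : Set (Vec d) := {x | floorVec (lin a (l • x)) = n}

lemma continuous_lin (a : Aff d) : Continuous (lin a) := by
  have : lin a = fun x => actL d a.1 x + a.2 := rfl
  rw [this]; fun_prop

lemma measurableSet_cell (l : ℝ) (a : Aff d) (n : Fin d → ℤ) : MeasurableSet (cell l a n) := by
  have h : Measurable fun x : Vec d => lin a (l • x) :=
    ((continuous_lin a).comp (continuous_const_smul l)).measurable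
  exact h (measurableSet_floorVec n)

lemma volume_cell {l : ℝ} (hl : 0 < l) {a : Aff d} (ha : 0 < a.1.det) (n : Fin d → ℤ) :
    volume.real (cell l a n) = (a.1.det * l ^ d)⁻¹ := by
  have hdet : LinearMap.det (l • Matrix.toEuclideanLin a.1) = l ^ d * a.1.det := by
    rw [LinearMap.det_smul, det_toEuclideanLin]; simp
  have h1 : cell l a n = (l • Matrix.toEuclideanLin a.1) ⁻¹'
      ((fun z => z + a.2) ⁻¹' {z : Vec d | floorVec z = n}) := by
    ext x
    simp [cell, lin, act]
  rw [Measure.real, h1, Measure.addHaar_preimage_linearMap _ (by rw [hdet]; positivity),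
    measure_preimage_add_right, volume_floorVec, hdet, mul_one,
    ENNReal.toReal_ofReal (abs_nonneg _), abs_of_pos (by positivity), mul_comm]

lemma cell_disjoint (l : ℝ) (a : Aff d) {n k : Fin d → ℤ} (h : n ≠ k) :
    Disjoint (cell l a n) (cell l a k) := by
  rw [Set.disjoint_left]
  rintro x hx hx'
  exact h (hx.symm.trans hx')

lemma dist_le_of_mem_cell {l K : ℝ} (hl : 0 < l) {a : Aff d} (ha : a.1.det ≠ 0)
    (hK : ‖a.1⁻¹‖ ≤ K) {n : Fin d → ℤ} {x z : Vec d} (hx : x ∈ cell l a n)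
    (hz : ‖lin a (l • z) - intVec n‖ ≤ 1) : ‖z - x‖ ≤ l⁻¹ * (K * (d + 1)) := by
  have h1 : ‖lin a (l • x) - intVec n‖ ≤ d := by
    have := norm_sub_floorVec_le (lin a (l • x))
    rwa [show floorVec (lin a (l • x)) = n from hx] at this
  have h2 : ‖lin a (l • z) - lin a (l • x)‖ ≤ d + 1 := by
    have : lin a (l • z) - lin a (l • x)
      = (lin a (l • z) - intVec n) - (lin a (l • x) - intVec n) := by abel
    rw [this]
    refine (norm_sub_le _ _).trans (by linarith)
  have h3 : lin a (l • z) - lin a (l • x) = act a.1 (l • (z - x)) := by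
    simp [lin, smul_sub, act_sub_right]
  have h4 : ‖l • (z - x)‖ ≤ K * (d + 1) := by
    rw [← act_inv_act ha (l • (z - x)), ← h3]
    refine (norm_act_le _ _).trans ?_
    have : 0 ≤ K := (norm_nonneg _).trans hK
    gcongr
  rw [norm_smul, Real.norm_eq_abs, abs_of_pos hl] at h4
  rw [le_inv_mul_iff₀ hl]
  exact h4

/-- A Riemann sum over the cells of finitely many lattice points. -/
lemma abs_sum_sub_integral_cells_le {l K L : ℝ} (hl : 0 < l) {a : Aff d} (ha : 0 < a.1.det)
    (hK : ‖a.1⁻¹‖ ≤ K) (hlK : l⁻¹ * (K * (d + 1)) ≤ 1) {P : Finset (Vec d)} {x : Vec d → Vec d}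
    {n : Vec d → Fin d → ℤ} (hn : Set.InjOn n P) (hx : ∀ p ∈ P, ‖x p‖ ≤ 2)
    (hxn : ∀ p ∈ P, ‖lin a (l • x p) - intVec (n p)‖ ≤ 1) {g : Vec d → ℝ} (hg : Continuous g)
    (hL0 : 0 ≤ L) (hL : ∀ u v : Vec d, ‖u‖ ≤ 3 → ‖v‖ ≤ 3 → |g u - g v| ≤ L * ‖u - v‖) :
    |(∑ p ∈ P, g (x p)) * (a.1.det * l ^ d)⁻¹ - ∫ z in ⋃ p ∈ P, cell l a (n p), g z|
      ≤ L * (l⁻¹ * (K * (d + 1))) * volume.real (Metric.closedBall (0 : Vec d) 3) := by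
  have hsub : ∀ p ∈ P, cell l a (n p) ⊆ Metric.closedBall (0 : Vec d) 3 := by
    intro p hp z hz
    have h1 := dist_le_of_mem_cell hl ha.ne' hK hz (hxn p hp)
    have h2 := hx p hp
    have h3 : ‖z‖ ≤ ‖x p‖ + ‖x p - z‖ := by
      have := norm_sub_le (x p) (x p - z); simpa using this
    simp only [mem_closedBall_zero_iff]; linarith
  have hint : ∀ p ∈ P, IntegrableOn g (cell l a (n p)) := fun p hp =>
    (hg.continuousOn.integrableOn_compact (isCompact_closedBall _ _)).mono_set (hsub p hp)
  have hdisj : (↑P : Set (Vec d)).Pairwise (Function.onFun Disjoint fun p => cell l a (n p)) :=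
    fun p hp q hq hpq => cell_disjoint l a fun h => hpq (hn hp hq h)
  have hfin : ∀ p ∈ P, volume (cell l a (n p)) < ⊤ := fun p hp =>
    (measure_mono (hsub p hp)).trans_lt measure_closedBall_lt_top
  rw [integral_biUnion_finset _ (fun p _ => measurableSet_cell _ _ _) hdisj hint, Finset.sum_mul,
    ← Finset.sum_sub_distrib]
  set r := l⁻¹ * (K * (d + 1)) with hr
  -- all cells have the same volume, so each term compares `g` at one point with its mean over a
  -- cell
  have hterm : ∀ p ∈ P, |g (x p) * (a.1.det * l ^ d)⁻¹ - ∫ z in cell l a (n p), g z|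
      ≤ L * r * volume.real (cell l a (n p)) := by
    intro p hp
    have h1 : g (x p) * (a.1.det * l ^ d)⁻¹ - ∫ z in cell l a (n p), g z
        = ∫ z in cell l a (n p), (g (x p) - g z) := by
      have hc : IntegrableOn (fun _ => g (x p)) (cell l a (n p)) := integrableOn_const (hfin p hp).ne
      rw [integral_sub hc (hint p hp), setIntegral_const,
        volume_cell hl ha, smul_eq_mul, mul_comm]
    rw [h1, ← Real.norm_eq_abs]
    refine norm_setIntegral_le_of_norm_le_const (hfin p hp) fun z hz => ?_
    have h2 := dist_le_of_mem_cell hl ha.ne' hK hz (hxn p hp)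
    have h3 := hL (x p) z ((hx p hp).trans (by norm_num)) (by simpa using hsub p hp hz)
    rw [Real.norm_eq_abs]
    exact h3.trans (by gcongr)
  have hr0 : 0 ≤ r := by
    have : 0 ≤ K := (norm_nonneg _).trans hK
    positivity
  calc _ ≤ ∑ p ∈ P, L * r * volume.real (cell l a (n p)) :=
        (Finset.abs_sum_le_sum_abs _ _).trans (Finset.sum_le_sum hterm)
    _ = L * r * volume.real (⋃ p ∈ P, cell l a (n p)) := by
        rw [← Finset.mul_sum, measureReal_biUnion_finset hdisj (fun p _ => measurableSet_cell _ _ _)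
          (fun p hp => (hfin p hp).ne)]
    _ ≤ _ := by
        refine mul_le_mul_of_nonneg_left ?_ (by positivity)
        refine measureReal_mono (Set.iUnion₂_subset hsub) measure_closedBall_lt_top.ne

/-! ### Lattices fitting a configuration -/

namespace Model

variable (m : Model d)

/-- The weight of the atom `p` seen from `y` at scale `l`. -/
noncomputable def wt (l : ℝ) (y p : Vec d) : ℝ := m.φt (l⁻¹ • (p - y))

/-- The normalising factor of the local averages. -/
noncomputable def nrm (l : ℝ) : ℝ := (m.Cφ * l ^ d)⁻¹

/-- The misfit energy without the factor `‖A⁻¹‖²`. -/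
noncomputable def misfit (l : ℝ) (a : Aff d) (χ : Finset (Vec d)) (y : Vec d) : ℝ :=
  m.nrm l * ∑ p ∈ χ, m.W (lin a (p - y)) * m.wt l y p

variable {m}

lemma nrm_pos {l : ℝ} (hl : 0 < l) : 0 < m.nrm l := by
  have := m.Cφ_pos; unfold nrm; positivity

lemma wt_nonneg (l : ℝ) (y p : Vec d) : 0 ≤ m.wt l y p := m.φt_nonneg _

lemma wt_eq {l : ℝ} (hl : 0 < l) (y p : Vec d) : m.φ (l⁻¹ * ‖p - y‖) = m.wt l y p := by
  rw [wt, φt, norm_smul, Real.norm_eq_abs, abs_of_pos (inv_pos.2 hl)]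

lemma norm_scaled {l : ℝ} (hl : 0 < l) (v : Vec d) (r : ℝ) : ‖l⁻¹ • v‖ ≤ r ↔ ‖v‖ ≤ r * l := by
  rw [norm_smul, Real.norm_eq_abs, abs_of_pos (inv_pos.2 hl), inv_mul_le_iff₀ hl, mul_comm]

lemma wt_eq_zero {l : ℝ} (hl : 0 < l) {y p : Vec d} (h : ¬ ‖p - y‖ ≤ 2 * l) : m.wt l y p = 0 :=
  m.φt_zero (le_of_lt (not_le.1 fun h' => h ((norm_scaled hl _ _).1 h')))

lemma rho_eq {l : ℝ} (hl : 0 < l) (χ : Finset (Vec d)) (y : Vec d) :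
    m.rho l χ y = m.nrm l * ∑ p ∈ χ, m.wt l y p := by
  simp only [rho, wt_eq hl, nrm, one_div]

lemma J_eq {l : ℝ} (hl : 0 < l) (a : Aff d) (χ : Finset (Vec d)) (y : Vec d) :
    m.J l a χ y = invSq a.1 * m.misfit l a χ y := by
  simp only [J, wt_eq hl, misfit, nrm, invSq, lin]
  ring

lemma misfit_nonneg {l : ℝ} (hl : 0 < l) (a : Aff d) (χ : Finset (Vec d)) (y : Vec d) :
    0 ≤ m.misfit l a χ y :=
  mul_nonneg (nrm_pos hl).le (Finset.sum_nonneg fun _ _ => mul_nonneg (m.W_nonneg _) (wt_nonneg _ _ _))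

/-- The lattice `a` fits the configuration `χ` near `y` up to the error `η`: it is nondegenerate, its
misfit is small, and its density is close to the density of atoms. -/
structure Fit (m : Model d) (K η l : ℝ) (χ : Finset (Vec d)) (y : Vec d) (a : Aff d) : Prop where
  mem : a.1 ∈ bddSet d K
  misfit_le : m.misfit l a χ y ≤ η
  rho_near : |a.1.det - m.rho l χ y| ≤ η

/-- `z` has distance less than `δ` to the integer lattice. -/
def Near (δ : ℝ) (z : Vec d) : Prop := ∃ n : Fin d → ℤ, ‖z - intVec n‖ < δ

lemma W_ge_of_not_near {δ : ℝ} (hδ : 0 ≤ δ) {z : Vec d} (h : ¬ Near δ z) :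
    m.C₀W * δ ^ 2 ≤ m.W z := by
  have h1 : δ ≤ Metric.infDist z (intLattice d) := by
    by_contra! h2
    obtain ⟨_, ⟨n, rfl⟩, hn⟩ := (Metric.infDist_lt_iff intLattice_nonempty).1 h2
    exact h ⟨n, by rwa [← dist_eq_norm]⟩
  refine le_trans ?_ (m.W_coercive z).1
  have := m.C₀W_pos
  gcongr

open Classical in
/-- The atoms within the range of the cut-off that are close to both lattices. -/
noncomputable def good (δ l : ℝ) (χ : Finset (Vec d)) (y : Vec d) (a b : Aff d) : Finset (Vec d) :=
  χ.filter fun p => ‖p - y‖ ≤ 2 * l ∧ Near δ (lin a (p - y)) ∧ Near δ (lin b (p - y))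

lemma mem_good {δ l : ℝ} {χ : Finset (Vec d)} {y : Vec d} {a b : Aff d} {p : Vec d} :
    p ∈ good δ l χ y a b ↔
      p ∈ χ ∧ ‖p - y‖ ≤ 2 * l ∧ Near δ (lin a (p - y)) ∧ Near δ (lin b (p - y)) := by
  classical exact Finset.mem_filter

lemma good_subset (δ l : ℝ) (χ : Finset (Vec d)) (y : Vec d) (a b : Aff d) :
    good δ l χ y a b ⊆ χ := fun _ hp => (mem_good.1 hp).1

/-- The atoms far from one of the two lattices carry little weight: each of them costs at least
`C₀ δ²` of misfit. -/
lemma sum_wt_bad_le {δ l : ℝ} (hδ : 0 < δ) (hl : 0 < l) (χ : Finset (Vec d)) (y : Vec d)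
    (a b : Aff d) : m.nrm l * ∑ p ∈ χ \ good δ l χ y a b, m.wt l y p
      ≤ (m.misfit l a χ y + m.misfit l b χ y) / (m.C₀W * δ ^ 2) := by
  have hC := m.C₀W_pos
  have hN := nrm_pos (m := m) hl
  rw [le_div_iff₀ (by positivity), misfit, misfit, ← mul_add, ← Finset.sum_add_distrib, mul_assoc,
    Finset.sum_mul]
  refine mul_le_mul_of_nonneg_left ?_ hN.le
  refine (Finset.sum_le_sum fun p hp => ?_).trans
    (Finset.sum_le_sum_of_subset_of_nonneg Finset.sdiff_subset fun p _ _ => ?_)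
  · have hw := wt_nonneg (m := m) l y p
    by_cases h2 : ‖p - y‖ ≤ 2 * l
    · have h3 : m.C₀W * δ ^ 2 ≤ m.W (lin a (p - y)) + m.W (lin b (p - y)) := by
        simp only [Finset.mem_sdiff, mem_good, not_and] at hp
        by_cases h4 : Near δ (lin a (p - y))
        · have := W_ge_of_not_near (m := m) hδ.le (hp.2 hp.1 h2 h4)
          have := m.W_nonneg (lin a (p - y))
          linarith
        · have := W_ge_of_not_near (m := m) hδ.le h4
          have := m.W_nonneg (lin b (p - y))
          linarith
      nlinarith
    · simp [wt_eq_zero hl h2]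
  · have := m.W_nonneg (lin a (p - y))
    have := m.W_nonneg (lin b (p - y))
    have := wt_nonneg (m := m) l y p
    positivity

lemma exists_lipschitz_φ : ∃ L > 0, ∀ u v : Vec d, |m.φt u - m.φt v| ≤ L * ‖u - v‖ := by
  obtain ⟨C, hC, h⟩ := m.exists_bound_φ
  refine ⟨C, hC, fun u v => ?_⟩
  have := Convex.norm_image_sub_le_of_norm_hasFDerivWithin_le (s := Set.univ) (f := m.φt) (f' := m.dφ)
    (fun x _ => (m.hasFDerivAt_φt x).hasFDerivWithinAt) (fun x _ => (h x).1) convex_univ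
    (Set.mem_univ v) (Set.mem_univ u)
  simpa using this

end Model

end Kac

/-! ### Covering by the cells of a fitting lattice -/

namespace Kac

open Filter Topology MeasureTheory

variable {d : ℕ}

namespace Model

variable {m : Model d}

/-- If two lattices fit the configuration, then the cells of the first one that contain an atom close
to both lattices cover almost all of the support of the cut-off, each being used only once. -/
lemma exists_cover (m : Model d) {K K' δ : ℝ} (hK : 0 < K)
    (hK' : ∀ A ∈ bddSet d K, ‖A⁻¹‖ ≤ K') (hK'0 : 0 < K') (hδ : 0 < δ) (hδ1 : δ ≤ 1)
    (hδs : 2 * δ * K' < m.s₀) :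
    ∃ C > 0, ∀ η > 0, η * (K' * (d + 1)) ≤ 1 → ∀ l > 0, 1 ≤ η * l → ∀ χ : Finset (Vec d),
      m.HardCore χ → ∀ y a b, m.Fit K η l χ y a → m.Fit K η l χ y b →
      ∃ n : Vec d → Fin d → ℤ, (∀ p ∈ good δ l χ y a b, ‖lin a (p - y) - intVec (n p)‖ < δ) ∧
        Set.InjOn n (good δ l χ y a b) ∧
        m.nrm l * ∑ p ∈ χ \ good δ l χ y a b, m.wt l y p ≤ C * η ∧
        ∫ z in (⋃ p ∈ good δ l χ y a b, cell l a (n p))ᶜ, m.φt z ≤ C * η := by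
  obtain ⟨L, hL0, hL⟩ := m.exists_lipschitz_φ
  have hC0 := m.C₀W_pos
  have hCφ := m.Cφ_pos
  set V := volume.real (Metric.closedBall (0 : Vec d) 3) with hV
  have hV0 : 0 ≤ V := measureReal_nonneg
  set c₁ := 2 / (m.C₀W * δ ^ 2) with hc₁
  have hc₁0 : 0 < c₁ := by positivity
  refine ⟨c₁ + m.Cφ * K * (1 + c₁) + L * (K' * (d + 1)) * V, by positivity, ?_⟩
  intro η hη hη1 l hl hηl χ hχ y a b ha hb
  have hli : l⁻¹ ≤ η := by rw [inv_le_iff_one_le_mul₀ hl]; linarith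
  have hdet : 0 < a.1.det := bddSet_subset_GLPos hK ha.mem
  have hN := nrm_pos (m := m) hl
  set P := good δ l χ y a b with hP
  have hex : ∀ p ∈ P, ∃ n : Fin d → ℤ, ‖lin a (p - y) - intVec n‖ < δ := fun p hp =>
    (mem_good.1 hp).2.2.1
  choose! n hn using hex
  -- two atoms with the same index would violate the hard core
  have hinj : Set.InjOn n P := by
    intro p hp q hq hpq
    by_contra hne
    have h1 := hχ p (mem_good.1 hp).1 q (mem_good.1 hq).1 hne
    have h2 : act a.1 (p - q) = (lin a (p - y) - intVec (n p)) - (lin a (q - y) - intVec (n q)) := by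
      rw [hpq]; simp only [lin, act_sub_right]; abel
    have h3 : ‖act a.1 (p - q)‖ ≤ 2 * δ := by
      rw [h2]
      have := norm_sub_le (lin a (p - y) - intVec (n p)) (lin a (q - y) - intVec (n q))
      have := hn p hp
      have := hn q hq
      linarith
    have h4 : ‖p - q‖ ≤ K' * (2 * δ) := by
      rw [← act_inv_act hdet.ne' (p - q)]
      refine (norm_act_le _ _).trans ?_
      have := hK' a.1 ha.mem
      gcongr
    rw [dist_eq_norm] at h1
    linarith
  have hbad : m.nrm l * ∑ p ∈ χ \ P, m.wt l y p ≤ c₁ * η := by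
    refine (sum_wt_bad_le hδ hl χ y a b).trans ?_
    rw [div_le_iff₀ (by positivity), hc₁]
    have := ha.misfit_le
    have := hb.misfit_le
    have h5 : 2 / (m.C₀W * δ ^ 2) * η * (m.C₀W * δ ^ 2) = 2 * η := by field_simp
    linarith
  have hscale : ∀ p : Vec d, l • l⁻¹ • (p - y) = p - y := fun p => smul_inv_smul₀ hl.ne' _
  refine ⟨n, hn, hinj, hbad.trans ?_, ?_⟩
  · have : 0 ≤ m.Cφ * K * (1 + c₁) + L * (K' * (d + 1)) * V := by positivity
    nlinarith
  have hmeas : MeasurableSet (⋃ p ∈ P, cell l a (n p)) :=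
    Finset.measurableSet_biUnion _ fun p _ => measurableSet_cell _ _ _
  have hsplit := integral_add_compl hmeas m.integrable_φt
  rw [← Cφ_eq] at hsplit
  -- the integral over the covered part is a Riemann sum close to `C_φ ρ / det a`, and `ρ` is
  -- close to `det a`
  have hR := abs_sum_sub_integral_cells_le hl hdet (hK' a.1 ha.mem)
    (le_trans (by gcongr) hη1) (P := P) (x := fun p => l⁻¹ • (p - y)) (n := n) hinj
    (fun p hp => (norm_scaled hl _ _).2 (mem_good.1 hp).2.1)
    (fun p hp => by rw [hscale]; exact (hn p hp).le.trans hδ1) m.continuous_φt hL0.le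
    (fun u v _ _ => hL u v)
  have hsum : m.nrm l * ∑ p ∈ P, m.wt l y p = m.rho l χ y - m.nrm l * ∑ p ∈ χ \ P, m.wt l y p := by
    rw [rho_eq hl, ← Finset.sum_sdiff (good_subset δ l χ y a b)]; ring
  have hnrm : (a.1.det * l ^ d)⁻¹ = m.Cφ / a.1.det * m.nrm l := by
    rw [nrm]; field_simp
  have h6 : (∑ p ∈ P, m.φt (l⁻¹ • (p - y))) * (a.1.det * l ^ d)⁻¹
      ≥ m.Cφ - m.Cφ * K * (1 + c₁) * η := by
    have h7 : m.nrm l * ∑ p ∈ P, m.wt l y p ≥ a.1.det - (1 + c₁) * η := by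
      have := (abs_le.1 ha.rho_near).2
      rw [hsum]; linarith
    have h8 : (a.1.det)⁻¹ ≤ K := inv_le_of_inv_le₀ hK ha.mem.2
    calc (∑ p ∈ P, m.φt (l⁻¹ • (p - y))) * (a.1.det * l ^ d)⁻¹
        = m.Cφ / a.1.det * (m.nrm l * ∑ p ∈ P, m.wt l y p) := by
          rw [hnrm]; simp only [wt]; ring
      _ ≥ m.Cφ / a.1.det * (a.1.det - (1 + c₁) * η) := by gcongr
      _ = m.Cφ - m.Cφ * (a.1.det)⁻¹ * ((1 + c₁) * η) := by field_simp
      _ ≥ m.Cφ - m.Cφ * K * ((1 + c₁) * η) := by gcongr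
      _ = _ := by ring
  have h9 : L * (l⁻¹ * (K' * (d + 1))) * V ≤ L * (K' * (d + 1)) * V * η := by
    calc _ ≤ L * (η * (K' * (d + 1))) * V := by gcongr
      _ = _ := by ring
  have h10 := (abs_le.1 hR).2
  have h11 : 0 ≤ c₁ * η := by positivity
  rw [add_mul, add_mul]
  linarith

/-- Atoms that cover the support of the cut-off carry the second moments of a perfect lattice. -/
lemma exists_moment_le (m : Model d) (hd : 1 ≤ d) {K K' δ : ℝ} (hK : 0 < K)
    (hK' : ∀ A ∈ bddSet d K, ‖A⁻¹‖ ≤ K') (hK'0 : 0 < K') (hδ : 0 < δ) (hδ1 : δ ≤ 1)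
    (hδs : 2 * δ * K' < m.s₀) :
    ∃ C > 0, ∀ η > 0, η * (K' * (d + 1)) ≤ 1 → ∀ l > 0, 1 ≤ η * l → ∀ χ : Finset (Vec d),
      m.HardCore χ → ∀ y a, m.Fit K η l χ y a → ∀ b : Aff d,
        m.nrm l * ∑ p ∈ χ \ good δ l χ y a a, m.wt l y p ≤ C * η ∧
        (m.rho l χ y / (d + 2) - C * η) * affNorm l b ^ 2
          ≤ m.nrm l * ∑ p ∈ good δ l χ y a a, m.wt l y p * ‖lin b (p - y)‖ ^ 2 := by
  obtain ⟨C, hC0, hC⟩ := exists_cover m hK hK' hK'0 hδ hδ1 hδs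
  obtain ⟨L, hL0, hL⟩ := m.exists_lipschitz_φ
  obtain ⟨D, hD0, hD⟩ := exists_bound_on_bddSet (d := d) hK continuous_det.continuousOn
  have hCφ := m.Cφ_pos
  set V := volume.real (Metric.closedBall (0 : Vec d) 3) with hV
  have hV0 : 0 ≤ V := measureReal_nonneg
  refine ⟨C + (1 + D / m.Cφ * (5 * C + (8 + 10 * L) * (K' * (d + 1)) * V)), by positivity, ?_⟩
  intro η hη hη1 l hl hηl χ hχ y a ha b
  have hli : l⁻¹ ≤ η := by rw [inv_le_iff_one_le_mul₀ hl]; linarith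
  obtain ⟨n, hn, hinj, hbad, hcov⟩ := hC η hη hη1 l hl hηl χ hχ y a a ha ha
  have hN := nrm_pos (m := m) hl
  have hdet : 0 < a.1.det := bddSet_subset_GLPos hK ha.mem
  set P := good δ l χ y a a with hP
  refine ⟨hbad.trans ?_, ?_⟩
  · have : 0 ≤ 1 + D / m.Cφ * (5 * C + (8 + 10 * L) * (K' * (d + 1)) * V) := by positivity
    nlinarith
  -- `b` in coordinates rescaled to unit size, where its norm is `affNorm l b`
  set b' : Aff d := (l • b.1, b.2) with hb'
  set R := affNorm l b with hR
  have hR0 : 0 ≤ R := affNorm_nonneg _ _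
  have hnb : affNorm 1 b' = R := by
    rw [hR, affNorm, affNorm, hb']
    simp [norm_smul, mul_pow]
  have hlin : ∀ p, lin b' (l⁻¹ • (p - y)) = lin b (p - y) := by
    intro p
    simp only [lin, hb', act_smul_left, act_smul_right]
    rw [inv_smul_smul₀ hl.ne']
  set g : Vec d → ℝ := fun x => m.φt x * ‖lin b' x‖ ^ 2 with hg
  have hgc : Continuous g := m.continuous_φt.mul ((continuous_lin b').norm.pow 2)
  have hgL : ∀ u v : Vec d, ‖u‖ ≤ 3 → ‖v‖ ≤ 3 → |g u - g v| ≤ (8 + 10 * L) * R ^ 2 * ‖u - v‖ := by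
    intro u v hu hv
    have h1 : ‖lin b' u‖ ≤ 4 * R := by
      have := norm_lin_le (l := 1) (r := 3) (by norm_num) b' (x := u) (by linarith)
      rw [hnb] at this; linarith
    have h2 : ‖lin b' v‖ ≤ 4 * R := by
      have := norm_lin_le (l := 1) (r := 3) (by norm_num) b' (x := v) (by linarith)
      rw [hnb] at this; linarith
    have h3 : ‖lin b' v‖ ^ 2 ≤ 10 * R ^ 2 := by
      have := norm_lin_sq_le (l := 1) (r := 3) b' (x := v) (by linarith)
      rw [hnb] at this; linarith
    have h4 : |‖lin b' u‖ - ‖lin b' v‖| ≤ R * ‖u - v‖ := by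
      refine (abs_norm_sub_norm_le _ _).trans ?_
      have h5 : lin b' u - lin b' v = act b'.1 (u - v) := by simp [lin, act_sub_right]
      rw [h5]
      refine (norm_act_le _ _).trans ?_
      have := norm_fst_le_affNorm 1 b'
      rw [hnb, one_mul] at this
      gcongr
    have h6 : g u - g v = m.φt u * ((‖lin b' u‖ - ‖lin b' v‖) * (‖lin b' u‖ + ‖lin b' v‖))
        + (m.φt u - m.φt v) * ‖lin b' v‖ ^ 2 := by simp only [hg]; ring
    rw [h6]
    refine (abs_add_le _ _).trans ?_
    rw [abs_mul, abs_mul, abs_mul, abs_of_nonneg (m.φt_nonneg u),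
      abs_of_nonneg (sq_nonneg ‖lin b' v‖),
      abs_of_nonneg (add_nonneg (norm_nonneg (lin b' u)) (norm_nonneg (lin b' v)))]
    calc _ ≤ 1 * ((R * ‖u - v‖) * (4 * R + 4 * R)) + (L * ‖u - v‖) * (10 * R ^ 2) := by
          have := m.φt_le_one u
          have := hL u v
          gcongr
      _ = _ := by ring
  have hscale : ∀ p : Vec d, l • l⁻¹ • (p - y) = p - y := fun p => smul_inv_smul₀ hl.ne' _
  have hRS := abs_sum_sub_integral_cells_le hl hdet (hK' a.1 ha.mem)
    (le_trans (by gcongr) hη1) (P := P) (x := fun p => l⁻¹ • (p - y)) (n := n) hinj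
    (fun p hp => (norm_scaled hl _ _).2 (mem_good.1 hp).2.1)
    (fun p hp => by rw [hscale]; exact (hn p hp).le.trans hδ1) hgc (by positivity) hgL
  have hmeas : MeasurableSet (⋃ p ∈ P, cell l a (n p)) :=
    Finset.measurableSet_biUnion _ fun p _ => measurableSet_cell _ _ _
  have hgi : Integrable g := m.integrable_φt_mul ((continuous_lin b').norm.pow 2)
  have hsplit := integral_add_compl hmeas hgi
  have hmom := m.le_integral_lin hd b'
  -- the uncovered part of the support contributes little
  have hcompl : ∫ z in (⋃ p ∈ P, cell l a (n p))ᶜ, g z ≤ 5 * R ^ 2 * (C * η) := by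
    calc _ ≤ ∫ z in (⋃ p ∈ P, cell l a (n p))ᶜ, m.φt z * (5 * R ^ 2) := by
          refine setIntegral_mono hgi.integrableOn
            (m.integrable_φt.mul_const _).integrableOn fun z => ?_
          by_cases hz : ‖z‖ ≤ 2
          · have := norm_lin_sq_le (l := 1) (r := 2) b' (x := z) (by linarith)
            rw [hnb] at this
            exact mul_le_mul_of_nonneg_left (by linarith) (m.φt_nonneg z)
          · simp [hg, m.φt_zero (not_le.1 hz).le]
      _ = 5 * R ^ 2 * ∫ z in (⋃ p ∈ P, cell l a (n p))ᶜ, m.φt z := by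
          rw [integral_mul_const]; ring
      _ ≤ _ := by gcongr
  have hbn : ‖b'.1‖ ^ 2 / (d + 2) + ‖b'.2‖ ^ 2 ≥ R ^ 2 / (d + 2) := by
    have h1 : R ^ 2 = ‖b'.1‖ ^ 2 + ‖b'.2‖ ^ 2 := by rw [← hnb, affNorm_sq]; ring
    rw [h1, add_div]
    have h2 : ‖b'.2‖ ^ 2 / ((d : ℝ) + 2) ≤ ‖b'.2‖ ^ 2 := div_le_self (sq_nonneg _) (by linarith)
    linarith
  have hmom' : m.Cφ * (R ^ 2 / (d + 2)) ≤ ∫ x, g x :=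
    le_trans (mul_le_mul_of_nonneg_left hbn hCφ.le) hmom
  have hnrm : m.nrm l = a.1.det / m.Cφ * (a.1.det * l ^ d)⁻¹ := by
    rw [nrm]; field_simp
  have hsum : m.nrm l * ∑ p ∈ P, m.wt l y p * ‖lin b (p - y)‖ ^ 2
      = a.1.det / m.Cφ * ((∑ p ∈ P, g (l⁻¹ • (p - y))) * (a.1.det * l ^ d)⁻¹) := by
    rw [hnrm]
    simp only [hg, hlin, wt]
    ring
  have herr : (8 + 10 * L) * R ^ 2 * (l⁻¹ * (K' * (d + 1))) * V
      ≤ (8 + 10 * L) * (K' * (d + 1)) * V * η * R ^ 2 := by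
    calc _ ≤ (8 + 10 * L) * R ^ 2 * (η * (K' * (d + 1))) * V := by gcongr
      _ = _ := by ring
  have hlow : (∑ p ∈ P, g (l⁻¹ • (p - y))) * (a.1.det * l ^ d)⁻¹
      ≥ m.Cφ * (R ^ 2 / (d + 2)) - (5 * C + (8 + 10 * L) * (K' * (d + 1)) * V) * η * R ^ 2 := by
    have := (abs_le.1 hRS).1
    have h3 : (5 * C + (8 + 10 * L) * (K' * (d + 1)) * V) * η * R ^ 2
      = 5 * R ^ 2 * (C * η) + (8 + 10 * L) * (K' * (d + 1)) * V * η * R ^ 2 := by ring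
    linarith
  have hdD : a.1.det ≤ D := (le_abs_self _).trans (hD _ ha.mem)
  rw [hsum]
  set T := 5 * C + (8 + 10 * L) * (K' * (d + 1)) * V with hT
  have hT0 : 0 ≤ T := by positivity
  calc _ ≤ (a.1.det / (d + 2) - D / m.Cφ * T * η) * R ^ 2 := by
        gcongr ?_ * _
        have h4 := (abs_le.1 ha.rho_near).1
        have h5 : m.rho l χ y / (d + 2) ≤ a.1.det / (d + 2) + η := by
          rw [div_le_iff₀ (by positivity), add_mul, div_mul_cancel₀ _ (by positivity)]
          nlinarith
        have h6 : (0 : ℝ) ≤ C * η := by positivity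
        linarith
    _ ≤ (a.1.det / (d + 2) - a.1.det / m.Cφ * T * η) * R ^ 2 := by gcongr
    _ = a.1.det / m.Cφ * (m.Cφ * (R ^ 2 / (d + 2)) - T * η * R ^ 2) := by
        field_simp
    _ ≤ _ := by gcongr

end Model

end Kac

/-! ### Convexity of the misfit near a fitting lattice -/

namespace Kac

open Filter Topology MeasureTheory

variable {d : ℕ}

namespace Model

variable {m : Model d}

lemma mem_thickening_of_near {δ r : ℝ} {z z' : Vec d} (h : Near δ z) (hz : ‖z' - z‖ ≤ r) :
    z' ∈ Metric.thickening (δ + r) (intLattice d) := by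
  obtain ⟨n, hn⟩ := h
  refine mem_thickening_of_norm_lt (n := n) ?_
  have := norm_add_le (z' - z) (z - intVec n)
  rw [sub_add_sub_cancel] at this
  linarith

/-- Near a fitting lattice the second derivative of the misfit is bounded below by the convexity
constant of a perfect lattice, up to an arbitrarily small loss. -/
lemma exists_hess_lower (m : Model d) (hd : 1 ≤ d) {K : ℝ} (hK : 0 < K) :
    ∃ r > 0, ∃ η₀ > 0, ∀ η > 0, η ≤ η₀ → ∀ l > 0, 1 ≤ η * l → ∀ χ : Finset (Vec d),
      m.HardCore χ → ∀ y a, m.Fit K η l χ y a → ∀ a' : Aff d, affNorm l (a' - a) ≤ r →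
      ∀ b : Aff d, m.c₀ / (d + 3) * m.rho l χ y * affNorm l b ^ 2
        ≤ m.nrm l * ∑ p ∈ χ, m.W2 (lin a' (p - y)) (lin b (p - y)) (lin b (p - y)) * m.wt l y p := by
  obtain ⟨K', hK'0, hK'⟩ := exists_inv_bound_on_bddSet (d := d) hK
  obtain ⟨CW, hCW0, hCW⟩ := m.exists_bound_W
  have hΘ := m.Θ_pos
  have hs := m.s₀_pos
  have hc := m.c₀_pos
  -- half of `Θ` is left for the distance of the two lattices; the bound by `s₀` lets the hard
  -- core exclude two atoms with the same index
  set δ : ℝ := min (min (m.Θ / 2) (m.s₀ / (4 * K'))) 1 with hδ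
  have hδ0 : 0 < δ := by positivity
  have hδ1 : δ ≤ 1 := min_le_right _ _
  have hδ2 : δ ≤ m.Θ / 2 := (min_le_left _ _).trans (min_le_left _ _)
  have hδ3 : 2 * δ * K' < m.s₀ := by
    have h1 : δ ≤ m.s₀ / (4 * K') := (min_le_left _ _).trans (min_le_right _ _)
    have h2 : δ * (4 * K') ≤ m.s₀ := (le_div_iff₀ (by positivity)).1 h1
    linarith
  obtain ⟨C, hC0, hC⟩ := exists_moment_le m hd hK hK' hK'0 hδ0 hδ1 hδ3
  set S : ℝ := C * (m.c₀ + 5 * CW) with hS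
  have hS0 : 0 < S := by positivity
  refine ⟨m.Θ / 6, by positivity, min (1 / (K' * (d + 1)))
    (min (1 / (2 * K)) (m.c₀ / (2 * K * (d + 2) * (d + 3) * S))), by positivity, ?_⟩
  intro η hη hη0 l hl hηl χ hχ y a ha a' ha' b
  have hη1 : η * (K' * (d + 1)) ≤ 1 :=
    (le_div_iff₀ (by positivity)).1 (hη0.trans (min_le_left _ _))
  have hη2 : η ≤ 1 / (2 * K) := hη0.trans ((min_le_right _ _).trans (min_le_left _ _))
  have hη3 : η ≤ m.c₀ / (2 * K * (d + 2) * (d + 3) * S) :=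
    hη0.trans ((min_le_right _ _).trans (min_le_right _ _))
  obtain ⟨hbad, hmom⟩ := hC η hη hη1 l hl hηl χ hχ y a ha b
  set P := good δ l χ y a a with hP
  set R := affNorm l b with hR
  have hN := nrm_pos (m := m) hl
  have hρ : 1 / (2 * K) ≤ m.rho l χ y := by
    have h1 := (abs_le.1 ha.rho_near).2
    have h2 := ha.mem.2
    have h3 : K⁻¹ = 1 / (2 * K) + 1 / (2 * K) := by field_simp; norm_num
    linarith
  -- atoms close to the lattice lie where `W` is convex, the others are few
  have hgood : ∀ p ∈ P, m.c₀ * (m.wt l y p * ‖lin b (p - y)‖ ^ 2)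
      ≤ m.W2 (lin a' (p - y)) (lin b (p - y)) (lin b (p - y)) * m.wt l y p := by
    intro p hp
    obtain ⟨-, hp2, hp3, -⟩ := mem_good.1 hp
    have h1 : ‖lin a' (p - y) - lin a (p - y)‖ ≤ m.Θ / 2 := by
      rw [← lin_sub]
      refine (norm_lin_le zero_le_two _ hp2).trans ?_
      linarith
    have h2 : lin a' (p - y) ∈ Metric.thickening m.Θ (intLattice d) :=
      Metric.thickening_mono (by linarith) _ (mem_thickening_of_near hp3 h1)
    have h3 : m.c₀ * ‖lin b (p - y)‖ ^ 2 ≤ m.W2 (lin a' (p - y)) (lin b (p - y)) (lin b (p - y)) :=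
      (m.W_convex _ h2 _).1
    have := mul_le_mul_of_nonneg_right h3 (wt_nonneg (m := m) l y p)
    linarith
  have hbadp : ∀ p ∈ χ \ P, -(5 * CW * R ^ 2) * m.wt l y p
      ≤ m.W2 (lin a' (p - y)) (lin b (p - y)) (lin b (p - y)) * m.wt l y p := by
    intro p _
    by_cases h2 : ‖p - y‖ ≤ 2 * l
    · refine mul_le_mul_of_nonneg_right ?_ (wt_nonneg _ _ _)
      have h3 := (m.W2 (lin a' (p - y))).le_opNorm₂ (lin b (p - y)) (lin b (p - y))
      have h4 : ‖m.W2 (lin a' (p - y))‖ * ‖lin b (p - y)‖ * ‖lin b (p - y)‖ ≤ CW * (5 * R ^ 2) := by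
        rw [mul_assoc, ← sq]
        have h5 := norm_lin_sq_le b h2
        have := (hCW (lin a' (p - y))).2.2.1
        gcongr
        linarith
      have := (abs_le.1 (h3.trans h4)).1
      linarith
    · simp [wt_eq_zero hl h2]
  have hsum : m.nrm l * ∑ p ∈ χ, m.W2 (lin a' (p - y)) (lin b (p - y)) (lin b (p - y)) * m.wt l y p
      ≥ m.c₀ * (m.nrm l * ∑ p ∈ P, m.wt l y p * ‖lin b (p - y)‖ ^ 2)
        - 5 * CW * R ^ 2 * (m.nrm l * ∑ p ∈ χ \ P, m.wt l y p) := by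
    rw [← Finset.sum_sdiff (good_subset δ l χ y a a)]
    have h1 := Finset.sum_le_sum hgood
    have h2 := Finset.sum_le_sum hbadp
    rw [← Finset.mul_sum] at h1 h2
    have h3 := mul_le_mul_of_nonneg_left (add_le_add h2 h1) hN.le
    linarith
  refine le_trans ?_ hsum
  have h6 : m.c₀ * ((m.rho l χ y / (d + 2) - C * η) * R ^ 2)
      ≤ m.c₀ * (m.nrm l * ∑ p ∈ P, m.wt l y p * ‖lin b (p - y)‖ ^ 2) := by gcongr
  have h7 : 5 * CW * R ^ 2 * (m.nrm l * ∑ p ∈ χ \ P, m.wt l y p) ≤ 5 * CW * R ^ 2 * (C * η) := by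
    gcongr
  -- the loss from `d + 2` to `d + 3` absorbs the errors of order `η`
  have h8 : S * η ≤ m.c₀ * m.rho l χ y * (1 / (d + 2) - 1 / (d + 3)) := by
    calc S * η ≤ S * (m.c₀ / (2 * K * (d + 2) * (d + 3) * S)) := by gcongr
      _ = m.c₀ * (1 / (2 * K)) * (1 / (d + 2) - 1 / (d + 3)) := by field_simp; ring
      _ ≤ _ := by
        have h9 : (0 : ℝ) ≤ 1 / (d + 2) - 1 / (d + 3) := by
          rw [sub_nonneg]; exact one_div_le_one_div_of_le (by positivity) (by linarith)
        gcongr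
  have h10 := mul_le_mul_of_nonneg_right h8 (sq_nonneg R)
  have h11 : m.c₀ / (d + 3) * m.rho l χ y * R ^ 2
      = m.c₀ * m.rho l χ y * (1 / (d + 2)) * R ^ 2
        - m.c₀ * m.rho l χ y * (1 / (d + 2) - 1 / (d + 3)) * R ^ 2 := by ring
  have h12 : S * η * R ^ 2 = m.c₀ * (C * η) * R ^ 2 + 5 * CW * R ^ 2 * (C * η) := by rw [hS]; ring
  have h13 : m.c₀ * ((m.rho l χ y / (d + 2) - C * η) * R ^ 2)
      = m.c₀ * m.rho l χ y * (1 / (d + 2)) * R ^ 2 - m.c₀ * (C * η) * R ^ 2 := by ring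
  linarith

/-! ### Two fitting lattices agree up to a reparametrisation -/

lemma floorVec_add_intVec (z : Vec d) (v : Fin d → ℤ) : floorVec (z + intVec v) = floorVec z + v := by
  funext i
  simp [floorVec, intVec_apply]

lemma eq_zero_of_norm_intVec_lt {w : Fin d → ℤ} (h : ‖intVec w‖ < 1) : w = 0 := by
  funext i
  have h1 : |(w i : ℝ)| < 1 := by
    have := PiLp.norm_apply_le (intVec w) i
    rw [intVec_apply, Real.norm_eq_abs] at this
    linarith
  have h2 : |w i| < 1 := by exact_mod_cast h1
  simpa using h2

/-- A set of cells that covers almost all of the unit ball contains two cells whose indices differ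
by a prescribed vector of moderate length. -/
lemma exists_pair_of_cover {l : ℝ} (hl : 0 < l) {b : Aff d} (hb : b.1.det ≠ 0) {P : Finset (Vec d)}
    {n : Vec d → Fin d → ℤ} {κ : ℝ}
    (hcov : ∫ z in (⋃ p ∈ P, cell l b (n p))ᶜ, m.φt z ≤ κ)
    (hκ : 2 * κ < volume.real (Metric.closedBall (0 : Vec d) (1 / 2))) (v : Fin d → ℤ)
    (hv : ‖l⁻¹ • act b.1⁻¹ (intVec v)‖ ≤ 1 / 2) : ∃ p ∈ P, ∃ q ∈ P, n q = n p + v := by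
  by_contra! hcon
  set Ω := ⋃ p ∈ P, cell l b (n p) with hΩ
  set s := l⁻¹ • act b.1⁻¹ (intVec v) with hs
  have hmeas : MeasurableSet Ω := Finset.measurableSet_biUnion _ fun p _ => measurableSet_cell _ _ _
  set G := Metric.closedBall (0 : Vec d) 1 \ Ω with hG
  have hGm : MeasurableSet G := measurableSet_closedBall.diff hmeas
  have hGfin : volume G ≠ ⊤ := ne_top_of_le_ne_top measure_closedBall_lt_top.ne
    (measure_mono Set.sdiff_subset)
  have hGle : volume.real G ≤ κ := by
    refine le_trans ?_ hcov
    have h1 : volume.real G = ∫ z in G, m.φt z := by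
      rw [setIntegral_congr_fun (g := fun _ => (1 : ℝ)) hGm fun z hz => m.φt_one (by
        simpa using hz.1)]
      simp
    rw [h1]
    exact setIntegral_mono_set m.integrable_φt.integrableOn
      (Filter.Eventually.of_forall m.φt_nonneg) (Filter.Eventually.of_forall fun z hz => hz.2)
  -- otherwise no point is covered together with its translate, so that the uncovered set and its
  -- translate would cover a ball of larger volume
  have hsub : Metric.closedBall (0 : Vec d) (1 / 2) ⊆ G ∪ (fun z => z + s) ⁻¹' G := by
    intro z hz
    rw [mem_closedBall_zero_iff] at hz
    by_cases h1 : z ∈ Ω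
    · right
      refine ⟨?_, fun h2 => ?_⟩
      · rw [mem_closedBall_zero_iff]
        exact (norm_add_le _ _).trans (by linarith)
      · simp only [hΩ, Set.mem_iUnion, exists_prop] at h1 h2
        obtain ⟨p, hp, hp'⟩ := h1
        obtain ⟨q, hq, hq'⟩ := h2
        refine hcon p hp q hq ?_
        have h3 : lin b (l • (z + s)) = lin b (l • z) + intVec v := by
          simp only [lin, hs, smul_add, act_add_right]
          rw [smul_inv_smul₀ hl.ne', act_act_inv hb]; abel
        rw [← show floorVec (lin b (l • (z + s))) = n q from hq', h3, floorVec_add_intVec,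
          show floorVec (lin b (l • z)) = n p from hp']
    · left
      refine ⟨?_, h1⟩
      rw [mem_closedBall_zero_iff]; linarith
  have h4 : volume ((fun z => z + s) ⁻¹' G) = volume G := measure_preimage_add_right _ _ _
  have h5 : volume.real ((fun z => z + s) ⁻¹' G) = volume.real G := by rw [Measure.real, h4]; rfl
  have h6 := (measureReal_mono hsub (by
    refine ((measure_union_le _ _).trans_lt ?_).ne
    rw [h4]; exact ENNReal.add_lt_top.2 ⟨hGfin.lt_top, hGfin.lt_top⟩)).trans
    (measureReal_union_le (μ := volume) G ((fun z => z + s) ⁻¹' G))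
  linarith

lemma norm_le_of_norm_act_single_le {D : Mat d} {e : ℝ} (he : 0 ≤ e)
    (h : ∀ j, ‖act D (EuclideanSpace.single j 1)‖ ≤ e) : ‖D‖ ≤ d * e := by
  refine le_of_sq_le_sq ?_ (by positivity)
  rw [normSq_eq_sum_act]
  calc _ ≤ ∑ _j : Fin d, e ^ 2 := Finset.sum_le_sum fun j _ => by have := h j; gcongr
    _ = d * e ^ 2 := by simp
    _ ≤ _ := by
      rw [mul_pow]
      refine mul_le_mul_of_nonneg_right ?_ (sq_nonneg e)
      rcases Nat.eq_zero_or_pos d with rfl | h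
      · simp
      · have : (1 : ℝ) ≤ d := by exact_mod_cast h
        nlinarith

lemma intVec_single (j : Fin d) (k : ℤ) :
    intVec (Pi.single j k) = (k : ℝ) • (EuclideanSpace.single j 1 : Vec d) := by
  ext i
  by_cases h : i = j
  · subst h; simp [intVec_apply]
  · simp [intVec_apply, h]

/-- A linear map that sends long integer multiples of a unit vector close to integer vectors, and the
unit vector itself too, is very close to integral on that unit vector: along the multiples the error
cannot jump by an integer. -/
lemma norm_mul_act_single_le {T B : Mat d} {e : ℝ} (he3 : 3 * e < 1) {j : Fin d} {k₀ : ℕ}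
    (hB : ∀ v : Fin d → ℤ, ∃ w : Fin d → ℤ, act B (intVec v) = intVec w)
    (h1 : ‖act (T - B) (EuclideanSpace.single j 1)‖ ≤ e)
    (hT : ∀ k : ℕ, k ≤ k₀ → ∃ w : Fin d → ℤ,
      ‖act T ((k : ℝ) • EuclideanSpace.single j 1) - intVec w‖ ≤ e) :
    k₀ * ‖act (T - B) (EuclideanSpace.single j 1)‖ ≤ e := by
  have key : ∀ k : ℕ, k ≤ k₀ → ‖act (T - B) ((k : ℝ) • EuclideanSpace.single j 1)‖ ≤ e := by
    intro k
    induction k with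
    | zero => intro _; simp [act_zero_right]; exact (norm_nonneg _).trans h1
    | succ k ih =>
      intro hk
      have ih' := ih (by omega)
      obtain ⟨w, hw⟩ := hT (k + 1) hk
      obtain ⟨w', hw'⟩ := hB (Pi.single j ((k + 1 : ℕ) : ℤ))
      rw [intVec_single] at hw'
      simp only [Int.cast_natCast] at hw'
      have h2 : act (T - B) (((k + 1 : ℕ) : ℝ) • EuclideanSpace.single j 1)
          = (act T (((k + 1 : ℕ) : ℝ) • EuclideanSpace.single j 1) - intVec w)
            + intVec (w - w') := by
        rw [act_sub_left, hw', intVec_sub]; abel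
      have h3 : ‖act (T - B) (((k + 1 : ℕ) : ℝ) • EuclideanSpace.single j 1)‖ ≤ 2 * e := by
        have : act (T - B) (((k + 1 : ℕ) : ℝ) • EuclideanSpace.single j 1)
          = act (T - B) ((k : ℝ) • EuclideanSpace.single j 1)
            + act (T - B) (EuclideanSpace.single j 1) := by
          rw [← act_add_right]; congr 1; push_cast; rw [add_smul, one_smul]
        rw [this]
        exact (norm_add_le _ _).trans (by linarith)
      have h4 : ‖intVec (w - w')‖ < 1 := by
        have h5 : intVec (w - w') = act (T - B) (((k + 1 : ℕ) : ℝ) • EuclideanSpace.single j 1)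
          - (act T (((k + 1 : ℕ) : ℝ) • EuclideanSpace.single j 1) - intVec w) := by rw [h2]; abel
        rw [h5]
        exact (norm_sub_le _ _).trans_lt (by linarith)
      rw [h2, eq_zero_of_norm_intVec_lt h4, intVec_zero, add_zero]
      exact hw
  have := key k₀ le_rfl
  rwa [act_smul_right, norm_smul, Real.norm_eq_abs, abs_of_nonneg (by positivity)] at this

end Model

end Kac

namespace Kac

open Filter Topology MeasureTheory

variable {d : ℕ}

namespace Model

variable {m : Model d}

set_option maxHeartbeats 1000000 in
-- The proof carries many explicit constants.
/-- Two lattices fitting the same configuration agree near `y`, in the norm `‖·‖_λ`, up to a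
reparametrisation. -/
lemma exists_reparam_close (m : Model d) {K r : ℝ} (hK : 0 < K) (hr : 0 < r) :
    ∃ η₀ > 0, ∀ η > 0, η ≤ η₀ → ∀ l > 0, 1 ≤ η * l → ∀ χ : Finset (Vec d), m.HardCore χ →
      ∀ y a b, m.Fit K η l χ y a → m.Fit K η l χ y b →
      ∃ (B : GLInt d) (t : Fin d → ℤ), affNorm l (a - reparam B t b) ≤ r := by
  obtain ⟨K', hK'0, hK'⟩ := exists_inv_bound_on_bddSet (d := d) hK
  have hs := m.s₀_pos
  set Q : ℝ := 1 + K * K' with hQ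
  have hQ1 : 1 ≤ Q := by have : 0 ≤ K * K' := by positivity
                         linarith
  obtain ⟨r₁, hr₁, hdetc⟩ := exists_det_close (d := d) Q (e := 1 / 2) (by norm_num)
  set D : ℝ := d + 1 with hD
  have hD1 : 1 ≤ D := by simp [hD]
  set δ : ℝ := min (min (m.s₀ / (4 * K')) (1 / (8 * Q)))
    (min (min r₁ 1 / (2 * D * Q)) (r / (24 * D * Q * Q + 2 * Q))) with hδ
  have hδ0 : 0 < δ := by positivity
  have hδa : δ ≤ m.s₀ / (4 * K') := (min_le_left _ _).trans (min_le_left _ _)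
  have hδb : δ ≤ 1 / (8 * Q) := (min_le_left _ _).trans (min_le_right _ _)
  have hδc : δ ≤ min r₁ 1 / (2 * D * Q) := (min_le_right _ _).trans (min_le_left _ _)
  have hδd : δ ≤ r / (24 * D * Q * Q + 2 * Q) := (min_le_right _ _).trans (min_le_right _ _)
  have hδs : 2 * δ * K' < m.s₀ := by
    have := (le_div_iff₀ (by positivity)).1 hδa
    linarith
  have hδb' : δ * (8 * Q) ≤ 1 := (le_div_iff₀ (by positivity)).1 hδb
  have hδQ : δ * 1 ≤ δ * Q := mul_le_mul_of_nonneg_left hQ1 hδ0.le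
  have hδ1 : δ ≤ 1 := by linarith
  have hδc' : δ * (2 * D * Q) ≤ min r₁ 1 := (le_div_iff₀ (by positivity)).1 hδc
  have hδd' : δ * (24 * D * Q * Q + 2 * Q) ≤ r := (le_div_iff₀ (by positivity)).1 hδd
  obtain ⟨C, hC0, hC⟩ := exists_cover m hK hK' hK'0 hδ0 hδ1 hδs
  set w := volume.real (Metric.closedBall (0 : Vec d) (1 / 2)) with hw
  have hw0 : 0 < w := by
    refine ENNReal.toReal_pos (Metric.measure_closedBall_pos _ _ (by norm_num)).ne'
      measure_closedBall_lt_top.ne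
  refine ⟨min (min (1 / (K' * (d + 1))) (w / (4 * C))) (min (1 / (2 * K')) (1 / (8 * K))),
    by positivity, ?_⟩
  intro η hη hη0 l hl hηl χ hχ y a b ha hb
  have hηa : η * (K' * (d + 1)) ≤ 1 := (le_div_iff₀ (by positivity)).1
    (hη0.trans ((min_le_left _ _).trans (min_le_left _ _)))
  have hηb : η * (4 * C) ≤ w := (le_div_iff₀ (by positivity)).1
    (hη0.trans ((min_le_left _ _).trans (min_le_right _ _)))
  have hηc : η * (2 * K') ≤ 1 := (le_div_iff₀ (by positivity)).1
    (hη0.trans ((min_le_right _ _).trans (min_le_left _ _)))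
  have hηd : η * (8 * K) ≤ 1 := (le_div_iff₀ (by positivity)).1
    (hη0.trans ((min_le_right _ _).trans (min_le_right _ _)))
  obtain ⟨n, hn, hinj, hbad, hcov⟩ := hC η hη hηa l hl hηl χ hχ y b a hb ha
  have hbdet : 0 < b.1.det := bddSet_subset_GLPos hK hb.mem
  have hbK' := hK' b.1 hb.mem
  have hpair := fun v hv => exists_pair_of_cover (m := m) hl hbdet.ne' hcov
    (by rw [← hw]; linarith [mul_pos hC0 hη]) v hv
  set P := good δ l χ y b a with hP
  set T : Mat d := a.1 * b.1⁻¹ with hT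
  have hTn : ‖T‖ ≤ K * K' := by
    refine (norm_mul_le' _ _).trans ?_
    have := ha.mem.1
    gcongr
  set e := 2 * δ * Q with he
  have he0 : 0 ≤ e := by positivity
  have he3 : 3 * e < 1 := by rw [he]; linarith
  -- moderate integer vectors are sent close to integer vectors
  have hTint : ∀ v : Fin d → ℤ, ‖l⁻¹ • act b.1⁻¹ (intVec v)‖ ≤ 1 / 2 →
      ∃ k : Fin d → ℤ, ‖act T (intVec v) - intVec k‖ ≤ e := by
    intro v hv
    obtain ⟨p, hp, q, hq, hpq⟩ := hpair v hv
    obtain ⟨k₁, hk₁⟩ := (mem_good.1 hp).2.2.2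
    obtain ⟨k₂, hk₂⟩ := (mem_good.1 hq).2.2.2
    have hnp := hn p hp
    have hnq := hn q hq
    refine ⟨k₂ - k₁, ?_⟩
    set E : Vec d := (lin b (q - y) - intVec (n q)) - (lin b (p - y) - intVec (n p)) with hE
    have hEn : ‖E‖ ≤ 2 * δ := (norm_sub_le _ _).trans (by linarith)
    have h1 : intVec v = act b.1 (q - p) - E := by
      rw [hE, hpq, intVec_add]; simp only [lin, act_sub_right]; abel
    have h2 : act T (intVec v) - intVec (k₂ - k₁)
        = (lin a (q - y) - intVec k₂) - (lin a (p - y) - intVec k₁) - act T E := by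
      rw [h1, act_sub_right, hT, act_mul, act_inv_act hbdet.ne', intVec_sub]
      simp only [lin, act_sub_right]; abel
    rw [h2]
    have h3 : ‖act T E‖ ≤ K * K' * (2 * δ) := (norm_act_le _ _).trans (by gcongr)
    have h4 := norm_sub_le (lin a (q - y) - intVec k₂) (lin a (p - y) - intVec k₁)
    have h5 := norm_sub_le ((lin a (q - y) - intVec k₂) - (lin a (p - y) - intVec k₁)) (act T E)
    have h6 : e = 2 * δ + K * K' * (2 * δ) := by rw [he, hQ]; ring
    linarith
  -- in particular the multiples `k e_j` for `k` up to order `l`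
  have hmul : ∀ (j : Fin d) (k : ℕ), (k : ℝ) ≤ l / (2 * K') → ∃ w : Fin d → ℤ,
      ‖act T ((k : ℝ) • EuclideanSpace.single j 1) - intVec w‖ ≤ e := by
    intro j k hk
    have h1 : ((k : ℝ) • EuclideanSpace.single j 1 : Vec d) = intVec (Pi.single j (k : ℤ)) := by
      rw [intVec_single]; simp
    rw [h1]
    refine hTint _ ?_
    rw [← h1, act_smul_right, norm_scaled hl, norm_smul, Real.norm_eq_abs,
      abs_of_nonneg (by positivity)]
    have h2 := norm_act_le b.1⁻¹ (EuclideanSpace.single j 1)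
    rw [norm_single_one, mul_one] at h2
    calc (k : ℝ) * ‖act b.1⁻¹ (EuclideanSpace.single j 1)‖ ≤ l / (2 * K') * K' := by
          gcongr; exact h2.trans hbK'
      _ = _ := by field_simp
  have hl2 : 1 ≤ l / (2 * K') := by
    rw [le_div_iff₀ (by positivity)]
    have h1 := mul_le_mul_of_nonneg_right hηc hl.le
    have h2 := mul_le_mul_of_nonneg_left hηl (show 0 ≤ 2 * K' by positivity)
    linarith
  have hcol : ∀ j : Fin d, ∃ w : Fin d → ℤ,
      ‖act T (EuclideanSpace.single j 1) - intVec w‖ ≤ e := by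
    intro j
    have := hmul j 1 (by simpa using hl2)
    simpa using this
  choose k hk using hcol
  -- the integer matrix with columns `k j`
  set Bz : Matrix (Fin d) (Fin d) ℤ := Matrix.of fun i j => k j i with hBz
  set B' : Mat d := Bz.map (fun n : ℤ => (n : ℝ)) with hB'
  have hB'col : ∀ j, act B' (EuclideanSpace.single j 1) = intVec (k j) := by
    intro j; ext i; rw [act_single]; rfl
  have hB'int : ∀ v : Fin d → ℤ, act B' (intVec v) = intVec (Bz.mulVec v) := by
    intro v; ext i
    simp [act_apply, intVec_apply, hB', Matrix.mulVec, dotProduct]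
  have hTB : ∀ j, ‖act (T - B') (EuclideanSpace.single j 1)‖ ≤ e := by
    intro j; rw [act_sub_left, hB'col]; exact hk j
  have hTBn : ‖T - B'‖ ≤ d * e := norm_le_of_norm_act_single_le he0 hTB
  have hde : d * e ≤ min r₁ 1 := by
    have : d * e ≤ D * e := by gcongr; simp [hD]
    calc _ ≤ D * e := this
      _ = δ * (2 * D * Q) := by rw [he]; ring
      _ ≤ _ := hδc'
  -- an integer close to `det a / det b`, which is close to one
  have hdet1 : Bz.det = 1 := by
    have h1 := hdetc T (hTn.trans (by linarith)) B' (by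
      rw [norm_sub_rev]; exact hTBn.trans (hde.trans (min_le_left _ _)))
    have h2 : T.det = a.1.det / b.1.det := by
      rw [hT, Matrix.det_mul, Matrix.det_nonsing_inv, Ring.inverse_eq_inv']; rfl
    have h3 : |T.det - 1| ≤ 1 / 4 := by
      have h4 : |a.1.det - b.1.det| ≤ 2 * η := by
        have := abs_sub_le a.1.det (m.rho l χ y) b.1.det
        have := ha.rho_near
        have := hb.rho_near
        rw [abs_sub_comm] at this
        linarith
      have h5 : T.det - 1 = (a.1.det - b.1.det) / b.1.det := by
        rw [h2]; field_simp
      rw [h5, abs_div, abs_of_pos hbdet, div_le_iff₀ hbdet]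
      have h6 : 1 ≤ K * b.1.det := by
        have := hb.mem.2
        rwa [inv_le_iff_one_le_mul₀ hK, mul_comm] at this
      have h7 := mul_le_mul_of_nonneg_left h6 (show 0 ≤ 2 * η by positivity)
      have h8 := mul_le_mul_of_nonneg_right hηd hbdet.le
      linarith
    have h7 : B'.det = (Bz.det : ℝ) := by
      rw [hB', ← Int.cast_det]
    rw [h7] at h1
    have h8 : |((Bz.det - 1 : ℤ) : ℝ)| < 1 := by
      rw [Int.cast_sub, Int.cast_one]
      have := abs_sub_le (Bz.det : ℝ) T.det 1
      linarith
    have h9 : |Bz.det - 1| < 1 := by exact_mod_cast h8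
    have := Int.abs_lt_one_iff.1 h9
    linarith
  set k₀ := ⌊l / (2 * K')⌋₊ with hk₀
  have hk₀l : l / (4 * K') ≤ k₀ := by
    have h1 := Nat.lt_floor_add_one (l / (2 * K'))
    have h2 : (1 : ℝ) ≤ k₀ := by exact_mod_cast (Nat.one_le_floor_iff _).2 hl2
    have h3 : l / (4 * K') = l / (2 * K') / 2 := by field_simp; norm_num
    rw [h3]; linarith
  -- the multiples up to order `l` improve the error by a factor `1 / l`
  have hsmall : ∀ j, ‖act (T - B') (EuclideanSpace.single j 1)‖ ≤ 4 * K' * e / l := by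
    intro j
    have h1 := norm_mul_act_single_le (k₀ := k₀) he3 (fun v => ⟨_, hB'int v⟩) (hTB j) fun k hk =>
      hmul j k ((by exact_mod_cast hk : (k : ℝ) ≤ k₀).trans (Nat.floor_le (by positivity)))
    have h2 := (mul_le_mul_of_nonneg_right hk₀l (norm_nonneg
      (act (T - B') (EuclideanSpace.single j 1)))).trans h1
    rw [div_mul_eq_mul_div, div_le_iff₀ (by positivity)] at h2
    rw [le_div_iff₀ hl]; linarith
  have hTBl : ‖T - B'‖ ≤ d * (4 * K' * e / l) := norm_le_of_norm_act_single_le (by positivity) hsmall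
  set M : Mat d := a.1 - B' * b.1 with hM
  have hMn : l * ‖M‖ ≤ 4 * D * Q * e := by
    have h1 : M = (T - B') * b.1 := by
      rw [sub_mul, hT, mul_assoc, inv_mul_cancel_of_det hbdet.ne', mul_one]
    have h2 : ‖M‖ ≤ d * (4 * K' * e / l) * K := by
      rw [h1]
      refine (norm_mul_le' _ _).trans ?_
      have := hb.mem.1
      gcongr
    calc l * ‖M‖ ≤ l * (d * (4 * K' * e / l) * K) := by gcongr
      _ = 4 * d * (K * K') * e := by field_simp
      _ ≤ 4 * D * Q * e := by
        have : (d : ℝ) ≤ D := by simp [hD]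
        have : K * K' ≤ Q := by linarith
        gcongr
  have hB'n : ‖B'‖ ≤ Q := by
    have h1 : ‖B'‖ ≤ ‖T‖ + ‖T - B'‖ := by
      have := norm_sub_le T (T - B'); rwa [sub_sub_cancel] at this
    have := hTBn.trans (hde.trans (min_le_right _ _))
    linarith
  -- one atom close to both lattices fixes the translation
  obtain ⟨p, hp, -⟩ := hpair 0 (by rw [intVec_zero, act_zero_right]; simp)
  obtain ⟨-, hp2, -, k₁, hk₁⟩ := mem_good.1 hp
  have hnp := hn p hp
  refine ⟨⟨Bz, hdet1⟩, k₁ - Bz.mulVec (n p), ?_⟩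
  refine (affNorm_le hl.le _).trans ?_
  have hfst : (a - reparam (⟨Bz, hdet1⟩ : GLInt d) (k₁ - Bz.mulVec (n p)) b).1 = M := rfl
  have hsnd : (a - reparam (⟨Bz, hdet1⟩ : GLInt d) (k₁ - Bz.mulVec (n p)) b).2
      = (lin a (p - y) - intVec k₁) - act B' (lin b (p - y) - intVec (n p)) - act M (p - y) := by
    change a.2 - (act B' b.2 + intVec _) = _
    rw [intVec_sub, hM, act_sub_left, act_mul, act_sub_right, hB'int]
    simp only [lin, act_add_right]
    abel
  rw [hfst, hsnd]
  have h1 : ‖act B' (lin b (p - y) - intVec (n p))‖ ≤ Q * δ :=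
    (norm_act_le _ _).trans (by gcongr)
  have h2 : ‖act M (p - y)‖ ≤ 2 * (4 * D * Q * e) := by
    refine (norm_act_le _ _).trans ?_
    calc ‖M‖ * ‖p - y‖ ≤ ‖M‖ * (2 * l) := by gcongr
      _ = 2 * (l * ‖M‖) := by ring
      _ ≤ _ := by gcongr
  have h3 := norm_sub_le (lin a (p - y) - intVec k₁) (act B' (lin b (p - y) - intVec (n p)))
  have h4 := norm_sub_le ((lin a (p - y) - intVec k₁) - act B' (lin b (p - y) - intVec (n p)))
    (act M (p - y))
  have h5 : 12 * D * Q * e + δ + Q * δ ≤ δ * (24 * D * Q * Q + 2 * Q) := by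
    rw [he]; linarith
  linarith

end Model

end Kac

/-! ### Strong convexity of the misfit energy -/

namespace Kac

open Filter Topology MeasureTheory

variable {d : ℕ}

namespace Model

variable {m : Model d}

/-- The derivative of the misfit `I(·)` at `a` in the direction `b`. -/
noncomputable def dMisfit (m : Model d) (l : ℝ) (a : Aff d) (χ : Finset (Vec d)) (y : Vec d)
    (b : Aff d) : ℝ :=
  m.nrm l * ∑ p ∈ χ, m.W1 (lin a (p - y)) (lin b (p - y)) * m.wt l y p

/-- The second derivative of the misfit `I(·)` at `a` in the directions `b` and `c`. -/
noncomputable def ddMisfit (m : Model d) (l : ℝ) (a : Aff d) (χ : Finset (Vec d)) (y : Vec d)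
    (b c : Aff d) : ℝ :=
  m.nrm l * ∑ p ∈ χ, m.W2 (lin a (p - y)) (lin b (p - y)) (lin c (p - y)) * m.wt l y p

/-- The derivative of the misfit energy `J(·)` at `a` in the direction `b`. -/
noncomputable def dJ (m : Model d) (l : ℝ) (a : Aff d) (χ : Finset (Vec d)) (y : Vec d)
    (b : Aff d) : ℝ :=
  fderiv ℝ (invSq (d := d)) a.1 b.1 * m.misfit l a χ y + invSq a.1 * m.dMisfit l a χ y b

lemma hasDerivAt_lin_line (a b : Aff d) (x : Vec d) (s : ℝ) :
    HasDerivAt (fun s : ℝ => lin (a + s • b) x) (lin b x) s := by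
  simp only [lin_add, lin_smul]
  simpa using ((hasDerivAt_id s).smul_const (lin b x)).const_add (lin a x)

lemma hasDerivAt_misfit (l : ℝ) (χ : Finset (Vec d)) (y : Vec d) (a b : Aff d) (s : ℝ) :
    HasDerivAt (fun s : ℝ => m.misfit l (a + s • b) χ y) (m.dMisfit l (a + s • b) χ y b) s := by
  simp only [misfit, dMisfit]
  refine HasDerivAt.const_mul _ (HasDerivAt.fun_sum fun p _ => HasDerivAt.mul_const ?_ _)
  exact (m.hasFDerivAt_W _).comp_hasDerivAt s (hasDerivAt_lin_line a b (p - y) s)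

lemma hasDerivAt_dMisfit (l : ℝ) (χ : Finset (Vec d)) (y : Vec d) (a b c : Aff d) (s : ℝ) :
    HasDerivAt (fun s : ℝ => m.dMisfit l (a + s • b) χ y c) (m.ddMisfit l (a + s • b) χ y b c) s := by
  unfold ddMisfit dMisfit
  refine HasDerivAt.const_mul _ (HasDerivAt.fun_sum fun p _ => HasDerivAt.mul_const ?_ _)
  have := ((m.hasFDerivAt_W1 _).comp_hasDerivAt s (hasDerivAt_lin_line a b (p - y) s)).clm_apply
    (hasDerivAt_const s (lin c (p - y)))
  simpa using this

lemma hasDerivAt_fst_line (a b : Aff d) (s : ℝ) :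
    HasDerivAt (fun s : ℝ => (a + s • b).1) b.1 s := by
  simpa using ((hasDerivAt_id s).smul_const b.1).const_add a.1

lemma hasFDerivAt_invSq {A : Mat d} (hA : A.det ≠ 0) :
    HasFDerivAt (invSq (d := d)) (fderiv ℝ (invSq (d := d)) A) A :=
  ((contDiffAt_invSq (n := 1) hA).differentiableAt (by simp)).hasFDerivAt

lemma hasFDerivAt_fderiv_invSq {A : Mat d} (hA : A.det ≠ 0) :
    HasFDerivAt (fderiv ℝ (invSq (d := d))) (fderiv ℝ (fderiv ℝ (invSq (d := d))) A) A :=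
  (((contDiffAt_invSq (n := 2) hA).fderiv_right (m := 1) (by norm_num)).differentiableAt
    (by simp)).hasFDerivAt

lemma hasDerivAt_J {l : ℝ} (hl : 0 < l) (χ : Finset (Vec d)) (y : Vec d) (a b : Aff d) (s : ℝ)
    (hs : (a + s • b).1.det ≠ 0) :
    HasDerivAt (fun s : ℝ => m.J l (a + s • b) χ y) (m.dJ l (a + s • b) χ y b) s := by
  simp only [J_eq hl, dJ]
  exact ((hasFDerivAt_invSq hs).comp_hasDerivAt s (hasDerivAt_fst_line a b s)).mul
    (hasDerivAt_misfit l χ y a b s)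

/-- The second derivative of the misfit energy `J(·)` at `a` in the directions `b` and `c`. -/
noncomputable def ddJ (m : Model d) (l : ℝ) (a : Aff d) (χ : Finset (Vec d)) (y : Vec d)
    (b c : Aff d) : ℝ :=
  (fderiv ℝ (fderiv ℝ (invSq (d := d))) a.1 b.1 c.1 * m.misfit l a χ y
      + fderiv ℝ (invSq (d := d)) a.1 c.1 * m.dMisfit l a χ y b)
    + (fderiv ℝ (invSq (d := d)) a.1 b.1 * m.dMisfit l a χ y c
      + invSq a.1 * m.ddMisfit l a χ y b c)

lemma hasDerivAt_dJ (l : ℝ) (χ : Finset (Vec d)) (y : Vec d) (a b c : Aff d) (s : ℝ)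
    (hs : (a + s • b).1.det ≠ 0) :
    HasDerivAt (fun s : ℝ => m.dJ l (a + s • b) χ y c) (m.ddJ l (a + s • b) χ y b c) s := by
  have h1 : HasDerivAt (fun s : ℝ => fderiv ℝ (invSq (d := d)) (a + s • b).1 c.1)
      (fderiv ℝ (fderiv ℝ (invSq (d := d))) (a + s • b).1 b.1 c.1) s := by
    have h0 : HasDerivAt (fun s : ℝ => fderiv ℝ (invSq (d := d)) (a + s • b).1)
        (fderiv ℝ (fderiv ℝ (invSq (d := d))) (a + s • b).1 b.1) s :=
      (hasFDerivAt_fderiv_invSq hs).comp_hasDerivAt s (hasDerivAt_fst_line a b s)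
    exact (ContinuousLinearMap.apply ℝ ℝ c.1).hasFDerivAt.comp_hasDerivAt s h0
  have h2 : HasDerivAt (fun s : ℝ => invSq (a + s • b).1)
      (fderiv ℝ (invSq (d := d)) (a + s • b).1 b.1) s :=
    HasFDerivAt.comp_hasDerivAt (l := invSq (d := d)) s (hasFDerivAt_invSq hs) (hasDerivAt_fst_line a b s)
  have h3 := h1.fun_mul (hasDerivAt_misfit (m := m) l χ y a b s)
  have h4 := h2.fun_mul (hasDerivAt_dMisfit (m := m) l χ y a b c s)
  exact h3.fun_add h4

lemma misfit_le_rho {l : ℝ} (hl : 0 < l) {C : ℝ} (hC : ∀ z, |m.W z| ≤ C) (a : Aff d)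
    (χ : Finset (Vec d)) (y : Vec d) : m.misfit l a χ y ≤ C * m.rho l χ y := by
  rw [misfit, rho_eq hl, mul_left_comm C, Finset.mul_sum (a := C)]
  refine mul_le_mul_of_nonneg_left (Finset.sum_le_sum fun p _ => ?_) (nrm_pos hl).le
  have := (le_abs_self _).trans (hC (lin a (p - y)))
  have := wt_nonneg (m := m) l y p
  gcongr

lemma abs_dMisfit_le {l : ℝ} (hl : 0 < l) {C : ℝ} (hC : ∀ z, ‖m.W1 z‖ ≤ C) (a b : Aff d)
    (χ : Finset (Vec d)) (y : Vec d) :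
    |m.dMisfit l a χ y b| ≤ 3 * C * affNorm l b * m.rho l χ y := by
  have hN := nrm_pos (m := m) hl
  rw [dMisfit, rho_eq hl, abs_mul, abs_of_pos hN, mul_left_comm, Finset.mul_sum]
  refine mul_le_mul_of_nonneg_left ((Finset.abs_sum_le_sum_abs _ _).trans
    (Finset.sum_le_sum fun p _ => ?_)) hN.le
  by_cases h2 : ‖p - y‖ ≤ 2 * l
  · rw [abs_mul, abs_of_nonneg (wt_nonneg (m := m) l y p)]
    refine mul_le_mul_of_nonneg_right ?_ (wt_nonneg _ _ _)
    refine ((m.W1 _).le_opNorm _).trans ?_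
    have h3 := norm_lin_le zero_le_two b h2
    have h4 := hC (lin a (p - y))
    have h5 : 0 ≤ C := (norm_nonneg _).trans h4
    calc _ ≤ C * ((2 + 1) * affNorm l b) := by gcongr
      _ = _ := by ring
  · simp [wt_eq_zero hl h2]

lemma rho_nonneg {l : ℝ} (hl : 0 < l) (χ : Finset (Vec d)) (y : Vec d) : 0 ≤ m.rho l χ y := by
  rw [rho_eq hl]
  exact mul_nonneg (nrm_pos hl).le (Finset.sum_nonneg fun _ _ => wt_nonneg _ _ _)

lemma one_add_sq_mul_le {x : ℝ} (hx : 0 ≤ x) {k : ℝ} (hk : k * (4 * (x + 5)) = 1) :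
    (1 + k) ^ 2 * (x + 4) ≤ x + 5 := by
  have hk0 : 0 < k := by
    by_contra h
    have := mul_nonpos_of_nonpos_of_nonneg (not_lt.1 h) (by positivity : 0 ≤ 4 * (x + 5))
    linarith
  have h1 : k ≤ 1 := by
    have := mul_nonneg hk0.le hx
    linarith
  have h2 : k * k * (x + 4) ≤ 1 * (k * (x + 4)) := by
    have : 0 ≤ k * (x + 4) := by positivity
    have := mul_le_mul_of_nonneg_right h1 this
    linarith
  have h3 : k * (x + 4) ≤ 1 / 4 := by linarith
  calc _ = x + 4 + (2 * (k * (x + 4)) + k * k * (x + 4)) := by ring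
    _ ≤ _ := by linarith

-- The quantitative perturbation argument is one long computation.
set_option maxHeartbeats 1000000 in
/-- Near a fitting lattice the misfit energy is uniformly convex; `a₂` is any lattice near `a₀`. -/
lemma exists_ddJ_lower (m : Model d) (hd : 1 ≤ d) {K : ℝ} (hK : 0 < K) :
    ∃ r > 0, ∃ η₀ > 0, ∀ η > 0, η ≤ η₀ → ∀ l > 0, 1 ≤ η * l → ∀ χ : Finset (Vec d),
      m.HardCore χ → ∀ y a₀, m.Fit K η l χ y a₀ →
      (∀ a : Aff d, affNorm l (a - a₀) ≤ r → a.1 ∈ bddSet d (2 * K)) ∧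
      (∀ a : Aff d, affNorm l (a - a₀) ≤ r → ∀ b : Aff d,
        m.c₀ / (d + 3) * m.rho l χ y * affNorm l b ^ 2 ≤ m.ddMisfit l a χ y b b) ∧
      ∀ a a₂ : Aff d, affNorm l (a - a₀) ≤ r → affNorm l (a₂ - a₀) ≤ r → ∀ b : Aff d,
        m.c₀ / (d + 5) * invSq a₂.1 * m.rho l χ y * affNorm l b ^ 2 ≤ m.ddJ l a χ y b b := by
  obtain ⟨r, hr, η₁, hη₁, H⟩ := exists_hess_lower m hd hK
  obtain ⟨r₁, hr₁, hball⟩ := exists_dist_bddSet (d := d) hK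
  have hK2 : 0 < 2 * K := by positivity
  obtain ⟨K', hK'0, hK'⟩ := exists_inv_bound_on_bddSet (d := d) hK2
  obtain ⟨CW, hCW0, hCW⟩ := m.exists_bound_W
  obtain ⟨C₁, hC₁0, hC₁⟩ := exists_bound_on_bddSet hK2 (f := fderiv ℝ (invSq (d := d))) fun A hA =>
    (hasFDerivAt_fderiv_invSq (ne_of_gt hA)).continuousAt.continuousWithinAt
  obtain ⟨C₂, hC₂0, hC₂⟩ := exists_bound_on_bddSet hK2 (f := fderiv ℝ (fderiv ℝ (invSq (d := d))))
    fun A hA => ((((contDiffAt_invSq (n := 3) (ne_of_gt hA)).fderiv_right (m := 2)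
      (by norm_num)).fderiv_right (m := 1) (by norm_num)).continuousAt).continuousWithinAt
  obtain ⟨C₃, hC₃0, hC₃⟩ := exists_bound_on_bddSet hK2 (f := fun A : Mat d => (invSq A)⁻¹) fun A hA =>
    ((contDiffAt_invSq (n := 0) (ne_of_gt hA)).inv
      (invSq_pos hd (ne_of_gt hA)).ne').continuousAt.continuousWithinAt
  have hc := m.c₀_pos
  set S : ℝ := C₃ * (C₂ * CW + 6 * C₁ * CW) with hS
  have hS0 : 0 < S := by positivity
  set g : ℝ := (1 / (d + 3) - 1 / (d + 4)) with hg
  have hg0 : 0 < g := by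
    rw [hg, sub_pos]; exact one_div_lt_one_div_of_lt (by positivity) (by linarith)
  set k : ℝ := (1 / (4 * (d + 5))) with hk
  have hk0 : 0 < k := by positivity
  refine ⟨r, hr, min (min η₁ 1) (min (min (r₁ / r) (m.c₀ * g / S)) (k / (2 * r * K'))),
    by positivity, ?_⟩
  intro η hη hη0 l hl hηl χ hχ y a₀ ha₀
  have hηa : η ≤ η₁ := hη0.trans ((min_le_left _ _).trans (min_le_left _ _))
  have hηb : η ≤ 1 := hη0.trans ((min_le_left _ _).trans (min_le_right _ _))
  have hηc : η * r ≤ r₁ := (le_div_iff₀ hr).1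
    (hη0.trans ((min_le_right _ _).trans ((min_le_left _ _).trans (min_le_left _ _))))
  have hηd : η * S ≤ m.c₀ * g := (le_div_iff₀ hS0).1
    (hη0.trans ((min_le_right _ _).trans ((min_le_left _ _).trans (min_le_right _ _))))
  have hηe : η * (2 * r * K') ≤ k := (le_div_iff₀ (by positivity)).1
    (hη0.trans ((min_le_right _ _).trans (min_le_right _ _)))
  have hli : l⁻¹ ≤ η := by rw [inv_le_iff_one_le_mul₀ hl]; linarith
  -- the matrix part of a variation is smaller than its norm by a factor `η`, so that the
  -- derivatives of `‖A⁻¹‖²` cause only small errors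
  have hfst : ∀ b : Aff d, ‖b.1‖ ≤ η * affNorm l b := by
    intro b
    have h1 := norm_fst_le_affNorm l b
    calc ‖b.1‖ = l⁻¹ * (l * ‖b.1‖) := by field_simp
      _ ≤ η * affNorm l b := by gcongr
  have hmem : ∀ a : Aff d, affNorm l (a - a₀) ≤ r → a.1 ∈ bddSet d (2 * K) := by
    intro a ha
    refine hball a₀.1 ha₀.mem a.1 ?_
    have h1 := hfst (a - a₀)
    have h2 : η * affNorm l (a - a₀) ≤ η * r := by gcongr
    exact (h1.trans h2).trans hηc
  refine ⟨hmem, fun a ha b => H η hη hηa l hl hηl χ hχ y a₀ ha₀ a ha b, ?_⟩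
  intro a a₂ ha ha₂ b
  have hdet : a.1.det ≠ 0 := ne_of_gt (bddSet_subset_GLPos hK2 (hmem a ha))
  have hdet₂ : a₂.1.det ≠ 0 := ne_of_gt (bddSet_subset_GLPos hK2 (hmem a₂ ha₂))
  have hH := H η hη hηa l hl hηl χ hχ y a₀ ha₀ a ha b
  have hρ := rho_nonneg (m := m) hl χ y
  set R := affNorm l b with hR
  have hR0 : 0 ≤ R := affNorm_nonneg _ _
  have hb1 := hfst b
  have hb2 : ‖b.1‖ ≤ R := hb1.trans (by
    have := mul_le_mul_of_nonneg_right hηb hR0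
    linarith)
  have hI0 := misfit_nonneg (m := m) hl a χ y
  have hI := misfit_le_rho (m := m) hl (fun z => (hCW z).1) a χ y
  have hdI := abs_dMisfit_le (m := m) hl (fun z => (hCW z).2.1) a b χ y
  set ρ := m.rho l χ y with hρd
  set q := invSq a.1 with hq
  have hq0 : 0 < q := invSq_pos hd hdet
  have hq3 : 1 ≤ C₃ * q := by
    have := (le_abs_self _).trans (hC₃ a.1 (hmem a ha))
    rwa [inv_le_iff_one_le_mul₀ hq0] at this
  have hterm1 : |fderiv ℝ (fderiv ℝ (invSq (d := d))) a.1 b.1 b.1 * m.misfit l a χ y|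
      ≤ η * (C₂ * CW * ρ * R ^ 2) := by
    rw [abs_mul, abs_of_nonneg hI0]
    have h1 : |fderiv ℝ (fderiv ℝ (invSq (d := d))) a.1 b.1 b.1| ≤ C₂ * (η * R) * R := by
      refine ((fderiv ℝ (fderiv ℝ (invSq (d := d))) a.1).le_opNorm₂ b.1 b.1).trans ?_
      have := hC₂ a.1 (hmem a ha)
      gcongr
    calc _ ≤ (C₂ * (η * R) * R) * (CW * ρ) := by gcongr
      _ = _ := by ring
  have hterm2 : |fderiv ℝ (invSq (d := d)) a.1 b.1 * m.dMisfit l a χ y b|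
      ≤ η * (3 * C₁ * CW * ρ * R ^ 2) := by
    rw [abs_mul]
    have h1 : |fderiv ℝ (invSq (d := d)) a.1 b.1| ≤ C₁ * (η * R) := by
      refine ((fderiv ℝ (invSq (d := d)) a.1).le_opNorm b.1).trans ?_
      have := hC₁ a.1 (hmem a ha)
      gcongr
    calc _ ≤ (C₁ * (η * R)) * (3 * CW * R * ρ) := by gcongr
      _ = _ := by ring
  have hlow : m.ddJ l a χ y b b ≥ q * (m.c₀ / (d + 3) * ρ * R ^ 2) - η * S * (q * (ρ * R ^ 2)) := by
    have h1 := (abs_le.1 hterm1).1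
    have h2 := (abs_le.1 hterm2).1
    have h3 : q * (m.c₀ / (d + 3) * ρ * R ^ 2) ≤ q * m.ddMisfit l a χ y b b := by
      unfold ddMisfit; gcongr
    have h4 : η * ((C₂ * CW + 6 * C₁ * CW) * (ρ * R ^ 2)) * 1
        ≤ η * ((C₂ * CW + 6 * C₁ * CW) * (ρ * R ^ 2)) * (C₃ * q) := by gcongr
    have h5 : η * ((C₂ * CW + 6 * C₁ * CW) * (ρ * R ^ 2)) * (C₃ * q)
      = η * S * (q * (ρ * R ^ 2)) := by rw [hS]; ring
    unfold ddJ
    linarith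
  -- from `d + 3` to `d + 4`: the errors are absorbed
  have hlow2 : m.c₀ / (d + 4) * (q * (ρ * R ^ 2)) ≤ m.ddJ l a χ y b b := by
    have h1 : η * S * (q * (ρ * R ^ 2)) ≤ m.c₀ * g * (q * (ρ * R ^ 2)) := by gcongr
    have h2 : m.c₀ / (d + 4) * (q * (ρ * R ^ 2))
        = q * (m.c₀ / (d + 3) * ρ * R ^ 2) - m.c₀ * g * (q * (ρ * R ^ 2)) := by rw [hg]; ring
    linarith
  -- from `d + 4` to `d + 5`: the matrix of `a` is replaced by the one of `a₂`
  have hratio : invSq a₂.1 * (d + 4) ≤ (d + 5) * q := by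
    have h1 := norm_inv_sub_inv_le hdet hdet₂
    have h2 : ‖a.1 - a₂.1‖ * ‖a₂.1⁻¹‖ ≤ k := by
      have h3 : ‖a.1 - a₂.1‖ ≤ η * (2 * r) := by
        refine (hfst (a - a₂)).trans ?_
        have h4 := affNorm_add_le l (a - a₀) (a₀ - a₂)
        rw [sub_add_sub_cancel, affNorm_sub_comm l a₀ a₂] at h4
        gcongr; linarith
      have h4 := hK' a₂.1 (hmem a₂ ha₂)
      calc _ ≤ η * (2 * r) * K' := by gcongr
        _ = η * (2 * r * K') := by ring
        _ ≤ k := hηe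
    have h3 : ‖a₂.1⁻¹‖ ≤ ‖a.1⁻¹‖ * (1 + k) := h1.trans (by gcongr)
    have h4 : invSq a₂.1 ≤ q * (1 + k) ^ 2 := by
      rw [hq, invSq, invSq, ← mul_pow]; gcongr
    have h5 : (1 + k) ^ 2 * (d + 4) ≤ d + 5 := by
      have hk1 : k * (4 * (d + 5)) = 1 := by rw [hk]; field_simp
      exact one_add_sq_mul_le (by positivity) hk1
    calc _ ≤ q * (1 + k) ^ 2 * (d + 4) := by gcongr
      _ = q * ((1 + k) ^ 2 * (d + 4)) := by ring
      _ ≤ q * (d + 5) := by gcongr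
      _ = _ := by ring
  refine le_trans ?_ hlow2
  have h6 : invSq a₂.1 / (d + 5) ≤ q / (d + 4) := by
    rw [div_le_div_iff₀ (by positivity) (by positivity)]
    linarith
  calc _ = m.c₀ * (invSq a₂.1 / (d + 5)) * (ρ * R ^ 2) := by ring
    _ ≤ m.c₀ * (q / (d + 4)) * (ρ * R ^ 2) := by gcongr
    _ = _ := by ring

end Model

end Kac

/-! ### The branch of local minimizers -/

namespace Kac

open Filter Topology MeasureTheory

variable {d : ℕ}

/-- A continuous bilinear form on a finite dimensional space that is positive definite is
invertible as a map to the dual. -/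
lemma isInvertible_of_pos {V : Type*} [NormedAddCommGroup V] [NormedSpace ℝ V]
    [FiniteDimensional ℝ V] (T : V →L[ℝ] V →L[ℝ] ℝ) (h : ∀ b, b ≠ 0 → 0 < T b b) :
    T.IsInvertible := by
  have hinj : Function.Injective (T : V →ₗ[ℝ] V →L[ℝ] ℝ) := by
    rw [← LinearMap.ker_eq_bot, LinearMap.ker_eq_bot']
    intro b hb
    by_contra hb0
    have h1 := h b hb0
    have h2 : T b = 0 := hb
    simp [h2] at h1
  have hdim : Module.finrank ℝ V = Module.finrank ℝ (V →L[ℝ] ℝ) := by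
    rw [← (LinearMap.toContinuousLinearMap (𝕜 := ℝ) (E := V) (F' := ℝ)).finrank_eq]
    exact (Subspace.dual_finrank_eq (K := ℝ) (V := V)).symm
  refine ⟨(LinearMap.linearEquivOfInjective _ hinj hdim).toContinuousLinearEquiv, ?_⟩
  ext b c
  rfl

namespace Model

variable {m : Model d}

/-- In the ball of radius `r` around `a₀` the misfit energy is uniformly convex. -/
structure UnifConvex (m : Model d) (K r l : ℝ) (χ : Finset (Vec d)) (y : Vec d) (a₀ : Aff d) :
    Prop where
  mem : ∀ a : Aff d, affNorm l (a - a₀) ≤ r → a.1 ∈ bddSet d (2 * K)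
  hess : ∀ a : Aff d, affNorm l (a - a₀) ≤ r → ∀ b : Aff d,
    m.c₀ / (d + 3) * m.rho l χ y * affNorm l b ^ 2 ≤ m.ddMisfit l a χ y b b
  conv : ∀ a a₂ : Aff d, affNorm l (a - a₀) ≤ r → affNorm l (a₂ - a₀) ≤ r → ∀ b : Aff d,
    m.c₀ / (d + 5) * invSq a₂.1 * m.rho l χ y * affNorm l b ^ 2 ≤ m.ddJ l a χ y b b

lemma exists_unifConvex (m : Model d) (hd : 1 ≤ d) {K : ℝ} (hK : 0 < K) :
    ∃ r > 0, ∃ η₀ > 0, ∀ η > 0, η ≤ η₀ → ∀ l > 0, 1 ≤ η * l → ∀ χ : Finset (Vec d),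
      m.HardCore χ → ∀ y a₀, m.Fit K η l χ y a₀ → m.UnifConvex K r l χ y a₀ := by
  obtain ⟨r, hr, η₀, hη₀, H⟩ := exists_ddJ_lower m hd hK
  exact ⟨r, hr, η₀, hη₀, fun η hη hηη l hl hl1 χ hχ y a₀ ha₀ =>
    ⟨(H η hη hηη l hl hl1 χ hχ y a₀ ha₀).1, (H η hη hηη l hl hl1 χ hχ y a₀ ha₀).2.1,
      (H η hη hηη l hl hl1 χ hχ y a₀ ha₀).2.2⟩⟩

lemma affNorm_line_le {l r : ℝ} {a a' a₀ : Aff d} (ha : affNorm l (a - a₀) ≤ r)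
    (ha' : affNorm l (a' - a₀) ≤ r) {s : ℝ} (hs0 : 0 ≤ s) (hs1 : s ≤ 1) :
    affNorm l (a + s • (a' - a) - a₀) ≤ r := by
  have h : a + s • (a' - a) - a₀ = (1 - s) • (a - a₀) + s • (a' - a₀) := by module
  rw [h]
  refine (affNorm_add_le _ _ _).trans ?_
  rw [affNorm_smul, affNorm_smul, abs_of_nonneg hs0, abs_of_nonneg (by linarith : 0 ≤ 1 - s)]
  have h1 := mul_le_mul_of_nonneg_left ha (by linarith : 0 ≤ 1 - s)
  have h2 := mul_le_mul_of_nonneg_left ha' hs0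
  linarith

lemma UnifConvex.det_ne {K r l : ℝ} (hK : 0 < K) {χ : Finset (Vec d)} {y : Vec d} {a₀ : Aff d}
    (H : m.UnifConvex K r l χ y a₀) {a : Aff d} (ha : affNorm l (a - a₀) ≤ r) : a.1.det ≠ 0 :=
  ne_of_gt (bddSet_subset_GLPos (by positivity) (H.mem a ha))

/-- The quantitative form of convexity. -/
lemma UnifConvex.add_le {K r l : ℝ} (hK : 0 < K) (hl : 0 < l) {χ : Finset (Vec d)} {y : Vec d}
    {a₀ : Aff d} (H : m.UnifConvex K r l χ y a₀) {a a' a₂ : Aff d} (ha : affNorm l (a - a₀) ≤ r)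
    (ha' : affNorm l (a' - a₀) ≤ r) (ha₂ : affNorm l (a₂ - a₀) ≤ r) :
    m.J l a χ y + m.dJ l a χ y (a' - a)
      + m.c₀ / (d + 5) * invSq a₂.1 * m.rho l χ y * affNorm l (a' - a) ^ 2 / 2 ≤ m.J l a' χ y := by
  have h1 : ∀ s ∈ Set.Icc (0 : ℝ) 1, affNorm l (a + s • (a' - a) - a₀) ≤ r := fun s hs =>
    affNorm_line_le ha ha' hs.1 hs.2
  have h := add_add_half_le_of_deriv2_ge
    (fun s hs => hasDerivAt_J (m := m) hl χ y a (a' - a) s (H.det_ne hK (h1 s hs)))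
    (fun s hs => hasDerivAt_dJ (m := m) l χ y a (a' - a) (a' - a) s (H.det_ne hK (h1 s hs)))
    (fun s hs => H.conv _ a₂ (h1 s hs) ha₂ (a' - a))
  simpa using h

/-- The convex misfit energy has an interior critical point, close to the centre of the ball. -/
lemma UnifConvex.exists_crit {K r l : ℝ} (hK : 0 < K) (hl : 0 < l) (hr : 0 < r)
    {χ : Finset (Vec d)} {y : Vec d} {a₀ : Aff d} (H : m.UnifConvex K r l χ y a₀)
    (hJ : m.J l a₀ χ y < m.c₀ / (d + 5) * invSq a₀.1 * m.rho l χ y * r ^ 2 / 2) :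
    ∃ a : Aff d, affNorm l (a - a₀) < r ∧ (∀ b, m.dJ l a χ y b = 0) ∧
      m.c₀ / (d + 5) * invSq a₀.1 * m.rho l χ y * affNorm l (a₀ - a) ^ 2 / 2 ≤ m.J l a₀ χ y := by
  set S : Set (Aff d) := {a | affNorm l (a - a₀) ≤ r} with hS
  have h00 : affNorm l (a₀ - a₀) ≤ r := by
    rw [sub_self, show (0 : Aff d) = (0 : ℝ) • 0 by simp, affNorm_smul]; simpa using hr.le
  have hcont : Continuous fun a : Aff d => affNorm l (a - a₀) :=
    (continuous_affNorm l).comp (continuous_id.sub continuous_const)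
  have hcomp : IsCompact S := by
    refine (isCompact_closedBall a₀ (l⁻¹ * r + r)).of_isClosed_subset
      (isClosed_le hcont continuous_const) fun a ha => ?_
    have h1 := norm_fst_le_affNorm l (a - a₀)
    have h2 := norm_snd_le_affNorm l (a - a₀)
    have ha' : affNorm l (a - a₀) ≤ r := ha
    have h3 : ‖(a - a₀).1‖ ≤ l⁻¹ * r := by
      rw [inv_mul_eq_div, le_div_iff₀ hl]; linarith
    have h4 : 0 ≤ l⁻¹ * r := by positivity
    rw [mem_closedBall_iff_norm, Prod.norm_def]
    exact max_le (by linarith) (by linarith)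
  have hJc : ContinuousOn (fun a => m.J l a χ y) S := by
    intro a ha
    have hdet : a.1.det ≠ 0 := H.det_ne hK ha
    simp only [J_eq hl, misfit]
    refine ContinuousWithinAt.mul ?_ ?_
    · exact (((contDiffAt_invSq (n := 0) hdet).continuousAt).comp
        (f := fun a : Aff d => a.1) continuous_fst.continuousAt).continuousWithinAt
    · refine Continuous.continuousWithinAt ?_
      refine continuous_const.mul (continuous_finsetSum _ fun p _ => ?_)
      refine Continuous.mul ((m.contDiff_W (n := 0)).continuous.comp ?_) continuous_const
      exact ((((actL d).continuous.comp continuous_fst).clm_apply continuous_const).add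
        continuous_snd)
  obtain ⟨a, haS, hmin⟩ := hcomp.exists_isMinOn ⟨a₀, h00⟩ hJc
  have haS' : affNorm l (a - a₀) ≤ r := haS
  have hder : ∀ b, HasDerivAt (fun s : ℝ => m.J l (a + s • b) χ y) (m.dJ l a χ y b) 0 := by
    intro b
    have := hasDerivAt_J (m := m) hl χ y a b 0 (by simpa using H.det_ne hK haS')
    simpa using this
  -- at the minimum the derivative towards the centre is nonnegative
  have hpos : 0 ≤ m.dJ l a χ y (a₀ - a) := by
    refine ge_of_tendsto ((hasDerivWithinAt_iff_tendsto_slope' (by simp)).1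
      ((hder (a₀ - a)).hasDerivWithinAt (s := Set.Ioi 0))) ?_
    have : Set.Ioo (0 : ℝ) 1 ∈ 𝓝[>] (0 : ℝ) := Ioo_mem_nhdsGT one_pos
    filter_upwards [this] with s hs
    have h1 : m.J l a χ y ≤ m.J l (a + s • (a₀ - a)) χ y :=
      hmin (affNorm_line_le haS' h00 hs.1.le hs.2.le)
    rw [slope_def_field]
    refine div_nonneg ?_ (by linarith [hs.1])
    simpa using h1
  have hconv := H.add_le hK hl haS' h00 h00
  have hJ0 : 0 ≤ m.J l a χ y := by
    rw [J_eq hl]; exact mul_nonneg (sq_nonneg _) (misfit_nonneg hl _ _ _)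
  have hb : m.c₀ / (d + 5) * invSq a₀.1 * m.rho l χ y * affNorm l (a₀ - a) ^ 2 / 2
      ≤ m.J l a₀ χ y := by linarith
  -- on the sphere convexity would contradict the smallness of the energy at the centre
  have hlt : affNorm l (a - a₀) < r := by
    by_contra h
    have heq : affNorm l (a₀ - a) = r := by
      rw [affNorm_sub_comm]; exact le_antisymm haS' (not_lt.1 h)
    rw [heq] at hb
    linarith
  refine ⟨a, hlt, fun b => ?_, hb⟩
  have hc : Continuous fun s : ℝ => affNorm l (a + s • b - a₀) := by
    refine hcont.comp ?_
    fun_prop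
  have hev : ∀ᶠ s in 𝓝 (0 : ℝ), affNorm l (a + s • b - a₀) < r :=
    hc.continuousAt.eventually_lt continuousAt_const (by simpa using hlt)
  have hloc : IsLocalMin (fun s : ℝ => m.J l (a + s • b) χ y) 0 := by
    filter_upwards [hev] with s hs
    have := hmin (show a + s • b ∈ S from hs.le)
    simpa using this
  exact hloc.hasDerivAt_eq_zero (hder b)

/-- A critical point inside the ball is a local minimizer. -/
lemma UnifConvex.isLocalMin {K r l : ℝ} (hK : 0 < K) (hl : 0 < l)
    {χ : Finset (Vec d)} {y : Vec d} {a₀ : Aff d} (H : m.UnifConvex K r l χ y a₀) {a : Aff d}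
    (ha : affNorm l (a - a₀) < r) (hcrit : ∀ b, m.dJ l a χ y b = 0) :
    IsLocalMin (fun a => m.J l a χ y) a := by
  have hcont : Continuous fun a : Aff d => affNorm l (a - a₀) :=
    (continuous_affNorm l).comp (continuous_id.sub continuous_const)
  filter_upwards [hcont.continuousAt.eventually_lt continuousAt_const ha] with a' ha'
  have h1 := H.add_le hK hl ha.le ha'.le ha.le
  rw [hcrit, add_zero] at h1
  have h2 : 0 ≤ m.c₀ / (d + 5) * invSq a.1 * m.rho l χ y * affNorm l (a' - a) ^ 2 / 2 := by
    have := rho_nonneg (m := m) hl χ y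
    have := m.c₀_pos
    have : 0 ≤ invSq a.1 := sq_nonneg _
    positivity
  linarith

/-- The misfit energy as a function of the position and the lattice. -/
noncomputable def Jfun (m : Model d) (l : ℝ) (χ : Finset (Vec d)) (q : Vec d × Aff d) : ℝ :=
  invSq q.2.1 * m.misfit l q.2 χ q.1

lemma contDiff_misfit (l : ℝ) (χ : Finset (Vec d)) {n : ℕ} :
    ContDiff ℝ n fun q : Vec d × Aff d => m.misfit l q.2 χ q.1 := by
  unfold misfit
  refine contDiff_const.mul (ContDiff.sum fun p _ => ContDiff.mul (m.contDiff_W.comp ?_)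
    (m.contDiff_φt.comp ?_))
  · have h1 : ContDiff ℝ n fun q : Vec d × Aff d => actL d q.2.1 :=
      (actL d).contDiff.comp (contDiff_fst.comp contDiff_snd)
    have h2 : ContDiff ℝ n fun q : Vec d × Aff d => p - q.1 := contDiff_const.sub contDiff_fst
    have h3 : ContDiff ℝ n fun q : Vec d × Aff d => q.2.2 := contDiff_snd.comp contDiff_snd
    exact (h1.clm_apply h2).add h3
  · have h2 : ContDiff ℝ n fun q : Vec d × Aff d => p - q.1 := contDiff_const.sub contDiff_fst
    exact h2.const_smul l⁻¹

lemma contDiffAt_Jfun (l : ℝ) (χ : Finset (Vec d)) {n : ℕ} {q : Vec d × Aff d}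
    (hq : q.2.1.det ≠ 0) : ContDiffAt ℝ n (m.Jfun l χ) q := by
  refine ContDiffAt.mul ?_ (contDiff_misfit l χ).contDiffAt
  exact (contDiffAt_invSq (A := q.2.1) hq).comp q (contDiff_fst.comp contDiff_snd).contDiffAt

/-- The derivative of the misfit energy with respect to the lattice. -/
noncomputable def dJfun (m : Model d) (l : ℝ) (χ : Finset (Vec d)) (q : Vec d × Aff d) :
    Aff d →L[ℝ] ℝ :=
  fderiv ℝ (m.Jfun l χ) q ∘L ContinuousLinearMap.inr ℝ (Vec d) (Aff d)

lemma contDiffAt_dJfun (l : ℝ) (χ : Finset (Vec d)) {n : ℕ} {q : Vec d × Aff d}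
    (hq : q.2.1.det ≠ 0) : ContDiffAt ℝ n (m.dJfun l χ) q :=
  ((contDiffAt_Jfun (n := n + 1) l χ hq).fderiv_right (by norm_cast)).clm_comp contDiffAt_const

lemma hasDerivAt_line_snd (q : Vec d × Aff d) (b : Aff d) (s : ℝ) :
    HasDerivAt (fun s : ℝ => q + s • ((0 : Vec d), b)) ((0 : Vec d), b) s := by
  simpa using ((hasDerivAt_id s).smul_const ((0 : Vec d), b)).const_add q

lemma dJfun_apply {l : ℝ} (hl : 0 < l) (χ : Finset (Vec d)) {q : Vec d × Aff d}
    (hq : q.2.1.det ≠ 0) (b : Aff d) : m.dJfun l χ q b = m.dJ l q.2 χ q.1 b := by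
  have h1 : HasFDerivAt (m.Jfun l χ) (fderiv ℝ (m.Jfun l χ) q) (q + (0 : ℝ) • ((0 : Vec d), b)) := by
    simpa using ((contDiffAt_Jfun (m := m) (n := 1) l χ hq).differentiableAt (by simp)).hasFDerivAt
  have h2 := h1.comp_hasDerivAt (0 : ℝ) (hasDerivAt_line_snd q b 0)
  have h3 := hasDerivAt_J (m := m) hl χ q.1 q.2 b 0 (by simpa using hq)
  have h4 : (m.Jfun l χ ∘ fun s : ℝ => q + s • ((0 : Vec d), b))
      = fun s : ℝ => m.J l (q.2 + s • b) χ q.1 := by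
    ext s; simp [Jfun, J_eq hl]
  rw [h4] at h2
  have := h2.unique h3
  simpa [dJfun] using this

lemma fderiv_dJfun_apply {l : ℝ} (hl : 0 < l) (χ : Finset (Vec d)) {q : Vec d × Aff d}
    (hq : q.2.1.det ≠ 0) (b c : Aff d) :
    fderiv ℝ (m.dJfun l χ) q (0, b) c = m.ddJ l q.2 χ q.1 b c := by
  have h1 : HasFDerivAt (m.dJfun l χ) (fderiv ℝ (m.dJfun l χ) q)
      (q + (0 : ℝ) • ((0 : Vec d), b)) := by
    simpa using ((contDiffAt_dJfun (m := m) (n := 1) l χ hq).differentiableAt (by simp)).hasFDerivAt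
  have h2 := h1.comp_hasDerivAt (0 : ℝ) (hasDerivAt_line_snd q b 0)
  have h3 := (ContinuousLinearMap.apply ℝ ℝ c).hasFDerivAt.comp_hasDerivAt (0 : ℝ) h2
  have h4 := hasDerivAt_dJ (m := m) l χ q.1 q.2 b c 0 (by simpa using hq)
  have hdet : ∀ᶠ s in 𝓝 (0 : ℝ), (q.2 + s • b).1.det ≠ 0 := by
    have hc : Continuous fun s : ℝ => (q.2 + s • b).1.det :=
      continuous_det.comp (continuous_fst.comp (by fun_prop))
    exact hc.continuousAt.eventually_ne (by simpa using hq)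
  have h5 : (fun s : ℝ => m.dJ l (q.2 + s • b) χ q.1 c) =ᶠ[𝓝 0]
      (ContinuousLinearMap.apply ℝ ℝ c) ∘ (m.dJfun l χ ∘ fun s : ℝ => q + s • ((0 : Vec d), b)) := by
    filter_upwards [hdet] with s hs
    have := dJfun_apply (m := m) hl χ (q := q + s • ((0 : Vec d), b)) (by simpa using hs) c
    simpa using this.symm
  have := (h3.congr_of_eventuallyEq h5).unique h4
  simpa using this

/-- The critical point extends to a smooth branch of critical points. -/
lemma exists_branch {l : ℝ} (hl : 0 < l) (χ : Finset (Vec d)) {x : Vec d} {a : Aff d}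
    (ha : a.1.det ≠ 0) (hcrit : ∀ b, m.dJ l a χ x b = 0) (hpos : ∀ b, b ≠ 0 → 0 < m.ddJ l a χ x b b) :
    ∃ f : Vec d → Aff d, f x = a ∧ ContDiffAt ℝ 2 f x ∧
      ∀ᶠ y in 𝓝 x, ∀ b, m.dJ l (f y) χ y b = 0 := by
  have hC : ContDiffAt ℝ 2 (m.dJfun l χ) (x, a) := contDiffAt_dJfun (n := 2) l χ ha
  have hinv : (fderiv ℝ (m.dJfun l χ) (x, a) ∘L
      ContinuousLinearMap.inr ℝ (Vec d) (Aff d)).IsInvertible := by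
    refine isInvertible_of_pos _ fun b hb => ?_
    have := fderiv_dJfun_apply (m := m) hl χ (q := (x, a)) ha b b
    simpa [this] using hpos b hb
  refine ⟨hC.implicitFunction two_ne_zero hinv, hC.implicitFunction_apply_self two_ne_zero hinv,
    hC.contDiffAt_implicitFunction two_ne_zero hinv, ?_⟩
  have h0 : m.dJfun l χ (x, a) = 0 := by
    refine ContinuousLinearMap.ext fun b => ?_
    rw [dJfun_apply hl χ ha]; exact hcrit b
  have h1 : (hC.implicitFunction two_ne_zero hinv) x = a :=
    hC.implicitFunction_apply_self two_ne_zero hinv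
  have hcont := (hC.contDiffAt_implicitFunction two_ne_zero hinv).continuousAt
  have hdet : ∀ᶠ y in 𝓝 x, (hC.implicitFunction two_ne_zero hinv y).1.det ≠ 0 := by
    have hc : ContinuousAt (fun y => (hC.implicitFunction two_ne_zero hinv y).1.det) x :=
      (continuous_det.comp continuous_fst).continuousAt.comp hcont
    exact hc.eventually_ne (by rw [h1]; exact ha)
  filter_upwards [hdet, hC.eventually_apply_implicitFunction two_ne_zero hinv] with y hy hy' b
  rw [h0] at hy'
  have := dJfun_apply (m := m) hl χ (q := (y, hC.implicitFunction two_ne_zero hinv y)) hy b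
  rw [← this, hy']; simp

end Model

end Kac

/-! ### Differentiating the critical point equation -/

namespace Kac

open Filter Topology MeasureTheory

variable {d : ℕ}

/-- The value of an affine map as a continuous linear function of the map. -/
noncomputable def linL (d : ℕ) (x : Vec d) : Aff d →L[ℝ] Vec d :=
  ((actL d).flip x) ∘L ContinuousLinearMap.fst ℝ (Mat d) (Vec d)
    + ContinuousLinearMap.snd ℝ (Mat d) (Vec d)

lemma hasDerivAt_lin_comp {g : ℝ → Aff d} {g' : Aff d} {s : ℝ} (hg : HasDerivAt g g' s) (x : Vec d) :
    HasDerivAt (fun s => lin (g s) x) (lin g' x) s :=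
  (linL d x).hasFDerivAt.comp_hasDerivAt s hg

namespace Model

variable {m : Model d}

/-- The normalised sum over the atoms. -/
noncomputable def avg (m : Model d) (l : ℝ) (χ : Finset (Vec d)) (f : Vec d → ℝ) : ℝ :=
  m.nrm l * ∑ p ∈ χ, f p

/-- The derivative of the weight of `p` with respect to the point `y` of observation. -/
noncomputable def dwt (m : Model d) (l : ℝ) (y p e : Vec d) : ℝ :=
  m.dφ (l⁻¹ • (p - y)) (-(l⁻¹ • e))

/-- The second derivative of the weight of `p` with respect to the point `y` of observation. -/
noncomputable def ddwt (m : Model d) (l : ℝ) (y p e' e : Vec d) : ℝ :=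
  m.ddφ (l⁻¹ • (p - y)) (-(l⁻¹ • e')) (-(l⁻¹ • e))

lemma hasDerivAt_avg {l : ℝ} {χ : Finset (Vec d)} {f : ℝ → Vec d → ℝ} {f' : Vec d → ℝ} {s : ℝ}
    (h : ∀ p, HasDerivAt (fun s => f s p) (f' p) s) :
    HasDerivAt (fun s => m.avg l χ (f s)) (m.avg l χ f') s :=
  HasDerivAt.const_mul _ (HasDerivAt.fun_sum fun p _ => h p)

lemma hasDerivAt_scaled {l : ℝ} {γ : ℝ → Vec d} {e : Vec d} {s : ℝ} (hγ : HasDerivAt γ e s)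
    (p : Vec d) : HasDerivAt (fun s => l⁻¹ • (p - γ s)) (-(l⁻¹ • e)) s := by
  simpa using (hγ.const_sub p).fun_const_smul l⁻¹

lemma hasDerivAt_wt {l : ℝ} {γ : ℝ → Vec d} {e : Vec d} {s : ℝ} (hγ : HasDerivAt γ e s)
    (p : Vec d) : HasDerivAt (fun s => m.wt l (γ s) p) (m.dwt l (γ s) p e) s :=
  (m.hasFDerivAt_φt _).comp_hasDerivAt s (hasDerivAt_scaled hγ p)

lemma hasDerivAt_dwt {l : ℝ} {γ : ℝ → Vec d} {e : Vec d} {s : ℝ} (hγ : HasDerivAt γ e s)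
    (p e' : Vec d) : HasDerivAt (fun s => m.dwt l (γ s) p e') (m.ddwt l (γ s) p e e') s := by
  have h0 : HasDerivAt (fun s => m.dφ (l⁻¹ • (p - γ s)))
      (m.ddφ (l⁻¹ • (p - γ s)) (-(l⁻¹ • e))) s :=
    (m.hasFDerivAt_dφ _).comp_hasDerivAt s (hasDerivAt_scaled hγ p)
  exact (ContinuousLinearMap.apply ℝ ℝ (-(l⁻¹ • e'))).hasFDerivAt.comp_hasDerivAt s h0

lemma hasDerivAt_W_comp {Z : ℝ → Vec d} {Z' : Vec d} {s : ℝ} (hZ : HasDerivAt Z Z' s) :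
    HasDerivAt (fun s => m.W (Z s)) (m.W1 (Z s) Z') s :=
  (m.hasFDerivAt_W _).comp_hasDerivAt s hZ

lemma hasDerivAt_W1_comp {Z v : ℝ → Vec d} {Z' v' : Vec d} {s : ℝ} (hZ : HasDerivAt Z Z' s)
    (hv : HasDerivAt v v' s) :
    HasDerivAt (fun s => m.W1 (Z s) (v s)) (m.W2 (Z s) Z' (v s) + m.W1 (Z s) v') s := by
  have h0 : HasDerivAt (fun s => m.W1 (Z s)) (m.W2 (Z s) Z') s :=
    (m.hasFDerivAt_W1 _).comp_hasDerivAt s hZ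
  exact h0.clm_apply hv

lemma hasDerivAt_W2_comp {Z v : ℝ → Vec d} {Z' v' : Vec d} {s : ℝ} (hZ : HasDerivAt Z Z' s)
    (hv : HasDerivAt v v' s) (b : Vec d) :
    HasDerivAt (fun s => m.W2 (Z s) (v s) b) (m.W3 (Z s) Z' (v s) b + m.W2 (Z s) v' b) s := by
  have h0 : HasDerivAt (fun s => m.W2 (Z s)) (m.W3 (Z s) Z') s :=
    (m.hasFDerivAt_W2 _).comp_hasDerivAt s hZ
  exact (ContinuousLinearMap.apply ℝ ℝ b).hasFDerivAt.comp_hasDerivAt s (h0.clm_apply hv)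

/-- The misfit of the lattice `g z`, in coordinates that do not move with `z`. -/
noncomputable def mis (m : Model d) (l : ℝ) (χ : Finset (Vec d)) (g : Vec d → Aff d) (z : Vec d) :
    ℝ :=
  m.avg l χ fun p => m.W (lin (g z) p) * m.wt l z p

/-- The derivative of `mis` in the direction `e`. -/
noncomputable def dmis (m : Model d) (l : ℝ) (χ : Finset (Vec d)) (g : Vec d → Aff d) (e z : Vec d) :
    ℝ :=
  m.avg l χ fun p => m.W1 (lin (g z) p) (lin (fderiv ℝ g z e) p) * m.wt l z p
    + m.W (lin (g z) p) * m.dwt l z p e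

/-- The second derivative of `mis` in the directions `e` and `e'`. -/
noncomputable def ddmis (m : Model d) (l : ℝ) (χ : Finset (Vec d)) (g : Vec d → Aff d)
    (e e' z : Vec d) : ℝ :=
  m.avg l χ fun p => ((m.W2 (lin (g z) p) (lin (fderiv ℝ g z e') p) (lin (fderiv ℝ g z e) p)
      + m.W1 (lin (g z) p) (lin (fderiv ℝ (fderiv ℝ g) z e' e) p)) * m.wt l z p
      + m.W1 (lin (g z) p) (lin (fderiv ℝ g z e) p) * m.dwt l z p e')
    + (m.W1 (lin (g z) p) (lin (fderiv ℝ g z e') p) * m.dwt l z p e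
      + m.W (lin (g z) p) * m.ddwt l z p e' e)

/-- The critical point equation in the direction `b`, divided by the factor `‖A⁻¹‖²`. -/
noncomputable def eqn (m : Model d) (l : ℝ) (χ : Finset (Vec d)) (g : Vec d → Aff d) (b : Aff d)
    (z : Vec d) : ℝ :=
  m.avg l χ (fun p => m.W1 (lin (g z) p) (lin b p) * m.wt l z p)
    + dlog (g z).1 b.1 * m.mis l χ g z

/-- The derivative of the critical point equation in the direction `e`. -/
noncomputable def deqn (m : Model d) (l : ℝ) (χ : Finset (Vec d)) (g : Vec d → Aff d) (b : Aff d)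
    (e z : Vec d) : ℝ :=
  m.avg l χ (fun p => m.W2 (lin (g z) p) (lin (fderiv ℝ g z e) p) (lin b p) * m.wt l z p
      + m.W1 (lin (g z) p) (lin b p) * m.dwt l z p e)
    + (fderiv ℝ dlog (g z).1 (fderiv ℝ g z e).1 b.1 * m.mis l χ g z
      + dlog (g z).1 b.1 * m.dmis l χ g e z)

/-- The second derivative of the critical point equation in the directions `e` and `e'`. -/
noncomputable def ddeqn (m : Model d) (l : ℝ) (χ : Finset (Vec d)) (g : Vec d → Aff d) (b : Aff d)
    (e e' z : Vec d) : ℝ :=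
  m.avg l χ (fun p => ((m.W3 (lin (g z) p) (lin (fderiv ℝ g z e') p) (lin (fderiv ℝ g z e) p)
          (lin b p)
        + m.W2 (lin (g z) p) (lin (fderiv ℝ (fderiv ℝ g) z e' e) p) (lin b p)) * m.wt l z p
        + m.W2 (lin (g z) p) (lin (fderiv ℝ g z e) p) (lin b p) * m.dwt l z p e')
      + (m.W2 (lin (g z) p) (lin (fderiv ℝ g z e') p) (lin b p) * m.dwt l z p e
        + m.W1 (lin (g z) p) (lin b p) * m.ddwt l z p e' e))
    + (((fderiv ℝ (fderiv ℝ dlog) (g z).1 (fderiv ℝ g z e').1 (fderiv ℝ g z e).1 b.1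
          + fderiv ℝ dlog (g z).1 (fderiv ℝ (fderiv ℝ g) z e' e).1 b.1) * m.mis l χ g z
        + fderiv ℝ dlog (g z).1 (fderiv ℝ g z e).1 b.1 * m.dmis l χ g e' z)
      + (fderiv ℝ dlog (g z).1 (fderiv ℝ g z e').1 b.1 * m.dmis l χ g e z
        + dlog (g z).1 b.1 * m.ddmis l χ g e e' z))

section

variable {l : ℝ} {χ : Finset (Vec d)} {g : Vec d → Aff d} {z : Vec d}

lemma hasDerivAt_path (z e : Vec d) (s : ℝ) : HasDerivAt (fun s : ℝ => z + s • e) e s := by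
  simpa using ((hasDerivAt_id s).smul_const e).const_add z

lemma hasDerivAt_comp_path {V : Type*} [NormedAddCommGroup V] [NormedSpace ℝ V] {g : Vec d → V}
    (hg : DifferentiableAt ℝ g z) (e : Vec d) :
    HasDerivAt (fun s : ℝ => g (z + s • e)) (fderiv ℝ g z e) 0 := by
  have h : HasFDerivAt g (fderiv ℝ g z) (z + (0 : ℝ) • e) := by simpa using hg.hasFDerivAt
  exact h.comp_hasDerivAt (0 : ℝ) (hasDerivAt_path z e 0)

lemma hasDerivAt_mis (hg : DifferentiableAt ℝ g z) (e : Vec d) :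
    HasDerivAt (fun s : ℝ => m.mis l χ g (z + s • e)) (m.dmis l χ g e z) 0 := by
  have h := hasDerivAt_avg (m := m) (l := l) (χ := χ) fun p =>
    (hasDerivAt_W_comp (m := m) (hasDerivAt_lin_comp (hasDerivAt_comp_path hg e) p)).fun_mul
      (hasDerivAt_wt (m := m) (l := l) (hasDerivAt_path z e 0) p)
  simp only [zero_smul, add_zero] at h
  exact h

lemma hasDerivAt_dmis (hg : DifferentiableAt ℝ g z) (hg' : DifferentiableAt ℝ (fderiv ℝ g) z)
    (e e' : Vec d) :
    HasDerivAt (fun s : ℝ => m.dmis l χ g e (z + s • e')) (m.ddmis l χ g e e' z) 0 := by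
  have hZ := hasDerivAt_comp_path hg e'
  have hY : HasDerivAt (fun s : ℝ => fderiv ℝ g (z + s • e') e) (fderiv ℝ (fderiv ℝ g) z e' e) 0 :=
    (ContinuousLinearMap.apply ℝ (Aff d) e).hasFDerivAt.comp_hasDerivAt (0 : ℝ)
      (hasDerivAt_comp_path hg' e')
  have h := hasDerivAt_avg (m := m) (l := l) (χ := χ) fun p =>
    ((hasDerivAt_W1_comp (m := m) (hasDerivAt_lin_comp hZ p) (hasDerivAt_lin_comp hY p)).fun_mul
      (hasDerivAt_wt (m := m) (l := l) (hasDerivAt_path z e' 0) p)).fun_add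
    ((hasDerivAt_W_comp (m := m) (hasDerivAt_lin_comp hZ p)).fun_mul
      (hasDerivAt_dwt (m := m) (l := l) (hasDerivAt_path z e' 0) p e))
  simp only [zero_smul, add_zero] at h
  exact h

lemma hasDerivAt_dlog (hd : 1 ≤ d) (hA : 0 < (g z).1.det) (hg : DifferentiableAt ℝ g z)
    (e : Vec d) (B : Mat d) :
    HasDerivAt (fun s : ℝ => dlog (g (z + s • e)).1 B)
      (fderiv ℝ dlog (g z).1 (fderiv ℝ g z e).1 B) 0 := by
  have h0 : HasFDerivAt (dlog (d := d)) (fderiv ℝ dlog (g z).1) (g (z + (0 : ℝ) • e)).1 := by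
    simpa using (((contDiffOn_dlog hd (n := 1)).contDiffAt (isOpen_GLPos.mem_nhds hA)).differentiableAt
      (by simp)).hasFDerivAt
  have h1 : HasDerivAt (fun s : ℝ => (g (z + s • e)).1) (fderiv ℝ g z e).1 0 :=
    (ContinuousLinearMap.fst ℝ (Mat d) (Vec d)).hasFDerivAt.comp_hasDerivAt (0 : ℝ)
      (hasDerivAt_comp_path hg e)
  have h2 := HasFDerivAt.comp_hasDerivAt (l := dlog (d := d)) (0 : ℝ) h0 h1
  exact (ContinuousLinearMap.apply ℝ ℝ B).hasFDerivAt.comp_hasDerivAt (0 : ℝ) h2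

lemma hasDerivAt_ddlog (hd : 1 ≤ d) (hA : 0 < (g z).1.det) (hg : DifferentiableAt ℝ g z)
    (hg' : DifferentiableAt ℝ (fderiv ℝ g) z) (e e' : Vec d) (B : Mat d) :
    HasDerivAt (fun s : ℝ => fderiv ℝ dlog (g (z + s • e')).1 (fderiv ℝ g (z + s • e') e).1 B)
      (fderiv ℝ (fderiv ℝ dlog) (g z).1 (fderiv ℝ g z e').1 (fderiv ℝ g z e).1 B
        + fderiv ℝ dlog (g z).1 (fderiv ℝ (fderiv ℝ g) z e' e).1 B) 0 := by
  have h0 : HasFDerivAt (fderiv ℝ (dlog (d := d))) (fderiv ℝ (fderiv ℝ dlog) (g z).1)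
      (g (z + (0 : ℝ) • e')).1 := by
    simpa using ((((contDiffOn_dlog hd (n := 2)).contDiffAt (isOpen_GLPos.mem_nhds hA)).fderiv_right
      (m := 1) (by norm_num)).differentiableAt (by simp)).hasFDerivAt
  have h1 : HasDerivAt (fun s : ℝ => (g (z + s • e')).1) (fderiv ℝ g z e').1 0 :=
    (ContinuousLinearMap.fst ℝ (Mat d) (Vec d)).hasFDerivAt.comp_hasDerivAt (0 : ℝ)
      (hasDerivAt_comp_path hg e')
  have hY : HasDerivAt (fun s : ℝ => (fderiv ℝ g (z + s • e') e).1)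
      (fderiv ℝ (fderiv ℝ g) z e' e).1 0 :=
    ((ContinuousLinearMap.fst ℝ (Mat d) (Vec d)) ∘L
      (ContinuousLinearMap.apply ℝ (Aff d) e)).hasFDerivAt.comp_hasDerivAt (0 : ℝ)
      (hasDerivAt_comp_path hg' e')
  have h2 := HasFDerivAt.comp_hasDerivAt (l := fderiv ℝ (dlog (d := d))) (0 : ℝ) h0 h1
  have h3 := (ContinuousLinearMap.apply ℝ ℝ B).hasFDerivAt.comp_hasDerivAt (0 : ℝ)
    (h2.clm_apply hY)
  simp only [zero_smul, add_zero, Function.comp_apply, map_add] at h3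
  exact h3

lemma hasDerivAt_eqn (hd : 1 ≤ d) (hA : 0 < (g z).1.det) (hg : DifferentiableAt ℝ g z) (b : Aff d)
    (e : Vec d) : HasDerivAt (fun s : ℝ => m.eqn l χ g b (z + s • e)) (m.deqn l χ g b e z) 0 := by
  have hZ := hasDerivAt_comp_path hg e
  have h1 := hasDerivAt_avg (m := m) (l := l) (χ := χ) fun p =>
    (hasDerivAt_W1_comp (m := m) (hasDerivAt_lin_comp hZ p)
      (hasDerivAt_const (0 : ℝ) (lin b p))).fun_mul
      (hasDerivAt_wt (m := m) (l := l) (hasDerivAt_path z e 0) p)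
  have h2 := (hasDerivAt_dlog hd hA hg e b.1).fun_mul (hasDerivAt_mis (m := m) (l := l) (χ := χ) hg e)
  have h3 := h1.fun_add h2
  simp only [zero_smul, add_zero, map_zero] at h3
  exact h3

lemma hasDerivAt_deqn (hd : 1 ≤ d) (hA : 0 < (g z).1.det) (hg : DifferentiableAt ℝ g z)
    (hg' : DifferentiableAt ℝ (fderiv ℝ g) z) (b : Aff d) (e e' : Vec d) :
    HasDerivAt (fun s : ℝ => m.deqn l χ g b e (z + s • e')) (m.ddeqn l χ g b e e' z) 0 := by
  have hZ := hasDerivAt_comp_path hg e'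
  have hY : HasDerivAt (fun s : ℝ => fderiv ℝ g (z + s • e') e) (fderiv ℝ (fderiv ℝ g) z e' e) 0 :=
    (ContinuousLinearMap.apply ℝ (Aff d) e).hasFDerivAt.comp_hasDerivAt (0 : ℝ)
      (hasDerivAt_comp_path hg' e')
  have h1 := hasDerivAt_avg (m := m) (l := l) (χ := χ) fun p =>
    ((hasDerivAt_W2_comp (m := m) (hasDerivAt_lin_comp hZ p) (hasDerivAt_lin_comp hY p)
      (lin b p)).fun_mul (hasDerivAt_wt (m := m) (l := l) (hasDerivAt_path z e' 0) p)).fun_add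
    ((hasDerivAt_W1_comp (m := m) (hasDerivAt_lin_comp hZ p)
      (hasDerivAt_const (0 : ℝ) (lin b p))).fun_mul
      (hasDerivAt_dwt (m := m) (l := l) (hasDerivAt_path z e' 0) p e))
  have h2 := (hasDerivAt_ddlog hd hA hg hg' e e' b.1).fun_mul
    (hasDerivAt_mis (m := m) (l := l) (χ := χ) hg e')
  have h3 := (hasDerivAt_dlog hd hA hg e' b.1).fun_mul
    (hasDerivAt_dmis (m := m) (l := l) (χ := χ) hg hg' e e')
  have h4 := h1.fun_add (h2.fun_add h3)
  simp only [zero_smul, add_zero, map_zero] at h4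
  exact h4

lemma eq_zero_of_hasDerivAt_path {f : Vec d → ℝ} {e : Vec d} {f' : ℝ}
    (hf : HasDerivAt (fun s : ℝ => f (z + s • e)) f' 0) (h0 : ∀ᶠ y in 𝓝 z, f y = 0) : f' = 0 := by
  have hc : Tendsto (fun s : ℝ => z + s • e) (𝓝 0) (𝓝 z) := by
    have := (hasDerivAt_path z e 0).continuousAt
    simpa [ContinuousAt] using this
  have h1 : (fun s : ℝ => f (z + s • e)) =ᶠ[𝓝 0] fun _ => 0 := hc.eventually h0
  exact hf.unique ((hasDerivAt_const (0 : ℝ) (0 : ℝ)).congr_of_eventuallyEq h1)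

/-- The first and second derivatives of the critical point equation vanish. -/
lemma deqn_eq_zero (hd : 1 ≤ d) (hA : 0 < (g z).1.det) (hg : ContDiffAt ℝ 2 g z)
    (hcrit : ∀ᶠ y in 𝓝 z, ∀ b, m.eqn l χ g b y = 0) (b : Aff d) (e e' : Vec d) :
    m.deqn l χ g b e z = 0 ∧ m.ddeqn l χ g b e e' z = 0 := by
  have hgd : ∀ᶠ y in 𝓝 z, DifferentiableAt ℝ g y := by
    filter_upwards [hg.eventually (by simp)] with y hy using hy.differentiableAt (by simp)
  have hdet : ∀ᶠ y in 𝓝 z, 0 < (g y).1.det := by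
    have hc : ContinuousAt (fun y => (g y).1.det) z :=
      (continuous_det.comp continuous_fst).continuousAt.comp hg.continuousAt
    exact continuousAt_const.eventually_lt hc hA
  have h1 : ∀ᶠ y in 𝓝 z, m.deqn l χ g b e y = 0 := by
    filter_upwards [hgd, hdet, hcrit.eventually_nhds] with y hy hy' hy''
    refine eq_zero_of_hasDerivAt_path (hasDerivAt_eqn hd hy' hy b e) ?_
    filter_upwards [hy''] with x hx using hx b
  refine ⟨h1.self_of_nhds, ?_⟩
  exact eq_zero_of_hasDerivAt_path (hasDerivAt_deqn hd hA (hg.differentiableAt (by simp))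
    ((hg.fderiv_right (m := 1) (by norm_num)).differentiableAt (by simp)) b e e') h1

end

end Model

end Kac

/-! ### Weighted sums over the atoms -/

namespace Kac

open Filter Topology MeasureTheory

variable {d : ℕ}

/-- The affine map `b`, with its translation read off at the point `y`. -/
noncomputable def recenter (y : Vec d) (b : Aff d) : Aff d := (b.1, b.2 + act b.1 y)

lemma lin_recenter (y : Vec d) (b : Aff d) (p : Vec d) : lin (recenter y b) (p - y) = lin b p := by
  simp only [lin, recenter, act_sub_right]; abel

/-- The norm of the affine map `b` seen from `y` at scale `l`. -/
noncomputable def cn (l : ℝ) (y : Vec d) (b : Aff d) : ℝ := affNorm l (recenter y b)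

lemma cn_nonneg (l : ℝ) (y : Vec d) (b : Aff d) : 0 ≤ cn l y b := affNorm_nonneg _ _

lemma norm_lin_sq_le_cn {l : ℝ} {y p : Vec d} (b : Aff d) (h : ‖p - y‖ ≤ 2 * l) :
    ‖lin b p‖ ^ 2 ≤ 5 * cn l y b ^ 2 := by
  have := norm_lin_sq_le (recenter y b) h
  rw [lin_recenter] at this
  refine this.trans (le_of_eq ?_)
  rw [cn]; norm_num

lemma norm_lin_le_cn {l : ℝ} {y p : Vec d} (b : Aff d) (h : ‖p - y‖ ≤ 2 * l) :
    ‖lin b p‖ ≤ 3 * cn l y b := by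
  have := norm_lin_le zero_le_two (recenter y b) h
  rw [lin_recenter] at this
  refine this.trans (le_of_eq ?_)
  rw [cn]; norm_num

lemma norm_fst_le_cn {l : ℝ} (hl : 0 < l) (y : Vec d) (b : Aff d) : ‖b.1‖ ≤ l⁻¹ * cn l y b := by
  rw [inv_mul_eq_div, le_div_iff₀ hl, mul_comm]
  exact norm_fst_le_affNorm l (recenter y b)

namespace Model

variable {m : Model d}

/-- The normalised number of atoms within the range of the cut-off. -/
noncomputable def count (m : Model d) (l : ℝ) (χ : Finset (Vec d)) (y : Vec d) : ℝ :=
  open Classical in m.avg l χ fun p => if ‖p - y‖ ≤ 2 * l then 1 else 0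

lemma count_nonneg {l : ℝ} (hl : 0 < l) (χ : Finset (Vec d)) (y : Vec d) : 0 ≤ m.count l χ y := by
  refine mul_nonneg (nrm_pos hl).le (Finset.sum_nonneg fun p _ => ?_)
  split_ifs <;> norm_num

lemma count_le {l : ℝ} (hl : 0 < l) (χ : Finset (Vec d)) (y : Vec d) :
    m.count l χ y ≤ 2 ^ d * m.rho (2 * l) χ y := by
  have hN : m.nrm l = 2 ^ d * m.nrm (2 * l) := by
    have := m.Cφ_pos
    unfold nrm; rw [mul_pow]; field_simp
  have h2l : 0 < 2 * l := by positivity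
  rw [count, avg, rho_eq h2l, hN, mul_assoc]
  have := nrm_pos (m := m) h2l
  gcongr with p _
  split_ifs with h
  · refine ge_of_eq (m.φt_one ?_)
    rw [norm_scaled h2l]; linarith
  · exact wt_nonneg _ _ _

lemma rho_le_count {l : ℝ} (hl : 0 < l) (χ : Finset (Vec d)) (y : Vec d) :
    m.rho l χ y ≤ m.count l χ y := by
  rw [count, avg, rho_eq hl]
  have := nrm_pos (m := m) hl
  gcongr with p _
  split_ifs with h
  · exact m.φt_le_one _
  · rw [wt_eq_zero hl h]

/-- The hard core bounds the number of atoms. -/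
lemma exists_count_le (m : Model d) : ∃ C > 0, ∀ l : ℝ, 1 ≤ l → ∀ χ : Finset (Vec d),
    m.HardCore χ → ∀ y, m.count l χ y ≤ C := by
  classical
  have hs := m.s₀_pos
  have hC := m.Cφ_pos
  refine ⟨(2 * (2 + m.s₀ / 2) / m.s₀) ^ d / m.Cφ, by positivity, fun l hl χ hχ y => ?_⟩
  have hl0 : 0 < l := by linarith
  set P := χ.filter fun p => ‖p - y‖ ≤ 2 * l with hP
  have hcount : m.count l χ y = m.nrm l * P.card := by
    rw [count, avg, hP, Finset.card_filter]; push_cast; rfl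
  have hvol := MeasureTheory.measureReal_mono (μ := (volume : Measure (Vec d)))
    (s₁ := ⋃ p ∈ P, Metric.ball p (m.s₀ / 2)) (s₂ := Metric.ball y ((2 + m.s₀ / 2) * l))
    (Set.iUnion₂_subset fun p hp z hz => by
      have h1 : ‖p - y‖ ≤ 2 * l := (Finset.mem_filter.1 hp).2
      rw [Metric.mem_ball, dist_eq_norm] at hz ⊢
      have h2 := norm_add_le (z - p) (p - y)
      rw [sub_add_sub_cancel] at h2
      have h3 : m.s₀ / 2 * 1 ≤ m.s₀ / 2 * l := by gcongr
      linarith) (by exact measure_ball_lt_top.ne)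
  have hdisj : (↑P : Set (Vec d)).PairwiseDisjoint fun p => Metric.ball p (m.s₀ / 2) := by
    intro p hp q hq hpq
    refine Metric.ball_disjoint_ball ?_
    have := hχ p (Finset.mem_filter.1 hp).1 q (Finset.mem_filter.1 hq).1 hpq
    linarith
  have hball : ∀ (z : Vec d) (r : ℝ), 0 < r →
      volume.real (Metric.ball z r) = r ^ d * volume.real (Metric.ball (0 : Vec d) 1) := by
    intro z r hr
    rw [Measure.real, Measure.addHaar_ball_of_pos _ _ hr, ENNReal.toReal_mul,
      ENNReal.toReal_ofReal (by positivity)]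
    simp [Measure.real]
  rw [measureReal_biUnion_finset hdisj (fun p _ => measurableSet_ball)
    (fun p _ => measure_ball_lt_top.ne), Finset.sum_congr rfl fun p _ => hball p _ (by positivity),
    Finset.sum_const, nsmul_eq_mul, hball y _ (by positivity), ← mul_assoc] at hvol
  have hpos : 0 < volume.real (Metric.ball (0 : Vec d) 1) :=
    ENNReal.toReal_pos (Metric.measure_ball_pos _ _ one_pos).ne' measure_ball_lt_top.ne
  have h2 := le_of_mul_le_mul_right hvol hpos
  have h3 : (P.card : ℝ) ≤ (2 * (2 + m.s₀ / 2) / m.s₀) ^ d * l ^ d := by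
    rw [← mul_pow, ← mul_le_mul_iff_left₀ (show 0 < (m.s₀ / 2) ^ d by positivity)]
    refine h2.trans (le_of_eq ?_)
    rw [← mul_pow]; congr 1; field_simp
  rw [hcount, nrm, inv_mul_le_iff₀ (by positivity)]
  calc _ ≤ _ := h3
    _ = _ := by field_simp

lemma avg_nonneg {l : ℝ} (hl : 0 < l) (χ : Finset (Vec d)) {f : Vec d → ℝ} (h : ∀ p, 0 ≤ f p) :
    0 ≤ m.avg l χ f :=
  mul_nonneg (nrm_pos hl).le (Finset.sum_nonneg fun p _ => h p)

lemma avg_add (l : ℝ) (χ : Finset (Vec d)) (f g : Vec d → ℝ) :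
    m.avg l χ (fun p => f p + g p) = m.avg l χ f + m.avg l χ g := by
  simp only [avg, Finset.sum_add_distrib, mul_add]

lemma avg_sum {T : Type*} (s : Finset T) (l : ℝ) (χ : Finset (Vec d)) (f : T → Vec d → ℝ) :
    ∑ t ∈ s, m.avg l χ (f t) = m.avg l χ fun p => ∑ t ∈ s, f t p := by
  simp only [avg, ← Finset.mul_sum]
  rw [Finset.sum_comm]

/-- The Cauchy-Schwarz inequality for a sum over the atoms in range of terms bounded by `A √X`. -/
lemma abs_avg_le {l : ℝ} (hl : 0 < l) {χ : Finset (Vec d)} {y : Vec d} {f X : Vec d → ℝ} {A : ℝ}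
    (hX : ∀ p, 0 ≤ X p) (h0 : ∀ p, ¬ ‖p - y‖ ≤ 2 * l → f p = 0)
    (h : ∀ p, ‖p - y‖ ≤ 2 * l → |f p| ≤ A * √(X p)) (hA : 0 ≤ A) :
    |m.avg l χ f| ≤ A * (√(m.count l χ y) * √(m.avg l χ X)) := by
  classical
  have hN := nrm_pos (m := m) hl
  set i : Vec d → ℝ := fun p => if ‖p - y‖ ≤ 2 * l then 1 else 0 with hi
  have h1 : ∀ p, |f p| ≤ A * (i p * √(X p)) := by
    intro p
    by_cases hp : ‖p - y‖ ≤ 2 * l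
    · simpa [hi, hp] using h p hp
    · simp [hi, hp, h0 p hp]
  have h2 : ∑ p ∈ χ, i p * √(X p) ≤ √(∑ p ∈ χ, i p) * √(∑ p ∈ χ, X p) := by
    refine (Real.sum_mul_le_sqrt_mul_sqrt χ i fun p => √(X p)).trans (le_of_eq ?_)
    congr 2
    · refine Finset.sum_congr rfl fun p _ => ?_
      simp only [hi]; split_ifs <;> simp
    · exact Finset.sum_congr rfl fun p _ => Real.sq_sqrt (hX p)
  have h3 : √(m.count l χ y) * √(m.avg l χ X)
      = m.nrm l * (√(∑ p ∈ χ, i p) * √(∑ p ∈ χ, X p)) := by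
    have hc : m.count l χ y = m.nrm l * ∑ p ∈ χ, i p := rfl
    rw [hc, avg, Real.sqrt_mul hN.le, Real.sqrt_mul hN.le]
    have := Real.mul_self_sqrt hN.le
    linear_combination (√(∑ p ∈ χ, i p) * √(∑ p ∈ χ, X p)) * this
  rw [h3, avg, abs_mul, abs_of_pos hN, mul_left_comm]
  refine mul_le_mul_of_nonneg_left ?_ hN.le
  calc |∑ p ∈ χ, f p| ≤ ∑ p ∈ χ, |f p| := Finset.abs_sum_le_sum_abs _ _
    _ ≤ ∑ p ∈ χ, A * (i p * √(X p)) := Finset.sum_le_sum fun p _ => h1 p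
    _ = A * ∑ p ∈ χ, i p * √(X p) := by rw [Finset.mul_sum]
    _ ≤ _ := by gcongr

lemma abs_avg_le_count {l : ℝ} (hl : 0 < l) {χ : Finset (Vec d)} {y : Vec d} {f : Vec d → ℝ}
    {A : ℝ} (h0 : ∀ p, ¬ ‖p - y‖ ≤ 2 * l → f p = 0) (h : ∀ p, ‖p - y‖ ≤ 2 * l → |f p| ≤ A) :
    |m.avg l χ f| ≤ A * m.count l χ y := by
  classical
  have hN := nrm_pos (m := m) hl
  rw [count, avg, avg, abs_mul, abs_of_pos hN, mul_left_comm, Finset.mul_sum]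
  refine mul_le_mul_of_nonneg_left ((Finset.abs_sum_le_sum_abs _ _).trans
    (Finset.sum_le_sum fun p _ => ?_)) hN.le
  split_ifs with hp
  · simpa using h p hp
  · simp [h0 p hp]

lemma dwt_eq_zero {l : ℝ} (hl : 0 < l) {y p : Vec d} (e : Vec d) (h : ¬ ‖p - y‖ ≤ 2 * l) :
    m.dwt l y p e = 0 := by
  rw [dwt, m.dφ_eq_zero (wt_eq_zero hl h)]; simp

/-- The `j`-th coordinate direction, scaled to the range of the cut-off. -/
noncomputable def dir (l : ℝ) (j : Fin d) : Vec d := l • EuclideanSpace.single j 1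

lemma dwt_dir {l : ℝ} (hl : 0 < l) (y p : Vec d) (j : Fin d) :
    m.dwt l y p (dir l j) = - m.dφ (l⁻¹ • (p - y)) (EuclideanSpace.single j 1) := by
  simp [dwt, dir, smul_smul, inv_mul_cancel₀ hl.ne']

lemma ddwt_dir {l : ℝ} (hl : 0 < l) (y p : Vec d) (i j : Fin d) :
    m.ddwt l y p (dir l i) (dir l j)
      = m.ddφ (l⁻¹ • (p - y)) (EuclideanSpace.single i 1) (EuclideanSpace.single j 1) := by
  simp [ddwt, dir, smul_smul, inv_mul_cancel₀ hl.ne']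

lemma sum_dwt_sq_le (h1 : m.N₁ ≠ ⊤) {l : ℝ} (hl : 0 < l) (y p : Vec d) :
    ∑ j, m.dwt l y p (dir l j) ^ 2 ≤ (2 * m.N₁.toReal) ^ 2 * m.wt l y p := by
  simp only [dwt_dir hl, neg_sq]
  refine (sum_sq_apply_single_le _).trans ?_
  have h2 := m.norm_dφ_le h1 (l⁻¹ • (p - y))
  calc _ ≤ (2 * m.N₁.toReal * √(m.φt (l⁻¹ • (p - y)))) ^ 2 := by gcongr
    _ = _ := by rw [mul_pow, Real.sq_sqrt (m.φt_nonneg _)]; rfl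

lemma sum_ddwt_sq_le (h2 : m.N₂ ≠ ⊤) (h4 : m.N₄ ≠ ⊤) {l : ℝ} (hl : 0 < l) (y p : Vec d) :
    ∑ i, ∑ j, m.ddwt l y p (dir l i) (dir l j) ^ 2
      ≤ (2 * (4 * m.N₄.toReal ^ 2 + √d * m.N₂.toReal)) ^ 2 * m.wt l y p := by
  simp only [ddwt_dir hl]
  have h := m.sqrt_sum_ddφ_sq_le h2 h4 (l⁻¹ • (p - y))
  rw [Real.sqrt_le_left (by positivity), mul_pow, Real.sq_sqrt (m.φt_nonneg _)] at h
  exact h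

lemma norm_W1_le_sqrt (z : Vec d) : ‖m.W1 z‖ ≤ √(m.αGrad / 32) * √(m.W z) := by
  have := m.αGrad_pos
  rw [← Real.sqrt_mul (by positivity)]
  exact Real.le_sqrt_of_sq_le (m.norm_W1_sq_le z)

/-- The Cauchy-Schwarz estimate behind the bounds on the derivatives of the branch. -/
lemma abs_avg_sum_W1_le {T : Type*} [Fintype T] {l : ℝ} (hl : 0 < l) {χ : Finset (Vec d)}
    {y : Vec d} (a : Aff d) (b : T → Aff d) (ψ : T → Vec d → ℝ) {M : ℝ} (hM : 0 ≤ M)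
    (hψ : ∀ p, ∑ t, ψ t p ^ 2 ≤ M ^ 2 * m.wt l y p) :
    |m.avg l χ fun p => ∑ t, m.W1 (lin a p) (lin (b t) p) * ψ t p|
      ≤ M * √(5 * (m.αGrad / 32)) * √(∑ t, cn l y (b t) ^ 2)
        * (√(m.count l χ y) * √(m.avg l χ fun p => m.W (lin a p) * m.wt l y p)) := by
  have hα := m.αGrad_pos
  refine abs_avg_le hl (fun p => mul_nonneg (m.W_nonneg _) (wt_nonneg _ _ _)) ?_ ?_ (by positivity)
  · intro p hp
    have h1 := hψ p
    rw [wt_eq_zero hl hp, mul_zero] at h1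
    refine Finset.sum_eq_zero fun t _ => ?_
    have h2 := (Finset.sum_eq_zero_iff_of_nonneg fun t _ => sq_nonneg (ψ t p)).1
      (le_antisymm h1 (Finset.sum_nonneg fun t _ => sq_nonneg _)) t (Finset.mem_univ t)
    rw [pow_eq_zero_iff two_ne_zero] at h2
    rw [h2, mul_zero]
  · intro p hp
    have hb : √(∑ t, ‖lin (b t) p‖ ^ 2) ≤ √5 * √(∑ t, cn l y (b t) ^ 2) := by
      rw [← Real.sqrt_mul (by norm_num), Finset.mul_sum]
      exact Real.sqrt_le_sqrt (Finset.sum_le_sum fun t _ => norm_lin_sq_le_cn _ hp)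
    have hψ' : √(∑ t, |ψ t p| ^ 2) ≤ M * √(m.wt l y p) := by
      rw [← Real.sqrt_sq hM, ← Real.sqrt_mul (sq_nonneg M)]
      refine Real.sqrt_le_sqrt ?_
      simpa using hψ p
    calc |∑ t, m.W1 (lin a p) (lin (b t) p) * ψ t p|
        ≤ ∑ t, ‖m.W1 (lin a p)‖ * (‖lin (b t) p‖ * |ψ t p|) := by
          refine (Finset.abs_sum_le_sum_abs _ _).trans (Finset.sum_le_sum fun t _ => ?_)
          rw [abs_mul, ← mul_assoc]
          exact mul_le_mul_of_nonneg_right ((m.W1 _).le_opNorm _) (abs_nonneg _)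
      _ = ‖m.W1 (lin a p)‖ * ∑ t, ‖lin (b t) p‖ * |ψ t p| := by rw [Finset.mul_sum]
      _ ≤ (√(m.αGrad / 32) * √(m.W (lin a p))) * ((√5 * √(∑ t, cn l y (b t) ^ 2))
            * (M * √(m.wt l y p))) := by
          have h3 := Real.sum_mul_le_sqrt_mul_sqrt Finset.univ (fun t => ‖lin (b t) p‖)
            fun t => |ψ t p|
          refine mul_le_mul (norm_W1_le_sqrt _) (h3.trans (by gcongr)) ?_ (by positivity)
          exact Finset.sum_nonneg fun t _ => by positivity
      _ = _ := by
          rw [Real.sqrt_mul (m.W_nonneg _), Real.sqrt_mul (by norm_num : (0 : ℝ) ≤ 5)]; ring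

end Model

end Kac

/-! ### First derivatives of the branch -/

namespace Kac

open Filter Topology MeasureTheory

variable {d : ℕ}

/-- The scaled partial derivative `∂_j g` of a field of affine maps. -/
noncomputable def uvec (l : ℝ) (g : Vec d → Aff d) (y : Vec d) (j : Fin d) : Aff d :=
  fderiv ℝ g y (Model.dir l j)

/-- The scaled second partial derivative `∂_i ∂_j g` of a field of affine maps. -/
noncomputable def wvec (l : ℝ) (g : Vec d → Aff d) (y : Vec d) (i j : Fin d) : Aff d :=
  fderiv ℝ (fderiv ℝ g) y (Model.dir l i) (Model.dir l j)

/-- The size of the first derivative of a field of affine maps. -/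
noncomputable def normU (l : ℝ) (g : Vec d → Aff d) (y : Vec d) : ℝ :=
  √(∑ j, cn l y (uvec l g y j) ^ 2)

/-- The size of the second derivative of a field of affine maps. -/
noncomputable def normW (l : ℝ) (g : Vec d → Aff d) (y : Vec d) : ℝ :=
  √(∑ t : Fin d × Fin d, cn l y (wvec l g y t.1 t.2) ^ 2)

lemma normU_nonneg (l : ℝ) (g : Vec d → Aff d) (y : Vec d) : 0 ≤ normU l g y := Real.sqrt_nonneg _

lemma normW_nonneg (l : ℝ) (g : Vec d → Aff d) (y : Vec d) : 0 ≤ normW l g y := Real.sqrt_nonneg _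

lemma normU_sq (l : ℝ) (g : Vec d → Aff d) (y : Vec d) :
    normU l g y ^ 2 = ∑ j, cn l y (uvec l g y j) ^ 2 :=
  Real.sq_sqrt (Finset.sum_nonneg fun _ _ => sq_nonneg _)

lemma normW_sq (l : ℝ) (g : Vec d → Aff d) (y : Vec d) :
    normW l g y ^ 2 = ∑ t : Fin d × Fin d, cn l y (wvec l g y t.1 t.2) ^ 2 :=
  Real.sq_sqrt (Finset.sum_nonneg fun _ _ => sq_nonneg _)

lemma cn_uvec_le (l : ℝ) (g : Vec d → Aff d) (y : Vec d) (j : Fin d) :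
    cn l y (uvec l g y j) ≤ normU l g y :=
  Real.le_sqrt_of_sq_le (Finset.single_le_sum (f := fun j => cn l y (uvec l g y j) ^ 2)
    (fun _ _ => sq_nonneg _) (Finset.mem_univ j))

lemma cn_wvec_le (l : ℝ) (g : Vec d → Aff d) (y : Vec d) (i j : Fin d) :
    cn l y (wvec l g y i j) ≤ normW l g y := by
  refine le_of_sq_le_sq ?_ (normW_nonneg _ _ _)
  rw [normW_sq]
  have h := Finset.single_le_sum (s := (Finset.univ : Finset (Fin d × Fin d)))
    (f := fun t => cn l y (wvec l g y t.1 t.2) ^ 2) (fun _ _ => sq_nonneg _)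
    (Finset.mem_univ (i, j))
  simpa only using h

namespace Model

variable {m : Model d}

/-- A twice differentiable branch of critical points near `y`, at which the misfit is strictly
convex and small. The lattices are given by affine maps in coordinates that do not move. -/
structure Crit (m : Model d) (K η l : ℝ) (χ : Finset (Vec d)) (g : Vec d → Aff d) (y : Vec d) :
    Prop where
  one_le : 1 ≤ η * l
  mem : (g y).1 ∈ bddSet d K
  rho_ge : K⁻¹ ≤ m.rho l χ y
  hess : ∀ b, m.c₀ / (d + 3) * m.rho l χ y * cn l y b ^ 2
    ≤ m.avg l χ fun p => m.W2 (lin (g y) p) (lin b p) (lin b p) * m.wt l y p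
  mis_le : m.mis l χ g y ≤ η
  contDiff : ContDiffAt ℝ 2 g y
  crit : ∀ᶠ z in 𝓝 y, ∀ b, m.eqn l χ g b z = 0

lemma mis_nonneg {l : ℝ} (hl : 0 < l) (χ : Finset (Vec d)) (g : Vec d → Aff d) (y : Vec d) :
    0 ≤ m.mis l χ g y :=
  avg_nonneg hl χ fun _ => mul_nonneg (m.W_nonneg _) (wt_nonneg _ _ _)

lemma abs_W1_lin_le {CW : ℝ} (hCW : ∀ z, ‖m.W1 z‖ ≤ CW) {l : ℝ} {y p : Vec d} (a b : Aff d)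
    (hp : ‖p - y‖ ≤ 2 * l) : |m.W1 (lin a p) (lin b p)| ≤ CW * (3 * cn l y b) := by
  refine ((m.W1 _).le_opNorm _).trans ?_
  have h1 := norm_lin_le_cn b hp
  have h2 := hCW (lin a p)
  have h3 : 0 ≤ CW := (norm_nonneg _).trans h2
  gcongr

lemma abs_W1_lin_le_sqrt {l : ℝ} {y p : Vec d} (a b : Aff d) (hp : ‖p - y‖ ≤ 2 * l) :
    |m.W1 (lin a p) (lin b p)| ≤ √(m.αGrad / 32) * (3 * cn l y b) * √(m.W (lin a p)) := by
  refine ((m.W1 _).le_opNorm _).trans ?_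
  have h1 := norm_lin_le_cn b hp
  have h2 := m.norm_W1_le_sqrt (lin a p)
  calc _ ≤ (√(m.αGrad / 32) * √(m.W (lin a p))) * (3 * cn l y b) := by gcongr
    _ = _ := by ring

lemma wt_le_sqrt (l : ℝ) (y p : Vec d) : m.wt l y p ≤ √(m.wt l y p) := by
  refine Real.le_sqrt_of_sq_le ?_
  have h0 := wt_nonneg (m := m) l y p
  have h1 : m.wt l y p ≤ 1 := m.φt_le_one _
  calc m.wt l y p ^ 2 = m.wt l y p * m.wt l y p := sq _
    _ ≤ 1 * m.wt l y p := by gcongr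
    _ = _ := one_mul _

lemma W_le_sqrt {CW : ℝ} (hCW : ∀ z, |m.W z| ≤ CW) (z : Vec d) : m.W z ≤ √CW * √(m.W z) := by
  have h0 := m.W_nonneg z
  have h1 : m.W z ≤ CW := (le_abs_self _).trans (hCW z)
  calc m.W z = √(m.W z) * √(m.W z) := (Real.mul_self_sqrt h0).symm
    _ ≤ _ := by gcongr

lemma abs_dwt_le_sqrt (h1 : m.N₁ ≠ ⊤) {l : ℝ} (hl : 0 < l) (y p : Vec d) (j : Fin d) :
    |m.dwt l y p (dir l j)| ≤ 2 * m.N₁.toReal * √(m.wt l y p) := by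
  have h := (Finset.single_le_sum (f := fun j => m.dwt l y p (dir l j) ^ 2)
    (fun _ _ => sq_nonneg _) (Finset.mem_univ j)).trans (sum_dwt_sq_le h1 hl y p)
  have h2 := Real.abs_le_sqrt h
  rwa [Real.sqrt_mul (by positivity), Real.sqrt_sq (by positivity)] at h2

lemma abs_dwt_le {C : ℝ} (hC : ∀ x, ‖m.dφ x‖ ≤ C) {l : ℝ} (hl : 0 < l) (y p : Vec d) (j : Fin d) :
    |m.dwt l y p (dir l j)| ≤ C := by
  rw [dwt_dir hl, abs_neg]
  refine ((m.dφ _).le_opNorm _).trans ?_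
  simpa using hC _

/-- The weighted sum of the derivatives of `W` is controlled by the root of the misfit. -/
lemma exists_avg_W1_wt_le (m : Model d) : ∃ C > 0, ∀ l : ℝ, 1 ≤ l → ∀ χ : Finset (Vec d),
    m.HardCore χ → ∀ (y : Vec d) (g : Vec d → Aff d) (b : Aff d),
      |m.avg l χ fun p => m.W1 (lin (g y) p) (lin b p) * m.wt l y p|
        ≤ C * cn l y b * √(m.mis l χ g y) := by
  obtain ⟨Cn, hCn0, hCn⟩ := m.exists_count_le
  have hα := m.αGrad_pos
  refine ⟨√(m.αGrad / 32) * 3 * √Cn, by positivity, fun l hl χ hχ y g b => ?_⟩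
  have hl0 : 0 < l := by linarith
  have hc := cn_nonneg l y b
  refine (abs_avg_le (y := y) (A := √(m.αGrad / 32) * (3 * cn l y b))
    (X := fun p => m.W (lin (g y) p) * m.wt l y p) hl0
    (fun p => mul_nonneg (m.W_nonneg _) (wt_nonneg _ _ _)) (fun p hp => ?_) (fun p hp => ?_)
    (by positivity)).trans ?_
  · rw [wt_eq_zero hl0 hp, mul_zero]
  · rw [abs_mul, abs_of_nonneg (wt_nonneg (m := m) l y p), Real.sqrt_mul (m.W_nonneg _), ← mul_assoc]
    exact mul_le_mul (abs_W1_lin_le_sqrt (g y) b hp) (wt_le_sqrt l y p) (wt_nonneg _ _ _)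
      (by positivity)
  · have h1 := Real.sqrt_le_sqrt (hCn l hl χ hχ y)
    have h2 : m.avg l χ (fun p => m.W (lin (g y) p) * m.wt l y p) = m.mis l χ g y := rfl
    rw [h2]
    calc _ ≤ √(m.αGrad / 32) * (3 * cn l y b) * (√Cn * √(m.mis l χ g y)) := by gcongr
      _ = _ := by ring

/-- Crude bounds for the misfit and its derivative, which hold for every cut-off. -/
lemma exists_dmis_crude (m : Model d) : ∃ C > 0, ∀ l : ℝ, 1 ≤ l → ∀ χ : Finset (Vec d),
    m.HardCore χ → ∀ (y : Vec d) (g : Vec d → Aff d),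
      m.mis l χ g y ≤ C ∧ (∀ j, |m.dmis l χ g (dir l j) y| ≤ C * (1 + cn l y (uvec l g y j))) ∧
      |m.avg l χ fun p => ∑ j, m.W1 (lin (g y) p) (lin (uvec l g y j) p) * m.dwt l y p (dir l j)|
        ≤ C * normU l g y := by
  obtain ⟨Cn, hCn0, hCn⟩ := m.exists_count_le
  obtain ⟨CW, hCW0, hCW⟩ := m.exists_bound_W
  obtain ⟨Cφ, hCφ0, hCφ⟩ := m.exists_bound_φ
  set C := (CW * 3 * (1 + Cφ)) * (1 + d) * Cn with hC
  have hC1 : CW * 3 * (1 + Cφ) * Cn ≤ C := by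
    rw [hC]
    have : 0 ≤ CW * 3 * (1 + Cφ) * d * Cn := by positivity
    linarith
  refine ⟨C, by positivity, fun l hl χ hχ y g => ?_⟩
  have hl0 : 0 < l := by linarith
  have hcnt := hCn l hl χ hχ y
  have hcnt0 := count_nonneg (m := m) hl0 χ y
  refine ⟨?_, fun j => ?_, ?_⟩
  · have h := abs_avg_le_count (m := m) (χ := χ) (y := y) (A := CW)
      (f := fun p => m.W (lin (g y) p) * m.wt l y p) hl0
      (fun p hp => by simp [wt_eq_zero hl0 hp]) fun p hp => by
        rw [abs_mul, abs_of_nonneg (wt_nonneg (m := m) l y p)]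
        have h1 : m.wt l y p ≤ 1 := m.φt_le_one _
        calc _ ≤ CW * 1 := mul_le_mul (hCW _).1 h1 (wt_nonneg _ _ _) hCW0.le
          _ = CW := mul_one _
    refine ((le_abs_self _).trans h).trans (le_trans ?_ hC1)
    have h2 : CW * m.count l χ y ≤ CW * Cn := by gcongr
    have h3 : 0 ≤ CW * (2 + 3 * Cφ) * Cn := by positivity
    linarith
  · have hu := cn_nonneg l y (uvec l g y j)
    have h := abs_avg_le_count (m := m) (χ := χ) (y := y)
      (A := CW * (3 * cn l y (uvec l g y j)) + CW * Cφ)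
      (f := fun p => m.W1 (lin (g y) p) (lin (uvec l g y j) p) * m.wt l y p
        + m.W (lin (g y) p) * m.dwt l y p (dir l j)) hl0
      (fun p hp => by simp [wt_eq_zero hl0 hp, dwt_eq_zero hl0 _ hp]) fun p hp => by
        refine (abs_add_le _ _).trans (add_le_add ?_ ?_)
        · rw [abs_mul, abs_of_nonneg (wt_nonneg (m := m) l y p)]
          have h1 : m.wt l y p ≤ 1 := m.φt_le_one _
          calc _ ≤ CW * (3 * cn l y (uvec l g y j)) * 1 :=
                mul_le_mul (abs_W1_lin_le (fun z => (hCW z).2.1) _ _ hp) h1 (wt_nonneg _ _ _)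
                  (by positivity)
            _ = _ := mul_one _
        · rw [abs_mul]
          exact mul_le_mul (hCW _).1 (abs_dwt_le (fun x => (hCφ x).1) hl0 y p j) (abs_nonneg _)
            hCW0.le
    refine h.trans ?_
    calc _ ≤ (CW * (3 * cn l y (uvec l g y j)) + CW * Cφ) * Cn := by gcongr
      _ ≤ CW * 3 * (1 + Cφ) * Cn * (1 + cn l y (uvec l g y j)) := by
          have h3 : 0 ≤ CW * Cn * (3 + 2 * Cφ + 3 * Cφ * cn l y (uvec l g y j)) := by positivity
          linarith
      _ ≤ _ := by gcongr
  · have hU := normU_nonneg l g y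
    have h := abs_avg_le_count (m := m) (χ := χ) (y := y) (A := d * (CW * (3 * normU l g y) * Cφ))
      (f := fun p => ∑ j, m.W1 (lin (g y) p) (lin (uvec l g y j) p) * m.dwt l y p (dir l j)) hl0
      (fun p hp => by simp [dwt_eq_zero hl0 _ hp]) fun p hp => by
        refine (Finset.abs_sum_le_sum_abs _ _).trans ?_
        refine (Finset.sum_le_card_nsmul _ _ (CW * (3 * normU l g y) * Cφ) fun j _ => ?_).trans
          (by simp)
        rw [abs_mul]
        refine mul_le_mul ((abs_W1_lin_le (fun z => (hCW z).2.1) _ _ hp).trans ?_)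
          (abs_dwt_le (fun x => (hCφ x).1) hl0 y p j) (abs_nonneg _) (by positivity)
        have := cn_uvec_le l g y j
        gcongr
    refine h.trans ?_
    calc _ ≤ d * (CW * (3 * normU l g y) * Cφ) * Cn := by gcongr
      _ ≤ _ := by
          have h3 : 0 ≤ CW * 3 * Cn * normU l g y * (1 + d + Cφ) := by positivity
          rw [hC]; linarith

/-- If `√φ` is Lipschitz, the derivative of the misfit is controlled by the root of the misfit. -/
lemma exists_dmis_sharp (m : Model d) (h1 : m.N₁ ≠ ⊤) : ∃ C > 0, ∀ l : ℝ, 1 ≤ l →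
    ∀ χ : Finset (Vec d), m.HardCore χ → ∀ (y : Vec d) (g : Vec d → Aff d) (j : Fin d),
      |m.dmis l χ g (dir l j) y| ≤ C * (1 + cn l y (uvec l g y j)) * √(m.mis l χ g y) := by
  obtain ⟨Cn, hCn0, hCn⟩ := m.exists_count_le
  obtain ⟨CW, hCW0, hCW⟩ := m.exists_bound_W
  obtain ⟨C₁, hC₁0, hC₁⟩ := m.exists_avg_W1_wt_le
  refine ⟨C₁ + √CW * (2 * m.N₁.toReal) * √Cn, by positivity, fun l hl χ hχ y g j => ?_⟩
  have hl0 : 0 < l := by linarith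
  have hu := cn_nonneg l y (uvec l g y j)
  have hb : |m.avg l χ fun p => m.W (lin (g y) p) * m.dwt l y p (dir l j)|
      ≤ √CW * (2 * m.N₁.toReal) * √Cn * √(m.mis l χ g y) := by
    refine (abs_avg_le (y := y) (A := √CW * (2 * m.N₁.toReal))
      (X := fun p => m.W (lin (g y) p) * m.wt l y p) hl0
      (fun p => mul_nonneg (m.W_nonneg _) (wt_nonneg _ _ _)) (fun p hp => ?_) (fun p hp => ?_)
      (by positivity)).trans ?_
    · rw [dwt_eq_zero hl0 _ hp, mul_zero]
    · rw [abs_mul, abs_of_nonneg (m.W_nonneg _), Real.sqrt_mul (m.W_nonneg _)]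
      calc _ ≤ (√CW * √(m.W (lin (g y) p))) * (2 * m.N₁.toReal * √(m.wt l y p)) :=
            mul_le_mul (W_le_sqrt (fun z => (hCW z).1) _) (abs_dwt_le_sqrt h1 hl0 y p j)
              (abs_nonneg _) (by positivity)
        _ = _ := by ring
    · have h1 := Real.sqrt_le_sqrt (hCn l hl χ hχ y)
      have h2 : m.avg l χ (fun p => m.W (lin (g y) p) * m.wt l y p) = m.mis l χ g y := rfl
      rw [h2]
      calc _ ≤ √CW * (2 * m.N₁.toReal) * (√Cn * √(m.mis l χ g y)) := by gcongr
        _ = _ := by ring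
  have ha := hC₁ l hl χ hχ y g (uvec l g y j)
  have heq : m.dmis l χ g (dir l j) y
      = (m.avg l χ fun p => m.W1 (lin (g y) p) (lin (uvec l g y j) p) * m.wt l y p)
        + m.avg l χ fun p => m.W (lin (g y) p) * m.dwt l y p (dir l j) := avg_add _ _ _ _
  rw [heq]
  refine (abs_add_le _ _).trans ((add_le_add ha hb).trans ?_)
  have hs := Real.sqrt_nonneg (m.mis l χ g y)
  have e1 : 0 ≤ C₁ * √(m.mis l χ g y) := by positivity
  have e2 : 0 ≤ √CW * (2 * m.N₁.toReal) * √Cn * √(m.mis l χ g y) * cn l y (uvec l g y j) := by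
    positivity
  linarith

/-- The contribution of the factor `‖A⁻¹‖²` to the derivative of the critical point equation,
tested with the derivative of the branch. -/
noncomputable def kap (m : Model d) (l : ℝ) (χ : Finset (Vec d)) (g : Vec d → Aff d) (y : Vec d)
    (j : Fin d) : ℝ :=
  fderiv ℝ dlog (g y).1 (uvec l g y j).1 (uvec l g y j).1 * m.mis l χ g y
    + dlog (g y).1 (uvec l g y j).1 * m.dmis l χ g (dir l j) y

/-- This contribution is small, because the derivative of `log ‖A⁻¹‖²` sees only the matrix parts of
the derivatives of the branch, which carry a factor `l⁻¹`. -/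
lemma sum_abs_kap_le {D C Q l : ℝ} (hD : 0 < D) (hC : 0 < C) (hQ : 0 ≤ Q) (hl : 1 ≤ l)
    {χ : Finset (Vec d)} {g : Vec d → Aff d} {y : Vec d} (hD0 : ‖dlog (g y).1‖ ≤ D)
    (hD1 : ‖fderiv ℝ dlog (g y).1‖ ≤ D) (hm : m.mis l χ g y ≤ C * Q)
    (hdm : ∀ j, |m.dmis l χ g (dir l j) y| ≤ C * (1 + cn l y (uvec l g y j)) * Q) :
    ∑ j, |m.kap l χ g y j| ≤ 2 * D * C * d * l⁻¹ * (normU l g y * (1 + normU l g y)) * Q := by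
  have hl0 : 0 < l := by linarith
  have hli : l⁻¹ ≤ 1 := inv_le_one_of_one_le₀ hl
  have hli0 : 0 < l⁻¹ := inv_pos.2 hl0
  have hU := normU_nonneg l g y
  have hm0 := mis_nonneg (m := m) hl0 χ g y
  set U := normU l g y with hUd
  refine (Finset.sum_le_card_nsmul _ _ (2 * D * C * l⁻¹ * (U * (1 + U)) * Q) fun j _ => ?_).trans
    (le_of_eq (by simp; ring))
  have hc := cn_uvec_le l g y j
  have hn : ‖(uvec l g y j).1‖ ≤ l⁻¹ * U :=
    (norm_fst_le_cn hl0 y _).trans (by gcongr)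
  have hdm' : |m.dmis l χ g (dir l j) y| ≤ C * (1 + U) * Q := (hdm j).trans (by gcongr)
  have e1 : |fderiv ℝ dlog (g y).1 (uvec l g y j).1 (uvec l g y j).1 * m.mis l χ g y|
      ≤ D * (1 * U) * (l⁻¹ * U) * (C * Q) := by
    rw [abs_mul, abs_of_nonneg hm0]
    refine mul_le_mul (((fderiv ℝ dlog (g y).1).le_opNorm₂ _ _).trans ?_) hm hm0 (by positivity)
    gcongr
    exact hn.trans (by gcongr)
  have e2 : |dlog (g y).1 (uvec l g y j).1 * m.dmis l χ g (dir l j) y|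
      ≤ D * (l⁻¹ * U) * (C * (1 + U) * Q) := by
    rw [abs_mul]
    refine mul_le_mul (((dlog (g y).1).le_opNorm _).trans ?_) hdm' (abs_nonneg _) (by positivity)
    gcongr
  refine (abs_add_le _ _).trans ((add_le_add e1 e2).trans ?_)
  have e3 : 0 ≤ D * C * l⁻¹ * U * Q := by positivity
  linarith

/-- The critical point equation, differentiated in the direction `∂_j` and tested with `∂_j g`, summed
over `j`; convexity of the misfit bounds the main term from below. -/
lemma normU_sq_le (hd : 1 ≤ d) {K η l : ℝ} (hK : 0 < K) {χ : Finset (Vec d)} {g : Vec d → Aff d}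
    {y : Vec d} (h : m.Crit K η l χ g y) :
    m.c₀ / (d + 3) * m.rho l χ y * normU l g y ^ 2
      ≤ |m.avg l χ fun p => ∑ j, m.W1 (lin (g y) p) (lin (uvec l g y j) p) * m.dwt l y p (dir l j)|
        + ∑ j, |m.kap l χ g y j| := by
  have hA : 0 < (g y).1.det := bddSet_subset_GLPos hK h.mem
  have heq : ∀ j, (m.avg l χ fun p =>
        m.W2 (lin (g y) p) (lin (uvec l g y j) p) (lin (uvec l g y j) p) * m.wt l y p)
      + (m.avg l χ fun p => m.W1 (lin (g y) p) (lin (uvec l g y j) p) * m.dwt l y p (dir l j))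
      + m.kap l χ g y j = 0 := by
    intro j
    have := (deqn_eq_zero hd hA h.contDiff h.crit (uvec l g y j) (dir l j) (dir l j)).1
    rw [← avg_add]
    exact this
  have hsum := Finset.sum_congr (rfl : (Finset.univ : Finset (Fin d)) = Finset.univ)
    fun j _ => heq j
  rw [Finset.sum_const_zero, Finset.sum_add_distrib, Finset.sum_add_distrib,
    avg_sum Finset.univ l χ fun j p => m.W1 (lin (g y) p) (lin (uvec l g y j) p)
      * m.dwt l y p (dir l j)] at hsum
  have hlow : m.c₀ / (d + 3) * m.rho l χ y * normU l g y ^ 2 ≤ ∑ j, m.avg l χ fun p =>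
        m.W2 (lin (g y) p) (lin (uvec l g y j) p) (lin (uvec l g y j) p) * m.wt l y p := by
    rw [normU_sq, Finset.mul_sum]
    exact Finset.sum_le_sum fun j _ => h.hess _
  have h1 := neg_abs_le (m.avg l χ fun p => ∑ j, m.W1 (lin (g y) p) (lin (uvec l g y j) p)
    * m.dwt l y p (dir l j))
  have h2 : -∑ j, |m.kap l χ g y j| ≤ ∑ j, m.kap l χ g y j := by
    rw [← Finset.sum_neg_distrib]
    exact Finset.sum_le_sum fun j _ => neg_abs_le _
  linarith

lemma exists_dlog_bounds (hd : 1 ≤ d) {K : ℝ} (hK : 0 < K) : ∃ D > 0, ∀ A ∈ bddSet d K,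
    ‖dlog A‖ ≤ D ∧ ‖fderiv ℝ dlog A‖ ≤ D ∧ ‖fderiv ℝ (fderiv ℝ dlog) A‖ ≤ D := by
  have h3 := contDiffOn_dlog (d := d) hd (n := 2)
  obtain ⟨D₀, hD₀, h0⟩ := exists_bound_on_bddSet hK h3.continuousOn
  obtain ⟨D₁, hD₁, h1⟩ := exists_bound_on_bddSet hK
    (h3.continuousOn_fderiv_of_isOpen isOpen_GLPos (by simp))
  have h4 : ContDiffOn ℝ 1 (fderiv ℝ (dlog (d := d))) (GLPos d) :=
    h3.fderiv_of_isOpen isOpen_GLPos (by norm_num)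
  obtain ⟨D₂, hD₂, h2⟩ := exists_bound_on_bddSet hK
    (h4.continuousOn_fderiv_of_isOpen isOpen_GLPos (by simp))
  exact ⟨D₀ + D₁ + D₂, by positivity, fun A hA =>
    ⟨(h0 A hA).trans (by linarith), (h1 A hA).trans (by linarith), (h2 A hA).trans (by linarith)⟩⟩

/-- The first derivatives of the branch are bounded. -/
lemma exists_normU_le (m : Model d) (hd : 1 ≤ d) {K : ℝ} (hK : 0 < K) :
    ∃ C > 0, ∃ η₀ > 0, ∀ η > 0, η ≤ η₀ → ∀ l > 0, ∀ χ : Finset (Vec d), m.HardCore χ →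
      ∀ (g : Vec d → Aff d) (y : Vec d), m.Crit K η l χ g y → normU l g y ≤ C := by
  obtain ⟨C₁, hC₁0, hC₁⟩ := m.exists_dmis_crude
  obtain ⟨D, hD, hDb⟩ := exists_dlog_bounds (d := d) hd hK
  have hc := m.c₀_pos
  set c := m.c₀ / (d + 3) * K⁻¹ with hcd
  have hc0 : 0 < c := by positivity
  set S := 2 * D * C₁ * d with hS
  have hS0 : 0 ≤ S := by positivity
  refine ⟨2 * (C₁ + S) / c, by positivity, min 1 (c / (2 * (S + 1))), by positivity, ?_⟩
  intro η hη hη0 l hl0 χ hχ g y h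
  have hη1 : η ≤ 1 := hη0.trans (min_le_left _ _)
  have hl : 1 ≤ l := h.one_le.trans (by
    calc η * l ≤ 1 * l := by gcongr
      _ = l := one_mul l)
  have hli : l⁻¹ ≤ η := by rw [inv_le_iff_one_le_mul₀ hl0]; linarith [h.one_le]
  have hηc : η * (2 * (S + 1)) ≤ c := (le_div_iff₀ (by positivity)).1 (hη0.trans (min_le_right _ _))
  obtain ⟨b1, b2, b3⟩ := hC₁ l hl χ hχ y g
  have hk := sum_abs_kap_le (m := m) (Q := 1) hD hC₁0 zero_le_one hl (hDb _ h.mem).1 (hDb _ h.mem).2.1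
    (by simpa using b1) (fun j => by simpa using b2 j)
  have hmain := normU_sq_le hd hK h
  have hU := normU_nonneg l g y
  set U := normU l g y with hUd
  have hρ : c * U ^ 2 ≤ m.c₀ / (d + 3) * m.rho l χ y * U ^ 2 := by
    have := h.rho_ge
    rw [hcd]; gcongr
  -- the contribution of `‖A⁻¹‖²` carries a factor `l⁻¹ ≤ η` and can be absorbed
  have h1 : S * l⁻¹ * (U * (1 + U)) ≤ S * η * (U * (1 + U)) := by gcongr
  have h2 : S * η * (U * (1 + U)) ≤ S * U + c / 2 * U ^ 2 := by
    have e1 : S * η * U ≤ S * 1 * U := by gcongr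
    have e2 : η * S * U ^ 2 ≤ c / 2 * U ^ 2 := by
      have : η * S ≤ c / 2 := by linarith
      gcongr
    linarith
  rw [mul_one] at hk
  have h3 : c / 2 * U ^ 2 ≤ (C₁ + S) * U := by linarith
  rw [le_div_iff₀ hc0]
  by_contra hlt
  have hUpos : 0 < U := by
    rcases hU.lt_or_eq with h' | h'
    · exact h'
    · rw [← h', zero_mul] at hlt
      exact absurd (by positivity) hlt
  have h4 : c / 2 * U ≤ C₁ + S := by
    have : (c / 2 * U) * U ≤ (C₁ + S) * U := by linarith [h3, sq U]
    exact le_of_mul_le_mul_right this hUpos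
  linarith

/-- If `√φ` is Lipschitz, the first derivatives of the branch are controlled by the misfit. -/
lemma exists_normU_le_sqrt (m : Model d) (hd : 1 ≤ d) (hN : m.N₁ ≠ ⊤) {K : ℝ} (hK : 0 < K) {e : ℝ}
    (he : 0 < e) :
    ∃ η₀ > 0, ∀ η > 0, η ≤ η₀ → ∀ l > 0, ∀ χ : Finset (Vec d), m.HardCore χ →
      ∀ (g : Vec d → Aff d) (y : Vec d), m.Crit K η l χ g y →
      m.c₀ / (d + 3) * m.rho l χ y * normU l g y
        ≤ (2 * m.N₁.toReal * √(5 * (m.αGrad / 32)) * √(m.count l χ y) + e) * √(m.mis l χ g y) := by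
  obtain ⟨C₁, hC₁0, hC₁⟩ := m.exists_dmis_sharp hN
  obtain ⟨D, hD, hDb⟩ := exists_dlog_bounds (d := d) hd hK
  obtain ⟨CU, hCU0, η₁, hη₁, hCU⟩ := m.exists_normU_le hd hK
  have hα := m.αGrad_pos
  set S := 2 * D * (C₁ + 1) * d * (1 + CU) with hS
  have hS0 : 0 ≤ S := by positivity
  refine ⟨min (min 1 η₁) (e / (S + 1)), by positivity, ?_⟩
  intro η hη hη0 l hl0 χ hχ g y h
  have hη1 : η ≤ 1 := hη0.trans ((min_le_left _ _).trans (min_le_left _ _))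
  have hη2 : η ≤ η₁ := hη0.trans ((min_le_left _ _).trans (min_le_right _ _))
  have hηe : η * (S + 1) ≤ e := (le_div_iff₀ (by positivity)).1 (hη0.trans (min_le_right _ _))
  have hl : 1 ≤ l := h.one_le.trans (by
    calc η * l ≤ 1 * l := by gcongr
      _ = l := one_mul l)
  have hli : l⁻¹ ≤ η := by rw [inv_le_iff_one_le_mul₀ hl0]; linarith [h.one_le]
  have hm0 := mis_nonneg (m := m) hl0 χ g y
  set Q := √(m.mis l χ g y) with hQ
  have hQ0 : 0 ≤ Q := Real.sqrt_nonneg _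
  have hmQ : m.mis l χ g y ≤ (C₁ + 1) * Q := by
    have h1 : Q ≤ 1 := by
      rw [hQ, Real.sqrt_le_left zero_le_one, one_pow]; exact h.mis_le.trans hη1
    calc m.mis l χ g y = Q * Q := (Real.mul_self_sqrt hm0).symm
      _ ≤ 1 * Q := by gcongr
      _ ≤ (C₁ + 1) * Q := by gcongr; linarith
  have hk := sum_abs_kap_le (m := m) (Q := Q) hD (by positivity : 0 < C₁ + 1) hQ0 hl
    (hDb _ h.mem).1 (hDb _ h.mem).2.1 hmQ (fun j => (hC₁ l hl χ hχ y g j).trans (by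
      have := cn_nonneg l y (uvec l g y j)
      gcongr; linarith))
  have hmain := normU_sq_le hd hK h
  have hcs := abs_avg_sum_W1_le (m := m) (χ := χ) (y := y) hl0 (g y) (uvec l g y)
    (fun j p => m.dwt l y p (dir l j)) (M := 2 * m.N₁.toReal) (by positivity)
    (fun p => sum_dwt_sq_le hN hl0 y p)
  have hU := normU_nonneg l g y
  have hUC := hCU η hη hη2 l hl0 χ hχ g y h
  have hcs' : |m.avg l χ fun p => ∑ j, m.W1 (lin (g y) p) (lin (uvec l g y j) p)
      * m.dwt l y p (dir l j)|
      ≤ 2 * m.N₁.toReal * √(5 * (m.αGrad / 32)) * normU l g y * (√(m.count l χ y) * Q) := hcs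
  set U := normU l g y with hUd
  -- the factor `l⁻¹ ≤ η` makes this term small
  have hk' : ∑ j, |m.kap l χ g y j| ≤ e * Q * U := by
    refine hk.trans ?_
    calc _ ≤ 2 * D * (C₁ + 1) * d * η * (U * (1 + CU)) * Q := by gcongr
      _ = (η * S) * Q * U := by rw [hS]; ring
      _ ≤ e * Q * U := by gcongr; linarith
  rcases hU.lt_or_eq with h' | h'
  · refine le_of_mul_le_mul_right ?_ h'
    calc _ = m.c₀ / (d + 3) * m.rho l χ y * U ^ 2 := by ring
      _ ≤ _ := hmain.trans (add_le_add hcs' hk')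
      _ = _ := by ring
  · rw [← h', mul_zero]; positivity

end Model

end Kac

/-! ### Second derivatives of the branch -/

namespace Kac

open Filter Topology MeasureTheory

variable {d : ℕ}

namespace Model

variable {m : Model d}

lemma abs_W2_lin_le {CW : ℝ} (hCW : ∀ z, ‖m.W2 z‖ ≤ CW) {l : ℝ} {y p : Vec d} (a b c : Aff d)
    (hp : ‖p - y‖ ≤ 2 * l) :
    |m.W2 (lin a p) (lin b p) (lin c p)| ≤ CW * (3 * cn l y b) * (3 * cn l y c) := by
  refine ((m.W2 _).le_opNorm₂ _ _).trans ?_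
  have h1 := norm_lin_le_cn b hp
  have h2 := norm_lin_le_cn c hp
  have h3 := hCW (lin a p)
  have h4 : 0 ≤ CW := (norm_nonneg _).trans h3
  have h5 := cn_nonneg l y b
  gcongr

lemma abs_W3_lin_le {CW : ℝ} (hCW : ∀ z, ‖m.W3 z‖ ≤ CW) {l : ℝ} {y p : Vec d} (a b c e : Aff d)
    (hp : ‖p - y‖ ≤ 2 * l) :
    |m.W3 (lin a p) (lin b p) (lin c p) (lin e p)|
      ≤ CW * (3 * cn l y b) * (3 * cn l y c) * (3 * cn l y e) := by
  have h0 := (m.W3 (lin a p)).le_opNorm (lin b p)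
  have h6 := (m.W3 (lin a p) (lin b p)).le_opNorm₂ (lin c p) (lin e p)
  have h1 := norm_lin_le_cn b hp
  have h2 := norm_lin_le_cn c hp
  have h2' := norm_lin_le_cn e hp
  have h3 := hCW (lin a p)
  have h4 : 0 ≤ CW := (norm_nonneg _).trans h3
  have h5 := cn_nonneg l y b
  have h5' := cn_nonneg l y c
  refine h6.trans ?_
  calc _ ≤ (‖m.W3 (lin a p)‖ * ‖lin b p‖) * ‖lin c p‖ * ‖lin e p‖ := by gcongr
    _ ≤ _ := by gcongr

lemma abs_ddwt_le_sqrt (h2 : m.N₂ ≠ ⊤) (h4 : m.N₄ ≠ ⊤) {l : ℝ} (hl : 0 < l) (y p : Vec d)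
    (i j : Fin d) : |m.ddwt l y p (dir l i) (dir l j)|
      ≤ 2 * (4 * m.N₄.toReal ^ 2 + √d * m.N₂.toReal) * √(m.wt l y p) := by
  have h := ((Finset.single_le_sum (f := fun j => m.ddwt l y p (dir l i) (dir l j) ^ 2)
    (fun _ _ => sq_nonneg _) (Finset.mem_univ j)).trans
    (Finset.single_le_sum (f := fun i => ∑ j, m.ddwt l y p (dir l i) (dir l j) ^ 2)
    (fun _ _ => Finset.sum_nonneg fun _ _ => sq_nonneg _) (Finset.mem_univ i))).trans
    (sum_ddwt_sq_le h2 h4 hl y p)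
  have h2 := Real.abs_le_sqrt h
  rwa [Real.sqrt_mul (by positivity), Real.sqrt_sq (by positivity)] at h2

/-- Terms of the form `∑ W'(z_p)[v_p] ψ_p` with a weight `ψ` dominated by the root of the cut-off. -/
lemma exists_avg_W1_mul_le (m : Model d) {M : ℝ} (hM : 0 ≤ M) : ∃ C > 0, ∀ l : ℝ, 1 ≤ l →
    ∀ χ : Finset (Vec d), m.HardCore χ → ∀ (y : Vec d) (g : Vec d → Aff d) (b : Aff d)
      (ψ : Vec d → ℝ), (∀ p, |ψ p| ≤ M * √(m.wt l y p)) →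
      |m.avg l χ fun p => m.W1 (lin (g y) p) (lin b p) * ψ p|
        ≤ C * cn l y b * √(m.mis l χ g y) ∧
      |m.avg l χ fun p => m.W (lin (g y) p) * ψ p| ≤ C * √(m.mis l χ g y) := by
  obtain ⟨Cn, hCn0, hCn⟩ := m.exists_count_le
  obtain ⟨CW, hCW0, hCW⟩ := m.exists_bound_W
  have hα := m.αGrad_pos
  refine ⟨√(m.αGrad / 32) * 3 * M * √Cn + √CW * M * √Cn + 1, by positivity,
    fun l hl χ hχ y g b ψ hψ => ?_⟩
  have hl0 : 0 < l := by linarith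
  have hc := cn_nonneg l y b
  have hcnt := Real.sqrt_le_sqrt (hCn l hl χ hχ y)
  have hs := Real.sqrt_nonneg (m.mis l χ g y)
  have hmis : m.avg l χ (fun p => m.W (lin (g y) p) * m.wt l y p) = m.mis l χ g y := rfl
  have hψ0 : ∀ p, ¬ ‖p - y‖ ≤ 2 * l → ψ p = 0 := by
    intro p hp
    have := hψ p
    rw [wt_eq_zero hl0 hp, Real.sqrt_zero, mul_zero] at this
    exact abs_eq_zero.1 (le_antisymm this (abs_nonneg _))
  constructor
  · refine (abs_avg_le (y := y) (A := √(m.αGrad / 32) * (3 * cn l y b) * M)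
      (X := fun p => m.W (lin (g y) p) * m.wt l y p) hl0
      (fun p => mul_nonneg (m.W_nonneg _) (wt_nonneg _ _ _)) (fun p hp => ?_) (fun p hp => ?_)
      (by positivity)).trans ?_
    · rw [hψ0 p hp, mul_zero]
    · rw [abs_mul, Real.sqrt_mul (m.W_nonneg _)]
      calc _ ≤ (√(m.αGrad / 32) * (3 * cn l y b) * √(m.W (lin (g y) p))) * (M * √(m.wt l y p)) :=
            mul_le_mul (abs_W1_lin_le_sqrt (g y) b hp) (hψ p) (abs_nonneg _) (by positivity)
        _ = _ := by ring
    · rw [hmis]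
      calc _ ≤ √(m.αGrad / 32) * (3 * cn l y b) * M * (√Cn * √(m.mis l χ g y)) := by gcongr
        _ = √(m.αGrad / 32) * 3 * M * √Cn * (cn l y b * √(m.mis l χ g y)) := by ring
        _ ≤ _ := by
          rw [mul_assoc (_ + _ + _)]
          gcongr
          have : 0 ≤ √CW * M * √Cn := by positivity
          linarith
  · refine (abs_avg_le (y := y) (A := √CW * M)
      (X := fun p => m.W (lin (g y) p) * m.wt l y p) hl0
      (fun p => mul_nonneg (m.W_nonneg _) (wt_nonneg _ _ _)) (fun p hp => ?_) (fun p hp => ?_)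
      (by positivity)).trans ?_
    · rw [hψ0 p hp, mul_zero]
    · rw [abs_mul, abs_of_nonneg (m.W_nonneg _), Real.sqrt_mul (m.W_nonneg _)]
      calc _ ≤ (√CW * √(m.W (lin (g y) p))) * (M * √(m.wt l y p)) :=
            mul_le_mul (W_le_sqrt (fun z => (hCW z).1) _) (hψ p) (abs_nonneg _) (by positivity)
        _ = _ := by ring
    · rw [hmis]
      calc _ ≤ √CW * M * (√Cn * √(m.mis l χ g y)) := by gcongr
        _ = √CW * M * √Cn * √(m.mis l χ g y) := by ring
        _ ≤ _ := by
          gcongr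
          have : 0 ≤ √(m.αGrad / 32) * 3 * M * √Cn := by positivity
          linarith

lemma exists_avg_W2_wt_le (m : Model d) : ∃ C > 0, ∀ l : ℝ, 1 ≤ l →
    ∀ χ : Finset (Vec d), m.HardCore χ → ∀ (y : Vec d) (a b c : Aff d),
      |m.avg l χ fun p => m.W2 (lin a p) (lin b p) (lin c p) * m.wt l y p|
        ≤ C * cn l y b * cn l y c := by
  obtain ⟨Cn, hCn0, hCn⟩ := m.exists_count_le
  obtain ⟨CW, hCW0, hCW⟩ := m.exists_bound_W
  refine ⟨9 * CW * Cn, by positivity, fun l hl χ hχ y a b c => ?_⟩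
  have hl0 : 0 < l := by linarith
  have hb := cn_nonneg l y b
  have hc := cn_nonneg l y c
  refine (abs_avg_le_count (y := y) (A := CW * (3 * cn l y b) * (3 * cn l y c)) hl0
    (fun p hp => by rw [wt_eq_zero hl0 hp, mul_zero]) fun p hp => ?_).trans ?_
  · rw [abs_mul, abs_of_nonneg (wt_nonneg (m := m) l y p)]
    have h1 : m.wt l y p ≤ 1 := m.φt_le_one _
    calc _ ≤ CW * (3 * cn l y b) * (3 * cn l y c) * 1 :=
          mul_le_mul (abs_W2_lin_le (fun z => (hCW z).2.2.1) _ _ _ hp) h1 (wt_nonneg _ _ _)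
            (by positivity)
      _ = _ := mul_one _
  · have := hCn l hl χ hχ y
    calc _ ≤ CW * (3 * cn l y b) * (3 * cn l y c) * Cn := by gcongr
      _ = _ := by ring

lemma exists_avg_W3_wt_le (m : Model d) : ∃ C > 0, ∀ l : ℝ, 1 ≤ l →
    ∀ χ : Finset (Vec d), m.HardCore χ → ∀ (y : Vec d) (a b c e : Aff d),
      |m.avg l χ fun p => m.W3 (lin a p) (lin b p) (lin c p) (lin e p) * m.wt l y p|
        ≤ C * cn l y b * cn l y c * cn l y e := by
  obtain ⟨Cn, hCn0, hCn⟩ := m.exists_count_le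
  obtain ⟨CW, hCW0, hCW⟩ := m.exists_bound_W
  refine ⟨27 * CW * Cn, by positivity, fun l hl χ hχ y a b c e => ?_⟩
  have hl0 : 0 < l := by linarith
  have hb := cn_nonneg l y b
  have hc := cn_nonneg l y c
  have he := cn_nonneg l y e
  refine (abs_avg_le_count (y := y)
    (A := CW * (3 * cn l y b) * (3 * cn l y c) * (3 * cn l y e)) hl0
    (fun p hp => by rw [wt_eq_zero hl0 hp, mul_zero]) fun p hp => ?_).trans ?_
  · rw [abs_mul, abs_of_nonneg (wt_nonneg (m := m) l y p)]
    have h1 : m.wt l y p ≤ 1 := m.φt_le_one _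
    calc _ ≤ CW * (3 * cn l y b) * (3 * cn l y c) * (3 * cn l y e) * 1 :=
          mul_le_mul (abs_W3_lin_le (fun z => (hCW z).2.2.2) _ _ _ _ hp) h1 (wt_nonneg _ _ _)
            (by positivity)
      _ = _ := mul_one _
  · have := hCn l hl χ hχ y
    calc _ ≤ CW * (3 * cn l y b) * (3 * cn l y c) * (3 * cn l y e) * Cn := by gcongr
      _ = _ := by ring

/-- The second derivative of the misfit along the branch. -/
lemma exists_ddmis_le (m : Model d) (h1 : m.N₁ ≠ ⊤) (h2 : m.N₂ ≠ ⊤) (h4 : m.N₄ ≠ ⊤) :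
    ∃ C > 0, ∀ l : ℝ, 1 ≤ l → ∀ χ : Finset (Vec d), m.HardCore χ →
      ∀ (y : Vec d) (g : Vec d → Aff d) (i j : Fin d), |m.ddmis l χ g (dir l j) (dir l i) y|
        ≤ C * (normU l g y ^ 2 + (1 + normU l g y + normW l g y) * √(m.mis l χ g y)) := by
  obtain ⟨C₂, hC₂0, hC₂⟩ := m.exists_avg_W2_wt_le
  obtain ⟨C₁, hC₁0, hC₁⟩ := m.exists_avg_W1_wt_le
  obtain ⟨Ca, hCa0, hCa⟩ := m.exists_avg_W1_mul_le (M := 2 * m.N₁.toReal) (by positivity)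
  obtain ⟨Cb, hCb0, hCb⟩ := m.exists_avg_W1_mul_le
    (M := 2 * (4 * m.N₄.toReal ^ 2 + √d * m.N₂.toReal)) (by positivity)
  refine ⟨C₂ + C₁ + 2 * Ca + Cb, by positivity, fun l hl χ hχ y g i j => ?_⟩
  have hl0 : 0 < l := by linarith
  have heq : m.ddmis l χ g (dir l j) (dir l i) y
      = (m.avg l χ fun p => m.W2 (lin (g y) p) (lin (uvec l g y i) p) (lin (uvec l g y j) p)
          * m.wt l y p)
        + (m.avg l χ fun p => m.W1 (lin (g y) p) (lin (wvec l g y i j) p) * m.wt l y p)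
        + (m.avg l χ fun p => m.W1 (lin (g y) p) (lin (uvec l g y j) p) * m.dwt l y p (dir l i))
        + (m.avg l χ fun p => m.W1 (lin (g y) p) (lin (uvec l g y i) p) * m.dwt l y p (dir l j))
        + (m.avg l χ fun p => m.W (lin (g y) p) * m.ddwt l y p (dir l i) (dir l j)) := by
    simp only [← avg_add]
    unfold ddmis
    congr 1
    ext p
    simp only [uvec, wvec]
    ring
  have b1 := hC₂ l hl χ hχ y (g y) (uvec l g y i) (uvec l g y j)
  have b2 := hC₁ l hl χ hχ y g (wvec l g y i j)
  have b3 := (hCa l hl χ hχ y g (uvec l g y j) (fun p => m.dwt l y p (dir l i))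
    fun p => abs_dwt_le_sqrt h1 hl0 y p i).1
  have b4 := (hCa l hl χ hχ y g (uvec l g y i) (fun p => m.dwt l y p (dir l j))
    fun p => abs_dwt_le_sqrt h1 hl0 y p j).1
  have b5 := (hCb l hl χ hχ y g 0 (fun p => m.ddwt l y p (dir l i) (dir l j))
    fun p => abs_ddwt_le_sqrt h2 h4 hl0 y p i j).2
  have hi := cn_uvec_le l g y i
  have hj := cn_uvec_le l g y j
  have hi0 := cn_nonneg l y (uvec l g y i)
  have hj0 := cn_nonneg l y (uvec l g y j)
  have hw := cn_wvec_le l g y i j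
  have hU := normU_nonneg l g y
  have hW := normW_nonneg l g y
  have hQ := Real.sqrt_nonneg (m.mis l χ g y)
  set U := normU l g y
  set V := normW l g y
  set Q := √(m.mis l χ g y)
  have b1' := b1.trans (show _ ≤ C₂ * U * U by gcongr)
  have b2' := b2.trans (show _ ≤ C₁ * V * Q by gcongr)
  have b3' := b3.trans (show _ ≤ Ca * U * Q by gcongr)
  have b4' := b4.trans (show _ ≤ Ca * U * Q by gcongr)
  rw [heq]
  refine (abs_add_le _ _).trans ((add_le_add ((abs_add_le _ _).trans (add_le_add
    ((abs_add_le _ _).trans (add_le_add ((abs_add_le _ _).trans (add_le_add b1' b2')) b3')) b4'))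
    b5).trans ?_)
  have e1 : 0 ≤ C₂ * ((1 + U + V) * Q) := by positivity
  have e2 : 0 ≤ C₁ * (U ^ 2 + (1 + U) * Q) := by positivity
  have e3 : 0 ≤ Ca * (2 * U ^ 2 + 2 * (1 + V) * Q) := by positivity
  have e4 : 0 ≤ Cb * (U ^ 2 + (U + V) * Q) := by positivity
  linarith

/-- The contribution of the factor `‖A⁻¹‖²` to the second derivative of the critical point equation,
tested with the second derivative of the branch. -/
noncomputable def kap2 (m : Model d) (l : ℝ) (χ : Finset (Vec d)) (g : Vec d → Aff d) (y : Vec d)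
    (t : Fin d × Fin d) : ℝ :=
  ((fderiv ℝ (fderiv ℝ dlog) (g y).1 (uvec l g y t.1).1 (uvec l g y t.2).1 (wvec l g y t.1 t.2).1
        + fderiv ℝ dlog (g y).1 (wvec l g y t.1 t.2).1 (wvec l g y t.1 t.2).1) * m.mis l χ g y
      + fderiv ℝ dlog (g y).1 (uvec l g y t.2).1 (wvec l g y t.1 t.2).1
        * m.dmis l χ g (dir l t.1) y)
    + (fderiv ℝ dlog (g y).1 (uvec l g y t.1).1 (wvec l g y t.1 t.2).1
        * m.dmis l χ g (dir l t.2) y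
      + dlog (g y).1 (wvec l g y t.1 t.2).1 * m.ddmis l χ g (dir l t.2) (dir l t.1) y)

/-- This contribution is small, because the derivative of `log ‖A⁻¹‖²` sees only the matrix parts of
the derivatives of the branch, which carry a factor `l⁻¹`. -/
lemma sum_abs_kap2_le {D C Q R l : ℝ} (hD : 0 < D) (hC : 0 < C) (hQ : 0 ≤ Q) (hR : 0 ≤ R)
    (hl : 1 ≤ l) {χ : Finset (Vec d)} {g : Vec d → Aff d} {y : Vec d} (hD0 : ‖dlog (g y).1‖ ≤ D)
    (hD1 : ‖fderiv ℝ dlog (g y).1‖ ≤ D) (hD2 : ‖fderiv ℝ (fderiv ℝ dlog) (g y).1‖ ≤ D)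
    (hUR : normU l g y ≤ R) (hm : m.mis l χ g y ≤ C * Q)
    (hdm : ∀ j, |m.dmis l χ g (dir l j) y| ≤ C * Q)
    (hddm : ∀ i j, |m.ddmis l χ g (dir l j) (dir l i) y| ≤ C * (1 + normW l g y) * Q) :
    ∑ t, |m.kap2 l χ g y t|
      ≤ D * C * (R ^ 2 + 2 * R + 1) * 2 * d ^ 2 * l⁻¹ * (normW l g y * (1 + normW l g y)) * Q := by
  have hl0 : 0 < l := by linarith
  have hli : l⁻¹ ≤ 1 := inv_le_one_of_one_le₀ hl
  have hli0 : 0 < l⁻¹ := inv_pos.2 hl0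
  have hV := normW_nonneg l g y
  have hU := normU_nonneg l g y
  have hm0 := mis_nonneg (m := m) hl0 χ g y
  set U := normU l g y with hUd
  set V := normW l g y with hVd
  refine (Finset.sum_le_card_nsmul _ _
    (D * C * (R ^ 2 + 2 * R + 1) * 2 * l⁻¹ * (V * (1 + V)) * Q) fun t _ => ?_).trans
    (le_of_eq (by simp; ring))
  have hu : ∀ j, ‖(uvec l g y j).1‖ ≤ R := fun j => by
    refine (norm_fst_le_cn hl0 y _).trans ?_
    calc _ ≤ 1 * R := by
          have := (cn_uvec_le l g y j).trans hUR
          have := cn_nonneg l y (uvec l g y j)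
          gcongr
      _ = R := one_mul R
  have hw : ‖(wvec l g y t.1 t.2).1‖ ≤ l⁻¹ * V := (norm_fst_le_cn hl0 y _).trans (by
    have := cn_wvec_le l g y t.1 t.2
    gcongr)
  have hw' : ‖(wvec l g y t.1 t.2).1‖ ≤ V := hw.trans (by
    calc _ ≤ 1 * V := by gcongr
      _ = V := one_mul V)
  have e1 : |fderiv ℝ (fderiv ℝ dlog) (g y).1 (uvec l g y t.1).1 (uvec l g y t.2).1
      (wvec l g y t.1 t.2).1| ≤ D * R * R * (l⁻¹ * V) := by
    refine (((fderiv ℝ (fderiv ℝ dlog) (g y).1 (uvec l g y t.1).1).le_opNorm₂ _ _).trans ?_)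
    have h0 := (fderiv ℝ (fderiv ℝ dlog) (g y).1).le_opNorm (uvec l g y t.1).1
    have h1 : ‖fderiv ℝ (fderiv ℝ dlog) (g y).1 (uvec l g y t.1).1‖ ≤ D * R := h0.trans (by
      have := hu t.1
      gcongr)
    have := hu t.2
    gcongr
  have hD1' : ∀ B : Mat d, ∀ S : ℝ, ‖B‖ ≤ S →
      |fderiv ℝ dlog (g y).1 B (wvec l g y t.1 t.2).1| ≤ D * S * (l⁻¹ * V) := by
    intro B S hB
    have hS : 0 ≤ S := (norm_nonneg _).trans hB
    refine ((fderiv ℝ dlog (g y).1).le_opNorm₂ _ _).trans ?_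
    gcongr
  have e2 := hD1' _ _ hw'
  have e3 := hD1' _ _ (hu t.2)
  have e4 := hD1' _ _ (hu t.1)
  have e5 : |dlog (g y).1 (wvec l g y t.1 t.2).1| ≤ D * (l⁻¹ * V) :=
    ((dlog (g y).1).le_opNorm _).trans (by gcongr)
  have f1 : |(fderiv ℝ (fderiv ℝ dlog) (g y).1 (uvec l g y t.1).1 (uvec l g y t.2).1
        (wvec l g y t.1 t.2).1
        + fderiv ℝ dlog (g y).1 (wvec l g y t.1 t.2).1 (wvec l g y t.1 t.2).1) * m.mis l χ g y|
      ≤ (D * R * R * (l⁻¹ * V) + D * V * (l⁻¹ * V)) * (C * Q) := by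
    rw [abs_mul, abs_of_nonneg hm0]
    exact mul_le_mul ((abs_add_le _ _).trans (add_le_add e1 e2)) hm hm0 (by positivity)
  have f2 : |fderiv ℝ dlog (g y).1 (uvec l g y t.2).1 (wvec l g y t.1 t.2).1
        * m.dmis l χ g (dir l t.1) y| ≤ D * R * (l⁻¹ * V) * (C * Q) := by
    rw [abs_mul]
    exact mul_le_mul e3 (hdm _) (abs_nonneg _) (by positivity)
  have f3 : |fderiv ℝ dlog (g y).1 (uvec l g y t.1).1 (wvec l g y t.1 t.2).1
        * m.dmis l χ g (dir l t.2) y| ≤ D * R * (l⁻¹ * V) * (C * Q) := by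
    rw [abs_mul]
    exact mul_le_mul e4 (hdm _) (abs_nonneg _) (by positivity)
  have f4 : |dlog (g y).1 (wvec l g y t.1 t.2).1 * m.ddmis l χ g (dir l t.2) (dir l t.1) y|
      ≤ D * (l⁻¹ * V) * (C * (1 + V) * Q) := by
    rw [abs_mul]
    exact mul_le_mul e5 (hddm _ _) (abs_nonneg _) (by positivity)
  refine (abs_add_le _ _).trans ((add_le_add ((abs_add_le _ _).trans (add_le_add f1 f2))
    ((abs_add_le _ _).trans (add_le_add f3 f4))).trans ?_)
  have g1 : 0 ≤ D * C * (l⁻¹ * V) * Q * (R ^ 2 + 2 * R + 1 + 2 * R ^ 2 * V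
      + 4 * R * V) := by positivity
  linarith

/-- The term of second order in the potential, with one derivative on the cut-off. -/
lemma abs_avg_sum_W2_dwt_le (h1 : m.N₁ ≠ ⊤) {l : ℝ} (hl : 0 < l) {χ : Finset (Vec d)} {y : Vec d}
    (a : Aff d) (u : Fin d → Aff d) (w : Fin d → Fin d → Aff d) :
    |m.avg l χ fun p => ∑ t : Fin d × Fin d,
        m.W2 (lin a p) (lin (u t.2) p) (lin (w t.1 t.2) p) * m.dwt l y p (dir l t.1)|
      ≤ 10 * m.supHessW * m.N₁.toReal * √(∑ j, cn l y (u j) ^ 2)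
        * √(∑ t : Fin d × Fin d, cn l y (w t.1 t.2) ^ 2)
        * (√(m.count l χ y) * √(m.rho l χ y)) := by
  have hH : 0 ≤ m.supHessW := ENNReal.toReal_nonneg
  have hρ : m.avg l χ (fun p => m.wt l y p) = m.rho l χ y := (rho_eq hl χ y).symm
  rw [← hρ]
  refine abs_avg_le hl (fun p => wt_nonneg _ _ _) ?_ ?_ (by positivity)
  · intro p hp
    simp [dwt_eq_zero hl _ hp]
  · intro p hp
    have hw : √(∑ t : Fin d × Fin d, ‖lin (w t.1 t.2) p‖ ^ 2)
        ≤ √5 * √(∑ t : Fin d × Fin d, cn l y (w t.1 t.2) ^ 2) := by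
      rw [← Real.sqrt_mul (by norm_num), Finset.mul_sum]
      exact Real.sqrt_le_sqrt (Finset.sum_le_sum fun t _ => norm_lin_sq_le_cn _ hp)
    have hu : √(∑ t : Fin d × Fin d, (‖lin (u t.2) p‖ * |m.dwt l y p (dir l t.1)|) ^ 2)
        ≤ (2 * m.N₁.toReal * √(m.wt l y p)) * (√5 * √(∑ j, cn l y (u j) ^ 2)) := by
      rw [Real.sqrt_le_left (by have := Real.sqrt_nonneg (m.wt l y p); positivity)]
      have e1 : ∑ t : Fin d × Fin d, (‖lin (u t.2) p‖ * |m.dwt l y p (dir l t.1)|) ^ 2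
          = (∑ i, m.dwt l y p (dir l i) ^ 2) * ∑ j, ‖lin (u j) p‖ ^ 2 := by
        rw [Finset.sum_mul_sum, Fintype.sum_prod_type]
        refine Finset.sum_congr rfl fun i _ => Finset.sum_congr rfl fun j _ => ?_
        rw [mul_pow, sq_abs, mul_comm]
      have e2 : ∑ j, ‖lin (u j) p‖ ^ 2 ≤ 5 * ∑ j, cn l y (u j) ^ 2 := by
        rw [Finset.mul_sum]
        exact Finset.sum_le_sum fun t _ => norm_lin_sq_le_cn _ hp
      rw [e1]
      calc _ ≤ ((2 * m.N₁.toReal) ^ 2 * m.wt l y p) * (5 * ∑ j, cn l y (u j) ^ 2) :=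
            mul_le_mul (sum_dwt_sq_le h1 hl y p) e2
              (Finset.sum_nonneg fun _ _ => sq_nonneg _)
              (mul_nonneg (sq_nonneg _) (wt_nonneg _ _ _))
        _ = _ := by
            simp only [mul_pow]
            rw [Real.sq_sqrt (wt_nonneg _ _ _), Real.sq_sqrt (by norm_num : (0 : ℝ) ≤ 5),
              Real.sq_sqrt (Finset.sum_nonneg fun _ _ => sq_nonneg _)]
    have h5 : √5 * √5 = 5 := Real.mul_self_sqrt (by norm_num)
    calc |∑ t : Fin d × Fin d,
          m.W2 (lin a p) (lin (u t.2) p) (lin (w t.1 t.2) p) * m.dwt l y p (dir l t.1)|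
        ≤ ∑ t : Fin d × Fin d, m.supHessW *
            ((‖lin (u t.2) p‖ * |m.dwt l y p (dir l t.1)|) * ‖lin (w t.1 t.2) p‖) := by
          refine (Finset.abs_sum_le_sum_abs _ _).trans (Finset.sum_le_sum fun t _ => ?_)
          rw [abs_mul]
          have h2 : |m.W2 (lin a p) (lin (u t.2) p) (lin (w t.1 t.2) p)|
              ≤ m.supHessW * ‖lin (u t.2) p‖ * ‖lin (w t.1 t.2) p‖ := by
            refine ((m.W2 _).le_opNorm₂ _ _).trans ?_
            have := m.norm_W2_le (lin a p)
            gcongr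
          calc _ ≤ m.supHessW * ‖lin (u t.2) p‖ * ‖lin (w t.1 t.2) p‖
                * |m.dwt l y p (dir l t.1)| := mul_le_mul_of_nonneg_right h2 (abs_nonneg _)
            _ = _ := by ring
      _ = m.supHessW * ∑ t : Fin d × Fin d,
            (‖lin (u t.2) p‖ * |m.dwt l y p (dir l t.1)|) * ‖lin (w t.1 t.2) p‖ := by
          rw [Finset.mul_sum]
      _ ≤ m.supHessW * (((2 * m.N₁.toReal * √(m.wt l y p)) * (√5 * √(∑ j, cn l y (u j) ^ 2)))
            * (√5 * √(∑ t : Fin d × Fin d, cn l y (w t.1 t.2) ^ 2))) := by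
          refine mul_le_mul_of_nonneg_left ?_ hH
          exact (Real.sum_mul_le_sqrt_mul_sqrt _ _ _).trans
            (mul_le_mul hu hw (Real.sqrt_nonneg _) (by positivity))
      _ = _ := by
          linear_combination (m.supHessW * (2 * m.N₁.toReal * √(m.wt l y p))
            * √(∑ j, cn l y (u j) ^ 2) * √(∑ t : Fin d × Fin d, cn l y (w t.1 t.2) ^ 2)) * h5

end Model

end Kac

namespace Kac

open Filter Topology MeasureTheory

variable {d : ℕ}

namespace Model

variable {m : Model d}

lemma sum_sqrt_swap (l : ℝ) (y : Vec d) (w : Fin d → Fin d → Aff d) :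
    ∑ t : Fin d × Fin d, cn l y (w t.2 t.1) ^ 2 = ∑ t : Fin d × Fin d, cn l y (w t.1 t.2) ^ 2 :=
  Equiv.sum_comp (Equiv.prodComm (Fin d) (Fin d)) fun t => cn l y (w t.1 t.2) ^ 2

/-- The critical point equation, differentiated in the directions `∂_i` and `∂_j` and tested with
`∂_i ∂_j g`, summed over `i` and `j`. -/
lemma normW_sq_le (hd : 1 ≤ d) (h1 : m.N₁ ≠ ⊤) (h2 : m.N₂ ≠ ⊤) (h4 : m.N₄ ≠ ⊤) {K η l : ℝ}
    (hK : 0 < K) (hl : 0 < l) {χ : Finset (Vec d)} {g : Vec d → Aff d} {y : Vec d}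
    (h : m.Crit K η l χ g y) {C₃ : ℝ} (hC₃0 : 0 ≤ C₃) (hC₃ : ∀ a b c e : Aff d,
      |m.avg l χ fun p => m.W3 (lin a p) (lin b p) (lin c p) (lin e p) * m.wt l y p|
        ≤ C₃ * cn l y b * cn l y c * cn l y e) :
    m.c₀ / (d + 3) * m.rho l χ y * normW l g y ^ 2
      ≤ d ^ 2 * C₃ * normU l g y ^ 2 * normW l g y
        + 20 * m.supHessW * m.N₁.toReal * normU l g y * normW l g y
          * (√(m.count l χ y) * √(m.rho l χ y))
        + 2 * (4 * m.N₄.toReal ^ 2 + √d * m.N₂.toReal) * √(5 * (m.αGrad / 32)) * normW l g y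
          * (√(m.count l χ y) * √(m.mis l χ g y))
        + ∑ t, |m.kap2 l χ g y t| := by
  have hA : 0 < (g y).1.det := bddSet_subset_GLPos hK h.mem
  set u := uvec l g y with hu
  set w := wvec l g y with hw
  -- the index is the order of the derivative of `W` in the term, except for the main term `f₀`
  set f₃ : Fin d × Fin d → Vec d → ℝ := fun t p =>
    m.W3 (lin (g y) p) (lin (u t.1) p) (lin (u t.2) p) (lin (w t.1 t.2) p) * m.wt l y p with hf₃
  set f₀ : Fin d × Fin d → Vec d → ℝ := fun t p =>
    m.W2 (lin (g y) p) (lin (w t.1 t.2) p) (lin (w t.1 t.2) p) * m.wt l y p with hf₀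
  set f₂ : Fin d × Fin d → Vec d → ℝ := fun t p =>
    m.W2 (lin (g y) p) (lin (u t.2) p) (lin (w t.1 t.2) p) * m.dwt l y p (dir l t.1) with hf₂
  set f₂' : Fin d × Fin d → Vec d → ℝ := fun t p =>
    m.W2 (lin (g y) p) (lin (u t.1) p) (lin (w t.1 t.2) p) * m.dwt l y p (dir l t.2) with hf₂'
  set f₁ : Fin d × Fin d → Vec d → ℝ := fun t p =>
    m.W1 (lin (g y) p) (lin (w t.1 t.2) p) * m.ddwt l y p (dir l t.1) (dir l t.2) with hf₁
  have heq : ∀ t, m.avg l χ (f₀ t) + m.avg l χ (f₃ t) + m.avg l χ (f₂ t) + m.avg l χ (f₂' t)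
      + m.avg l χ (f₁ t) + m.kap2 l χ g y t = 0 := by
    intro t
    have := (deqn_eq_zero hd hA h.contDiff h.crit (w t.1 t.2) (dir l t.2) (dir l t.1)).2
    unfold ddeqn at this
    simp only [← avg_add]
    rw [← this]
    congr 1
    congr 1
    ext p
    simp only [hf₀, hf₁, hf₂, hf₂', hf₃, hu, hw, uvec, wvec]
    ring
  have hsum := Finset.sum_congr (rfl : (Finset.univ : Finset (Fin d × Fin d)) = Finset.univ)
    fun t _ => heq t
  rw [Finset.sum_const_zero] at hsum
  simp only [Finset.sum_add_distrib] at hsum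
  have hlow : m.c₀ / (d + 3) * m.rho l χ y * normW l g y ^ 2 ≤ ∑ t, m.avg l χ (f₀ t) := by
    rw [normW_sq, Finset.mul_sum]
    exact Finset.sum_le_sum fun t _ => h.hess _
  have hV := normW_nonneg l g y
  have hU := normU_nonneg l g y
  have b3 : |∑ t, m.avg l χ (f₃ t)| ≤ d ^ 2 * C₃ * normU l g y ^ 2 * normW l g y := by
    refine (Finset.abs_sum_le_sum_abs _ _).trans ((Finset.sum_le_card_nsmul _ _
      (C₃ * normU l g y * normU l g y * normW l g y) fun t _ => ?_).trans
      (le_of_eq (by simp; ring)))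
    refine (hC₃ _ _ _ _).trans ?_
    have h1 := cn_uvec_le l g y t.1
    have h2 := cn_uvec_le l g y t.2
    have h3 := cn_wvec_le l g y t.1 t.2
    have h4 := cn_nonneg l y (u t.1)
    have h5 := cn_nonneg l y (u t.2)
    have h6 := cn_nonneg l y (w t.1 t.2)
    gcongr
  have b2 : |∑ t, m.avg l χ (f₂ t)| ≤ 10 * m.supHessW * m.N₁.toReal * normU l g y * normW l g y
      * (√(m.count l χ y) * √(m.rho l χ y)) := by
    rw [avg_sum]
    exact abs_avg_sum_W2_dwt_le h1 hl (g y) u w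
  have b2' : |∑ t, m.avg l χ (f₂' t)| ≤ 10 * m.supHessW * m.N₁.toReal * normU l g y * normW l g y
      * (√(m.count l χ y) * √(m.rho l χ y)) := by
    have hs : ∑ t, m.avg l χ (f₂' t) = m.avg l χ fun p => ∑ t : Fin d × Fin d,
        m.W2 (lin (g y) p) (lin (u t.2) p) (lin (w t.2 t.1) p) * m.dwt l y p (dir l t.1) := by
      rw [← avg_sum, ← Equiv.sum_comp (Equiv.prodComm (Fin d) (Fin d))]
      rfl
    rw [hs]
    have := abs_avg_sum_W2_dwt_le (m := m) h1 hl (χ := χ) (y := y) (g y) u fun i j => w j i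
    rw [sum_sqrt_swap l y w] at this
    exact this
  have b1 : |∑ t, m.avg l χ (f₁ t)|
      ≤ 2 * (4 * m.N₄.toReal ^ 2 + √d * m.N₂.toReal) * √(5 * (m.αGrad / 32)) * normW l g y
          * (√(m.count l χ y) * √(m.mis l χ g y)) := by
    rw [avg_sum]
    refine abs_avg_sum_W1_le hl (g y) (fun t : Fin d × Fin d => w t.1 t.2)
      (fun t p => m.ddwt l y p (dir l t.1) (dir l t.2)) (by positivity) fun p => ?_
    rw [Fintype.sum_prod_type]
    exact sum_ddwt_sq_le h2 h4 hl y p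
  have b0 : -∑ t, |m.kap2 l χ g y t| ≤ ∑ t, m.kap2 l χ g y t := by
    rw [← Finset.sum_neg_distrib]
    exact Finset.sum_le_sum fun j _ => neg_abs_le _
  have c1 := (abs_le.1 b1).1
  have c2 := (abs_le.1 b2).1
  have c2' := (abs_le.1 b2').1
  have c3 := (abs_le.1 b3).1
  linarith

/-- From a quadratic inequality with a small quadratic perturbation to a linear one. -/
lemma linear_of_quadratic {c V A s S : ℝ} (hV : 0 ≤ V) (hA : 0 ≤ A) (hs0 : 0 ≤ s)
    (hsc : s ≤ c / 2) (hc : 0 < c) (hAS : 2 * (A + s) / c ≤ S)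
    (h : c * V ^ 2 ≤ A * V + s * (V * (1 + V))) : c * V ≤ A + s * (1 + S) := by
  rcases hV.lt_or_eq with hV' | hV'
  · have h1 : c * V ≤ A + s * (1 + V) := by
      refine le_of_mul_le_mul_right ?_ hV'
      linarith
    have h2 : V ≤ S := by
      refine le_trans ?_ hAS
      rw [le_div_iff₀ hc]
      have : s * V ≤ c / 2 * V := by gcongr
      linarith
    refine h1.trans ?_
    gcongr
  · rw [← hV']
    have : 0 ≤ S := le_trans (by positivity) hAS
    rw [mul_zero]; positivity

-- The perturbation argument is one long computation.
set_option maxHeartbeats 1000000 in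
/-- If the norms of the roots of the cut-off are finite, the second derivatives of the branch are
controlled by the misfit. -/
lemma exists_normW_le_sqrt (m : Model d) (hd : 1 ≤ d) (h1 : m.N₁ ≠ ⊤) (h2 : m.N₂ ≠ ⊤)
    (h4 : m.N₄ ≠ ⊤) {K : ℝ} (hK : 0 < K) {e : ℝ} (he : 0 < e) :
    ∃ η₀ > 0, ∀ η > 0, η ≤ η₀ → ∀ l > 0, ∀ χ : Finset (Vec d), m.HardCore χ →
      ∀ (g : Vec d → Aff d) (y : Vec d), m.Crit K η l χ g y →
      m.c₀ / (d + 3) * m.rho l χ y * normW l g y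
        ≤ (2 * (4 * m.N₄.toReal ^ 2 + √d * m.N₂.toReal) * √(5 * (m.αGrad / 32))
            * √(m.count l χ y) + e) * √(m.mis l χ g y)
          + 20 * m.supHessW * m.N₁.toReal * normU l g y
            * (√(m.count l χ y) * √(m.rho l χ y)) := by
  obtain ⟨Cn, hCn0, hCn⟩ := m.exists_count_le
  obtain ⟨C₃, hC₃0, hC₃⟩ := m.exists_avg_W3_wt_le
  obtain ⟨C₁, hC₁0, hC₁⟩ := m.exists_dmis_sharp h1
  obtain ⟨C₂, hC₂0, hC₂⟩ := m.exists_ddmis_le h1 h2 h4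
  obtain ⟨D, hD, hDb⟩ := exists_dlog_bounds (d := d) hd hK
  obtain ⟨CU, hCU0, η₁, hη₁, hCU⟩ := m.exists_normU_le hd hK
  obtain ⟨η₂, hη₂, hU₂⟩ := m.exists_normU_le_sqrt hd h1 hK one_pos
  have hα := m.αGrad_pos
  have hc := m.c₀_pos
  have hH : 0 ≤ m.supHessW := ENNReal.toReal_nonneg
  set c := m.c₀ / (d + 3) * K⁻¹ with hcd
  have hc0 : 0 < c := by positivity
  -- the first derivatives are at most `C₆` times the root of the misfit
  set C₆ := (2 * m.N₁.toReal * √(5 * (m.αGrad / 32)) * √Cn + 1) / c with hC₆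
  have hC₆0 : 0 < C₆ := by positivity
  set M := 2 * (4 * m.N₄.toReal ^ 2 + √d * m.N₂.toReal) * √(5 * (m.αGrad / 32)) with hM
  have hM0 : 0 ≤ M := by positivity
  set C := C₁ * (1 + CU) + C₂ * (CU * C₆ + 1 + CU) + 1 with hC
  have hCpos : 0 < C := by positivity
  set s₁ := D * C * (CU ^ 2 + 2 * CU + 1) * 2 * d ^ 2 with hs₁
  have hs₁0 : 0 ≤ s₁ := by positivity
  set P := M * √Cn + e + 20 * m.supHessW * m.N₁.toReal * CU * (√Cn * √Cn) with hP
  have hP0 : 0 ≤ P := by positivity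
  set S := 2 * (P + c) / c with hS
  have hS0 : 0 ≤ S := by positivity
  set T := d ^ 2 * C₃ * C₆ ^ 2 with hT
  have hT0 : 0 ≤ T := by positivity
  refine ⟨min (min (min η₁ η₂) (min 1 (c / (2 * (s₁ + 1)))))
    (min ((e / (2 * (T + 1))) ^ 2) (e / (2 * ((s₁ + 1) * (1 + S))))), by positivity, ?_⟩
  intro η hη hη0 l hl0 χ hχ g y h
  have hηa : η ≤ η₁ := hη0.trans ((min_le_left _ _).trans ((min_le_left _ _).trans (min_le_left _ _)))
  have hηb : η ≤ η₂ := hη0.trans ((min_le_left _ _).trans ((min_le_left _ _).trans (min_le_right _ _)))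
  have hηc : η ≤ 1 := hη0.trans ((min_le_left _ _).trans ((min_le_right _ _).trans (min_le_left _ _)))
  have hηd : η * (2 * (s₁ + 1)) ≤ c := (le_div_iff₀ (by positivity)).1
    (hη0.trans ((min_le_left _ _).trans ((min_le_right _ _).trans (min_le_right _ _))))
  have hηe : √η * (2 * (T + 1)) ≤ e := by
    rw [← le_div_iff₀ (by positivity), Real.sqrt_le_left (by positivity)]
    exact hη0.trans ((min_le_right _ _).trans (min_le_left _ _))
  have hηf : η * (2 * ((s₁ + 1) * (1 + S))) ≤ e := (le_div_iff₀ (by positivity)).1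
    (hη0.trans ((min_le_right _ _).trans (min_le_right _ _)))
  have hl : 1 ≤ l := h.one_le.trans (by
    calc η * l ≤ 1 * l := by gcongr
      _ = l := one_mul l)
  have hli : l⁻¹ ≤ η := by rw [inv_le_iff_one_le_mul₀ hl0]; linarith [h.one_le]
  have hm0 := mis_nonneg (m := m) hl0 χ g y
  have hρ0 := rho_nonneg (m := m) hl0 χ y
  have hUC := hCU η hη hηa l hl0 χ hχ g y h
  have hUQ := hU₂ η hη hηb l hl0 χ hχ g y h
  have hU := normU_nonneg l g y
  have hV := normW_nonneg l g y
  have hcnt := Real.sqrt_le_sqrt (hCn l hl χ hχ y)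
  have hρcnt := (Real.sqrt_le_sqrt (rho_le_count (m := m) hl0 χ y)).trans hcnt
  have hmain := normW_sq_le hd h1 h2 h4 hK hl0 h hC₃0.le (hC₃ l hl χ hχ y)
  have hmm : m.mis l χ g y = √(m.mis l χ g y) * √(m.mis l χ g y) := (Real.mul_self_sqrt hm0).symm
  have hQη : √(m.mis l χ g y) ≤ √η := Real.sqrt_le_sqrt h.mis_le
  have hQ1 : √(m.mis l χ g y) ≤ 1 := by
    rw [Real.sqrt_le_one]; exact h.mis_le.trans hηc
  have hQ0 : 0 ≤ √(m.mis l χ g y) := Real.sqrt_nonneg _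
  have hdm := fun j => hC₁ l hl χ hχ y g j
  have hddm := fun i j => hC₂ l hl χ hχ y g i j
  have huj := cn_uvec_le l g y
  have hk : ∀ Q, Q = √(m.mis l χ g y) → (m.mis l χ g y ≤ C * Q) →
      (∀ j, |m.dmis l χ g (dir l j) y| ≤ C * Q) →
      (∀ i j, |m.ddmis l χ g (dir l j) (dir l i) y| ≤ C * (1 + normW l g y) * Q) →
      ∑ t, |m.kap2 l χ g y t| ≤ s₁ * l⁻¹ * (normW l g y * (1 + normW l g y)) * Q := by
    intro Q hQ a1 a2 a3
    exact sum_abs_kap2_le hD hCpos (hQ ▸ hQ0) hCU0.le hl (hDb _ h.mem).1 (hDb _ h.mem).2.1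
      (hDb _ h.mem).2.2 hUC a1 a2 a3
  set U := normU l g y with hUd
  set V := normW l g y with hVd
  set Q := √(m.mis l χ g y) with hQd
  set n := √(m.count l χ y) with hn
  have hn0 : 0 ≤ n := Real.sqrt_nonneg _
  set ρ := m.rho l χ y with hρd
  have hr0 : 0 ≤ √ρ := Real.sqrt_nonneg _
  have hcρ : c ≤ m.c₀ / (d + 3) * ρ := by
    have := h.rho_ge
    rw [hcd]; gcongr
  have hU6 : U ≤ C₆ * Q := by
    rw [hC₆, div_mul_eq_mul_div, le_div_iff₀ hc0]
    calc U * c = c * U := mul_comm _ _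
      _ ≤ m.c₀ / (d + 3) * ρ * U := by gcongr
      _ ≤ _ := hUQ
      _ ≤ _ := by gcongr
  -- the square of the first derivatives is of higher order in the root of the misfit
  have hUU : U ^ 2 ≤ C₆ ^ 2 * Q * √η := by
    calc U ^ 2 ≤ (C₆ * Q) ^ 2 := by gcongr
      _ = C₆ ^ 2 * Q * Q := by ring
      _ ≤ _ := by gcongr
  have hmC : m.mis l χ g y ≤ C * Q := by
    have hC1 : 1 ≤ C := by
      have : 0 ≤ C₁ * (1 + CU) + C₂ * (CU * C₆ + 1 + CU) := by positivity
      rw [hC]; linarith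
    calc m.mis l χ g y = Q * Q := hmm
      _ ≤ C * Q := by gcongr; exact hQ1.trans hC1
  have hdm' : ∀ j, |m.dmis l χ g (dir l j) y| ≤ C * Q := by
    intro j
    refine (hdm j).trans ?_
    have h5 := (huj j).trans hUC
    have h6 : C₁ * (1 + cn l y (uvec l g y j)) ≤ C₁ * (1 + CU) := by gcongr
    have h7 : C₁ * (1 + CU) ≤ C := by
      have : 0 ≤ C₂ * (CU * C₆ + 1 + CU) := by positivity
      rw [hC]; linarith
    exact mul_le_mul_of_nonneg_right (h6.trans h7) hQ0
  have hddm' : ∀ i j, |m.ddmis l χ g (dir l j) (dir l i) y| ≤ C * (1 + V) * Q := by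
    intro i j
    refine (hddm i j).trans ?_
    have h5 : U ^ 2 ≤ CU * (C₆ * Q) := by
      rw [sq]; gcongr
    have h6 : U * Q ≤ CU * Q := by gcongr
    have h7 : U ^ 2 + (1 + U + V) * Q ≤ (CU * C₆ + 1 + CU) * (1 + V) * Q := by
      have : 0 ≤ (CU * C₆ + CU) * V * Q := by positivity
      linarith
    calc _ ≤ C₂ * ((CU * C₆ + 1 + CU) * (1 + V) * Q) := by gcongr
      _ = C₂ * (CU * C₆ + 1 + CU) * ((1 + V) * Q) := by ring
      _ ≤ C * ((1 + V) * Q) := by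
          gcongr
          have : 0 ≤ C₁ * (1 + CU) := by positivity
          rw [hC]; linarith
      _ = _ := by ring
  have hkk := hk Q rfl hmC hdm' hddm'
  set s := s₁ * η * Q with hs
  have hs0 : 0 ≤ s := by positivity
  have hkk' : ∑ t, |m.kap2 l χ g y t| ≤ s * (V * (1 + V)) := by
    refine hkk.trans ?_
    calc _ ≤ s₁ * η * (V * (1 + V)) * Q := by gcongr
      _ = _ := by rw [hs]; ring
  set A := (M * n + e / 2) * Q + 20 * m.supHessW * m.N₁.toReal * U * (n * √ρ) with hA
  have hA0 : 0 ≤ A := by positivity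
  have hsη : s ≤ s₁ * η := by
    calc s ≤ s₁ * η * 1 := by rw [hs]; gcongr
      _ = _ := mul_one _
  have hsc : s ≤ c / 2 := by linarith
  have hAP : A ≤ P := by
    have e1 : (M * n + e / 2) * Q ≤ (M * √Cn + e) * 1 := by
      refine mul_le_mul ?_ hQ1 hQ0 (by positivity)
      have : M * n ≤ M * √Cn := by gcongr
      linarith
    have e2 : 20 * m.supHessW * m.N₁.toReal * U * (n * √ρ)
        ≤ 20 * m.supHessW * m.N₁.toReal * CU * (√Cn * √Cn) := by gcongr
    rw [hA, hP]; linarith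
  -- the term with `D³W` is quadratic in the first derivatives and absorbed by `e`
  have hquad : m.c₀ / (d + 3) * ρ * V ^ 2 ≤ A * V + s * (V * (1 + V)) := by
    have e1 : d ^ 2 * C₃ * U ^ 2 * V ≤ e / 2 * Q * V := by
      have e2 : d ^ 2 * C₃ * U ^ 2 ≤ d ^ 2 * C₃ * (C₆ ^ 2 * Q * √η) := by gcongr
      have e3 : d ^ 2 * C₃ * (C₆ ^ 2 * Q * √η) = √η * T * Q := by rw [hT]; ring
      have e4 : √η * T ≤ e / 2 := by
        have := Real.sqrt_nonneg η
        linarith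
      have e5 : √η * T * Q ≤ e / 2 * Q := by gcongr
      exact mul_le_mul_of_nonneg_right (e2.trans (e3.le.trans e5)) hV
    refine hmain.trans ?_
    rw [hA]
    linarith
  have hfin := linear_of_quadratic (c := m.c₀ / (d + 3) * ρ) (S := S) hV hA0 hs0
    (hsc.trans (by linarith)) (hc0.trans_le hcρ) (by
      rw [hS]
      refine div_le_div₀ (by positivity) (by linarith) hc0 hcρ) hquad
  refine hfin.trans ?_
  have e6 : s * (1 + S) ≤ e / 2 * Q := by
    have e7 : s₁ * η * (1 + S) ≤ e / 2 := by
      have : 0 ≤ η * (1 + S) := by positivity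
      linarith
    calc s * (1 + S) = s₁ * η * (1 + S) * Q := by rw [hs]; ring
      _ ≤ _ := by gcongr
  rw [hA]
  linarith

end Model

end Kac

/-! ### The gradient and the Hessian of the translations -/

namespace Kac

open Filter Topology MeasureTheory

variable {d : ℕ}

section

variable {g : Vec d → Aff d} {y : Vec d}

lemma hasDerivAt_lin_moving {f : ℝ → Aff d} {f' : Aff d} {γ : ℝ → Vec d} {γ' : Vec d} {s : ℝ}
    (hf : HasDerivAt f f' s) (hγ : HasDerivAt γ γ' s) :
    HasDerivAt (fun s => lin (f s) (γ s)) (lin f' (γ s) + act (f s).1 γ') s := by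
  have h1 : HasDerivAt (fun s => actL d (f s).1) (actL d f'.1) s :=
    ((actL d) ∘L ContinuousLinearMap.fst ℝ (Mat d) (Vec d)).hasFDerivAt.comp_hasDerivAt s hf
  have h2 : HasDerivAt (fun s => (f s).2) f'.2 s :=
    (ContinuousLinearMap.snd ℝ (Mat d) (Vec d)).hasFDerivAt.comp_hasDerivAt s hf
  have h3 := (h1.clm_apply hγ).fun_add h2
  have e : lin f' (γ s) + act (f s).1 γ'
      = (actL d f'.1) (γ s) + (actL d (f s).1) γ' + f'.2 := by
    simp only [lin, actL_apply]; abel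
  rw [e]
  exact h3

lemma contDiffAt_lin_self {n : WithTop ℕ∞} (hg : ContDiffAt ℝ n g y) :
    ContDiffAt ℝ n (fun z => lin (g z) z) y := by
  have h1 : ContDiffAt ℝ n (fun z => actL d (g z).1) y :=
    (actL d).contDiff.contDiffAt.comp y (contDiff_fst.contDiffAt.comp y hg)
  exact (h1.clm_apply contDiffAt_id).add (contDiff_snd.contDiffAt.comp y hg)

lemma fderiv_lin_self (hg : DifferentiableAt ℝ g y) (hτ : DifferentiableAt ℝ (fun z => lin (g z) z) y)
    (e : Vec d) :
    fderiv ℝ (fun z => lin (g z) z) y e = lin (fderiv ℝ g y e) y + act (g y).1 e := by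
  have h1 := Model.hasDerivAt_comp_path hτ e
  have h2 := hasDerivAt_lin_moving (Model.hasDerivAt_comp_path hg e) (Model.hasDerivAt_path y e 0)
  simp only [zero_smul, add_zero] at h2
  exact h1.unique h2

lemma fderiv_fderiv_lin_self (hg : ContDiffAt ℝ 2 g y) (e e' : Vec d) :
    fderiv ℝ (fderiv ℝ (fun z => lin (g z) z)) y e' e
      = lin (fderiv ℝ (fderiv ℝ g) y e' e) y + act (fderiv ℝ g y e).1 e'
        + act (fderiv ℝ g y e').1 e := by
  have hτ := contDiffAt_lin_self hg
  have h1 : HasDerivAt (fun s : ℝ => fderiv ℝ (fun z => lin (g z) z) (y + s • e') e)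
      (fderiv ℝ (fderiv ℝ (fun z => lin (g z) z)) y e' e) 0 :=
    (ContinuousLinearMap.apply ℝ (Vec d) e).hasFDerivAt.comp_hasDerivAt (0 : ℝ)
      (Model.hasDerivAt_comp_path
        ((hτ.fderiv_right (m := 1) (by norm_num)).differentiableAt (by simp)) e')
  have hY : HasDerivAt (fun s : ℝ => fderiv ℝ g (y + s • e') e) (fderiv ℝ (fderiv ℝ g) y e' e) 0 :=
    (ContinuousLinearMap.apply ℝ (Aff d) e).hasFDerivAt.comp_hasDerivAt (0 : ℝ)
      (Model.hasDerivAt_comp_path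
        ((hg.fderiv_right (m := 1) (by norm_num)).differentiableAt (by simp)) e')
  have hA : HasDerivAt (fun s : ℝ => act (g (y + s • e')).1 e) (act (fderiv ℝ g y e').1 e) 0 :=
    (((actL d).flip e) ∘L ContinuousLinearMap.fst ℝ (Mat d) (Vec d)).hasFDerivAt.comp_hasDerivAt
      (0 : ℝ) (Model.hasDerivAt_comp_path (hg.differentiableAt (by simp)) e')
  have h2 := (hasDerivAt_lin_moving hY (Model.hasDerivAt_path y e' 0)).fun_add hA
  simp only [zero_smul, add_zero] at h2
  have hev : ∀ᶠ z in 𝓝 y, fderiv ℝ (fun z => lin (g z) z) z e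
      = lin (fderiv ℝ g z e) z + act (g z).1 e := by
    filter_upwards [hg.eventually (by simp), hτ.eventually (by simp)] with z hz hz'
    exact fderiv_lin_self (hz.differentiableAt (by simp)) (hz'.differentiableAt (by simp)) e
  have hc : Tendsto (fun s : ℝ => y + s • e') (𝓝 0) (𝓝 y) := by
    have := (Model.hasDerivAt_path y e' 0).continuousAt
    simpa [ContinuousAt] using this
  exact h1.unique (h2.congr_of_eventuallyEq (hc.eventually hev))

lemma recenter_snd (y : Vec d) (b : Aff d) : (recenter y b).2 = lin b y := by
  simp only [recenter, lin]; abel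

lemma cn_sq (l : ℝ) (y : Vec d) (b : Aff d) :
    cn l y b ^ 2 = l ^ 2 * ‖b.1‖ ^ 2 + ‖lin b y‖ ^ 2 := by
  rw [cn, affNorm_sq, recenter_snd]; rfl

lemma normSq_vec (v : Vec d) : ‖v‖ ^ 2 = ∑ i, v i ^ 2 := by
  rw [EuclideanSpace.norm_sq_eq]; simp

/-- The deviation of the gradient of the translations from the lattice matrix. -/
lemma normSq_gradMat_sub (hg : ContDiffAt ℝ 2 g y) (l : ℝ) :
    l ^ 2 * ‖gradMat (fun z => lin (g z) z) y - (g y).1‖ ^ 2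
      = ∑ j, ‖lin (uvec l g y j) y‖ ^ 2 := by
  have hτ := contDiffAt_lin_self hg
  have h : ∀ i j, (gradMat (fun z => lin (g z) z) y - (g y).1) i j
      = lin (fderiv ℝ g y (EuclideanSpace.single j 1)) y i := by
    intro i j
    rw [Matrix.sub_apply, gradMat, Matrix.of_apply,
      fderiv_lin_self (hg.differentiableAt (by simp)) (hτ.differentiableAt (by simp))]
    simp [act_apply]
  rw [normSq_eq_sum, Finset.sum_comm, Finset.mul_sum]
  refine Finset.sum_congr rfl fun j _ => ?_
  rw [uvec, Model.dir, map_smul, lin_smul, norm_smul, mul_pow, Real.norm_eq_abs, sq_abs, normSq_vec]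
  simp only [h]

lemma normU_sq_eq (hg : ContDiffAt ℝ 2 g y) (l : ℝ) :
    normU l g y ^ 2 = l ^ 2 * ∑ j, ‖(uvec l g y j).1‖ ^ 2
      + l ^ 2 * ‖gradMat (fun z => lin (g z) z) y - (g y).1‖ ^ 2 := by
  rw [normU_sq, normSq_gradMat_sub hg, Finset.mul_sum, ← Finset.sum_add_distrib]
  exact Finset.sum_congr rfl fun j _ => cn_sq _ _ _

lemma normSq_add_add_le {V : Type*} [SeminormedAddCommGroup V] (a b c : V) :
    ‖a + b + c‖ ^ 2 ≤ 3 * ‖a‖ ^ 2 + 3 * ‖b‖ ^ 2 + 3 * ‖c‖ ^ 2 := by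
  have h := norm_add₃_le (a := a) (b := b) (c := c)
  have h1 : ‖a + b + c‖ ^ 2 ≤ (‖a‖ + ‖b‖ + ‖c‖) ^ 2 := by gcongr
  have h2 := sq_nonneg (‖a‖ - ‖b‖)
  have h3 := sq_nonneg (‖a‖ - ‖c‖)
  have h4 := sq_nonneg (‖b‖ - ‖c‖)
  linarith

/-- The Hessian of the translations, by the product rule for `z ↦ A(z) z + t(z)`. -/
lemma hessNormSq_le (hg : ContDiffAt ℝ 2 g y) (l : ℝ) :
    l ^ 4 * hessNormSq (fun z => lin (g z) z) y
      ≤ 3 * normW l g y ^ 2 + 6 * (l ^ 2 * ∑ j, ‖(uvec l g y j).1‖ ^ 2) := by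
  have h1 : l ^ 4 * hessNormSq (fun z => lin (g z) z) y
      = ∑ t : Fin d × Fin d, ‖lin (wvec l g y t.1 t.2) y + act (uvec l g y t.2).1 (Model.dir l t.1)
        + act (uvec l g y t.1).1 (Model.dir l t.2)‖ ^ 2 := by
    have h2 : ∀ t : Fin d × Fin d, lin (wvec l g y t.1 t.2) y
        + act (uvec l g y t.2).1 (Model.dir l t.1) + act (uvec l g y t.1).1 (Model.dir l t.2)
        = l ^ 2 • fderiv ℝ (fderiv ℝ (fun z => lin (g z) z)) y (EuclideanSpace.single t.1 1)
          (EuclideanSpace.single t.2 1) := by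
      intro t
      rw [wvec, uvec, uvec, ← fderiv_fderiv_lin_self hg]
      simp only [Model.dir, map_smul, smul_smul, _root_.smul_apply, sq]
    simp only [h2, norm_smul, mul_pow, normSq_vec, norm_pow, Real.norm_eq_abs, sq_abs]
    rw [← Finset.mul_sum, Fintype.sum_prod_type, hessNormSq, ← pow_mul]
    congr 1
    calc _ = ∑ j, ∑ i, ∑ k, (fderiv ℝ (fderiv ℝ fun z => lin (g z) z) y
          (EuclideanSpace.single k 1) (EuclideanSpace.single j 1) i) ^ 2 := Finset.sum_comm
      _ = ∑ j, ∑ k, ∑ i, (fderiv ℝ (fderiv ℝ fun z => lin (g z) z) y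
          (EuclideanSpace.single k 1) (EuclideanSpace.single j 1) i) ^ 2 :=
        Finset.sum_congr rfl fun j _ => Finset.sum_comm
      _ = _ := Finset.sum_comm
  have h3 : ∀ j, ∑ i, ‖act (uvec l g y j).1 (Model.dir l i)‖ ^ 2 = l ^ 2 * ‖(uvec l g y j).1‖ ^ 2 := by
    intro j
    rw [normSq_eq_sum_act, Finset.mul_sum]
    refine Finset.sum_congr rfl fun i _ => ?_
    rw [Model.dir, act_smul_right, norm_smul, mul_pow, Real.norm_eq_abs, sq_abs]
  have h4 : ∑ t : Fin d × Fin d, ‖act (uvec l g y t.1).1 (Model.dir l t.2)‖ ^ 2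
      = l ^ 2 * ∑ j, ‖(uvec l g y j).1‖ ^ 2 := by
    rw [Fintype.sum_prod_type, Finset.mul_sum]
    exact Finset.sum_congr rfl fun j _ => h3 j
  have h5 : ∑ t : Fin d × Fin d, ‖act (uvec l g y t.2).1 (Model.dir l t.1)‖ ^ 2
      = l ^ 2 * ∑ j, ‖(uvec l g y j).1‖ ^ 2 := by
    rw [Fintype.sum_prod_type, Finset.sum_comm, Finset.mul_sum]
    exact Finset.sum_congr rfl fun j _ => h3 j
  have h6 : ∑ t : Fin d × Fin d, ‖lin (wvec l g y t.1 t.2) y‖ ^ 2 ≤ normW l g y ^ 2 := by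
    rw [normW_sq]
    refine Finset.sum_le_sum fun t _ => ?_
    rw [cn_sq]
    have : 0 ≤ l ^ 2 * ‖(wvec l g y t.1 t.2).1‖ ^ 2 := by positivity
    linarith
  rw [h1]
  calc _ ≤ ∑ t : Fin d × Fin d, (3 * ‖lin (wvec l g y t.1 t.2) y‖ ^ 2
          + 3 * ‖act (uvec l g y t.2).1 (Model.dir l t.1)‖ ^ 2
          + 3 * ‖act (uvec l g y t.1).1 (Model.dir l t.2)‖ ^ 2) :=
        Finset.sum_le_sum fun t _ => normSq_add_add_le _ _ _
    _ = 3 * (∑ t : Fin d × Fin d, ‖lin (wvec l g y t.1 t.2) y‖ ^ 2)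
        + 6 * (l ^ 2 * ∑ j, ‖(uvec l g y j).1‖ ^ 2) := by
        rw [Finset.sum_add_distrib, Finset.sum_add_distrib, ← Finset.mul_sum, ← Finset.mul_sum,
          ← Finset.mul_sum, h4, h5]
        ring
    _ ≤ _ := by linarith

/-- The first and second derivatives of the translations in terms of those of the branch. -/
lemma grad_add_hess_le (hg : ContDiffAt ℝ 2 g y) (l : ℝ) :
    1 / 2 * (l ^ 2 * ‖gradMat (fun z => lin (g z) z) y - (g y).1‖ ^ 2)
        + 1 / 5 * (l ^ 4 * hessNormSq (fun z => lin (g z) z) y)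
      ≤ 6 / 5 * normU l g y ^ 2 + 3 / 5 * normW l g y ^ 2 := by
  have h1 := hessNormSq_le hg l
  have h2 := normU_sq_eq hg l
  have h3 : 0 ≤ l ^ 2 * ‖gradMat (fun z => lin (g z) z) y - (g y).1‖ ^ 2 := by positivity
  linarith

lemma norm_gradMat_sub_le (hg : ContDiffAt ℝ 2 g y) {l : ℝ} (hl : 0 < l) :
    ‖gradMat (fun z => lin (g z) z) y - (g y).1‖ ≤ l⁻¹ * normU l g y := by
  rw [inv_mul_eq_div, le_div_iff₀ hl, mul_comm]
  refine le_of_sq_le_sq ?_ (normU_nonneg _ _ _)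
  have h2 := normU_sq_eq hg l
  have h3 : 0 ≤ l ^ 2 * ∑ j, ‖(uvec l g y j).1‖ ^ 2 := by positivity
  rw [mul_pow]
  linarith

end

end Kac

/-! ### The constants of the gradient estimate -/

namespace Kac

open Filter Topology MeasureTheory

variable {d : ℕ}

namespace Model

variable {m : Model d}

lemma CA_pos (m : Model d) (hd : 1 ≤ d) : 0 < m.CA := by
  have hE : 0 < m.E.det := m.E_mem
  have h1 : 0 < opNorm m.E ^ (d - 1) := by
    rcases Nat.lt_or_ge 1 d with h | h
    · have h2 := opNorm_inv_mul_det_le (M := m.E) hE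
      have h3 : 0 < opNorm m.E⁻¹ := by
        have h4 := norm_inv_pos hd hE.ne'
        have h5 := norm_le_sqrt_mul_opNorm m.E⁻¹
        by_contra h6
        have h7 : opNorm m.E⁻¹ = 0 := le_antisymm (not_lt.1 h6) (opNorm_nonneg _)
        rw [h7, mul_zero] at h5
        linarith
      exact lt_of_lt_of_le (by positivity) h2
    · have : d - 1 = 0 := by omega
      rw [this]; simp
  unfold CA
  positivity

lemma Crep_pos (m : Model d) (hd : 1 ≤ d) : 0 < m.Crep := by
  have hE : 0 < m.E.det := m.E_mem
  have h1 := m.CA_pos hd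
  have h2 := m.C₀W_pos
  have h3 := m.C₁W_pos
  unfold Crep
  positivity

/-- The value of `C_{∇2}^{-1/2}` if all norms of roots of the cut-off are finite. -/
noncomputable def gradConst₂ (m : Model d) (Cc X : ℝ) : ℝ :=
  √m.αGrad / Cc * (m.N₁.toReal ^ 2 + m.N₂.toReal + 2 * m.N₄.toReal ^ 2) * (d * √(2 ^ d * X))
    + √m.αGrad / Cc ^ 2 * m.supHessW * m.N₁.toReal * (√(2 ^ d) * m.N₁.toReal)
      * (16 * √(2 ^ d) * X + √(8 * d) * √X)

lemma invSqrtCgrad2_eq (h1 : m.N₁ ≠ ⊤) (h2 : m.N₂ ≠ ⊤) (h4 : m.N₄ ≠ ⊤) {Cc X : ℝ} (hC : 0 < Cc)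
    (hX : 0 ≤ X) : m.invSqrtCgrad2 Cc X = ENNReal.ofReal (m.gradConst₂ Cc X) := by
  have hH : 0 ≤ m.supHessW := ENNReal.toReal_nonneg
  have e1 : m.N₁ = ENNReal.ofReal m.N₁.toReal := (ENNReal.ofReal_toReal h1).symm
  have e2 : m.N₂ = ENNReal.ofReal m.N₂.toReal := (ENNReal.ofReal_toReal h2).symm
  have e4 : m.N₄ = ENNReal.ofReal m.N₄.toReal := (ENNReal.ofReal_toReal h4).symm
  have e5 : (2 : ℝ≥0∞) = ENNReal.ofReal 2 := by simp
  have p1 : m.N₁ ^ 2 + m.N₂ + 2 * m.N₄ ^ 2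
      = ENNReal.ofReal (m.N₁.toReal ^ 2 + m.N₂.toReal + 2 * m.N₄.toReal ^ 2) := by
    rw [ENNReal.ofReal_add (by positivity) (by positivity),
      ENNReal.ofReal_add (by positivity) (by positivity), ENNReal.ofReal_mul (by norm_num),
      ENNReal.ofReal_pow (by positivity), ENNReal.ofReal_pow (by positivity), ← e1, ← e2, ← e4, ← e5]
  have p2 : ENNReal.ofReal (√m.αGrad / Cc ^ 2 * m.supHessW) * m.N₁
        * (ENNReal.ofReal (√(2 ^ d)) * m.N₁)
      = ENNReal.ofReal (√m.αGrad / Cc ^ 2 * m.supHessW * m.N₁.toReal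
        * (√(2 ^ d) * m.N₁.toReal)) := by
    rw [ENNReal.ofReal_mul (q := √(2 ^ d) * m.N₁.toReal) (by positivity),
      ENNReal.ofReal_mul (p := √m.αGrad / Cc ^ 2 * m.supHessW) (by positivity),
      ENNReal.ofReal_mul (Real.sqrt_nonneg _), ← e1]
  rw [invSqrtCgrad2, p1, p2, ← ENNReal.ofReal_mul (by positivity),
    ← ENNReal.ofReal_mul (by positivity), ← ENNReal.ofReal_mul (by positivity),
    ← ENNReal.ofReal_add (by positivity) (by positivity), gradConst₂]

lemma Cgrad_eq (hd : 1 ≤ d) (h1 : m.N₁ ≠ ⊤) (h2 : m.N₂ ≠ ⊤) (h4 : m.N₄ ≠ ⊤) {Cc X : ℝ}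
    (hC : 0 < Cc) (hX : 0 ≤ X) : m.Cgrad Cc X = (m.Crep * (m.gradConst₂ Cc X ^ 2
      + (√m.αGrad * m.N₁.toReal * √(2 ^ d * X) / Cc) ^ 2))⁻¹ := by
  have hH : 0 ≤ m.supHessW := ENNReal.toReal_nonneg
  have hα := m.αGrad_pos
  have e1 : m.N₁ = ENNReal.ofReal m.N₁.toReal := (ENNReal.ofReal_toReal h1).symm
  have hg : 0 ≤ m.gradConst₂ Cc X := by unfold gradConst₂; positivity
  have hr := m.Crep_pos hd
  have p1 : ENNReal.ofReal (m.αGrad * 2 ^ d / Cc ^ 2 * X) * m.N₁ ^ 2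
      = ENNReal.ofReal ((√m.αGrad * m.N₁.toReal * √(2 ^ d * X) / Cc) ^ 2) := by
    rw [e1, ← ENNReal.ofReal_pow (by positivity), ← ENNReal.ofReal_mul (by positivity), ← e1]
    congr 1
    rw [div_pow, mul_pow, mul_pow, Real.sq_sqrt hα.le, Real.sq_sqrt (by positivity)]
    ring
  rw [Cgrad, invSqrtCgrad2_eq h1 h2 h4 hC hX, p1, ← ENNReal.ofReal_pow hg,
    ← ENNReal.ofReal_add (by positivity) (by positivity), ← ENNReal.ofReal_mul hr.le,
    ENNReal.toReal_inv, ENNReal.toReal_ofReal (by positivity)]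

/-- If one of the norms of roots of the cut-off is infinite, the gradient constant vanishes. -/
lemma Cgrad_eq_zero (hd : 1 ≤ d) (h : ¬ (m.N₁ ≠ ⊤ ∧ m.N₂ ≠ ⊤ ∧ m.N₄ ≠ ⊤)) {Cc X : ℝ}
    (hC : 0 < Cc) (hX : 0 < X) : m.Cgrad Cc X = 0 := by
  have hα := m.αGrad_pos
  have hr := m.Crep_pos hd
  have hd' : (0 : ℝ) < d := by exact_mod_cast hd
  have h1 : m.N₁ ^ 2 + m.N₂ + 2 * m.N₄ ^ 2 = ⊤ := by
    by_contra h2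
    refine h ⟨?_, ?_, ?_⟩ <;> rintro h3 <;> simp [h3] at h2
  have h2 : m.invSqrtCgrad2 Cc X = ⊤ := by
    rw [invSqrtCgrad2, h1, ENNReal.mul_top (ENNReal.ofReal_pos.2 (by positivity)).ne',
      ENNReal.top_mul (ENNReal.ofReal_pos.2 (by positivity)).ne', top_add]
  rw [Cgrad, h2, ENNReal.top_pow two_ne_zero, top_add, ENNReal.mul_top (by simpa using hr)]
  simp

/-- The square root of the cut-off is not constant. -/
lemma N₁_toReal_pos (hd : 1 ≤ d) (h1 : m.N₁ ≠ ⊤) : 0 < m.N₁.toReal := by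
  by_contra h
  have h0 : m.N₁.toReal = 0 := le_antisymm (not_lt.1 h) ENNReal.toReal_nonneg
  have h2 : ∀ x, fderiv ℝ m.φt x = 0 := by
    intro x
    have := m.norm_dφ_le h1 x
    rw [h0] at this
    simpa [dφ] using this
  have h3 := is_const_of_fderiv_eq_zero (𝕜 := ℝ) (f := m.φt)
    ((m.contDiff_φt (n := 1)).differentiable (by simp)) h2 0
    ((2 : ℝ) • EuclideanSpace.single (⟨0, hd⟩ : Fin d) (1 : ℝ))
  rw [m.φt_one (by simp), m.φt_zero (by simp [norm_smul])] at h3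
  exact one_ne_zero h3

/-- The convexity constant is smaller than the modulus of convexity of the misfit. -/
lemma Ccon_le_modulus (hd : 1 ≤ d) {ρ D : ℝ} (h : (d + 3) * ρ ^ 2 ≤ (d + 9) * D ^ 2) (hD : 0 < D) :
    m.Ccon ρ D ≤ m.c₀ / (d + 3) ∧ (d = 1 → 2 * m.Ccon ρ D ≤ m.c₀ / (d + 3)) := by
  have hc := m.c₀_pos
  have h1 := m.Ccon_le hd ρ D
  constructor
  · refine h1.trans ?_
    rw [div_eq_mul_inv]
    refine mul_le_mul_of_nonneg_left ((min_le_right _ _).trans ?_) hc.le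
    rw [← one_div, one_div_mul_eq_div, div_div, div_le_div_iff₀ (by positivity) (by positivity)]
    linarith
  · intro h2
    have h3 : m.c₀ * min (1 / 12) (1 / (9 + d) * (ρ ^ 2 / D ^ 2)) ≤ m.c₀ * (1 / 12) :=
      mul_le_mul_of_nonneg_left (min_le_left _ _) hc.le
    subst h2
    norm_num at h1 h3 ⊢
    linarith

lemma four_fifths_le (hd : 1 ≤ d) {a b c C : ℝ} (ha : 0 ≤ a) (hb : 0 ≤ b) (hC : 0 < C)
    (hCc : C ≤ c) (hCc1 : d = 1 → 2 * C ≤ c) :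
    4 / 5 * (4 * a + √d * b) * C ≤ (b + 2 * a) * d * c := by
  have hc : 0 < c := hC.trans_le hCc
  have hd' : (1 : ℝ) ≤ d := by exact_mod_cast hd
  have hs : √(d : ℝ) ≤ d := by
    rw [Real.sqrt_le_left (by positivity)]
    have := mul_le_mul_of_nonneg_right hd' (by positivity : (0 : ℝ) ≤ d)
    linarith [sq (d : ℝ)]
  have h1 : 4 / 5 * (√d * b) * C ≤ b * d * c := by
    calc 4 / 5 * (√d * b) * C ≤ 1 * (d * b) * c := by gcongr; norm_num
      _ = _ := by ring
  have h2 : 4 / 5 * (4 * a) * C ≤ 2 * a * d * c := by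
    rcases Nat.lt_or_ge 1 d with h | h
    · have h3 : (2 : ℝ) ≤ d := by exact_mod_cast h
      calc 4 / 5 * (4 * a) * C ≤ 2 * a * 2 * c := by
            have : a * C ≤ a * c := by gcongr
            have : 0 ≤ a * c := by positivity
            linarith
        _ ≤ _ := by gcongr
    · have h3 : d = 1 := le_antisymm h hd
      have h4 := hCc1 h3
      have : a * (2 * C) ≤ a * c := by gcongr
      have : 0 ≤ a * c := by positivity
      rw [h3]; push_cast
      linarith
  linarith

lemma sq_add_le (x e : ℝ) : (x + e) ^ 2 ≤ 11 / 10 * x ^ 2 + 11 * e ^ 2 := by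
  have := sq_nonneg (x - 10 * e)
  linarith

lemma two_sqrt_le {a : ℝ} (ha : 0 ≤ a) : 2 * √(5 * (a / 32)) ≤ 4 / 5 * √a := by
  have h : 5 * (a / 32) ≤ (2 / 5 * √a) ^ 2 := by
    rw [mul_pow, Real.sq_sqrt ha]; linarith
  have := (Real.sqrt_le_left (by positivity)).2 h
  linarith

/-- The elementary estimate that combines the bounds on the two derivatives `u` and `w` of the
branch; `Q` is the root of the misfit, `n₁`, `n₂`, `n₄` are the norms of the roots of the
cut-off. -/
lemma combine_bounds (hd : 1 ≤ d) {c C α H n₁ n₂ n₄ Y R Q u w e₀ : ℝ} (hα : 0 < α) (hH : 0 ≤ H)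
    (hn₁ : 0 < n₁) (hn₂ : 0 ≤ n₂) (hY : 1 ≤ Y) (hR : 0 < R) (hQ : 0 ≤ Q) (hu : 0 ≤ u) (hw : 0 ≤ w)
    (hC : 0 < C) (hCc : C ≤ c) (hCc1 : d = 1 → 2 * C ≤ c) (he₀ : 0 ≤ e₀)
    (he : 20 * e₀ ≤ √α * n₁ * R)
    (hU : c * R ^ 2 * u ≤ (n₁ * (4 / 5 * √α) * (Y * R) + e₀) * Q)
    (hW : c * R ^ 2 * w ≤ ((4 * n₄ ^ 2 + √d * n₂) * (4 / 5 * √α) * (Y * R) + e₀) * Q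
      + 20 * H * n₁ * u * (Y * R * R)) :
    10 / 9 * (6 / 5 * u ^ 2 + 3 / 5 * w ^ 2) * R ^ 2
      ≤ ((√α / C * (n₁ ^ 2 + n₂ + 2 * n₄ ^ 2) * (d * Y)
          + √α / C ^ 2 * H * n₁ ^ 2 * (16 * Y ^ 2 + √(8 * d) * Y)) ^ 2
        + (√α * n₁ * Y / C) ^ 2) * Q ^ 2 := by
  have hc : 0 < c := hC.trans_le hCc
  have hd' : (1 : ℝ) ≤ d := by exact_mod_cast hd
  have hs8 : 1 ≤ √(8 * (d : ℝ)) := by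
    rw [Real.one_le_sqrt]; linarith
  have hsα : 0 < √α := Real.sqrt_pos.2 hα
  set K₁ := √α * n₁ * Y / C with hK₁
  set C₂ := √α / C * (n₁ ^ 2 + n₂ + 2 * n₄ ^ 2) * (d * Y)
          + √α / C ^ 2 * H * n₁ ^ 2 * (16 * Y ^ 2 + √(8 * d) * Y) with hC₂
  have hK₁0 : 0 < K₁ := by positivity
  have hC₂0 : 0 ≤ C₂ := by positivity
  -- the error terms are small compared to `K₁`
  have heK : e₀ / (c * R) ≤ K₁ / 20 := by
    rw [hK₁, div_div, div_le_div_iff₀ (by positivity) (by positivity)]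
    calc e₀ * (C * 20) = 20 * e₀ * C := by ring
      _ ≤ (√α * n₁ * R) * c := by gcongr
      _ = √α * n₁ * 1 * (c * R) := by ring
      _ ≤ _ := by gcongr
  have hU' : u * R ≤ ((4 / 5 * (√α * n₁ * Y)) / c + e₀ / (c * R)) * Q := by
    have h1 : u * R = c * R ^ 2 * u / (c * R) := by field_simp
    rw [h1, div_le_iff₀ (by positivity)]
    refine hU.trans (le_of_eq ?_)
    field_simp
  have hUK : u * R ≤ (4 / 5 * K₁ + K₁ / 20) * Q := by
    refine hU'.trans ?_
    have h1 : (4 / 5 * (√α * n₁ * Y)) / c ≤ 4 / 5 * K₁ := by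
      rw [hK₁, mul_div_assoc]
      gcongr
    gcongr
  have hW' : w * R ≤ (C₂ + K₁ / 20) * Q := by
    have h1 : w * R = c * R ^ 2 * w / (c * R) := by field_simp
    have h2 : w * R ≤ ((4 / 5 * (4 * n₄ ^ 2 + √d * n₂) * (√α * Y)) / c + e₀ / (c * R)) * Q
        + 20 * H * n₁ * Y / c * (u * R) := by
      rw [h1, div_le_iff₀ (by positivity)]
      refine hW.trans (le_of_eq ?_)
      field_simp
    have h3 : 20 * H * n₁ * Y / c * (u * R)
        ≤ (√α / C ^ 2 * H * n₁ ^ 2 * (16 * Y ^ 2 + √(8 * d) * Y)) * Q := by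
      have h4 : 20 * H * n₁ * Y / c * (u * R)
          ≤ 20 * H * n₁ * Y / c * (((4 / 5 * (√α * n₁ * Y)) / c + e₀ / (c * R)) * Q) := by gcongr
      refine h4.trans ?_
      rw [← mul_assoc]
      refine mul_le_mul_of_nonneg_right ?_ hQ
      have h5 : 20 * (e₀ / (c * R)) ≤ √α * n₁ / c := by
        rw [mul_div_assoc', div_le_div_iff₀ (by positivity) hc]
        calc 20 * e₀ * c ≤ √α * n₁ * R * c := by gcongr
          _ = _ := by ring
      calc 20 * H * n₁ * Y / c * ((4 / 5 * (√α * n₁ * Y)) / c + e₀ / (c * R))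
          = H * n₁ * Y / c * (16 * (√α * n₁ * Y) / c + 20 * (e₀ / (c * R))) := by ring
        _ ≤ H * n₁ * Y / c * (16 * (√α * n₁ * Y) / c + √α * n₁ / c) := by gcongr
        _ = √α / c ^ 2 * H * n₁ ^ 2 * (16 * Y ^ 2 + 1 * Y) := by field_simp
        _ ≤ _ := by gcongr
    have h6 : (4 / 5 * (4 * n₄ ^ 2 + √d * n₂) * (√α * Y)) / c
        ≤ √α / C * (n₁ ^ 2 + n₂ + 2 * n₄ ^ 2) * (d * Y) := by
      have h7 := four_fifths_le hd (sq_nonneg n₄) hn₂ hC hCc hCc1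
      rw [div_le_iff₀ hc]
      have h8 : √α / C * (n₁ ^ 2 + n₂ + 2 * n₄ ^ 2) * (d * Y) * c
          = (√α * Y) * ((n₁ ^ 2 + n₂ + 2 * n₄ ^ 2) * d * c / C) := by field_simp
      rw [h8, mul_comm]
      refine mul_le_mul_of_nonneg_left ?_ (by positivity)
      rw [le_div_iff₀ hC]
      refine h7.trans ?_
      gcongr
      have := sq_nonneg n₁
      linarith
    calc w * R ≤ _ := h2
      _ ≤ (√α / C * (n₁ ^ 2 + n₂ + 2 * n₄ ^ 2) * (d * Y) + K₁ / 20) * Q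
          + (√α / C ^ 2 * H * n₁ ^ 2 * (16 * Y ^ 2 + √(8 * d) * Y)) * Q := by gcongr
      _ = _ := by rw [hC₂]; ring
  -- `(x + e)² ≤ 11/10 x² + 11 e²` leaves enough room for the weights `4/3` and `2/3` below
  have hUsq : (u * R) ^ 2 ≤ (11 / 10 * (4 / 5 * K₁) ^ 2 + 11 * (K₁ / 20) ^ 2) * Q ^ 2 := by
    have h1 : 0 ≤ u * R := by positivity
    calc (u * R) ^ 2 ≤ ((4 / 5 * K₁ + K₁ / 20) * Q) ^ 2 := by gcongr
      _ = (4 / 5 * K₁ + K₁ / 20) ^ 2 * Q ^ 2 := mul_pow _ _ _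
      _ ≤ _ := by gcongr; exact sq_add_le _ _
  have hWsq : (w * R) ^ 2 ≤ (11 / 10 * C₂ ^ 2 + 11 * (K₁ / 20) ^ 2) * Q ^ 2 := by
    have h1 : 0 ≤ w * R := by positivity
    calc (w * R) ^ 2 ≤ ((C₂ + K₁ / 20) * Q) ^ 2 := by gcongr
      _ = (C₂ + K₁ / 20) ^ 2 * Q ^ 2 := mul_pow _ _ _
      _ ≤ _ := by gcongr; exact sq_add_le _ _
  have e1 : 0 ≤ K₁ ^ 2 * Q ^ 2 := by positivity
  have e2 : 0 ≤ C₂ ^ 2 * Q ^ 2 := by positivity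
  have e3 : 10 / 9 * (6 / 5 * u ^ 2 + 3 / 5 * w ^ 2) * R ^ 2
      = 4 / 3 * (u * R) ^ 2 + 2 / 3 * (w * R) ^ 2 := by ring
  rw [e3]
  linarith

end Model

end Kac

/-! ### The gradient part of the energy -/

namespace Kac

open Filter Topology MeasureTheory

variable {d : ℕ}

/-- The translation of the lattice `a`, read off at the origin instead of `z`. -/
noncomputable def unanchor (z : Vec d) (a : Aff d) : Aff d := (a.1, a.2 - act a.1 z)

lemma lin_unanchor (z : Vec d) (a : Aff d) (p : Vec d) : lin (unanchor z a) p = lin a (p - z) := by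
  simp only [lin, unanchor, act_sub_right]; abel

lemma lin_unanchor_self (z : Vec d) (a : Aff d) : lin (unanchor z a) z = a.2 := by
  rw [lin_unanchor, sub_self, lin, act_zero_right, zero_add]

lemma contDiffAt_unanchor {n : WithTop ℕ∞} {f : Vec d → Aff d} {y : Vec d}
    (hf : ContDiffAt ℝ n f y) : ContDiffAt ℝ n (fun z => unanchor z (f z)) y := by
  have h1 : ContDiffAt ℝ n (fun z => actL d (f z).1) y :=
    (actL d).contDiff.contDiffAt.comp y (contDiff_fst.contDiffAt.comp y hf)
  exact (contDiff_fst.contDiffAt.comp y hf).prodMk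
    ((contDiff_snd.contDiffAt.comp y hf).sub (h1.clm_apply contDiffAt_id))

namespace Model

variable {m : Model d}

lemma mis_unanchor (l : ℝ) (χ : Finset (Vec d)) (f : Vec d → Aff d) (y : Vec d) :
    m.mis l χ (fun z => unanchor z (f z)) y = m.misfit l (f y) χ y := by
  simp only [mis, avg, misfit, lin_unanchor]

lemma eqn_unanchor (hd : 1 ≤ d) (l : ℝ) (χ : Finset (Vec d)) {f : Vec d → Aff d} {z : Vec d}
    (hdet : (f z).1.det ≠ 0) (h : ∀ b, m.dJ l (f z) χ z b = 0) (b : Aff d) :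
    m.eqn l χ (fun z => unanchor z (f z)) b z = 0 := by
  have hq := (invSq_pos hd hdet).ne'
  have h1 : m.eqn l χ (fun z => unanchor z (f z)) b z
      = (invSq (f z).1)⁻¹ * m.dJ l (f z) χ z (recenter z b) := by
    rw [eqn, mis_unanchor, dJ, mul_add, dMisfit]
    simp only [avg, lin_unanchor, ← lin_recenter z b]
    rw [inv_mul_cancel_left₀ hq, add_comm]
    congr 1
    change ((invSq (f z).1)⁻¹ • fderiv ℝ (invSq (d := d)) (f z).1) b.1 * _ = _
    rw [_root_.smul_apply, smul_eq_mul, mul_assoc]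
    rfl
  rw [h1, h, mul_zero]

/-- A branch of critical points in the ball of convexity satisfies the standing assumptions of the
derivative estimates. -/
lemma UnifConvex.crit (hd : 1 ≤ d) {K r l η : ℝ} (hK : 0 < K) {χ : Finset (Vec d)} {y : Vec d}
    {a₀ : Aff d} (H : m.UnifConvex K r l χ y a₀) {f : Vec d → Aff d} (h1 : 1 ≤ η * l)
    (hf : affNorm l (f y - a₀) ≤ r) (hρ : (2 * K)⁻¹ ≤ m.rho l χ y) (hm : m.misfit l (f y) χ y ≤ η)
    (hC : ContDiffAt ℝ 2 f y) (hcrit : ∀ᶠ z in 𝓝 y, ∀ b, m.dJ l (f z) χ z b = 0) :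
    m.Crit (2 * K) η l χ (fun z => unanchor z (f z)) y where
  one_le := h1
  mem := by have := H.mem (f y) hf; exact this
  rho_ge := hρ
  hess := fun b => by
    have := H.hess _ hf (recenter y b)
    simpa only [ddMisfit, avg, lin_unanchor, lin_recenter, cn] using this
  mis_le := by rw [mis_unanchor]; exact hm
  contDiff := contDiffAt_unanchor hC
  crit := by
    have hdet : ∀ᶠ z in 𝓝 y, (f z).1.det ≠ 0 := by
      have hc : ContinuousAt (fun z => (f z).1.det) y :=
        (continuous_det.comp continuous_fst).continuousAt.comp hC.continuousAt
      exact hc.eventually_ne (H.det_ne hK hf)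
    filter_upwards [hdet, hcrit] with z hz hz' b
    exact eqn_unanchor hd l χ hz hz' b

/-- The energy of the first two derivatives of the branch is controlled by its misfit. -/
lemma exists_grad_energy_le (m : Model d) (hd : 1 ≤ d) {K : ℝ} (hK : 0 < K) :
    ∃ η₀ > 0, ∀ η > 0, η ≤ η₀ → ∀ l > 0, ∀ χ : Finset (Vec d), m.HardCore χ →
      ∀ (g : Vec d → Aff d) (y : Vec d), m.Crit K η l χ g y → ∀ D : ℝ, 0 < D →
      (d + 3) * m.rho l χ y ^ 2 ≤ (d + 9) * D ^ 2 →
      0 ≤ m.Cgrad (m.Ccon (m.rho l χ y) D) (m.rho (2 * l) χ y / m.rho l χ y) ∧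
      m.Crep * m.Cgrad (m.Ccon (m.rho l χ y) D) (m.rho (2 * l) χ y / m.rho l χ y)
        * (10 / 9 * (6 / 5 * normU l g y ^ 2 + 3 / 5 * normW l g y ^ 2) * m.rho l χ y)
        ≤ m.mis l χ g y := by
  have hKi : 0 < K⁻¹ := inv_pos.2 hK
  have hX : ∀ l > 0, ∀ χ : Finset (Vec d), ∀ y, K⁻¹ ≤ m.rho l χ y →
      m.count l χ y ≤ 2 ^ d * (m.rho (2 * l) χ y / m.rho l χ y) * m.rho l χ y ∧
      1 ≤ 2 ^ d * (m.rho (2 * l) χ y / m.rho l χ y) := by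
    intro l hl χ y hρ
    have hρ0 : 0 < m.rho l χ y := hKi.trans_le hρ
    have h1 : 2 ^ d * (m.rho (2 * l) χ y / m.rho l χ y) * m.rho l χ y = 2 ^ d * m.rho (2 * l) χ y := by
      field_simp
    have h2 := count_le (m := m) hl χ y
    have h3 := rho_le_count (m := m) hl χ y
    refine ⟨by rw [h1]; exact h2, ?_⟩
    refine le_of_mul_le_mul_right ?_ hρ0
    rw [h1, one_mul]; exact h3.trans h2
  have hXpos : ∀ X : ℝ, 1 ≤ 2 ^ d * X → 0 < X := by
    intro X hX
    by_contra h
    have := mul_nonpos_of_nonneg_of_nonpos (by positivity : (0 : ℝ) ≤ 2 ^ d) (not_lt.1 h)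
    linarith
  -- if one of the norms is infinite, the constant vanishes and the estimate is trivial
  by_cases hN : m.N₁ ≠ ⊤ ∧ m.N₂ ≠ ⊤ ∧ m.N₄ ≠ ⊤
  swap
  · refine ⟨1, one_pos, fun η _ _ l hl χ _ g y h D hD _ => ?_⟩
    have hρ0 : 0 < m.rho l χ y := hKi.trans_le h.rho_ge
    rw [Cgrad_eq_zero hd hN (m.Ccon_pos hρ0 hD) (hXpos _ (hX l hl χ y h.rho_ge).2)]
    simpa using mis_nonneg hl χ g y
  obtain ⟨h1, h2, h4⟩ := hN
  have hα := m.αGrad_pos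
  have hn₁ := N₁_toReal_pos (m := m) hd h1
  -- a fixed fraction of the main term, since `ρ ≥ K⁻¹`
  set e₀ := √m.αGrad * m.N₁.toReal * √K⁻¹ / 20 with he₀
  have he₀0 : 0 < e₀ := by positivity
  obtain ⟨η₁, hη₁, HU⟩ := m.exists_normU_le_sqrt hd h1 hK he₀0
  obtain ⟨η₂, hη₂, HW⟩ := m.exists_normW_le_sqrt hd h1 h2 h4 hK he₀0
  refine ⟨min η₁ η₂, by positivity, fun η hη hηη l hl χ hχ g y h D hD hDρ => ?_⟩
  have hU := HU η hη (hηη.trans (min_le_left _ _)) l hl χ hχ g y h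
  have hW := HW η hη (hηη.trans (min_le_right _ _)) l hl χ hχ g y h
  have hρ0 : 0 < m.rho l χ y := hKi.trans_le h.rho_ge
  obtain ⟨hcnt, hX1⟩ := hX l hl χ y h.rho_ge
  have hXp := hXpos _ hX1
  have hCp := m.Ccon_pos hρ0 hD
  have hCle := Ccon_le_modulus (m := m) hd hDρ hD
  have hRρ := Real.sqrt_le_sqrt h.rho_ge
  have hr := m.Crep_pos hd
  have hn2 := ENNReal.toReal_nonneg (a := m.N₂)
  have hH : 0 ≤ m.supHessW := ENNReal.toReal_nonneg
  have hm0 := mis_nonneg (m := m) hl χ g y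
  rw [Cgrad_eq hd h1 h2 h4 hCp hXp.le]
  set X := m.rho (2 * l) χ y / m.rho l χ y with hXd
  set Cc := m.Ccon (m.rho l χ y) D with hCc
  set ρ := m.rho l χ y with hρ
  have hY1 : 1 ≤ √(2 ^ d * X) := Real.one_le_sqrt.2 hX1
  have hncnt : √(m.count l χ y) ≤ √(2 ^ d * X) * √ρ := by
    rw [← Real.sqrt_mul (by positivity)]
    exact Real.sqrt_le_sqrt hcnt
  have hsα := two_sqrt_le hα.le
  have hRR : √ρ * √ρ = ρ := Real.mul_self_sqrt hρ0.le
  have hRR2 : √ρ ^ 2 = ρ := Real.sq_sqrt hρ0.le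
  have hQQ : √(m.mis l χ g y) ^ 2 = m.mis l χ g y := Real.sq_sqrt hm0
  have hU0 := normU_nonneg l g y
  have hW0 := normW_nonneg l g y
  set n₁ := m.N₁.toReal with hn₁d
  set n₂ := m.N₂.toReal with hn₂d
  set n₄ := m.N₄.toReal with hn₄d
  set Q := √(m.mis l χ g y) with hQ
  have hQ0 : 0 ≤ Q := Real.sqrt_nonneg _
  set u := normU l g y with hu
  set w := normW l g y with hw
  set s := √(5 * (m.αGrad / 32)) with hs
  have hs0 : 0 ≤ s := Real.sqrt_nonneg _
  set n := √(m.count l χ y) with hn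
  have hn0 : 0 ≤ n := Real.sqrt_nonneg _
  set R := √ρ with hR
  have hR0 : 0 < R := Real.sqrt_pos.2 hρ0
  set Y := √(2 ^ d * X) with hY
  have hcomb := combine_bounds (n₂ := n₂) (n₄ := n₄) (e₀ := e₀) (α := m.αGrad) (u := u) (w := w) hd hα hH
    hn₁ hn2 hY1 hR0 hQ0 hU0 hW0 hCp hCle.1 hCle.2 he₀0.le (by
      have h5 : √m.αGrad * n₁ * √K⁻¹ ≤ √m.αGrad * n₁ * R := by gcongr
      rw [he₀]; linarith)
    (by
      rw [hRR2]
      refine hU.trans (mul_le_mul_of_nonneg_right ?_ hQ0)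
      have h5 : 2 * n₁ * s * n ≤ n₁ * (4 / 5 * √m.αGrad) * (Y * R) := by
        calc 2 * n₁ * s * n = n₁ * (2 * s) * n := by ring
          _ ≤ _ := by gcongr
      linarith)
    (by
      rw [hRR2]
      refine hW.trans (add_le_add (mul_le_mul_of_nonneg_right ?_ hQ0) ?_)
      · have h5 : 2 * (4 * n₄ ^ 2 + √d * n₂) * s * n
            ≤ (4 * n₄ ^ 2 + √d * n₂) * (4 / 5 * √m.αGrad) * (Y * R) := by
          calc 2 * (4 * n₄ ^ 2 + √d * n₂) * s * n = (4 * n₄ ^ 2 + √d * n₂) * (2 * s) * n := by ring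
            _ ≤ _ := by gcongr
        linarith
      · have h5 : n * R ≤ Y * R * R := by gcongr
        calc _ ≤ 20 * m.supHessW * n₁ * u * (Y * R * R) := by gcongr
          _ = _ := by ring)
  rw [hRR2, hQQ] at hcomb
  have hg : m.gradConst₂ Cc X = √m.αGrad / Cc * (n₁ ^ 2 + n₂ + 2 * n₄ ^ 2) * (d * Y)
      + √m.αGrad / Cc ^ 2 * m.supHessW * n₁ ^ 2 * (16 * Y ^ 2 + √(8 * d) * Y) := by
    have h5 : Y ^ 2 = 2 ^ d * X := Real.sq_sqrt (by positivity)
    have h6 : Y = √(2 ^ d) * √X := Real.sqrt_mul (by positivity) X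
    have h7 : √((2 : ℝ) ^ d) * √(2 ^ d) = 2 ^ d := Real.mul_self_sqrt (by positivity)
    have h8 : √m.αGrad / Cc ^ 2 * m.supHessW * n₁ * (√(2 ^ d) * n₁)
        * (16 * √(2 ^ d) * X + √(8 * d) * √X)
        = √m.αGrad / Cc ^ 2 * m.supHessW * n₁ ^ 2
          * (16 * (√(2 ^ d) * √(2 ^ d) * X) + √(8 * d) * (√(2 ^ d) * √X)) := by ring
    rw [gradConst₂, h8, h7, ← h6, h5]
  rw [← hg] at hcomb
  set T := m.gradConst₂ Cc X ^ 2 + (√m.αGrad * n₁ * Y / Cc) ^ 2 with hT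
  have hT0 : 0 < T := by positivity
  refine ⟨by positivity, ?_⟩
  rw [mul_inv, mul_inv_cancel_left₀ hr.ne', inv_mul_le_iff₀ hT0]
  exact hcomb

end Model

end Kac

/-! ### Lattices of low energy -/

namespace Kac

open Filter Topology MeasureTheory

variable {d : ℕ}

lemma det_toMat (B : GLInt d) : B.toMat.det = 1 := by
  have h := (Int.castRingHom ℝ).map_det (B : Matrix (Fin d) (Fin d) ℤ)
  rw [B.2, map_one] at h
  exact h.symm

lemma lin_reparam (B : GLInt d) (t : Fin d → ℤ) (a : Aff d) (x : Vec d) :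
    lin (reparam B t a) x = act B.toMat (lin a x) + intVec t := by
  simp only [lin, reparam, act_mul, act_add_right, add_assoc]

lemma det_reparam (B : GLInt d) (t : Fin d → ℤ) (a : Aff d) :
    (reparam B t a).1.det = a.1.det := by
  change (B.toMat * a.1).det = _
  rw [Matrix.det_mul, det_toMat, one_mul]

lemma opNorm_le_det_mul {A : Mat d} (hA : 0 < A.det) :
    opNorm A ≤ A.det * opNorm A⁻¹ ^ (d - 1) := by
  have hi : A⁻¹.det = A.det⁻¹ := by rw [Matrix.det_nonsing_inv, Ring.inverse_eq_inv']
  have h := opNorm_inv_mul_det_le (M := A⁻¹) (by rw [hi]; positivity)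
  rw [Matrix.nonsing_inv_nonsing_inv _ (isUnit_iff_ne_zero.2 hA.ne'), hi,
    ← div_eq_mul_inv, div_le_iff₀ hA] at h
  linarith

lemma opNorm_toMat_le (B : GLInt d) {A : Mat d} (hA : A.det ≠ 0) :
    opNorm B.toMat ≤ opNorm (B.toMat * A) * ‖A⁻¹‖ := by
  have h : B.toMat = B.toMat * A * A⁻¹ := by
    rw [Matrix.mul_assoc, mul_inv_cancel_of_det hA, Matrix.mul_one]
  calc opNorm B.toMat = opNorm (B.toMat * A * A⁻¹) := by rw [← h]
    _ ≤ opNorm (B.toMat * A) * opNorm A⁻¹ := opNorm_mul_le _ _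
    _ ≤ _ := by gcongr; exacts [opNorm_nonneg _, opNorm_le_norm _]

lemma norm_le_of_mem_specialOrthogonal {R : Mat d}
    (hR : R ∈ Matrix.specialOrthogonalGroup (Fin d) ℝ) : ‖R‖ ≤ d := by
  have hR' := (Matrix.mem_specialOrthogonalGroup_iff.1 hR).1
  refine le_of_sq_le_sq ?_ (by positivity)
  rw [normSq_eq_sum]
  calc ∑ i, ∑ j, R i j ^ 2 ≤ ∑ _i : Fin d, ∑ _j : Fin d, (1 : ℝ) := by
        gcongr with i _ j _
        have := entry_norm_bound_of_unitary hR' i j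
        rw [Real.norm_eq_abs] at this
        exact (sq_le_one_iff_abs_le_one _).2 this
    _ = (d : ℝ) ^ 2 := by simp [sq]

/-- Stability of determinant and inverse under perturbations, uniformly on bounded sets. -/
lemma exists_perturb {K e δ : ℝ} (hK : 0 < K) (he : 0 < e) (hδ : 0 < δ) :
    ∃ s > 0, ∀ A ∈ bddSet d K, ∀ G : Mat d, ‖G - A‖ ≤ s →
      G ∈ bddSet d (2 * K) ∧ |G.det - A.det| < e ∧ ‖G⁻¹‖ ≤ (1 + δ) * ‖A⁻¹‖ := by
  obtain ⟨r₁, hr₁, h₁⟩ := exists_dist_bddSet (d := d) hK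
  obtain ⟨r₂, hr₂, h₂⟩ := exists_det_close (d := d) K he
  obtain ⟨C, hC, h₃⟩ := exists_inv_bound_on_bddSet (d := d) (K := 2 * K) (by positivity)
  refine ⟨min (min r₁ r₂) (δ / C), by positivity, fun A hA G hG => ?_⟩
  have hG1 := h₁ A hA G (hG.trans ((min_le_left _ _).trans (min_le_left _ _)))
  refine ⟨hG1, h₂ A hA.1 G (hG.trans ((min_le_left _ _).trans (min_le_right _ _))), ?_⟩
  have h4 := norm_inv_sub_inv_le (ne_of_gt (bddSet_subset_GLPos hK hA))
    (ne_of_gt (bddSet_subset_GLPos (by positivity) hG1))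
  have h5 : ‖A - G‖ * ‖G⁻¹‖ ≤ δ := by
    rw [norm_sub_rev]
    calc ‖G - A‖ * ‖G⁻¹‖ ≤ δ / C * C := by
          gcongr
          exacts [hG.trans (min_le_right _ _), h₃ G hG1]
      _ = δ := by field_simp
  calc _ ≤ _ := h4
    _ ≤ ‖A⁻¹‖ * (1 + δ) := by gcongr
    _ = _ := mul_comm _ _

namespace Model

variable {m : Model d}

lemma Fit.mono {K K' η η' l : ℝ} (hK : 0 < K) (hKK : K ≤ K') (hη : η ≤ η')
    {χ : Finset (Vec d)} {y : Vec d} {a : Aff d} (h : m.Fit K η l χ y a) : m.Fit K' η' l χ y a :=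
  ⟨bddSet_mono hK hKK h.mem, h.misfit_le.trans hη, h.rho_near.trans hη⟩

lemma J_nonneg {l : ℝ} (hl : 0 < l) (a : Aff d) (χ : Finset (Vec d)) (y : Vec d) :
    0 ≤ m.J l a χ y := by
  rw [J_eq hl]; exact mul_nonneg (sq_nonneg _) (misfit_nonneg hl _ _ _)

lemma nu_nonneg (l : ℝ) (A : Mat d) (χ : Finset (Vec d)) (y : Vec d) : 0 ≤ m.nu l A χ y :=
  mul_nonneg m.ϑ_pos.le (abs_nonneg _)

lemma F_nonneg {A : Mat d} (hA : A ∈ GLPos d) : 0 ≤ m.F A :=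
  le_trans (by have := m.C₁El_pos; have := m.C₂El_pos; positivity) (m.F_coercive A hA)

lemma misfit_reparam_le {l : ℝ} (hl : 0 < l) (B : GLInt d) (t : Fin d → ℤ) (a : Aff d)
    (χ : Finset (Vec d)) (y : Vec d) :
    m.misfit l (reparam B t a) χ y
      ≤ m.C₁W / m.C₀W * opNorm B.toMat ^ 2 * m.misfit l a χ y := by
  have hn := nrm_pos (m := m) hl
  rw [misfit, misfit, mul_left_comm, Finset.mul_sum (a := m.C₁W / m.C₀W * opNorm B.toMat ^ 2)]
  refine mul_le_mul_of_nonneg_left (Finset.sum_le_sum fun p _ => ?_) hn.le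
  rw [← mul_assoc, lin_reparam]
  exact mul_le_mul_of_nonneg_right (m.W_act_toMat_le B t _) (wt_nonneg _ _ _)

/-- Lattices of small energy are bounded, close to the ground states, and fit the atoms well. -/
lemma exists_fit_of_h_le (m : Model d) (hd : 1 ≤ d) :
    ∃ K > 0, ∀ η > 0, ∃ ε > 0, ∀ l > 0, ∀ (χ : Finset (Vec d)) (y : Vec d) (a : Aff d),
      a.1 ∈ GLPos d → m.h l a χ y ≤ ε → m.Fit K η l χ y a ∧ |a.1.det - m.E.det| ≤ η := by
  have hE : 0 < m.E.det := m.E_mem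
  have h1 := m.C₁El_pos
  have h2 := m.C₂El_pos
  have hϑ := m.ϑ_pos
  set K := 2 + ‖m.E‖ * d + 2 / m.E.det with hKd
  have hK : 0 < K := by positivity
  refine ⟨K, hK, fun η hη => ?_⟩
  -- the determinant is to stay close to the one of `E` and away from zero
  set e := min η (m.E.det / 2) with he
  have he0 : 0 < e := by positivity
  refine ⟨min (min m.C₂El (m.C₁El * e ^ 2)) (min (η / K ^ 2) (m.ϑ * η)), by positivity,
    fun l hl χ y a ha hh => ?_⟩
  have hF := F_nonneg (m := m) ha
  have hJ := J_nonneg (m := m) hl a χ y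
  have hν := nu_nonneg (m := m) l a.1 χ y
  have hhe : m.h l a χ y = m.F a.1 + m.J l a χ y + m.nu l a.1 χ y := rfl
  have hco := m.F_coercive a.1 ha
  have b1 : m.h l a χ y ≤ m.C₂El := hh.trans ((min_le_left _ _).trans (min_le_left _ _))
  have b2 : m.h l a χ y ≤ m.C₁El * e ^ 2 := hh.trans ((min_le_left _ _).trans (min_le_right _ _))
  have b3 : m.h l a χ y ≤ η / K ^ 2 := hh.trans ((min_le_right _ _).trans (min_le_left _ _))
  have b4 : m.h l a χ y ≤ m.ϑ * η := hh.trans ((min_le_right _ _).trans (min_le_right _ _))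
  -- the coercivity of `F` bounds the distance to the ground states and the determinant
  have hinf : Metric.infDist a.1 (orbitSO m.E) < 2 := by
    have h3 : m.C₂El * Metric.infDist a.1 (orbitSO m.E) ^ 2 ≤ m.C₂El * 1 := by
      have : 0 ≤ m.C₁El * (m.E.det - a.1.det) ^ 2 := by positivity
      linarith
    have h4 : Metric.infDist a.1 (orbitSO m.E) ^ 2 ≤ 1 ^ 2 := by
      rw [one_pow]; exact le_of_mul_le_mul_left h3 h2
    linarith [le_of_sq_le_sq h4 zero_le_one]
  have hne : (orbitSO m.E).Nonempty := ⟨m.E * 1, 1, one_mem _, rfl⟩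
  obtain ⟨_, ⟨R, hR, rfl⟩, hd2⟩ := (Metric.infDist_lt_iff hne).1 hinf
  have hnorm : ‖a.1‖ ≤ K := by
    have h3 : ‖a.1‖ ≤ ‖a.1 - m.E * R‖ + ‖m.E * R‖ := by
      simpa using norm_add_le (a.1 - m.E * R) (m.E * R)
    have h4 := norm_mul_le' m.E R
    have h5 : ‖m.E‖ * ‖R‖ ≤ ‖m.E‖ * d := by gcongr; exact norm_le_of_mem_specialOrthogonal hR
    rw [dist_eq_norm] at hd2
    have h6 : 0 < 2 / m.E.det := by positivity
    linarith
  have hdet : |a.1.det - m.E.det| ≤ e := by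
    have h3 : m.C₁El * (m.E.det - a.1.det) ^ 2 ≤ m.C₁El * e ^ 2 := by
      have : 0 ≤ m.C₂El * Metric.infDist a.1 (orbitSO m.E) ^ 2 := by positivity
      linarith
    have h4 := le_of_mul_le_mul_left h3 h1
    rw [abs_sub_comm]
    exact abs_le_of_sq_le_sq h4 he0.le
  have hdetK : K⁻¹ ≤ a.1.det := by
    have h3 : m.E.det / 2 ≤ a.1.det := by
      have := (abs_le.1 (hdet.trans (min_le_right _ _))).1
      linarith
    refine le_trans ?_ h3
    rw [inv_le_comm₀ hK (by positivity), inv_div, hKd]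
    have : 0 ≤ ‖m.E‖ * d := by positivity
    linarith
  -- `‖A⁻¹‖` is bounded below, so that the misfit energy controls the misfit
  have hq : (K ^ 2)⁻¹ ≤ invSq a.1 := by
    have h3 := norm_mul_le' a.1 a.1⁻¹
    rw [mul_inv_cancel_of_det (ne_of_gt ha)] at h3
    have h4 : 1 ≤ ‖(1 : Mat d)‖ := by
      have h5 := norm_act_le (1 : Mat d) (EuclideanSpace.single (⟨0, hd⟩ : Fin d) 1)
      rwa [act_one, norm_single_one, mul_one] at h5
    have h5 : 1 ≤ K * ‖a.1⁻¹‖ := by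
      calc (1 : ℝ) ≤ ‖a.1‖ * ‖a.1⁻¹‖ := h4.trans h3
        _ ≤ _ := by gcongr
    rw [← inv_pow]
    refine pow_le_pow_left₀ (by positivity) ?_ 2
    rwa [inv_le_iff_one_le_mul₀' hK]
  refine ⟨⟨⟨hnorm, hdetK⟩, ?_, ?_⟩, hdet.trans (min_le_left _ _)⟩
  · have h3 : (K ^ 2)⁻¹ * m.misfit l a χ y ≤ (K ^ 2)⁻¹ * η := by
      have h4 : (K ^ 2)⁻¹ * m.misfit l a χ y ≤ m.J l a χ y := by
        rw [J_eq hl]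
        exact mul_le_mul_of_nonneg_right hq (misfit_nonneg hl _ _ _)
      rw [div_eq_inv_mul] at b3
      linarith
    exact le_of_mul_le_mul_left h3 (by positivity)
  · have h3 : m.ϑ * |a.1.det - m.rho l χ y| ≤ m.ϑ * η := by
      have : m.nu l a.1 χ y = m.ϑ * |a.1.det - m.rho l χ y| := rfl
      linarith
    exact le_of_mul_le_mul_left h3 hϑ

/-- Reparametrisations with bounded inverse preserve the fit up to constants. -/
lemma exists_fit_reparam (m : Model d) {K : ℝ} (hK : 0 < K) :
    ∃ L ≥ K, ∃ C ≥ 1, ∀ η > 0, ∀ l > 0, ∀ (χ : Finset (Vec d)) (y : Vec d) (a : Aff d),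
      m.Fit K η l χ y a → ∀ (B : GLInt d) (t : Fin d → ℤ),
      ‖a.1⁻¹ * B.toMat⁻¹‖ ≤ 2 * ‖m.E⁻¹‖ → m.Fit L (C * η) l χ y (reparam B t a) := by
  obtain ⟨D, hD, hdet⟩ := exists_bound_on_bddSet (d := d) hK (f := fun A => A.det)
    continuous_det.continuousOn
  obtain ⟨I, hI, hinv⟩ := exists_inv_bound_on_bddSet (d := d) hK
  have hC0 := m.C₀W_pos
  have hC1 := m.C₁W_pos
  set N := D * (2 * ‖m.E⁻¹‖) ^ (d - 1) with hN
  have hN0 : 0 ≤ N := by positivity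
  refine ⟨max K (√d * N), le_max_left _ _, max 1 (m.C₁W / m.C₀W * (N * I) ^ 2), le_max_left _ _,
    fun η hη l hl χ y a h B t hB => ?_⟩
  have ha : 0 < a.1.det := bddSet_subset_GLPos hK h.mem
  have hb : 0 < (reparam B t a).1.det := by rw [det_reparam]; exact ha
  have hop : opNorm (reparam B t a).1 ≤ N := by
    refine (opNorm_le_det_mul hb).trans ?_
    have h1 : opNorm (reparam B t a).1⁻¹ ≤ 2 * ‖m.E⁻¹‖ := by
      refine (opNorm_le_norm _).trans ?_
      change ‖(B.toMat * a.1)⁻¹‖ ≤ _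
      rwa [Matrix.mul_inv_rev]
    have h2 : (reparam B t a).1.det ≤ D := by
      rw [det_reparam]; exact (le_abs_self _).trans (hdet _ h.mem)
    have := opNorm_nonneg (reparam B t a).1⁻¹
    rw [hN]
    gcongr
  have hopB : opNorm B.toMat ≤ N * I :=
    (opNorm_toMat_le B ha.ne').trans (mul_le_mul hop (hinv _ h.mem) (norm_nonneg _) hN0)
  refine ⟨⟨?_, ?_⟩, ?_, ?_⟩
  · refine (norm_le_sqrt_mul_opNorm _).trans (le_trans ?_ (le_max_right _ _))
    gcongr
  · rw [det_reparam]
    exact (inv_anti₀ hK (le_max_left _ _)).trans h.mem.2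
  · refine (misfit_reparam_le hl B t a χ y).trans ?_
    have := opNorm_nonneg B.toMat
    refine mul_le_mul (le_trans ?_ (le_max_right _ _)) h.misfit_le (misfit_nonneg hl _ _ _)
      (le_trans zero_le_one (le_max_left _ _))
    gcongr
  · rw [det_reparam]
    exact h.rho_near.trans (le_mul_of_one_le_left hη.le (le_max_left _ _))

lemma two_mul_norm_inv_E_le (m : Model d) (hd : 1 ≤ d) : 2 * ‖m.E⁻¹‖ ≤ m.CA := by
  have hE : 0 < m.E.det := m.E_mem
  obtain ⟨k, rfl⟩ : ∃ k, d = k + 1 := ⟨d - 1, by omega⟩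
  have h1 := norm_le_sqrt_mul_opNorm m.E⁻¹
  have h2 : opNorm m.E⁻¹ ≤ opNorm m.E ^ k / m.E.det := by
    rw [le_div_iff₀ hE]; exact opNorm_inv_mul_det_le hE
  have hop := opNorm_nonneg m.E
  -- the constant leaves room for the passage from the operator norm to the Frobenius norm
  have h3 : √((k + 1 : ℕ) : ℝ) ≤ (3 / 2) ^ k := by
    rw [Real.sqrt_le_left (by positivity), ← pow_mul, mul_comm k 2, pow_mul]
    have h4 := one_add_mul_le_pow (a := (5 / 4 : ℝ)) (by norm_num) k
    have h5 : (0 : ℝ) ≤ k := by positivity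
    norm_num at h4 ⊢
    linarith
  have h4 : m.CA = 2 * ((3 / 2) ^ k * (opNorm m.E ^ k / m.E.det)) := by
    have h5 : ((2 : ℝ) ^ (((k + 1 : ℕ) : ℤ) - 2)) = 2 ^ k / 2 := by
      rw [zpow_sub₀ two_ne_zero, zpow_natCast, pow_succ]; norm_num; ring
    rw [CA, h5, Nat.add_sub_cancel, div_pow]
    field_simp
  rw [h4]
  gcongr
  exact h1.trans (mul_le_mul h3 h2 (opNorm_nonneg _) (by positivity))

/-- The comparison of the misfit energies of equivalent lattices; the factor `(1 + δ)^(d+1) ≤ 3`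
accounts for perturbed bounds on inverse and determinant. -/
lemma J_reparam_le (m : Model d) (hd : 1 ≤ d) {l δ : ℝ} (hl : 0 < l) (hδ : 0 ≤ δ)
    (hδ3 : (1 + δ) ^ (d + 1) ≤ 3) {a : Aff d} (ha : 0 < a.1.det) (B : GLInt d) (t : Fin d → ℤ)
    (hB : ‖(reparam B t a).1⁻¹‖ ≤ (1 + δ) * (2 * ‖m.E⁻¹‖))
    (hdet : a.1.det ≤ (1 + δ) * m.E.det) (χ : Finset (Vec d)) (y : Vec d) :
    m.J l (reparam B t a) χ y ≤ m.Crep * m.J l a χ y := by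
  have hE : 0 < m.E.det := m.E_mem
  have hb : 0 < (reparam B t a).1.det := by rw [det_reparam]; exact ha
  have hCA := CA_pos m hd
  set A₁ := (reparam B t a).1 with hA₁
  set v := (1 + δ) * m.CA with hv
  have hv0 : 0 < v := by positivity
  have hB1 : ‖A₁⁻¹‖ ≤ v :=
    hB.trans (mul_le_mul_of_nonneg_left (two_mul_norm_inv_E_le m hd) (by positivity))
  have h1 : opNorm A₁ ≤ (1 + δ) * m.E.det * v ^ (d - 1) := by
    refine (opNorm_le_det_mul hb).trans ?_
    have h2 := opNorm_nonneg A₁⁻¹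
    have h3 : A₁.det ≤ (1 + δ) * m.E.det := by rw [det_reparam]; exact hdet
    have h4 := (opNorm_le_norm A₁⁻¹).trans hB1
    gcongr
  have h2 : ‖A₁⁻¹‖ * opNorm A₁ ≤ 3 * m.CA ^ d * m.E.det := by
    have h3 : ‖A₁⁻¹‖ * opNorm A₁ ≤ v * ((1 + δ) * m.E.det * v ^ (d - 1)) := by
      have := opNorm_nonneg A₁
      gcongr
    refine h3.trans ?_
    obtain ⟨k, rfl⟩ : ∃ k, d = k + 1 := ⟨d - 1, by omega⟩
    calc v * ((1 + δ) * m.E.det * v ^ (k + 1 - 1))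
        = (1 + δ) ^ (k + 1 + 1) * m.CA ^ (k + 1) * m.E.det := by
          rw [hv, Nat.add_sub_cancel, mul_pow]; ring
      _ ≤ _ := by gcongr
  have h3 : opNorm B.toMat ≤ opNorm A₁ * ‖a.1⁻¹‖ := opNorm_toMat_le B ha.ne'
  have hI := misfit_nonneg (m := m) hl a χ y
  have hC0 := m.C₀W_pos
  have hC1 := m.C₁W_pos
  rw [J_eq hl, J_eq hl]
  have h4 : 0 ≤ ‖A₁⁻¹‖ * opNorm A₁ := mul_nonneg (norm_nonneg _) (opNorm_nonneg _)
  have h5 : (9 : ℝ) ≤ 9 * 4 ^ (d - 1) := by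
    have := one_le_pow₀ (show (1 : ℝ) ≤ 4 by norm_num) (n := d - 1)
    linarith
  have h6 : invSq A₁ = ‖A₁⁻¹‖ ^ 2 := rfl
  have h7 : invSq a.1 = ‖a.1⁻¹‖ ^ 2 := rfl
  calc invSq A₁ * m.misfit l (reparam B t a) χ y
      ≤ invSq A₁ * (m.C₁W / m.C₀W * opNorm B.toMat ^ 2 * m.misfit l a χ y) :=
        mul_le_mul_of_nonneg_left (misfit_reparam_le hl B t a χ y) (sq_nonneg _)
    _ ≤ invSq A₁ * (m.C₁W / m.C₀W * (opNorm A₁ * ‖a.1⁻¹‖) ^ 2 * m.misfit l a χ y) := by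
        have := opNorm_nonneg B.toMat
        have h8 : 0 ≤ invSq A₁ := sq_nonneg _
        gcongr
    _ = m.C₁W / m.C₀W * (‖A₁⁻¹‖ * opNorm A₁) ^ 2 * (invSq a.1 * m.misfit l a χ y) := by
        rw [h6, h7]; ring
    _ ≤ m.C₁W / m.C₀W * (3 * m.CA ^ d * m.E.det) ^ 2 * (invSq a.1 * m.misfit l a χ y) := by
        have h8 : 0 ≤ invSq a.1 := sq_nonneg _
        gcongr
    _ = 9 * (m.C₁W / m.C₀W * m.CA ^ (2 * d) * m.E.det ^ 2 * (invSq a.1 * m.misfit l a χ y)) := by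
        rw [mul_comm 2 d, pow_mul]; ring
    _ ≤ 9 * 4 ^ (d - 1)
        * (m.C₁W / m.C₀W * m.CA ^ (2 * d) * m.E.det ^ 2 * (invSq a.1 * m.misfit l a χ y)) := by
        have h8 : 0 ≤ invSq a.1 := sq_nonneg _
        exact mul_le_mul_of_nonneg_right h5 (by positivity)
    _ = _ := by rw [Crep]; ring

end Model

end Kac

/-! ### Existence of minimizers and the lower bound of the energy density -/

namespace Kac

open Filter Topology MeasureTheory

variable {d : ℕ}

namespace Model

variable {m : Model d}

lemma continuous_misfit (l : ℝ) (a : Aff d) (χ : Finset (Vec d)) :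
    Continuous fun y => m.misfit l a χ y := by
  have h1 := m.continuous_φt
  have h2 := (m.contDiff_W (n := 0)).continuous
  have h3 := continuous_lin a
  simp only [misfit, wt]
  fun_prop

lemma continuous_misfit_left (l : ℝ) (χ : Finset (Vec d)) (y : Vec d) :
    Continuous fun a : Aff d => m.misfit l a χ y := by
  have h2 := (m.contDiff_W (n := 0)).continuous
  have h3 : ∀ x : Vec d, Continuous fun a : Aff d => lin a x := fun x =>
    (((actL d).continuous.comp continuous_fst).clm_apply continuous_const).add continuous_snd
  simp only [misfit]
  fun_prop

lemma continuous_rho {l : ℝ} (hl : 0 < l) (χ : Finset (Vec d)) :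
    Continuous fun y => m.rho l χ y := by
  simp only [rho_eq hl, wt]
  have := m.continuous_φt
  fun_prop

lemma continuous_h {l : ℝ} (hl : 0 < l) (a : Aff d) (χ : Finset (Vec d)) :
    Continuous fun y => m.h l a χ y := by
  simp only [h, J_eq hl, nu]
  have h1 := continuous_misfit (m := m) l a χ
  have h2 := continuous_rho (m := m) hl χ
  fun_prop

lemma continuousOn_h {l : ℝ} (hl : 0 < l) (χ : Finset (Vec d)) (y : Vec d) :
    ContinuousOn (fun a : Aff d => m.h l a χ y) {a | a.1 ∈ GLPos d} := by
  have hF : ContinuousOn (fun a : Aff d => m.F a.1) {a | a.1 ∈ GLPos d} :=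
    m.F_contDiff.continuousOn.comp continuous_fst.continuousOn fun _ ha => ha
  have hq : ContinuousOn (invSq (d := d)) (GLPos d) := fun A hA =>
    (contDiffAt_invSq (n := 0) (ne_of_gt hA)).continuousAt.continuousWithinAt
  have hq2 : ContinuousOn (fun a : Aff d => invSq a.1) {a | a.1 ∈ GLPos d} :=
    hq.comp continuous_fst.continuousOn fun _ ha => ha
  have hm := continuous_misfit_left (m := m) l χ y
  have hdet : Continuous fun a : Aff d => a.1.det := continuous_det.comp continuous_fst
  have hν : Continuous fun a : Aff d => m.ϑ * |a.1.det - m.rho l χ y| := by fun_prop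
  simp only [h, J_eq hl, nu]
  exact (hF.add (hq2.mul hm.continuousOn)).add hν.continuousOn

lemma h_sub_intVec (l : ℝ) (a : Aff d) (n : Fin d → ℤ) (χ : Finset (Vec d)) (y : Vec d) :
    m.h l (a.1, a.2 - intVec n) χ y = m.h l a χ y := by
  have h1 : ∀ p, m.W (act a.1 (p - y) + (a.2 - intVec n)) = m.W (act a.1 (p - y) + a.2) := by
    intro p
    rw [← m.W_per n (act a.1 (p - y) + (a.2 - intVec n))]
    congr 1
    abel
  simp only [h, J, h1]

lemma nonempty_h (l : ℝ) (χ : Finset (Vec d)) (y : Vec d) :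
    ((fun a : Aff d => m.h l a χ y) '' {a | a.1 ∈ GLPos d}).Nonempty :=
  ⟨_, (m.E, 0), m.E_mem, rfl⟩

lemma IsGlobalMinimizer.h_eq {l : ℝ} {χ : Finset (Vec d)} {y : Vec d} {a : Aff d}
    (ha : m.IsGlobalMinimizer l χ y a) : m.h l a χ y = m.hHat l χ y := by
  refine le_antisymm (le_csInf (nonempty_h l χ y) ?_) (csInf_le ?_ ⟨a, ha.1, rfl⟩)
  · rintro _ ⟨b, hb, rfl⟩; exact ha.2 b hb
  · exact ⟨_, by rintro _ ⟨b, hb, rfl⟩; exact ha.2 b hb⟩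

/-- At low energy a global minimizer exists: up to integer translations only a compact set of
lattices competes. -/
lemma exists_isGlobalMinimizer (m : Model d) (hd : 1 ≤ d) :
    ∃ ε > 0, ∀ l > 0, ∀ (χ : Finset (Vec d)) (y : Vec d), m.hHat l χ y < ε →
      ∃ a, m.IsGlobalMinimizer l χ y a := by
  obtain ⟨K, hK, H⟩ := exists_fit_of_h_le m hd
  obtain ⟨ε, hε, H⟩ := H 1 one_pos
  refine ⟨ε, hε, fun l hl χ y hh => ?_⟩
  set S : Set (Aff d) := bddSet d K ×ˢ Metric.closedBall (0 : Vec d) d with hS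
  have hSc : IsCompact S := (isCompact_bddSet K).prod (isCompact_closedBall _ _)
  have hSG : S ⊆ {a | a.1 ∈ GLPos d} := fun a ha => bddSet_subset_GLPos hK ha.1
  have key : ∀ b : Aff d, b.1 ∈ GLPos d → m.h l b χ y ≤ ε →
      ∃ c ∈ S, m.h l c χ y = m.h l b χ y := by
    intro b hb hbε
    refine ⟨(b.1, b.2 - intVec (floorVec b.2)), ⟨(H l hl χ y b hb hbε).1.mem, ?_⟩,
      h_sub_intVec l b _ χ y⟩
    rw [mem_closedBall_zero_iff]
    exact norm_sub_floorVec_le b.2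
  obtain ⟨_, ⟨b, hb, rfl⟩, hbε⟩ := exists_lt_of_csInf_lt (nonempty_h l χ y) hh
  obtain ⟨c, hc, hcb⟩ := key b hb hbε.le
  obtain ⟨a, ha, hmin⟩ := hSc.exists_isMinOn ⟨c, hc⟩ ((continuousOn_h hl χ y).mono hSG)
  refine ⟨a, hSG ha, fun e he => ?_⟩
  by_cases hee : m.h l e χ y ≤ ε
  · obtain ⟨f, hf, hfe⟩ := key e he hee
    rw [← hfe]; exact hmin hf
  · have h1 : m.h l a χ y ≤ m.h l c χ y := hmin hc
    exact h1.trans (by rw [hcb]; exact hbε.le.trans (not_le.1 hee).le)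

/-- A lower bound of the energy of a lattice `a` in terms of a branch of critical points `f`: up to
the factor `C_rep`, the misfit energy of `a` controls the distance of `b a` to `f y` by convexity
and the first two derivatives of `f` by the derivative estimates. -/
lemma FC_add_le_h (m : Model d) (hd : 1 ≤ d) {K r l η Cc Ct : ℝ} (hK : 0 < K) (hl : 0 < l)
    {χ : Finset (Vec d)} {y : Vec d} {a₀ : Aff d} (H : m.UnifConvex K r l χ y a₀)
    {f : Vec d → Aff d} (hf : affNorm l (f y - a₀) ≤ r) (hcrit : ∀ b, m.dJ l (f y) χ y b = 0)
    (hC : m.Crit (2 * K) η l χ (fun z => unanchor z (f z)) y) {G : Mat d}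
    (hG : G = gradMat (fun z => (f z).2) y) (hGpos : 0 < G.det)
    (hGρ : G.det ≤ 21 / 20 * m.rho l χ y) (hGinv : ‖G⁻¹‖ ^ 2 ≤ 21 / 20 * ‖(f y).1⁻¹‖ ^ 2)
    (hCc : 0 < Cc) (hCc1 : Cc ≤ m.c₀ / (d + 3)) (hCc2 : d = 1 → 2 * Cc ≤ m.c₀ / (d + 3))
    (hCt : 0 ≤ Ct)
    (hgrad : m.Crep * Ct * (10 / 9 * (6 / 5 * normU l (fun z => unanchor z (f z)) y ^ 2
      + 3 / 5 * normW l (fun z => unanchor z (f z)) y ^ 2) * m.rho l χ y)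
      ≤ m.mis l χ (fun z => unanchor z (f z)) y)
    {a : Aff d} (ha : a.1 ∈ GLPos d) (B : GLInt d) (t : Fin d → ℤ)
    (hB : affNorm l (reparam B t a - a₀) ≤ r)
    (hJ : m.J l (reparam B t a) χ y ≤ m.Crep * m.J l a χ y) :
    m.FC l Cc Ct G
      + 1 / 5 * Ct * ‖G⁻¹‖ ^ 2 * l ^ 4 * hessNormSq (fun z => (f z).2) y * G.det
      ≤ m.h l a χ y := by
  have hr := m.Crep_pos hd
  have hρ0 : 0 < m.rho l χ y := (inv_pos.2 (by positivity)).trans_le hC.rho_ge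
  have hfG : (f y).1 ∈ GLPos d := bddSet_subset_GLPos (by positivity) (H.mem (f y) hf)
  have hFC : m.FC l Cc Ct G ≤ m.U l Cc Ct G (f y).1 B a.1 := by
    refine csInf_le ⟨0, ?_⟩ ⟨_, hfG, _, ha, B, rfl⟩
    rintro _ ⟨A₁, hA₁, A₂, hA₂, B', rfl⟩
    have := F_nonneg (m := m) hA₂
    rw [U]
    positivity
  set A₁ := (reparam B t a).1 with hA₁
  have hτ : (fun z => lin (unanchor z (f z)) z) = fun z => (f z).2 :=
    funext fun z => lin_unanchor_self z (f z)
  -- the gradient terms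
  have h1 := grad_add_hess_le hC.contDiff l
  rw [hτ, ← hG] at h1
  change 1 / 2 * (l ^ 2 * ‖G - (f y).1‖ ^ 2) + _ ≤ _ at h1
  rw [mis_unanchor] at hgrad
  set E := 6 / 5 * normU l (fun z => unanchor z (f z)) y ^ 2
      + 3 / 5 * normW l (fun z => unanchor z (f z)) y ^ 2 with hEd
  set P := 1 / 2 * (l ^ 2 * ‖G - (f y).1‖ ^ 2) with hP
  set Q := 1 / 5 * (l ^ 4 * hessNormSq (fun z => (f z).2) y) with hQ
  have hP0 : 0 ≤ P := by positivity
  have hQ0 : 0 ≤ Q := by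
    have : 0 ≤ hessNormSq (fun z => (f z).2) y := by unfold hessNormSq; positivity
    positivity
  have hE0 : 0 ≤ E := by positivity
  set q := ‖(f y).1⁻¹‖ ^ 2 with hq
  have hq0 : 0 ≤ q := by positivity
  have h2 : Ct * q * G.det * P + Ct * ‖G⁻¹‖ ^ 2 * G.det * Q ≤ m.Crep⁻¹ * m.J l (f y) χ y := by
    have h3 : Ct * q * G.det * P ≤ Ct * q * (10 / 9 * m.rho l χ y) * P := by
      gcongr; linarith
    have h4 : Ct * ‖G⁻¹‖ ^ 2 * G.det * Q ≤ Ct * q * (10 / 9 * m.rho l χ y) * Q := by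
      calc Ct * ‖G⁻¹‖ ^ 2 * G.det * Q
          ≤ Ct * (21 / 20 * q) * (21 / 20 * m.rho l χ y) * Q := by gcongr
        _ = 441 / 400 * (Ct * q * m.rho l χ y * Q) := by ring
        _ ≤ 10 / 9 * (Ct * q * m.rho l χ y * Q) := by
          have : 0 ≤ Ct * q * m.rho l χ y * Q := by positivity
          linarith
        _ = _ := by ring
    have h5 : Ct * q * (10 / 9 * m.rho l χ y) * (P + Q)
        ≤ Ct * q * (10 / 9 * m.rho l χ y) * E := by gcongr
    have h6 : m.Crep⁻¹ * q * (m.Crep * Ct * (10 / 9 * E * m.rho l χ y))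
        ≤ m.Crep⁻¹ * q * m.misfit l (f y) χ y := by gcongr
    have h7 : m.Crep⁻¹ * q * (m.Crep * Ct * (10 / 9 * E * m.rho l χ y))
        = Ct * q * (10 / 9 * m.rho l χ y) * E := by field_simp
    have h8 : m.J l (f y) χ y = q * m.misfit l (f y) χ y := J_eq hl _ _ _
    rw [h8]
    linarith
  -- the convexity term
  have h9 := H.add_le hK hl hf hB hB
  rw [hcrit, add_zero] at h9
  set D := ‖A₁ - (f y).1‖ with hD
  have h10 : l ^ 2 * D ^ 2 ≤ affNorm l (reparam B t a - f y) ^ 2 := by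
    rw [affNorm_sq]
    exact le_add_of_nonneg_right (sq_nonneg _)
  have hc0 := m.c₀_pos
  -- the room between `d + 3` and `d + 5` suffices for `d ≥ 2`; for `d = 1` the constant gains a
  -- factor two
  have h11 : 1 / 3 * Cc * G.det ≤ m.c₀ / (d + 5) * m.rho l χ y / 2 := by
    have h12 : 1 / 3 * Cc * (21 / 20) ≤ m.c₀ / (d + 5) / 2 := by
      rcases Nat.eq_or_lt_of_le hd with h1d | h1d
      · have := hCc2 h1d.symm
        subst h1d
        norm_num at this ⊢
        linarith
      · have hd2 : (2 : ℝ) ≤ d := by exact_mod_cast h1d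
        have h13 : 7 / 20 * (m.c₀ / (d + 3)) ≤ m.c₀ / (d + 5) / 2 := by
          rw [div_div, mul_div_assoc', div_le_div_iff₀ (by positivity) (by positivity)]
          have : 0 ≤ m.c₀ * (d - 2) := mul_nonneg hc0.le (by linarith)
          linarith
        linarith
    calc 1 / 3 * Cc * G.det ≤ 1 / 3 * Cc * (21 / 20 * m.rho l χ y) := by gcongr
      _ = 1 / 3 * Cc * (21 / 20) * m.rho l χ y := by ring
      _ ≤ m.c₀ / (d + 5) / 2 * m.rho l χ y := by gcongr
      _ = _ := by ring
  have h12 : 1 / 3 * Cc * m.Crep⁻¹ * ‖A₁⁻¹‖ ^ 2 * G.det * l ^ 2 * D ^ 2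
      ≤ m.Crep⁻¹ * (m.c₀ / (d + 5) * invSq A₁ * m.rho l χ y
          * affNorm l (reparam B t a - f y) ^ 2 / 2) := by
    calc 1 / 3 * Cc * m.Crep⁻¹ * ‖A₁⁻¹‖ ^ 2 * G.det * l ^ 2 * D ^ 2
        = m.Crep⁻¹ * ‖A₁⁻¹‖ ^ 2 * (1 / 3 * Cc * G.det) * (l ^ 2 * D ^ 2) := by ring
      _ ≤ m.Crep⁻¹ * ‖A₁⁻¹‖ ^ 2 * (m.c₀ / (d + 5) * m.rho l χ y / 2)
          * affNorm l (reparam B t a - f y) ^ 2 := by gcongr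
      _ = _ := by rw [invSq]; ring
  have h13 : m.Crep⁻¹ * (m.J l (f y) χ y + m.c₀ / (d + 5) * invSq A₁ * m.rho l χ y
      * affNorm l (reparam B t a - f y) ^ 2 / 2) ≤ m.J l a χ y := by
    rw [inv_mul_le_iff₀ hr]
    exact h9.trans hJ
  rw [mul_add] at h13
  have h14 : m.U l Cc Ct G (f y).1 B a.1 = m.F a.1
      + 1 / 3 * Cc * m.Crep⁻¹ * ‖A₁⁻¹‖ ^ 2 * G.det * l ^ 2 * D ^ 2 + Ct * q * G.det * P := by
    rw [U, hP, hq, hD, hA₁]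
    simp only [reparam]
    ring
  have h15 : 1 / 5 * Ct * ‖G⁻¹‖ ^ 2 * l ^ 4 * hessNormSq (fun z => (f z).2) y * G.det
      = Ct * ‖G⁻¹‖ ^ 2 * G.det * Q := by rw [hQ]; ring
  have h16 := nu_nonneg (m := m) l a.1 χ y
  rw [h14] at hFC
  rw [h15, h]
  linarith

end Model

end Kac

/-! ### Construction of the branch and the bounds along it -/

namespace Kac

open Filter Topology MeasureTheory

variable {d : ℕ}

/-- The consequences of a determinant `D` being close to the density `ρ` that enter the constants. -/
lemma det_bounds {n ρ D : ℝ} (hn : 0 ≤ n) (hρ : 0 < ρ) (h : |D - ρ| ≤ ρ / (n + 20)) :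
    0 < D ∧ D ≤ 21 / 20 * ρ ∧ (n + 5) * ρ ^ 2 ≤ (n + 9) * D ^ 2 := by
  have h20 : 0 < n + 20 := by linarith
  obtain ⟨h1, h2⟩ := abs_le.1 h
  have h3 : (n + 20) * (ρ / (n + 20)) = ρ := by field_simp
  have h4 : (n + 19) * ρ ≤ (n + 20) * D := by
    have h5 : (n + 20) * (ρ - ρ / (n + 20)) ≤ (n + 20) * D :=
      mul_le_mul_of_nonneg_left (by linarith) h20.le
    rw [mul_sub, h3] at h5
    linarith
  have h6 : 0 < (n + 19) * ρ := by positivity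
  refine ⟨?_, ?_, ?_⟩
  · by_contra hD
    have := mul_nonpos_of_nonneg_of_nonpos h20.le (not_lt.1 hD)
    linarith
  · have : ρ / (n + 20) ≤ ρ / 20 := by gcongr; linarith
    linarith
  · have h7 : ((n + 19) * ρ) ^ 2 ≤ ((n + 20) * D) ^ 2 := by gcongr
    have h8 : (n + 5) * (n + 20) ^ 2 ≤ (n + 9) * (n + 19) ^ 2 := by
      have : 0 ≤ n ^ 2 := sq_nonneg n
      ring_nf
      linarith
    have h9 : (n + 5) * (n + 20) ^ 2 * ρ ^ 2 ≤ (n + 9) * (n + 19) ^ 2 * ρ ^ 2 := by gcongr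
    have h10 : (n + 9) * ((n + 19) * ρ) ^ 2 ≤ (n + 9) * ((n + 20) * D) ^ 2 := by gcongr
    refine le_of_mul_le_mul_left ?_ (show 0 < (n + 20) ^ 2 by positivity)
    linarith

lemma one_add_inv_pow_le (n : ℕ) : (1 + 1 / ((n : ℝ) + 100)) ^ (n + 1) ≤ 3 := by
  have h1 : 1 + 1 / ((n : ℝ) + 100) ≤ Real.exp (1 / ((n : ℝ) + 100)) := by
    rw [add_comm]; exact Real.add_one_le_exp _
  calc (1 + 1 / ((n : ℝ) + 100)) ^ (n + 1) ≤ Real.exp (1 / ((n : ℝ) + 100)) ^ (n + 1) := by gcongr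
    _ = Real.exp (((n + 1 : ℕ) : ℝ) * (1 / ((n : ℝ) + 100))) := by rw [Real.exp_nat_mul]
    _ ≤ Real.exp 1 := by
        rw [Real.exp_le_exp, mul_one_div, div_le_one (by positivity)]
        push_cast
        linarith
    _ ≤ 3 := Real.exp_one_lt_three.le

lemma norm_fst_sub_le_of_affNorm_le {l r s η : ℝ} (hr : 0 < r) (hη : η ≤ s / r) (hl : 0 < l)
    (hl1 : 1 ≤ η * l) {a b : Aff d} (hab : affNorm l (a - b) ≤ r) : ‖a.1 - b.1‖ ≤ s := by
  have h1 : l * ‖a.1 - b.1‖ ≤ r := (norm_fst_le_affNorm l (a - b)).trans hab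
  have h2 : ‖a.1 - b.1‖ ≤ r / l := by rw [le_div_iff₀ hl]; linarith
  have h3 : η * r ≤ s := by rwa [le_div_iff₀ hr] at hη
  refine h2.trans ?_
  rw [div_le_iff₀ hl]
  calc r ≤ r * (η * l) := le_mul_of_one_le_right hr.le hl1
    _ = η * r * l := by ring
    _ ≤ _ := by gcongr

lemma act_gradMat (τ : Vec d → Vec d) (y v : Vec d) : act (gradMat τ y) v = fderiv ℝ τ y v := by
  have hv : v = ∑ j, v j • (EuclideanSpace.single j 1 : Vec d) := by
    ext i; simp [Finset.sum_apply, Pi.single_apply]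
  ext i
  rw [act_apply]
  conv_rhs => rw [hv]
  rw [map_sum]
  simp [gradMat, mul_comm]

/-- A map with nonsingular gradient is injective near the point in question. -/
lemma exists_injOn_nhds {τ : Vec d → Vec d} {x : Vec d} (hτ : ContDiffAt ℝ 2 τ x)
    (hdet : (gradMat τ x).det ≠ 0) : ∃ s ∈ 𝓝 x, Set.InjOn τ s := by
  have hs := hτ.hasStrictFDerivAt two_ne_zero
  have hinj : Function.Injective (fderiv ℝ τ x : Vec d →ₗ[ℝ] Vec d) := by
    intro v w h
    change fderiv ℝ τ x v = fderiv ℝ τ x w at h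
    rw [← act_gradMat, ← act_gradMat] at h
    rw [← act_inv_act hdet v, h, act_inv_act hdet]
  set e : Vec d ≃L[ℝ] Vec d :=
    (LinearEquiv.ofInjectiveEndo (fderiv ℝ τ x : Vec d →ₗ[ℝ] Vec d) hinj).toContinuousLinearEquiv
    with he
  have hs' : HasStrictFDerivAt τ (e : Vec d →L[ℝ] Vec d) x := by
    have : (e : Vec d →L[ℝ] Vec d) = fderiv ℝ τ x := by ext v; rfl
    rwa [this]
  exact ⟨(hs'.toOpenPartialHomeomorph τ).source,
    (hs'.toOpenPartialHomeomorph τ).open_source.mem_nhds hs'.mem_toOpenPartialHomeomorph_source,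
    (hs'.toOpenPartialHomeomorph τ).injOn⟩

namespace Model

variable {m : Model d}

/-- Near a well fitting lattice there is a branch of critical points of the misfit energy. -/
lemma exists_branch_of_fit (m : Model d) (hd : 1 ≤ d) {K r : ℝ} (hK : 0 < K) (hr : 0 < r) :
    ∃ η₀ > 0, ∀ η > 0, η ≤ η₀ → ∀ l > 0, 1 ≤ η * l → ∀ (χ : Finset (Vec d)) (x : Vec d)
      (a₀ : Aff d), m.Fit K η l χ x a₀ → m.UnifConvex K r l χ x a₀ →
      ∃ f : Vec d → Aff d, ContDiffAt ℝ 2 f x ∧ affNorm l (f x - a₀) < r ∧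
        (∀ᶠ y in 𝓝 x, ∀ b, m.dJ l (f y) χ y b = 0) ∧ m.misfit l (f x) χ x ≤ 2 * η ∧
        affNorm l (f x - a₀) ≤ (1 / 2 * m.Ccon (m.rho l χ x) a₀.1.det * ‖a₀.1⁻¹‖ ^ 2
          * m.rho l χ x) ^ (-(1 / 2) : ℝ) * √(m.J l a₀ χ x) := by
  have hc0 := m.c₀_pos
  -- the tolerance for the error of the determinant required by `det_bounds`
  set κ := 1 / (2 * K * (d + 20)) with hκ
  have hκ0 : 0 < κ := by positivity
  obtain ⟨s, hs, hpert⟩ := exists_perturb (d := d) (K := 2 * K) (δ := 1 / 5) (by positivity)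
    one_pos (by norm_num)
  refine ⟨min (min (1 / (2 * K)) κ) (min (s / r) (m.c₀ / (d + 5) * (1 / (2 * K)) * r ^ 2 / 4)),
    by positivity, fun η hη hηη l hl hl1 χ x a₀ hF H => ?_⟩
  have hη1 : η ≤ 1 / (2 * K) := hηη.trans ((min_le_left _ _).trans (min_le_left _ _))
  have hη2 : η ≤ κ := hηη.trans ((min_le_left _ _).trans (min_le_right _ _))
  have hη3 : η ≤ s / r := hηη.trans ((min_le_right _ _).trans (min_le_left _ _))
  have hη4 : η ≤ m.c₀ / (d + 5) * (1 / (2 * K)) * r ^ 2 / 4 :=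
    hηη.trans ((min_le_right _ _).trans (min_le_right _ _))
  have hA0 : 0 < a₀.1.det := bddSet_subset_GLPos hK hF.mem
  have hq0 := invSq_pos hd hA0.ne'
  have hρ : 1 / (2 * K) ≤ m.rho l χ x := by
    have h1 := (abs_le.1 hF.rho_near).2
    have h2 : K⁻¹ = 1 / (2 * K) + 1 / (2 * K) := by field_simp; norm_num
    have h3 := hF.mem.2
    linarith
  have hρ0 : 0 < m.rho l χ x := lt_of_lt_of_le (by positivity) hρ
  have hJ : m.J l a₀ χ x < m.c₀ / (d + 5) * invSq a₀.1 * m.rho l χ x * r ^ 2 / 2 := by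
    have h1 : m.misfit l a₀ χ x < m.c₀ / (d + 5) * m.rho l χ x * r ^ 2 / 2 := by
      have h2 : 0 < m.c₀ / (d + 5) * (1 / (2 * K)) * r ^ 2 := by positivity
      have h3 : m.c₀ / (d + 5) * (1 / (2 * K)) * r ^ 2
          ≤ m.c₀ / (d + 5) * m.rho l χ x * r ^ 2 := by gcongr
      linarith [hF.misfit_le]
    rw [J_eq hl]
    calc _ < invSq a₀.1 * (m.c₀ / (d + 5) * m.rho l χ x * r ^ 2 / 2) := by gcongr
      _ = _ := by ring
  obtain ⟨a, har, hcrit, hdist⟩ := H.exists_crit hK hl hr hJ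
  have hadet := H.det_ne hK har.le
  have hqa := invSq_pos hd hadet
  obtain ⟨f, hfx, hf, hfc⟩ := exists_branch hl χ hadet hcrit fun b hb =>
    lt_of_lt_of_le (by have := affNorm_pos hl hb; positivity) (H.conv a a har.le har.le b)
  refine ⟨f, hf, by rwa [hfx], hfc, ?_, ?_⟩ <;> rw [hfx]
  · have h1 := H.add_le hK hl har.le (a' := a₀) (a₂ := a)
      (by rw [sub_self]; exact le_trans (by simp [affNorm]) hr.le) har.le
    rw [hcrit, add_zero, J_eq hl, J_eq hl] at h1
    have h2 : 0 ≤ m.c₀ / (d + 5) * invSq a.1 * m.rho l χ x * affNorm l (a₀ - a) ^ 2 / 2 := by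
      positivity
    have h3 : ‖a₀.1⁻¹‖ ≤ (1 + 1 / 5) * ‖a.1⁻¹‖ := by
      refine (hpert a.1 (H.mem a har.le) a₀.1 ?_).2.2
      rw [norm_sub_rev]
      exact norm_fst_sub_le_of_affNorm_le hr hη3 hl hl1 har.le
    have h4 : invSq a₀.1 ≤ 2 * invSq a.1 := by
      calc invSq a₀.1 ≤ ((1 + 1 / 5) * ‖a.1⁻¹‖) ^ 2 := by rw [invSq]; gcongr
        _ = 36 / 25 * invSq a.1 := by rw [invSq]; ring
        _ ≤ _ := by gcongr; norm_num
    have hI := misfit_nonneg (m := m) hl a₀ χ x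
    have h5 : invSq a.1 * m.misfit l a χ x ≤ invSq a.1 * (2 * η) := by
      calc invSq a.1 * m.misfit l a χ x ≤ invSq a₀.1 * m.misfit l a₀ χ x := by linarith
        _ ≤ 2 * invSq a.1 * η := by gcongr; exact hF.misfit_le
        _ = _ := by ring
    exact le_of_mul_le_mul_left h5 hqa
  · have hκρ : κ ≤ m.rho l χ x / (d + 20) := by
      rw [hκ, ← div_div]; gcongr
    have hb := det_bounds (n := d) (by positivity) hρ0 (hF.rho_near.trans (hη2.trans hκρ))
    have hCc := m.Ccon_pos hρ0 hA0
    have hCle : m.Ccon (m.rho l χ x) a₀.1.det ≤ m.c₀ / (d + 5) := by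
      refine (m.Ccon_le hd _ _).trans ?_
      rw [div_eq_mul_one_div m.c₀]
      refine mul_le_mul_of_nonneg_left ((min_le_right _ _).trans ?_) hc0.le
      rw [div_mul_div_comm, one_mul, div_le_div_iff₀ (by positivity) (by positivity)]
      linarith [hb.2.2]
    set k := 1 / 2 * m.Ccon (m.rho l χ x) a₀.1.det * ‖a₀.1⁻¹‖ ^ 2 * m.rho l χ x with hk
    have hk0 : 0 < k := by
      have : 0 < ‖a₀.1⁻¹‖ ^ 2 := hq0
      positivity
    have hJ0 := J_nonneg (m := m) hl a₀ χ x
    have h1 : k * affNorm l (a - a₀) ^ 2 ≤ m.J l a₀ χ x := by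
      rw [affNorm_sub_comm]
      refine le_trans ?_ hdist
      calc k * affNorm l (a₀ - a) ^ 2
          ≤ 1 / 2 * (m.c₀ / (d + 5)) * ‖a₀.1⁻¹‖ ^ 2 * m.rho l χ x * affNorm l (a₀ - a) ^ 2 := by
            rw [hk]; gcongr
        _ = _ := by rw [invSq]; ring
    rw [Real.rpow_neg hk0.le, ← Real.sqrt_eq_rpow, inv_mul_eq_div,
      le_div_iff₀ (Real.sqrt_pos.2 hk0)]
    refine Real.le_sqrt_of_sq_le ?_
    rw [mul_pow, Real.sq_sqrt hk0.le]
    linarith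

/-- At a point of the branch the gradient of the translations is close to the lattice matrix, hence
has positive determinant, and every fitting lattice close to the ground states obeys the lower
bound. -/
lemma exists_branch_props (m : Model d) (hd : 1 ≤ d) {K r : ℝ} (hK : 0 < K) (hr : 0 < r) :
    ∃ η₀ > 0, ∀ η > 0, η ≤ η₀ → ∀ l > 0, 1 ≤ η * l → ∀ χ : Finset (Vec d), m.HardCore χ →
      ∀ (y : Vec d) (a₀ : Aff d), m.Fit K η l χ y a₀ → m.UnifConvex K r l χ y a₀ →
      ‖a₀.1⁻¹‖ ≤ 2 * ‖m.E⁻¹‖ → ∀ f : Vec d → Aff d, ContDiffAt ℝ 2 f y →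
      affNorm l (f y - a₀) < r → (∀ᶠ z in 𝓝 y, ∀ b, m.dJ l (f z) χ z b = 0) →
      m.misfit l (f y) χ y ≤ η →
      0 < (gradMat (fun z => (f z).2) y).det ∧
      ∀ a : Aff d, m.Fit K η l χ y a → |a.1.det - m.E.det| ≤ η →
        let G := gradMat (fun z => (f z).2) y
        let Cc := m.Ccon (m.rho l χ y) G.det
        let Ct := m.Cgrad Cc (m.rho (2 * l) χ y / m.rho l χ y)
        m.FC l Cc Ct G
          + 1 / 5 * Ct * ‖G⁻¹‖ ^ 2 * l ^ 4 * hessNormSq (fun z => (f z).2) y * G.det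
          ≤ m.h l a χ y := by
  have hE : 0 < m.E.det := m.E_mem
  set κ := 1 / (2 * K * (d + 20)) with hκ
  have hκ0 : 0 < κ := by positivity
  -- so small that `(1 + δ)^(d+1) ≤ 3` and `(1 + δ)² ≤ 21/20`
  set δ := 1 / ((d : ℝ) + 100) with hδ
  have hδ0 : 0 < δ := by positivity
  have hδ1 : δ ≤ 1 / 100 := by
    rw [hδ]; gcongr; have : (0 : ℝ) ≤ d := by positivity
    linarith
  obtain ⟨s₁, hs₁, P₁⟩ := exists_perturb (d := d) (K := K) (e := κ / 4) (δ := δ) hK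
    (by positivity) hδ0
  obtain ⟨s₂, hs₂, P₂⟩ := exists_perturb (d := d) (K := 2 * K) (e := κ / 4) (δ := δ)
    (by positivity) (by positivity) hδ0
  obtain ⟨CU, hCU, η₁, hη₁, HU⟩ := m.exists_normU_le hd (K := 2 * K) (by positivity)
  obtain ⟨η₂, hη₂, HG⟩ := m.exists_grad_energy_le hd (K := 2 * K) (by positivity)
  obtain ⟨η₃, hη₃, HR⟩ := m.exists_reparam_close hK hr
  refine ⟨min (min (min η₁ η₂) (min η₃ (1 / (2 * K))))
    (min (min (κ / 4) (δ * m.E.det)) (min (s₁ / r) (s₂ / CU))), by positivity,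
    fun η hη hηη l hl hl1 χ hχ y a₀ hF H hinv f hf hfr hcrit hmis => ?_⟩
  obtain ⟨⟨⟨h1, h2⟩, h3, h4⟩, ⟨h5, h6⟩, h7, h8⟩ :
      ((η ≤ η₁ ∧ η ≤ η₂) ∧ η ≤ η₃ ∧ η ≤ 1 / (2 * K))
      ∧ (η ≤ κ / 4 ∧ η ≤ δ * m.E.det) ∧ η ≤ s₁ / r ∧ η ≤ s₂ / CU := by
    simpa only [le_min_iff] using hηη
  have hρ : 1 / (2 * K) ≤ m.rho l χ y := by
    have h1 := (abs_le.1 hF.rho_near).2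
    have h2 : K⁻¹ = 1 / (2 * K) + 1 / (2 * K) := by field_simp; norm_num
    have h3 := hF.mem.2
    linarith
  have hρ0 : 0 < m.rho l χ y := lt_of_lt_of_le (by positivity) hρ
  have hC := H.crit hd hK hl1 hfr.le (by rwa [← one_div]) hmis hf hcrit
  set g : Vec d → Aff d := fun z => unanchor z (f z) with hg
  have hτ : (fun z => lin (g z) z) = fun z => (f z).2 :=
    funext fun z => lin_unanchor_self z (f z)
  have hU := HU η hη h1 l hl χ hχ g y hC
  have hGf : ‖gradMat (fun z => (f z).2) y - (f y).1‖ ≤ s₂ := by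
    have h9 := norm_gradMat_sub_le hC.contDiff hl
    rw [hτ] at h9
    refine h9.trans ?_
    rw [inv_mul_le_iff₀ hl]
    have h10 : η * CU ≤ s₂ := by rwa [le_div_iff₀ hCU] at h8
    calc normU l g y ≤ CU * (η * l) := hU.trans (le_mul_of_one_le_right hCU.le hl1)
      _ = l * (η * CU) := by ring
      _ ≤ _ := by gcongr
  set G := gradMat (fun z => (f z).2) y with hG
  have hfa : ‖(f y).1 - a₀.1‖ ≤ s₁ := norm_fst_sub_le_of_affNorm_le hr h7 hl hl1 hfr.le
  obtain ⟨-, hd1, -⟩ := P₁ a₀.1 hF.mem _ hfa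
  obtain ⟨-, hd2, hGinv⟩ := P₂ (f y).1 (H.mem (f y) hfr.le) G hGf
  have hκρ : κ ≤ m.rho l χ y / (d + 20) := by
    rw [hκ, ← div_div]; gcongr
  have hdet : |G.det - m.rho l χ y| ≤ m.rho l χ y / (d + 20) := by
    have h9 := abs_add_three (G.det - (f y).1.det) ((f y).1.det - a₀.1.det)
      (a₀.1.det - m.rho l χ y)
    rw [sub_add_sub_cancel, sub_add_sub_cancel] at h9
    have h10 := hF.rho_near
    linarith
  obtain ⟨hGpos, hGρ, hDρ⟩ := det_bounds (by positivity) hρ0 hdet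
  have hDρ3 : (d + 3) * m.rho l χ y ^ 2 ≤ (d + 9) * G.det ^ 2 := by
    have : 0 ≤ m.rho l χ y ^ 2 := by positivity
    linarith
  refine ⟨hGpos, fun a ha hadet => ?_⟩
  have hCle := Ccon_le_modulus (m := m) hd hDρ3 hGpos
  obtain ⟨hCt, hgrad⟩ := HG η hη h2 l hl χ hχ g y hC G.det hGpos hDρ3
  obtain ⟨B, t, hBt⟩ := HR η hη h3 l hl hl1 χ hχ y a₀ a hF ha
  rw [affNorm_sub_comm] at hBt
  have ha0 : 0 < a.1.det := bddSet_subset_GLPos hK ha.mem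
  have hBinv : ‖(reparam B t a).1⁻¹‖ ≤ (1 + δ) * (2 * ‖m.E⁻¹‖) := by
    refine (P₁ a₀.1 hF.mem _ (norm_fst_sub_le_of_affNorm_le hr h7 hl hl1 hBt)).2.2.trans ?_
    gcongr
  have hdetE : a.1.det ≤ (1 + δ) * m.E.det := by
    have := (abs_le.1 hadet).2
    linarith
  refine FC_add_le_h m hd hK hl H hfr.le hcrit.self_of_nhds hC hG hGpos hGρ ?_
    (m.Ccon_pos hρ0 hGpos) hCle.1 hCle.2 hCt hgrad ha0 B t hBt
    (J_reparam_le m hd hl hδ0.le (one_add_inv_pow_le d) ha0 B t hBinv hdetE χ y)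
  calc ‖G⁻¹‖ ^ 2 ≤ ((1 + δ) * ‖(f y).1⁻¹‖) ^ 2 := by gcongr
    _ = (1 + δ) ^ 2 * ‖(f y).1⁻¹‖ ^ 2 := by ring
    _ ≤ (1 + 1 / 100) ^ 2 * ‖(f y).1⁻¹‖ ^ 2 := by gcongr
    _ ≤ _ := by gcongr; norm_num

end Model

end Kac

/-! ### The lower bound along the branch -/

namespace Kac

open Filter Topology MeasureTheory

variable {d : ℕ}

namespace Model

variable {m : Model d}

/-- The branch through a reparametrised global minimizer, on a neighbourhood of `x` on which the
conditions needed for the bounds along the branch persist. -/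
lemma exists_branch_of_isGlobalMinimizer (m : Model d) (hd : 1 ≤ d) :
    ∃ lamHat > (0 : ℝ), ∃ epsHat > (0 : ℝ), ∀ lam > lamHat,
      ∀ χ : Finset (Vec d), m.HardCore χ → ∀ x : Vec d, m.hHat lam χ x ≤ epsHat →
        (∃ a : Aff d, m.IsGlobalMinimizer lam χ x a) ∧
        ∀ aHat : Aff d, m.IsGlobalMinimizer lam χ x aHat → ∀ (B : GLInt d) (t : Fin d → ℤ),
          ‖aHat.1⁻¹ * B.toMat⁻¹‖ ≤ 2 * ‖m.E⁻¹‖ →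
          ∃ (U : Set (Vec d)) (aTilde : Vec d → Aff d), IsOpen U ∧ x ∈ U ∧
            ContDiffOn ℝ 2 aTilde U ∧ (∀ y ∈ U, (aTilde y).1 ∈ GLPos d) ∧
            (affNorm lam (aTilde x - reparam B t aHat) ≤
              (1 / 2 * m.Ccon (m.rho lam χ x) (reparam B t aHat).1.det
                  * ‖(reparam B t aHat).1⁻¹‖ ^ 2 * m.rho lam χ x) ^ (-(1 / 2) : ℝ)
                * Real.sqrt (m.J lam (reparam B t aHat) χ x)) ∧
            (∀ y ∈ U, IsLocalMin (fun a : Aff d => m.J lam a χ y) (aTilde y)) ∧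
            Set.InjOn (fun y => (aTilde y).2) U ∧
            (∀ y ∈ U, 0 < (gradMat (fun z => (aTilde z).2) y).det) ∧
            (∀ y ∈ U,
              let G : Mat d := gradMat (fun z => (aTilde z).2) y
              let Cc : ℝ := m.Ccon (m.rho lam χ y) G.det
              let Ct : ℝ := m.Cgrad Cc (m.rho (2 * lam) χ y / m.rho lam χ y)
              m.FC lam Cc Ct G
                  + 1 / 5 * Ct * ‖G⁻¹‖ ^ 2 * lam ^ 4
                    * hessNormSq (fun z => (aTilde z).2) y * G.det
                ≤ m.hHat lam χ y) := by
  obtain ⟨K₁, hK₁, HF⟩ := exists_fit_of_h_le m hd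
  obtain ⟨K, hKK, C, hC, HR⟩ := exists_fit_reparam m hK₁
  have hK : 0 < K := hK₁.trans_le hKK
  have hC0 : 0 < C := one_pos.trans_le hC
  obtain ⟨r, hr, η₁, hη₁, HU⟩ := exists_unifConvex m hd hK
  obtain ⟨η₂, hη₂, HB⟩ := exists_branch_of_fit m hd hK hr
  obtain ⟨η₃, hη₃, HP⟩ := exists_branch_props m hd hK hr
  set η := min η₁ (min η₂ η₃) with hη
  have hη0 : 0 < η := by positivity
  have hηη₁ : η ≤ η₁ := min_le_left _ _
  have hηη₂ : η ≤ η₂ := (min_le_right _ _).trans (min_le_left _ _)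
  have hηη₃ : η ≤ η₃ := (min_le_right _ _).trans (min_le_right _ _)
  have hη4 : 0 < η / 4 := by positivity
  have hηC : 0 < η / 4 / C := by positivity
  have hηC4 : η / 4 / C ≤ η / 4 := div_le_self hη4.le hC
  obtain ⟨ε, hε, HF⟩ := HF (η / 4 / C) hηC
  obtain ⟨ε₂, hε₂, HM⟩ := exists_isGlobalMinimizer m hd
  refine ⟨4 / η, by positivity, min (ε / 2) (ε₂ / 2), by positivity,
    fun l hll χ hχ x hx => ⟨HM l ?_ χ x ?_, fun a ha B t hB => ?_⟩⟩
  · exact lt_trans (by positivity) hll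
  · have := hx.trans (min_le_right _ _); linarith
  have hl : 0 < l := lt_trans (by positivity) hll
  have hl4 : 1 ≤ η / 4 * l := by
    rw [gt_iff_lt, div_lt_iff₀ hη0] at hll
    linarith
  have hl1 : 1 ≤ η * l := hl4.trans (by gcongr; linarith)
  have hax : m.h l a χ x < ε := by
    have := hx.trans (min_le_left _ _)
    rw [ha.h_eq]
    linarith
  have hfitx : m.Fit K (η / 4) l χ x (reparam B t a) := by
    have h1 := HR (η / 4 / C) hηC l hl χ x a (HF l hl χ x a ha.1 hax.le).1 B t hB
    rwa [mul_div_cancel₀ _ hC0.ne'] at h1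
  set a₀ := reparam B t a with ha₀
  have hinv : ‖a₀.1⁻¹‖ ≤ 2 * ‖m.E⁻¹‖ := by
    change ‖(B.toMat * a.1)⁻¹‖ ≤ _
    rwa [Matrix.mul_inv_rev]
  obtain ⟨f, hf, hfr, hcrit, hmis, hitem⟩ := HB (η / 4) hη4 (by linarith) l hl hl4 χ x a₀ hfitx
    (HU (η / 4) hη4 (by linarith) l hl hl4 χ hχ x a₀ hfitx)
  -- the conditions on the branch persist near `x`
  have e1 : ∀ᶠ y in 𝓝 x, m.Fit K η l χ y a₀ := by
    have h1 : ∀ᶠ y in 𝓝 x, m.misfit l a₀ χ y < η :=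
      (continuous_misfit l a₀ χ).continuousAt.eventually_lt continuousAt_const
        (hfitx.misfit_le.trans_lt (by linarith))
    have h2 : ∀ᶠ y in 𝓝 x, |a₀.1.det - m.rho l χ y| < η :=
      ((continuous_const.sub (continuous_rho hl χ)).abs).continuousAt.eventually_lt
        continuousAt_const (hfitx.rho_near.trans_lt (by linarith))
    filter_upwards [h1, h2] with y h1 h2 using ⟨hfitx.mem, h1.le, h2.le⟩
  have e2 : ∀ᶠ y in 𝓝 x, ContDiffAt ℝ 2 f y := hf.eventually (by simp)
  have e3 : ∀ᶠ y in 𝓝 x, affNorm l (f y - a₀) < r := by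
    have h1 : ContinuousAt (fun y => affNorm l (f y - a₀)) x :=
      (continuous_affNorm l).continuousAt.comp (hf.continuousAt.sub continuousAt_const)
    exact h1.eventually_lt continuousAt_const hfr
  have e4 : ∀ᶠ y in 𝓝 x, m.misfit l (f y) χ y < η := by
    have h0 := (contDiff_misfit (m := m) (n := 2) l χ).contDiffAt (x := (x, f x))
    have h1 := h0.comp x (contDiffAt_id.prodMk hf)
    have h2 : ContinuousAt (fun y => m.misfit l (f y) χ y) x := h1.continuousAt
    exact h2.eventually_lt continuousAt_const (hmis.trans_lt (by linarith))
  have e5 : ∀ᶠ y in 𝓝 x, m.h l a χ y < ε :=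
    (continuous_h hl a χ).continuousAt.eventually_lt continuousAt_const hax
  have hprops : ∀ y, m.Fit K η l χ y a₀ → ContDiffAt ℝ 2 f y → affNorm l (f y - a₀) < r →
      m.misfit l (f y) χ y < η → (∀ᶠ z in 𝓝 y, ∀ b, m.dJ l (f z) χ z b = 0) → _ :=
    fun y h1 h2 h3 h4 h5 => HP η hη0 hηη₃ l hl hl1 χ hχ y a₀ h1
      (HU η hη0 hηη₁ l hl hl1 χ hχ y a₀ h1) hinv f h2 h3 h5 h4.le
  have hτ : ContDiffAt ℝ 2 (fun z => (f z).2) x := contDiff_snd.contDiffAt.comp x hf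
  obtain ⟨s, hs, hinj⟩ := exists_injOn_nhds hτ
    (hprops x e1.self_of_nhds hf hfr e4.self_of_nhds hcrit).1.ne'
  obtain ⟨U, hUall, hUo, hxU⟩ := eventually_nhds_iff.1
    (e1.and (e2.and (e3.and (e4.and (e5.and (hcrit.eventually_nhds.and (eventually_mem_set.2 hs)))))))
  refine ⟨U, f, hUo, hxU, fun y hy => (hUall y hy).2.1.contDiffWithinAt, fun y hy => ?_, hitem,
    fun y hy => ?_, hinj.mono fun y hy => (hUall y hy).2.2.2.2.2.2, fun y hy => ?_, fun y hy => ?_⟩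
  · obtain ⟨h1, -, h3, -⟩ := hUall y hy
    exact bddSet_subset_GLPos (by positivity)
      ((HU η hη0 hηη₁ l hl hl1 χ hχ y a₀ h1).mem (f y) h3.le)
  · obtain ⟨h1, -, h3, -, -, h6, -⟩ := hUall y hy
    exact (HU η hη0 hηη₁ l hl hl1 χ hχ y a₀ h1).isLocalMin hK hl h3 h6.self_of_nhds
  · obtain ⟨h1, h2, h3, h4, h5, h6, -⟩ := hUall y hy
    exact (hprops y h1 h2 h3 h4 h6).1
  · obtain ⟨h1, h2, h3, h4, h5, h6, -⟩ := hUall y hy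
    have key := (hprops y h1 h2 h3 h4 h6).2
    have hlow : ∀ b : Aff d, b.1 ∈ GLPos d → m.h l b χ y ≤ ε →
        m.Fit K η l χ y b ∧ |b.1.det - m.E.det| ≤ η := by
      intro b hb hbε
      have h7 := HF l hl χ y b hb hbε
      exact ⟨h7.1.mono hK₁ hKK (by linarith), h7.2.trans (by linarith)⟩
    intro G Cc Ct
    refine le_csInf (nonempty_h l χ y) ?_
    rintro _ ⟨b, hb, rfl⟩
    -- lattices of larger energy are compared with the minimizer at `x`, whose energy at `y` is
    -- less than `ε`
    by_cases hbε : m.h l b χ y ≤ ε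
    · exact key b (hlow b hb hbε).1 (hlow b hb hbε).2
    · exact (key a (hlow a ha.1 h5.le).1 (hlow a ha.1 h5.le).2).trans
        (h5.le.trans (not_le.1 hbε).le)

end Model

end Kac

end

theorem theorem2 {d : ℕ} (hd : 1 ≤ d) (m : Kac.Model d) :
    ∃ lamHat > (0 : ℝ), ∃ epsHat > (0 : ℝ), ∀ lam > lamHat,
      ∀ χ : Finset (Kac.Vec d), m.HardCore χ →
      ∀ x : Kac.Vec d, m.hHat lam χ x ≤ epsHat →
        (∃ a : Kac.Aff d, m.IsGlobalMinimizer lam χ x a) ∧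
        ∀ aHat : Kac.Aff d, m.IsGlobalMinimizer lam χ x aHat →
        ∀ (B : Kac.GLInt d) (t : Fin d → ℤ),
          ‖aHat.1⁻¹ * B.toMat⁻¹‖ ≤ 2 * ‖m.E⁻¹‖ →
          ∃ (U : Set (Kac.Vec d)) (aTilde : Kac.Vec d → Kac.Aff d),
            IsOpen U ∧ x ∈ U ∧
            ContDiffOn ℝ 2 aTilde U ∧
            (∀ y ∈ U, (aTilde y).1 ∈ Kac.GLPos d) ∧
            -- the branch starts close to the reparametrised global minimizer
            (Kac.affNorm lam (aTilde x - Kac.reparam B t aHat) ≤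
              (1 / 2 * m.Ccon (m.rho lam χ x) (Kac.reparam B t aHat).1.det
                  * ‖(Kac.reparam B t aHat).1⁻¹‖ ^ 2 * m.rho lam χ x) ^ (-(1 / 2) : ℝ)
                * Real.sqrt (m.J lam (Kac.reparam B t aHat) χ x)) ∧
            -- it consists of local minimizers
            (∀ y ∈ U, IsLocalMin (fun a : Kac.Aff d => m.J lam a χ y) (aTilde y)) ∧
            -- its translational part is a local Lagrangian coordinate
            Set.InjOn (fun y => (aTilde y).2) U ∧
            (∀ y ∈ U, 0 < (Kac.gradMat (fun z => (aTilde z).2) y).det) ∧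
            -- lower bound of the energy density
            (∀ y ∈ U,
              let G : Kac.Mat d := Kac.gradMat (fun z => (aTilde z).2) y
              let Cc : ℝ := m.Ccon (m.rho lam χ y) G.det
              let Ct : ℝ := m.Cgrad Cc (m.rho (2 * lam) χ y / m.rho lam χ y)
              m.FC lam Cc Ct G
                  + 1 / 5 * Ct * ‖G⁻¹‖ ^ 2 * lam ^ 4
                    * Kac.hessNormSq (fun z => (aTilde z).2) y * G.det
                ≤ m.hHat lam χ y) := by
  exact m.exists_branch_of_isGlobalMinimizer hd
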